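/- **Setting.** Let $n\in\mathbb N$, $T>0$. Let $\mathcal D$ be either $\mathcal P_2(\mathbb R^n)$, the set of probability measures on $\mathbb R^n$ with finite second moment, or its subset of measures having a density with respect to Lebesgue measure. Write $M_2(m)=\int|\xi|^2dm(\xi)$ and let $W_2$ be the Wasserstein distance. For $G:\mathcal D\to\mathbb R$ and $m\in\mathcal D$, a function $g$ is a *functional derivative* of $G$ at $m$, written $g=\frac{\partial G(m)}{\partial m}$, if $g\in L^1_\mu$ for all $\mu\in\mathcal D$ and $G(\mu)-G(m)-\int g\,d(\mu-m)=o(W_2(\mu,m))$ as $W_2(\mu,m)\to0$, $\mu\in\mathcal D$. Let $f,h:\mathbb R^n\times\mathcal D\to\mathbb R$ with $f(\cdot,m),h(\cdot,m)\in L^1_m$, and let $F(\cdot,m)$, $F_T(\cdot,m)$ be functional derivatives at $m$ of $m\mapsto\int f(x,m)dm(x)$ and $m\mapsto\int h(x,m)dm(x)$. Assume that, for constants $c,C,\lambda$ with $\lambda>cT(1+T)$, and for all $x,x_1,x_2,\xi\in\mathbb R^n$, $m,m_1,m_2\in\mathcal D$, $F$ and $F_T$ are differentiable in $x$ and satisfy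 $$|D_xF(x_1,m_1)-D_xF(x_2,m_2)|\le\tfrac c2(|x_1-x_2|+W_2(m_1,m_2)),\qquad |D_xF(x,m)|\le\tfrac c2(1+|x|+\sqrt{M_2(m)}),$$ $$|F(x,m)|\le C(1+|x|^2+M_2(m)),\qquad \Big|\frac{\partial F(x,m)}{\partial m}(\xi)\Big|\le C(1+|x|^2+|\xi|^2+M_2(m)),$$ $$\int(F(x,m_1)-F(x,m_2))\,d(m_1-m_2)(x)\ge0,$$ and the same with $F_T$ in place of $F$ (the functional derivatives of $F(x,\cdot)$ and $F_T(x,\cdot)$ being assumed to exist); and that $D_xD_\xi\frac{\partial F(x,m)}{\partial m}(\xi)$ exists and is bounded by $C$. **Control problem.** For $(m,t)\in\mathcal D\times[0,T]$, a feedback $v(x,s)$ is admissible if it is measurable and comes with trajectories $\frac{d}{ds}X(x,s)=v(X(x,s),s)$, $X(x,t)=x$ (for $m$-a.e. $x$), with $\int_t^T\!\int|v(X,s)|^2dm\,ds<\infty$ and with laws $\mu_s=X(\cdot,s)_\#m\in\mathcal D$. Its cost is $$J_{m,t}(v)=\frac\lambda2\int_t^T\!\!\int|v(X(x,s),s)|^2dm(x)ds+\int_t^T\!\!\int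 f(X(x,s),\mu_s)dm(x)ds+\int h(X(x,T),\mu_T)dm(x),$$ and $V(m,t)=\inf_vJ_{m,t}(v)$. **Proposition.** 1. The infimum $V(m,t)$ is finite. For every admissible $v$, the laws $\mu_s$ solve $\partial_s\mu+\operatorname{div}(v\mu)=0$, $\mu_t=m$, in the sense of distributions, and $J_{m,t}(v)=\frac\lambda2\int_t^T\!\int|v(x,s)|^2d\mu_s\,ds+\int_t^T\!\int f(x,\mu_s)\,d\mu_s\,ds+\int h(x,\mu_T)\,d\mu_T$. 2. $V(\cdot,t)$ has a functional derivative $U(x,m,t)=\frac{\partial V(m,t)}{\partial m}(x)$, differentiable in $x$, such that for some constant $C'$ and all $x$, $m\in\mathcal D$, $t\in[0,T]$, $$|V(m,t)|\le C'(1+M_2(m)),\quad |U(x,m,t)|\le C'(1+|x|^2+M_2(m)),\quad |D_xU(x,m,t)|\le C'(1+|x|+\sqrt{M_2(m)}),\tag{1}$$ and $V$ solves on $\mathcal D\times[0,T]$ (with one-sided time derivatives at $0$ and $T$) the Bellman equation $$\frac{\partial V}{\partial t}-\frac1{2\lambda}\int\Big|D_\xi\frac{\partial V(m,t)}{\partial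 m}(\xi)\Big|^2dm(\xi)+\int f(\xi,m)\,dm(\xi)=0,\qquad V(m,T)=\int h(\xi,m)\,dm(\xi).\tag{2}$$ Moreover, for some constant $L$, for all $t$, all $m_1,m_2\in\mathcal D$ and all random variables $X_i$ with laws $m_i$, $$E|D_xU(X_1,m_1,t)-D_xU(X_2,m_2,t)|^2\le L^2E|X_1-X_2|^2.\tag{3}$$ 3. $V$ is the unique solution of (2) satisfying (1) if $\mathcal D=\mathcal P_2(\mathbb R^n)$, and the unique solution of (2) satisfying (1) and (3) if $\mathcal D$ is the set of measures with densities. (A solution is a $V'$ possessing a functional derivative $U'$ differentiable in $x$ for which (2) holds; the constants in (1), (3) may depend on $V'$.) 4. For every $(m,t)$ there is a solution $y=y_{xmt}(s)$, $s\in[t,T]$, unique in $C([t,T];L^2_m(\mathbb R^n;\mathbb R^n))$ among functions with $y(s)_\#m\in\mathcal D$ for all $s$ (where $y(s)_\#m$ is the image of $m$ under $x\mapsto y_{xmt}(s)$), of $$y(s)=x-\frac{s-t}\lambda D_xF_T(y(T),y(T)_\#m)-\frac1\lambda\int_t^TD_xF(y(\sigma),y(\sigma)_\#m)\,(s\wedge\sigma-t)\,d\sigma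 ;$$ it can be chosen to solve the equation for every $x$ and to be differentiable in $s$, and with $z_{xmt}(s)=-\lambda\frac{d}{ds}y_{xmt}(s)$, $$V(m,t)=\frac1{2\lambda}\int_t^T\!\!\int|z_{xmt}(s)|^2dm(x)ds+\int_t^T\!\!\int f(y_{xmt}(s),y(s)_\#m)\,dm(x)ds+\int h(y_{xmt}(T),y(T)_\#m)\,dm(x).$$ -/

import Mathlib

open MeasureTheory Set Filter Topology
open scoped ENNReal

namespace MFC

/-- The state space `ℝⁿ` with its Euclidean norm. -/
abbrev E (n : ℕ) := EuclideanSpace ℝ (Fin n)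

/-- Probability measures on `ℝⁿ` with finite second moment. -/
def P2 (n : ℕ) : Set (Measure (E n)) :=
  {m | IsProbabilityMeasure m ∧ Integrable (fun x => ‖x‖ ^ 2) m}

/-- The elements of `P2 n` that have a density with respect to Lebesgue measure. -/
def P2ac (n : ℕ) : Set (Measure (E n)) :=
  {m | m ∈ P2 n ∧ m ≪ volume}

variable {n : ℕ}

/-- Second moment `∫ |x|² dm`. -/
noncomputable def secondMoment (m : Measure (E n)) : ℝ := ∫ x, ‖x‖ ^ 2 ∂m

/-- Joint laws with marginals `μ` and `ν`. -/
def couplings (μ ν : Measure (E n)) : Set (Measure (E n × E n)) :=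
  {γ | γ.map Prod.fst = μ ∧ γ.map Prod.snd = ν}

/-- The Wasserstein distance `W₂`. -/
noncomputable def W2 (μ ν : Measure (E n)) : ℝ :=
  Real.sqrt (⨅ γ ∈ couplings μ ν, ∫⁻ p, ‖p.1 - p.2‖ₑ ^ 2 ∂γ).toReal

/-- `g` is a functional derivative at `m` of the functional `G` on the class `D` of measures:
`g` is integrable against every element of `D`, and
`G μ - G m - ∫ g d(μ - m) = o(W₂(μ, m))` as `W₂(μ, m) → 0` in `D`. -/
def HasFuncDeriv (D : Set (Measure (E n))) (G : Measure (E n) → ℝ) (m : Measure (E n))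
    (g : E n → ℝ) : Prop :=
  (∀ μ ∈ D, Integrable g μ) ∧
  ∀ ε > 0, ∃ δ > 0, ∀ μ ∈ D, W2 μ m < δ →
    |G μ - G m - (∫ x, g x ∂μ - ∫ x, g x ∂m)| ≤ ε * W2 μ m

/-- The functional `Φ(m) = ∫ f(x, m) dm(x)`. -/
noncomputable def meanCost (f : E n → Measure (E n) → ℝ) (m : Measure (E n)) : ℝ :=
  ∫ x, f x m ∂m

/-- `D_x F(x, m)`. -/
noncomputable def gradX (F : E n → Measure (E n) → ℝ) (x : E n) (m : Measure (E n)) : E n :=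
  gradient (fun x' => F x' m) x

/-- Standing assumptions on a cost `f`, on the functional derivative `F(·, m)` of
`Φ(m) = ∫ f(x, m) dm(x)`, and on the functional derivative `dF x m ξ = ∂F(x, m)/∂m (ξ)`. -/
structure CostData (D : Set (Measure (E n))) (c C : ℝ) (f F : E n → Measure (E n) → ℝ)
    (dF : E n → Measure (E n) → E n → ℝ) : Prop where
  integrable : ∀ m ∈ D, Integrable (fun x => f x m) m
  funcDeriv : ∀ m ∈ D, HasFuncDeriv D (meanCost f) m (fun x => F x m)
  differentiable : ∀ m ∈ D, Differentiable ℝ (fun x => F x m)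
  grad_lipschitz : ∀ x₁ x₂, ∀ m₁ ∈ D, ∀ m₂ ∈ D,
    ‖gradX F x₁ m₁ - gradX F x₂ m₂‖ ≤ c / 2 * (‖x₁ - x₂‖ + W2 m₁ m₂)
  grad_growth : ∀ x, ∀ m ∈ D,
    ‖gradX F x m‖ ≤ c / 2 * (1 + ‖x‖ + Real.sqrt (secondMoment m))
  growth : ∀ x, ∀ m ∈ D, |F x m| ≤ C * (1 + ‖x‖ ^ 2 + secondMoment m)
  funcDeriv_deriv : ∀ x, ∀ m ∈ D, HasFuncDeriv D (F x) m (dF x m)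
  deriv_growth : ∀ x ξ, ∀ m ∈ D,
    |dF x m ξ| ≤ C * (1 + ‖x‖ ^ 2 + ‖ξ‖ ^ 2 + secondMoment m)
  monotone : ∀ m₁ ∈ D, ∀ m₂ ∈ D,
    0 ≤ ∫ x, (F x m₁ - F x m₂) ∂m₁ - ∫ x, (F x m₁ - F x m₂) ∂m₂

/-- The mixed derivative `D_x D_ξ ∂F(x, m)/∂m (ξ)` exists and is bounded by `C`. -/
def MixedDerivBound (D : Set (Measure (E n))) (C : ℝ)
    (dF : E n → Measure (E n) → E n → ℝ) : Prop :=
  ∀ m ∈ D, (∀ x, Differentiable ℝ (dF x m)) ∧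
    ∀ ξ, Differentiable ℝ (fun x => gradient (dF x m) ξ) ∧
      ∀ x, ‖fderiv ℝ (fun x' => gradient (dF x' m) ξ) x‖ ≤ C

/-- The image `Y(s)(·)(m)` of `m` under the map `x ↦ Y(x, s)`. -/
noncomputable def law (m : Measure (E n)) (Y : E n → ℝ → E n) (s : ℝ) : Measure (E n) :=
  m.map (fun x => Y x s)

/-- The feedback `v` is admissible for the initial data `(m, t)`, with trajectories `X`:
`dX/ds = v(X, s)`, `X(x, t) = x`, with finite energy and with laws in `D`. -/
structure IsAdmissible (D : Set (Measure (E n))) (T t : ℝ) (m : Measure (E n))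
    (v X : E n → ℝ → E n) : Prop where
  measurable_feedback : Measurable (Function.uncurry v)
  aemeasurable : ∀ s ∈ Icc t T, AEMeasurable (fun x => X x s) m
  dynamics : ∀ᵐ x ∂m, IntervalIntegrable (fun σ => v (X x σ) σ) volume t T ∧
    ∀ s ∈ Icc t T, X x s = x + ∫ σ in t..s, v (X x σ) σ
  energy : ∫⁻ σ in Icc t T, ∫⁻ x, ‖v (X x σ) σ‖ₑ ^ 2 ∂m < ∞
  law_mem : ∀ s ∈ Icc t T, law m X s ∈ D

/-- The cost of a feedback, as an expectation along the trajectories. -/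
noncomputable def cost (f h : E n → Measure (E n) → ℝ) (lam T t : ℝ) (m : Measure (E n))
    (v X : E n → ℝ → E n) : ℝ :=
  lam / 2 * (∫ σ in t..T, ∫ x, ‖v (X x σ) σ‖ ^ 2 ∂m)
    + (∫ σ in t..T, ∫ x, f (X x σ) (law m X σ) ∂m)
    + ∫ x, h (X x T) (law m X T) ∂m

/-- The cost of a feedback `v`, written on the flow `μ` of state laws. -/
noncomputable def costOnLaws (f h : E n → Measure (E n) → ℝ) (lam T t : ℝ)
    (v : E n → ℝ → E n) (μ : ℝ → Measure (E n)) : ℝ :=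
  lam / 2 * (∫ σ in t..T, ∫ x, ‖v x σ‖ ^ 2 ∂(μ σ))
    + (∫ σ in t..T, ∫ x, f x (μ σ) ∂(μ σ))
    + ∫ x, h x (μ T) ∂(μ T)

/-- `∂μ/∂s + div(v μ) = 0` on `[t, T]` in the sense of distributions, with `μ(t) = m`. -/
def SolvesFokkerPlanck (T t : ℝ) (m : Measure (E n)) (v : E n → ℝ → E n)
    (μ : ℝ → Measure (E n)) : Prop :=
  μ t = m ∧ ∀ φ : E n → ℝ, ContDiff ℝ (⊤ : ℕ∞) φ → HasCompactSupport φ → ∀ s ∈ Icc t T,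
    ∫ x, φ x ∂(μ s) - ∫ x, φ x ∂m
      = ∫ σ in t..s, ∫ x, inner ℝ (gradient φ x) (v x σ) ∂(μ σ)

/-- The costs of all admissible feedbacks. -/
def costSet (D : Set (Measure (E n))) (f h : E n → Measure (E n) → ℝ) (lam T : ℝ)
    (m : Measure (E n)) (t : ℝ) : Set ℝ :=
  {r | ∃ v X, IsAdmissible D T t m v X ∧ r = cost f h lam T t m v X}

/-- The value function `V(m, t)`. -/
noncomputable def value (D : Set (Measure (E n))) (f h : E n → Measure (E n) → ℝ) (lam T : ℝ)
    (m : Measure (E n)) (t : ℝ) : ℝ :=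
  sInf (costSet D f h lam T m t)

/-- `V` solves the Bellman equation
`∂V/∂t - (1/2λ) ∫ |D_ξ ∂V(m,t)/∂m (ξ)|² dm(ξ) + ∫ f(ξ, m) dm(ξ) = 0`,
`V(m, T) = ∫ h(ξ, m) dm(ξ)`, where `U x m t = ∂V(m, t)/∂m (x)`.
At the end points of `[0, T]` the time derivative is one-sided. -/
structure SolvesBellman (D : Set (Measure (E n))) (f h : E n → Measure (E n) → ℝ) (lam T : ℝ)
    (V : Measure (E n) → ℝ → ℝ) (U : E n → Measure (E n) → ℝ → ℝ) : Prop where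
  funcDeriv : ∀ t ∈ Icc 0 T, ∀ m ∈ D,
    HasFuncDeriv D (fun μ => V μ t) m (fun x => U x m t)
  differentiable : ∀ t ∈ Icc 0 T, ∀ m ∈ D, Differentiable ℝ (fun x => U x m t)
  equation : ∀ t ∈ Icc 0 T, ∀ m ∈ D, ∃ Vt : ℝ,
    HasDerivWithinAt (fun s => V m s) Vt (Icc 0 T) t ∧
    Vt - 1 / (2 * lam) * (∫ ξ, ‖gradient (fun x => U x m t) ξ‖ ^ 2 ∂m)
      + ∫ ξ, f ξ m ∂m = 0
  terminal : ∀ m ∈ D, V m T = ∫ ξ, h ξ m ∂m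

/-- The growth estimates on `V`, on `U = ∂V/∂m` and on `D_x U`. -/
def GrowthBounds (D : Set (Measure (E n))) (T : ℝ)
    (V : Measure (E n) → ℝ → ℝ) (U : E n → Measure (E n) → ℝ → ℝ) : Prop :=
  ∃ C : ℝ, ∀ t ∈ Icc 0 T, ∀ m ∈ D,
    |V m t| ≤ C * (1 + secondMoment m) ∧
    ∀ x, |U x m t| ≤ C * (1 + ‖x‖ ^ 2 + secondMoment m) ∧
      ‖gradient (fun x' => U x' m t) x‖ ≤ C * (1 + ‖x‖ + Real.sqrt (secondMoment m))

/-- `D_x U` is Lipschitz as a map of random variables, uniformly in time: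
`E|D_xU(X₁, m₁, t) - D_xU(X₂, m₂, t)|² ≤ C² E|X₁ - X₂|²` whenever `Xᵢ` has law `mᵢ`. -/
def LipschitzGradient (D : Set (Measure (E n))) (T : ℝ)
    (U : E n → Measure (E n) → ℝ → ℝ) : Prop :=
  ∃ C : ℝ, ∀ t ∈ Icc 0 T, ∀ m₁ ∈ D, ∀ m₂ ∈ D, ∀ γ ∈ couplings m₁ m₂,
    ∫ p, ‖gradient (fun x => U x m₁ t) p.1 - gradient (fun x => U x m₂ t) p.2‖ ^ 2 ∂γ
      ≤ C ^ 2 * ∫ p, ‖p.1 - p.2‖ ^ 2 ∂γ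

/-- Right-hand side, at `(x, s)`, of the integral equation
`y(s) = x - (s-t)/λ D_xF_T(y(T), y(T)(·)(m))
  - (1/λ) ∫_t^T D_xF(y(σ), y(σ)(·)(m)) (s ∧ σ - t) dσ`. -/
noncomputable def integralRHS (F FT : E n → Measure (E n) → ℝ) (lam T t : ℝ)
    (m : Measure (E n)) (y : E n → ℝ → E n) (x : E n) (s : ℝ) : E n :=
  x - ((s - t) / lam) • gradX FT (y x T) (law m y T)
    - (1 / lam) • ∫ σ in t..T, (min s σ - t) • gradX F (y x σ) (law m y σ)

/-- `y` is (a jointly measurable representative of) an element of `C([t, T]; L²_m)`, with image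
measures in `D`, that solves the integral equation: for every `s`, for `m`-almost every `x`. -/
structure SolvesIntegralEq (D : Set (Measure (E n))) (F FT : E n → Measure (E n) → ℝ)
    (lam T t : ℝ) (m : Measure (E n)) (y : E n → ℝ → E n) : Prop where
  jointly_measurable :
    AEStronglyMeasurable (Function.uncurry y) (m.prod (volume.restrict (Icc t T)))
  memLp : ∀ s ∈ Icc t T, MemLp (fun x => y x s) 2 m
  continuous : ∀ s₀ ∈ Icc t T,
    Tendsto (fun s => eLpNorm (fun x => y x s - y x s₀) 2 m) (𝓝[Icc t T] s₀) (𝓝 0)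
  law_mem : ∀ s ∈ Icc t T, law m y s ∈ D
  equation : ∀ s ∈ Icc t T, ∀ᵐ x ∂m, y x s = integralRHS F FT lam T t m y x s

/-- `z = -λ dy/ds` on `[t, T]`. -/
noncomputable def adjoint (lam T t : ℝ) (y : E n → ℝ → E n) (x : E n) (s : ℝ) : E n :=
  -(lam • derivWithin (fun σ => y x σ) (Icc t T) s)

/-- The explicit expression of the value function in terms of `y` and `z = -λ dy/ds`. -/
noncomputable def explicitValue (f h : E n → Measure (E n) → ℝ) (lam T t : ℝ)
    (m : Measure (E n)) (y : E n → ℝ → E n) : ℝ :=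
  1 / (2 * lam) * (∫ s in t..T, ∫ x, ‖adjoint lam T t y x s‖ ^ 2 ∂m)
    + (∫ s in t..T, ∫ x, f (y x s) (law m y s) ∂m)
    + ∫ x, h (y x T) (law m y T) ∂m

end MFC

/-!
The problem is lifted to square integrable random variables: a functional of measures becomes a
functional of random variables that depends only on their laws, and the gradient of its functional
derivative, evaluated at the variable, is the gradient of the lift. The Lipschitz bounds on the
gradients of `F` and `F_T` in `x` say that the mean costs are of class `C^{1,1}` on the lift, with
constant `c`: they have a second order expansion along every coupling of two measures of `D`
(`regularCost_of_hasFuncDeriv`). As the interpolated measures need not have a density, they are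
smoothed with a small independent noise, which is removed afterwards.

The condition `λ > cT(1+T)` acts in two ways. First, it says that `a = cT(1+T)/2λ < 1/2`, so that
the integral equation is a contraction, and its iterates stay among the perturbations of the
identity with constant `a/(1-a) < 1`. Such maps are injective with Lipschitz inverse, so they
preserve the measures with a density. This gives a flow solving the equation at every point
(`Setup.exists_isFlow`), and the Lipschitz dependence of solutions and adjoint variables on random
initial positions (`IsSolution.stability`), hence uniqueness. Second, the energy of a velocity
dominates the concavity of the costs (`energy_dominates`). Integrating the adjoint variable `z` of
the flow by parts against another curve, one finds that the cost of any controlled random curve is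
at least the cost of the flow plus the pairing of `z(t)` with the difference of the initial
positions, up to a quadratic error (`Setup.flowCost_add_le_processCost`). There is no error when
the initial positions agree, so the flow is optimal; it is generated by a feedback because its
trajectories do not cross (`Setup.isLeast_costSet`).

When two flows are compared in both directions, the cost of the flow has a second order expansion
with gradient `z(t)` (`Setup.abs_flowCost_sub_le`). The same comparison for one agent facing the
frozen laws shows that `z(t)` is the gradient of a function of the position, the potential, which
is therefore a functional derivative of the value (`Setup.hasFuncDeriv_optValue`); its gradient is
Lipschitz in `L²` by stability. Dynamic programming along the flow and this expansion give the
time derivative of the value, that is, the Bellman equation (`Setup.solvesBellman_optValue`).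

For uniqueness, the difference of two solutions, as a function of a random variable, satisfies a
linear transport equation whose velocity is half the sum of the two gradients divided by `λ`. A
maximum principle in the Hilbert space `L²` (`le_of_maximum_principle`) applies: with a penalty at
infinity and Ekeland's variational principle in place of compactness, the directional derivatives
that functional derivatives provide are enough. On measures with densities the functionals are
defined only at some random variables, so one works with `X + δν`, where `ν` is an independent
noise. A perturbation of `X` may not depend on `ν`, but gradients that are Lipschitz in `L²` are
functions of `X` up to an error of order `δ` (`exists_l2norm_sub_le`), and `δ` tends to `0`
(`IsBoundedSolution.le`).
-/

namespace MFC

variable {n : ℕ}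

/-! ### Square integrable functions and the Wasserstein distance -/

section L2

variable {Ω G : Type*} [MeasurableSpace Ω] [NormedAddCommGroup G]

/-- The norm of `f` in `L²(P)`, as a real number. -/
noncomputable def l2norm (P : Measure Ω) (f : Ω → G) : ℝ := √(∫ ω, ‖f ω‖ ^ 2 ∂P)

lemma l2norm_nonneg (P : Measure Ω) (f : Ω → G) : 0 ≤ l2norm P f := Real.sqrt_nonneg _

lemma l2norm_sq (P : Measure Ω) (f : Ω → G) : l2norm P f ^ 2 = ∫ ω, ‖f ω‖ ^ 2 ∂P :=
  Real.sq_sqrt (integral_nonneg fun _ => by positivity)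

lemma integrable_sq_of_memLp {P : Measure Ω} {f : Ω → G} (hf : MemLp f 2 P) :
    Integrable (fun ω => ‖f ω‖ ^ 2) P :=
  (memLp_two_iff_integrable_sq_norm hf.1).1 hf

lemma memLp_fun_sub {P : Measure Ω} {f g : Ω → G} (hf : MemLp f 2 P) (hg : MemLp g 2 P) :
    MemLp (fun ω => f ω - g ω) 2 P := hf.sub hg

lemma memLp_fun_add {P : Measure Ω} {f g : Ω → G} (hf : MemLp f 2 P) (hg : MemLp g 2 P) :
    MemLp (fun ω => f ω + g ω) 2 P := hf.add hg

lemma l2norm_eq_toReal {P : Measure Ω} {f : Ω → G} (hf : MemLp f 2 P) :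
    l2norm P f = (eLpNorm f 2 P).toReal := by
  rw [hf.eLpNorm_eq_integral_rpow_norm two_ne_zero ENNReal.ofNat_ne_top, ENNReal.toReal_ofReal
    (by positivity), l2norm, Real.sqrt_eq_rpow]
  simp

lemma l2norm_congr {P : Measure Ω} {f g : Ω → G} (h : ∀ᵐ ω ∂P, ‖f ω‖ = ‖g ω‖) :
    l2norm P f = l2norm P g := by
  unfold l2norm
  congr 1
  exact integral_congr_ae (h.mono fun ω hω => by simp only [hω])

lemma l2norm_add_le {P : Measure Ω} {f g : Ω → G} (hf : MemLp f 2 P) (hg : MemLp g 2 P) :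
    l2norm P (fun ω => f ω + g ω) ≤ l2norm P f + l2norm P g := by
  have h := hf.add hg
  have e : l2norm P (fun ω => f ω + g ω) = (eLpNorm (f + g) 2 P).toReal := l2norm_eq_toReal h
  rw [e, l2norm_eq_toReal hf, l2norm_eq_toReal hg, ← ENNReal.toReal_add hf.2.ne hg.2.ne]
  exact ENNReal.toReal_mono (ENNReal.add_ne_top.2 ⟨hf.2.ne, hg.2.ne⟩)
    (eLpNorm_add_le hf.1 hg.1 (by norm_num))

lemma l2norm_neg (P : Measure Ω) (f : Ω → G) : l2norm P (fun ω => -f ω) = l2norm P f :=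
  l2norm_congr (by simp)

lemma l2norm_sub_comm (P : Measure Ω) (f g : Ω → G) :
    l2norm P (fun ω => f ω - g ω) = l2norm P (fun ω => g ω - f ω) :=
  l2norm_congr (by simp [norm_sub_rev])

lemma l2norm_mono {G' : Type*} [NormedAddCommGroup G'] {P : Measure Ω} {f : Ω → G} {g : Ω → G'}
    (hg : MemLp g 2 P) (h : ∀ᵐ ω ∂P, ‖f ω‖ ≤ ‖g ω‖) : l2norm P f ≤ l2norm P g := by
  refine Real.sqrt_le_sqrt (integral_mono_of_nonneg (Eventually.of_forall fun _ => by positivity)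
    (integrable_sq_of_memLp hg) (h.mono fun ω hω => ?_))
  exact pow_le_pow_left₀ (norm_nonneg _) hω 2

lemma l2norm_smul [NormedSpace ℝ G] (P : Measure Ω) (r : ℝ) (f : Ω → G) :
    l2norm P (fun ω => r • f ω) = |r| * l2norm P f := by
  unfold l2norm
  simp only [norm_smul, mul_pow, integral_const_mul]
  rw [Real.sqrt_mul (by positivity), Real.sqrt_sq (norm_nonneg _), Real.norm_eq_abs]

lemma l2norm_const {P : Measure Ω} [IsProbabilityMeasure P] (g : G) :
    l2norm P (fun _ => g) = ‖g‖ := by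
  simp [l2norm]

/-- The triangle inequality in `L²`, in the form in which bounds by an affine function of a known
norm are used. -/
lemma l2norm_le_affine {G' : Type*} [NormedAddCommGroup G'] {P : Measure Ω}
    [IsProbabilityMeasure P] {f : Ω → G} {g : Ω → G'} (hg : MemLp g 2 P) {α β : ℝ} (hα : 0 ≤ α)
    (hβ : 0 ≤ β) (h : ∀ᵐ ω ∂P, ‖f ω‖ ≤ α * ‖g ω‖ + β) :
    l2norm P f ≤ α * l2norm P g + β := by
  have h1 : MemLp (fun ω => α * ‖g ω‖) 2 P := hg.norm.const_mul α
  have h2 : MemLp (fun _ : Ω => β) 2 P := memLp_const β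
  calc l2norm P f ≤ l2norm P (fun ω => α * ‖g ω‖ + β) :=
        l2norm_mono (h1.add h2) (h.mono fun ω hω => hω.trans (le_abs_self _))
    _ ≤ l2norm P (fun ω => α * ‖g ω‖) + l2norm P (fun _ : Ω => β) := l2norm_add_le h1 h2
    _ = α * l2norm P g + β := by
        rw [l2norm_const, Real.norm_of_nonneg hβ]
        have : l2norm P (fun ω => α * ‖g ω‖) = |α| * l2norm P (fun ω => ‖g ω‖) :=
          l2norm_smul P α (fun ω => ‖g ω‖)
        rw [this, abs_of_nonneg hα]
        simp [l2norm]

lemma memLp_of_affine_bound {G' : Type*} [NormedAddCommGroup G'] {P : Measure Ω}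
    [IsFiniteMeasure P] {f : Ω → G} {g : Ω → G'} (hf : AEStronglyMeasurable f P)
    (hg : MemLp g 2 P) (α β : ℝ) (h : ∀ᵐ ω ∂P, ‖f ω‖ ≤ α * ‖g ω‖ + β) : MemLp f 2 P := by
  have h1 : MemLp (fun ω => α * ‖g ω‖) 2 P := hg.norm.const_mul α
  have h2 : MemLp (fun _ : Ω => β) 2 P := memLp_const β
  have h3 : MemLp (fun ω => α * ‖g ω‖ + β) 2 P := h1.add h2
  exact h3.of_le hf (h.mono fun ω hω => hω.trans (le_abs_self _))

lemma integral_norm_le_l2norm {P : Measure Ω} [IsProbabilityMeasure P] {f : Ω → G}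
    (hf : MemLp f 2 P) : ∫ ω, ‖f ω‖ ∂P ≤ l2norm P f := by
  refine Real.le_sqrt_of_sq_le ?_
  have h1 : Integrable (fun ω => ‖f ω‖) P := (hf.integrable (by norm_num)).norm
  have h2 := integrable_sq_of_memLp hf
  set μ := ∫ ω, ‖f ω‖ ∂P
  have h : 0 ≤ ∫ ω, (‖f ω‖ - μ) ^ 2 ∂P := integral_nonneg fun _ => by positivity
  have e : (fun ω => (‖f ω‖ - μ) ^ 2) = fun ω => (‖f ω‖ ^ 2 - 2 * μ * ‖f ω‖) + μ ^ 2 := by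
    ext ω; ring
  have h3 : Integrable (fun ω => ‖f ω‖ ^ 2 - 2 * μ * ‖f ω‖) P := h2.sub (h1.const_mul _)
  rw [e, integral_add h3 (integrable_const _), integral_sub h2 (h1.const_mul _),
    integral_const_mul] at h
  simp only [integral_const, probReal_univ, one_smul] at h
  change 0 ≤ _ - 2 * μ * μ + μ ^ 2 at h
  nlinarith

lemma abs_integral_inner_le {G : Type*} [NormedAddCommGroup G] [InnerProductSpace ℝ G]
    {P : Measure Ω}
    {f g : Ω → G} (hf : MemLp f 2 P) (hg : MemLp g 2 P) :
    |∫ ω, inner ℝ (f ω) (g ω) ∂P| ≤ l2norm P f * l2norm P g := by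
  calc |∫ ω, inner ℝ (f ω) (g ω) ∂P| ≤ ∫ ω, ‖f ω‖ * ‖g ω‖ ∂P := by
        refine norm_integral_le_of_norm_le (f := fun ω => inner ℝ (f ω) (g ω))
          (hf.norm.integrable_mul hg.norm) ?_
        exact Eventually.of_forall fun ω => by simpa using abs_real_inner_le_norm (f ω) (g ω)
    _ ≤ l2norm P f * l2norm P g := by
        have := integral_mul_le_Lp_mul_Lq_of_nonneg (μ := P) (f := fun ω => ‖f ω‖)
          (g := fun ω => ‖g ω‖) Real.HolderConjugate.two_two
          (Eventually.of_forall fun _ => norm_nonneg _)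
          (Eventually.of_forall fun _ => norm_nonneg _) (by simpa using hf.norm)
          (by simpa using hg.norm)
        simpa [l2norm, Real.sqrt_eq_rpow] using this

lemma integrable_inner_of_memLp {G : Type*} [NormedAddCommGroup G] [InnerProductSpace ℝ G]
    {P : Measure Ω} {f g : Ω → G} (hf : MemLp f 2 P) (hg : MemLp g 2 P) :
    Integrable (fun ω => inner ℝ (f ω) (g ω)) P := by
  refine (hf.norm.integrable_mul hg.norm).mono (hf.1.inner hg.1) (Eventually.of_forall fun ω => ?_)
  simpa using abs_real_inner_le_norm (f ω) (g ω)

end L2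

section Wasserstein

variable {Ω : Type*} [MeasurableSpace Ω]

lemma P2_prob {m : Measure (E n)} (h : m ∈ P2 n) : IsProbabilityMeasure m := h.1

lemma P2_memLp_id {m : Measure (E n)} (h : m ∈ P2 n) : MemLp (fun x : E n => x) 2 m :=
  (memLp_two_iff_integrable_sq_norm (by fun_prop)).2 h.2

lemma map_mem_P2 {P : Measure Ω} [IsProbabilityMeasure P] {X : Ω → E n} (hX : MemLp X 2 P) :
    P.map X ∈ P2 n := by
  refine ⟨Measure.isProbabilityMeasure_map hX.1.aemeasurable, ?_⟩
  rw [integrable_map_measure (by fun_prop) hX.1.aemeasurable]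
  exact integrable_sq_of_memLp hX

lemma secondMoment_map {P : Measure Ω} {X : Ω → E n} (hX : AEMeasurable X P) :
    secondMoment (P.map X) = ∫ ω, ‖X ω‖ ^ 2 ∂P := by
  unfold secondMoment
  rw [integral_map hX (by fun_prop)]

lemma sqrt_secondMoment_map {P : Measure Ω} {X : Ω → E n} (hX : AEMeasurable X P) :
    √(secondMoment (P.map X)) = l2norm P X := by
  rw [secondMoment_map hX, l2norm]

lemma sqrt_secondMoment (m : Measure (E n)) :
    √(secondMoment m) = l2norm m (fun x : E n => x) := rfl

lemma secondMoment_nonneg (m : Measure (E n)) : 0 ≤ secondMoment m :=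
  integral_nonneg fun _ => by positivity

lemma W2_nonneg (μ ν : Measure (E n)) : 0 ≤ W2 μ ν := Real.sqrt_nonneg _

lemma coupling_prob {μ ν : Measure (E n)} [IsProbabilityMeasure μ] {γ : Measure (E n × E n)}
    (h : γ ∈ couplings μ ν) : IsProbabilityMeasure γ :=
  have : IsProbabilityMeasure (γ.map Prod.fst) := by rw [h.1]; infer_instance
  Measure.isProbabilityMeasure_of_map Prod.fst

lemma coupling_memLp_fst {G : Type*} [NormedAddCommGroup G] {μ ν : Measure (E n)}
    {γ : Measure (E n × E n)} (h : γ ∈ couplings μ ν) {f : E n → G} (hf : MemLp f 2 μ) :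
    MemLp (fun p => f p.1) 2 γ := by
  rw [← h.1] at hf
  exact hf.comp_of_map measurable_fst.aemeasurable

lemma coupling_memLp_snd {G : Type*} [NormedAddCommGroup G] {μ ν : Measure (E n)}
    {γ : Measure (E n × E n)} (h : γ ∈ couplings μ ν) {f : E n → G} (hf : MemLp f 2 ν) :
    MemLp (fun p => f p.2) 2 γ := by
  rw [← h.2] at hf
  exact hf.comp_of_map measurable_snd.aemeasurable

lemma coupling_memLp_sub {μ ν : Measure (E n)} {γ : Measure (E n × E n)} (h : γ ∈ couplings μ ν)
    (hμ : μ ∈ P2 n) (hν : ν ∈ P2 n) : MemLp (fun p => p.2 - p.1) 2 γ :=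
  (coupling_memLp_snd h (P2_memLp_id hν)).sub (coupling_memLp_fst h (P2_memLp_id hμ))

lemma map_prodMk_mem_couplings {P : Measure Ω} {X Y : Ω → E n} (hX : AEMeasurable X P)
    (hY : AEMeasurable Y P) : P.map (fun ω => (X ω, Y ω)) ∈ couplings (P.map X) (P.map Y) := by
  constructor
  · rw [AEMeasurable.map_map_of_aemeasurable measurable_fst.aemeasurable (hX.prodMk hY)]; rfl
  · rw [AEMeasurable.map_map_of_aemeasurable measurable_snd.aemeasurable (hX.prodMk hY)]; rfl

lemma prod_mem_couplings (μ ν : Measure (E n)) [IsProbabilityMeasure μ] [IsProbabilityMeasure ν] :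
    μ.prod ν ∈ couplings μ ν := by
  constructor
  · simp
  · simp

lemma lintegral_eq_ofReal_sq {P : Measure Ω} {G : Type*} [NormedAddCommGroup G] {f : Ω → G}
    (hf : MemLp f 2 P) : ∫⁻ ω, ‖f ω‖ₑ ^ 2 ∂P = ENNReal.ofReal (∫ ω, ‖f ω‖ ^ 2 ∂P) := by
  rw [ofReal_integral_eq_lintegral_ofReal (integrable_sq_of_memLp hf)
    (Eventually.of_forall fun _ => by positivity)]
  refine lintegral_congr fun ω => ?_
  rw [ENNReal.ofReal_pow (norm_nonneg _), ofReal_norm]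

lemma W2_map_le {P : Measure Ω} {X Y : Ω → E n} (hX : AEMeasurable X P) (hY : AEMeasurable Y P)
    (h : MemLp (fun ω => X ω - Y ω) 2 P) :
    W2 (P.map X) (P.map Y) ≤ l2norm P (fun ω => X ω - Y ω) := by
  refine Real.sqrt_le_sqrt ?_
  have h1 : (⨅ γ ∈ couplings (P.map X) (P.map Y), ∫⁻ p, ‖p.1 - p.2‖ₑ ^ 2 ∂γ)
      ≤ ENNReal.ofReal (∫ ω, ‖X ω - Y ω‖ ^ 2 ∂P) := by
    refine (iInf₂_le _ (map_prodMk_mem_couplings hX hY)).trans ?_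
    rw [lintegral_map' (by fun_prop) (hX.prodMk hY), ← lintegral_eq_ofReal_sq h]
  have := ENNReal.toReal_mono ENNReal.ofReal_ne_top h1
  rwa [ENNReal.toReal_ofReal (integral_nonneg fun _ => by positivity)] at this

/-- A bound by the quadratic cost of every coupling is a bound by the squared distance. -/
lemma le_W2_sq_of_forall_coupling {μ ν : Measure (E n)} (hμ : μ ∈ P2 n) (hν : ν ∈ P2 n)
    {q K : ℝ} (hK : 0 < K) (h : ∀ γ ∈ couplings μ ν, q ≤ K * ∫ p, ‖p.2 - p.1‖ ^ 2 ∂γ) :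
    q ≤ K * W2 μ ν ^ 2 := by
  have := P2_prob hμ
  have := P2_prob hν
  unfold W2
  rw [Real.sq_sqrt ENNReal.toReal_nonneg]
  by_cases hq : q ≤ 0
  · exact hq.trans (by positivity)
  push Not at hq
  have h1 : ∀ γ ∈ couplings μ ν, ∫⁻ p, ‖p.1 - p.2‖ₑ ^ 2 ∂γ
      = ENNReal.ofReal (∫ p, ‖p.2 - p.1‖ ^ 2 ∂γ) := fun γ hγ => by
    rw [← lintegral_eq_ofReal_sq (coupling_memLp_sub hγ hμ hν)]
    refine lintegral_congr fun p => ?_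
    rw [← enorm_neg, neg_sub]
  have h2 : ENNReal.ofReal (q / K) ≤ ⨅ γ ∈ couplings μ ν, ∫⁻ p, ‖p.1 - p.2‖ₑ ^ 2 ∂γ := by
    refine le_iInf₂ fun γ hγ => ?_
    rw [h1 γ hγ]
    exact ENNReal.ofReal_le_ofReal (by rw [div_le_iff₀' hK]; exact h γ hγ)
  have h3 : (⨅ γ ∈ couplings μ ν, ∫⁻ p, ‖p.1 - p.2‖ₑ ^ 2 ∂γ) ≠ ∞ := by
    refine ne_top_of_le_ne_top ?_ (iInf₂_le _ (prod_mem_couplings μ ν))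
    rw [h1 _ (prod_mem_couplings μ ν)]
    exact ENNReal.ofReal_ne_top
  have := ENNReal.toReal_mono h3 h2
  rwa [ENNReal.toReal_ofReal (by positivity), div_le_iff₀' hK] at this

end Wasserstein

/-! ### Second order expansion of the mean cost -/

section Noise

/-- The uniform law on the unit ball, used to smooth the laws of random variables. -/
noncomputable def noise (n : ℕ) : Measure (E n) :=
  ProbabilityTheory.cond volume (Metric.ball 0 1)

instance : IsProbabilityMeasure (noise n) :=
  ProbabilityTheory.cond_isProbabilityMeasure_of_finite
    (Metric.measure_ball_pos _ _ one_pos).ne' measure_ball_lt_top.ne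

lemma noise_absolutelyContinuous : noise n ≪ volume :=
  ProbabilityTheory.cond_absolutelyContinuous

lemma norm_le_one_ae_noise : ∀ᵐ x ∂(noise n), ‖x‖ ≤ 1 := by
  have : ∀ᵐ x ∂(noise n), x ∈ Metric.ball (0 : E n) 1 :=
    ProbabilityTheory.ae_cond_mem measurableSet_ball
  exact this.mono fun x hx => (mem_ball_zero_iff.1 hx).le

variable {Ω : Type*} [MeasurableSpace Ω]

lemma norm_noise_le_one_ae (P : Measure Ω) [IsProbabilityMeasure P] :
    ∀ᵐ q ∂(P.prod (noise n)), ‖q.2‖ ≤ 1 :=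
  Measure.quasiMeasurePreserving_snd.ae norm_le_one_ae_noise

lemma memLp_noise (P : Measure Ω) [IsProbabilityMeasure P] :
    MemLp (fun q : Ω × E n => q.2) 2 (P.prod (noise n)) :=
  MemLp.of_bound (by fun_prop) 1 (norm_noise_le_one_ae P)

lemma l2norm_noise_le (P : Measure Ω) [IsProbabilityMeasure P] :
    l2norm (P.prod (noise n)) (fun q => q.2) ≤ 1 := by
  have := l2norm_mono (P := P.prod (noise n)) (f := fun q => q.2) (g := fun _ => (1 : ℝ))
    (memLp_const _) (by simpa using norm_noise_le_one_ae P)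
  simpa [l2norm_const] using this

lemma memLp_comp_fst {Ω' G : Type*} [MeasurableSpace Ω'] [NormedAddCommGroup G] {P : Measure Ω}
    {Q : Measure Ω'} [IsProbabilityMeasure Q] {X : Ω → G} (hX : MemLp X 2 P) :
    MemLp (fun q : Ω × Ω' => X q.1) 2 (P.prod Q) :=
  hX.comp_measurePreserving measurePreserving_fst

lemma map_add_noise_eq {P : Measure Ω} [IsProbabilityMeasure P] {X : Ω → E n}
    (hX : AEMeasurable X P) (ε : ℝ) :
    (P.prod (noise n)).map (fun q => X q.1 + ε • q.2)
      = ((P.map X).prod (noise n)).map (fun q => q.1 + ε • q.2) := by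
  have h1 := Measure.isProbabilityMeasure_map hX
  have hm : AEMeasurable (fun q : Ω × E n => X q.1) (P.prod (noise n)) := hX.comp_fst
  have : (P.map X).prod (noise n) = (P.prod (noise n)).map (fun q => (X q.1, q.2)) := by
    have hX' : P.map X = P.map (hX.mk X) := Measure.map_congr hX.ae_eq_mk
    rw [hX']
    conv_lhs => rw [← Measure.map_id (μ := noise n)]
    rw [Measure.map_prod_map _ _ hX.measurable_mk measurable_id]
    refine Measure.map_congr ?_
    have := Measure.quasiMeasurePreserving_fst (μ := P) (ν := noise n) |>.ae hX.ae_eq_mk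
    filter_upwards [this] with q hq
    simp [Prod.map, hq]
  rw [this, AEMeasurable.map_map_of_aemeasurable (by fun_prop) (hm.prodMk (by fun_prop))]
  rfl

end Noise

/-- The properties of the class `D` of measures that the argument uses: its elements have finite
second moment, it is stable under perturbations of the identity with Lipschitz constant less
than one, and it contains the laws obtained by adding an independent noise. -/
structure StateClass (D : Set (Measure (E n))) : Prop where
  subset : D ⊆ P2 n
  map_mem : ∀ m ∈ D, ∀ (ρ : ℝ) (g : E n → E n), 0 ≤ ρ → ρ < 1 →
    (∀ x x', ‖g x - g x' - (x - x')‖ ≤ ρ * ‖x - x'‖) → m.map g ∈ D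
  noise_mem : ∀ μ ∈ P2 n, ∀ ε : ℝ, ε ≠ 0 →
    (μ.prod (noise n)).map (fun q => q.1 + ε • q.2) ∈ D

lemma StateClass.add_noise_mem {D : Set (Measure (E n))} (hD : StateClass D) {Ω : Type*}
    [MeasurableSpace Ω] {P : Measure Ω} [IsProbabilityMeasure P] {X : Ω → E n} (hX : MemLp X 2 P)
    {ε : ℝ} (hε : ε ≠ 0) : (P.prod (noise n)).map (fun q => X q.1 + ε • q.2) ∈ D := by
  rw [map_add_noise_eq hX.1.aemeasurable]
  exact hD.noise_mem _ (map_mem_P2 hX) ε hε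

lemma lipschitz_of_perturbation {ρ : ℝ} {g : E n → E n}
    (hg : ∀ x x', ‖g x - g x' - (x - x')‖ ≤ ρ * ‖x - x'‖) (x x' : E n) :
    ‖g x - g x'‖ ≤ (1 + ρ) * ‖x - x'‖ := by
  have := norm_add_le (g x - g x' - (x - x')) (x - x')
  rw [sub_add_cancel] at this
  linarith [hg x x']

lemma antilipschitz_of_perturbation {ρ : ℝ} {g : E n → E n}
    (hg : ∀ x x', ‖g x - g x' - (x - x')‖ ≤ ρ * ‖x - x'‖) (x x' : E n) :
    (1 - ρ) * ‖x - x'‖ ≤ ‖g x - g x'‖ := by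
  have := norm_sub_norm_le (x - x') (g x - g x')
  rw [norm_sub_rev (x - x')] at this
  linarith [hg x x']

lemma continuous_of_norm_sub_le {G H : Type*} [SeminormedAddCommGroup G]
    [SeminormedAddCommGroup H] {g : G → H} {K : ℝ} (hg : ∀ x x', ‖g x - g x'‖ ≤ K * ‖x - x'‖) :
    Continuous g := by
  refine (LipschitzWith.of_dist_le_mul (K := K.toNNReal) fun x y => ?_).continuous
  rw [dist_eq_norm, dist_eq_norm]
  exact (hg x y).trans (mul_le_mul_of_nonneg_right (Real.le_coe_toNNReal K) (norm_nonneg _))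

lemma continuous_of_perturbation {ρ : ℝ} {g : E n → E n}
    (hg : ∀ x x', ‖g x - g x' - (x - x')‖ ≤ ρ * ‖x - x'‖) : Continuous g :=
  continuous_of_norm_sub_le (lipschitz_of_perturbation hg)

lemma map_perturbation_mem_P2 {m : Measure (E n)} (hm : m ∈ P2 n) {ρ : ℝ} {g : E n → E n}
    (hg : ∀ x x', ‖g x - g x' - (x - x')‖ ≤ ρ * ‖x - x'‖) : m.map g ∈ P2 n := by
  have := P2_prob hm
  refine map_mem_P2 (memLp_of_affine_bound
    (continuous_of_perturbation hg).aestronglyMeasurable (P2_memLp_id hm) (1 + ρ) ‖g 0‖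
    (Eventually.of_forall fun x => ?_))
  have h1 := lipschitz_of_perturbation hg x 0
  have h2 := norm_add_le (g x - g 0) (g 0)
  rw [sub_add_cancel] at h2
  rw [sub_zero] at h1
  linarith

lemma stateClass_P2 : StateClass (P2 n) where
  subset := subset_rfl
  map_mem m hm _ g _ _ hg := map_perturbation_mem_P2 hm hg
  noise_mem μ hμ ε _ := by
    have := P2_prob hμ
    exact map_mem_P2 ((memLp_comp_fst (P2_memLp_id hμ)).add ((memLp_noise μ).const_smul ε))

/-- Perturbations of the identity do not charge null sets, since their inverse is Lipschitz. -/
lemma map_perturbation_absolutelyContinuous {m : Measure (E n)} (hm : m ≪ volume) {ρ : ℝ}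
    {g : E n → E n} (hρ : ρ < 1) (hg : ∀ x x', ‖g x - g x' - (x - x')‖ ≤ ρ * ‖x - x'‖) :
    m.map g ≪ volume := by
  refine Measure.AbsolutelyContinuous.mk fun s hs h0 => ?_
  rw [Measure.map_apply (continuous_of_perturbation hg).measurable hs]
  refine hm ?_
  have hanti : AntilipschitzWith ((1 - ρ)⁻¹).toNNReal g := by
    refine AntilipschitzWith.of_le_mul_dist fun x y => ?_
    rw [Real.coe_toNNReal _ (by rw [inv_nonneg]; linarith), dist_eq_norm, dist_eq_norm,
      inv_mul_eq_div, le_div_iff₀' (by linarith)]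
    exact antilipschitz_of_perturbation hg x y
  let d := Module.finrank ℝ (E n)
  let H : Measure (E n) := Measure.hausdorffMeasure (d : ℝ)
  have hH : (volume : Measure (E n)) ≪ H ∧ H ≪ volume := by
    constructor
    · rw [Measure.isAddLeftInvariant_eq_smul (volume : Measure (E n)) H]
      exact Measure.smul_absolutelyContinuous
    · rw [Measure.isAddLeftInvariant_eq_smul H (volume : Measure (E n))]
      exact Measure.smul_absolutelyContinuous
  refine hH.1 ?_
  have := hanti.hausdorffMeasure_preimage_le (d := (d : ℝ)) (by positivity) s
  rw [show (Measure.hausdorffMeasure (d : ℝ) : Measure (E n)) s = 0 from hH.2 h0, mul_zero] at this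
  exact le_antisymm this bot_le

lemma stateClass_P2ac : StateClass (P2ac n) where
  subset := fun _ h => h.1
  map_mem m hm _ g _ hρ1 hg := ⟨map_perturbation_mem_P2 hm.1 hg,
    map_perturbation_absolutelyContinuous hm.2 hρ1 hg⟩
  noise_mem μ hμ ε hε := by
    refine ⟨stateClass_P2.noise_mem μ hμ ε hε, Measure.AbsolutelyContinuous.mk fun s hs h0 => ?_⟩
    have := P2_prob hμ
    rw [Measure.map_apply (by fun_prop) hs, Measure.prod_apply (by measurability),
      lintegral_eq_zero_iff' (measurable_measure_prodMk_left (by measurability)).aemeasurable]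
    refine Eventually.of_forall fun x => noise_absolutelyContinuous ?_
    have e : Prod.mk x ⁻¹' ((fun q : E n × E n => q.1 + ε • q.2) ⁻¹' s)
        = (ε • · ) ⁻¹' ((x + ·) ⁻¹' s) := rfl
    rw [e, Measure.addHaar_preimage_smul _ hε, measure_preimage_add, h0, mul_zero]

/-- The properties of a functional `Φ` of measures and of its functional derivative `F` that the
argument uses. The expansion says that the lift of `Φ` to random variables is of class `C^{1,1}`,
with gradient `D_xF(X, law X)`. -/
structure RegularCost (D : Set (Measure (E n))) (c : ℝ) (Φ : Measure (E n) → ℝ)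
    (F : E n → Measure (E n) → ℝ) : Prop where
  differentiable : ∀ m ∈ D, Differentiable ℝ (fun x => F x m)
  grad_lipschitz : ∀ x₁ x₂, ∀ m₁ ∈ D, ∀ m₂ ∈ D,
    ‖gradX F x₁ m₁ - gradX F x₂ m₂‖ ≤ c / 2 * (‖x₁ - x₂‖ + W2 m₁ m₂)
  grad_growth : ∀ x, ∀ m ∈ D,
    ‖gradX F x m‖ ≤ c / 2 * (1 + ‖x‖ + Real.sqrt (secondMoment m))
  expansion : ∀ m₁ ∈ D, ∀ m₂ ∈ D, ∀ γ ∈ couplings m₁ m₂,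
    |Φ m₂ - Φ m₁ - ∫ p, inner ℝ (gradX F p.1 m₁) (p.2 - p.1) ∂γ|
      ≤ c / 2 * ∫ p, ‖p.2 - p.1‖ ^ 2 ∂γ

lemma W2_self {m : Measure (E n)} (hm : m ∈ P2 n) : W2 m m = 0 := by
  have := P2_prob hm
  have h := W2_map_le (P := m) (X := fun x => x) (Y := fun x => x) aemeasurable_id'
    aemeasurable_id' (by simp)
  rw [Measure.map_id'] at h
  refine le_antisymm (h.trans ?_) (W2_nonneg _ _)
  simp [l2norm]

/-- A Taylor estimate for functions with Lipschitz gradient. -/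
lemma abs_sub_sub_inner_gradient_le {φ : E n → ℝ} (hφ : Differentiable ℝ φ) {K : ℝ} (hK : 0 ≤ K)
    (hL : ∀ x y, ‖gradient φ x - gradient φ y‖ ≤ K * ‖x - y‖) (x y : E n) :
    |φ y - φ x - inner ℝ (gradient φ x) (y - x)| ≤ K * ‖y - x‖ ^ 2 := by
  have h := (convex_segment x y).norm_image_sub_le_of_norm_hasFDerivWithin_le'
    (f := φ) (f' := fun z => fderiv ℝ φ z) (φ := fderiv ℝ φ x) (C := K * ‖y - x‖)
    (fun z _ => (hφ z).hasFDerivAt.hasFDerivWithinAt) (fun z hz => ?_)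
    (left_mem_segment ℝ x y) (right_mem_segment ℝ x y)
  · rw [gradient, InnerProductSpace.toDual_symm_apply]
    rw [Real.norm_eq_abs] at h
    calc _ ≤ K * ‖y - x‖ * ‖y - x‖ := h
      _ = _ := by ring
  · have h1 : ‖fderiv ℝ φ z - fderiv ℝ φ x‖ = ‖gradient φ z - gradient φ x‖ := by
      rw [gradient, gradient, ← map_sub, LinearIsometryEquiv.norm_map]
    rw [h1]
    refine (hL z x).trans (mul_le_mul_of_nonneg_left ?_ hK)
    obtain ⟨a, b, _, hb, hab, rfl⟩ := hz
    have : a • x + b • y - x = b • (y - x) := by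
      rw [show a = 1 - b by linarith]; module
    rw [this, norm_smul, Real.norm_of_nonneg hb]
    exact mul_le_of_le_one_left (norm_nonneg _) (by linarith)

section GradLemmas

variable {D : Set (Measure (E n))} {c : ℝ} {F : E n → Measure (E n) → ℝ}

lemma gradX_lipschitz_left (hD : StateClass D)
    (hL : ∀ x₁ x₂, ∀ m₁ ∈ D, ∀ m₂ ∈ D,
      ‖gradX F x₁ m₁ - gradX F x₂ m₂‖ ≤ c / 2 * (‖x₁ - x₂‖ + W2 m₁ m₂))
    {m : Measure (E n)} (hm : m ∈ D) (x y : E n) :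
    ‖gradX F x m - gradX F y m‖ ≤ c / 2 * ‖x - y‖ := by
  simpa [W2_self (hD.subset hm)] using hL x y m hm m hm

lemma memLp_gradX (hD : StateClass D)
    (hL : ∀ x₁ x₂, ∀ m₁ ∈ D, ∀ m₂ ∈ D,
      ‖gradX F x₁ m₁ - gradX F x₂ m₂‖ ≤ c / 2 * (‖x₁ - x₂‖ + W2 m₁ m₂))
    {m : Measure (E n)} (hm : m ∈ D) {Ω : Type*} [MeasurableSpace Ω] {P : Measure Ω}
    [IsProbabilityMeasure P] {X : Ω → E n} (hX : MemLp X 2 P) :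
    MemLp (fun ω => gradX F (X ω) m) 2 P := by
  have h := gradX_lipschitz_left hD hL hm
  refine memLp_of_affine_bound ((continuous_of_norm_sub_le h).comp_aestronglyMeasurable hX.1) hX
    (c / 2) ‖gradX F 0 m‖ (Eventually.of_forall fun ω => ?_)
  have h1 := h (X ω) 0
  have h2 := norm_add_le (gradX F (X ω) m - gradX F 0 m) (gradX F 0 m)
  rw [sub_add_cancel] at h2
  rw [sub_zero] at h1
  linarith

/-- First order expansion along random variables, at a fixed measure. -/
lemma HasFuncDeriv.expansion {Φ : Measure (E n) → ℝ} (hD : StateClass D) (hc : 0 ≤ c)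
    (hL : ∀ x₁ x₂, ∀ m₁ ∈ D, ∀ m₂ ∈ D,
      ‖gradX F x₁ m₁ - gradX F x₂ m₂‖ ≤ c / 2 * (‖x₁ - x₂‖ + W2 m₁ m₂))
    {m : Measure (E n)} (hm : m ∈ D) (hF : Differentiable ℝ (fun x => F x m))
    (hΦ : HasFuncDeriv D Φ m (fun x => F x m)) {η : ℝ} (hη : 0 < η) :
    ∃ δ > 0, ∀ {Ω : Type} [MeasurableSpace Ω] (P : Measure Ω) [IsProbabilityMeasure P]
      (X Y : Ω → E n), MemLp X 2 P → MemLp Y 2 P → P.map X = m → P.map Y ∈ D →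
      l2norm P (fun ω => Y ω - X ω) < δ →
      |Φ (P.map Y) - Φ m - ∫ ω, inner ℝ (gradX F (X ω) m) (Y ω - X ω) ∂P|
        ≤ η * l2norm P (fun ω => Y ω - X ω) + c / 2 * l2norm P (fun ω => Y ω - X ω) ^ 2 := by
  obtain ⟨δ, hδ, h⟩ := hΦ.2 η hη
  refine ⟨δ, hδ, fun {Ω} _ P _ X Y hX hY hXm hYD hlt => ?_⟩
  have hW : W2 (P.map Y) m ≤ l2norm P (fun ω => Y ω - X ω) := by
    rw [← hXm]
    exact W2_map_le hY.1.aemeasurable hX.1.aemeasurable (hY.sub hX)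
  have h1 := h _ hYD (hW.trans_lt hlt)
  have hiY : Integrable (fun ω => F (Y ω) m) P :=
    (integrable_map_measure (hF.continuous.aestronglyMeasurable) hY.1.aemeasurable).1
      (hΦ.1 _ hYD)
  have hiX : Integrable (fun ω => F (X ω) m) P :=
    (integrable_map_measure (hF.continuous.aestronglyMeasurable) hX.1.aemeasurable).1
      (hΦ.1 _ (hXm ▸ hm))
  have e : (∫ x, F x m ∂(P.map Y)) - ∫ x, F x m ∂m = ∫ ω, (F (Y ω) m - F (X ω) m) ∂P := by
    rw [integral_sub hiY hiX, integral_map hY.1.aemeasurable hF.continuous.aestronglyMeasurable]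
    conv_lhs => rw [← hXm, integral_map hX.1.aemeasurable
      (hXm ▸ hF.continuous.aestronglyMeasurable)]
    rw [hXm]
  have hin : Integrable (fun ω => inner ℝ (gradX F (X ω) m) (Y ω - X ω)) P :=
    integrable_inner_of_memLp (memLp_gradX hD hL hm hX) (hY.sub hX)
  have h2 : |(∫ ω, (F (Y ω) m - F (X ω) m) ∂P)
      - ∫ ω, inner ℝ (gradX F (X ω) m) (Y ω - X ω) ∂P|
      ≤ c / 2 * l2norm P (fun ω => Y ω - X ω) ^ 2 := by
    have hsub : Integrable (fun ω => F (Y ω) m - F (X ω) m) P := hiY.sub hiX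
    rw [← integral_sub hsub hin, l2norm_sq, ← integral_const_mul]
    refine norm_integral_le_of_norm_le
      (f := fun ω => F (Y ω) m - F (X ω) m - inner ℝ (gradX F (X ω) m) (Y ω - X ω))
      ((integrable_sq_of_memLp (hY.sub hX)).const_mul _)
      (Eventually.of_forall fun ω => ?_)
    exact abs_sub_sub_inner_gradient_le hF (by positivity) (gradX_lipschitz_left hD hL hm) _ _
  rw [e] at h1
  have h3 := abs_add_le (Φ (P.map Y) - Φ m - ∫ ω, (F (Y ω) m - F (X ω) m) ∂P)
    ((∫ ω, (F (Y ω) m - F (X ω) m) ∂P) - ∫ ω, inner ℝ (gradX F (X ω) m) (Y ω - X ω) ∂P)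
  rw [sub_add_sub_cancel] at h3
  have h4 := mul_le_mul_of_nonneg_left hW hη.le
  linarith

end GradLemmas

section Expansion

variable {D : Set (Measure (E n))} {c : ℝ} {F : E n → Measure (E n) → ℝ}
  {Φ : Measure (E n) → ℝ}

lemma l2norm_gradX_sub_le {D : Set (Measure (E n))} (hc : 0 ≤ c)
    (hL : ∀ x₁ x₂, ∀ m₁ ∈ D, ∀ m₂ ∈ D,
      ‖gradX F x₁ m₁ - gradX F x₂ m₂‖ ≤ c / 2 * (‖x₁ - x₂‖ + W2 m₁ m₂))
    {Ω : Type*} [MeasurableSpace Ω] {P : Measure Ω} [IsProbabilityMeasure P] {X Y : Ω → E n}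
    (hX : MemLp X 2 P) (hY : MemLp Y 2 P) (hXD : P.map X ∈ D) (hYD : P.map Y ∈ D) :
    l2norm P (fun ω => gradX F (X ω) (P.map X) - gradX F (Y ω) (P.map Y))
      ≤ c * l2norm P (fun ω => X ω - Y ω) := by
  have h := l2norm_le_affine (P := P)
    (f := fun ω => gradX F (X ω) (P.map X) - gradX F (Y ω) (P.map Y))
    (g := fun ω => X ω - Y ω) (hX.sub hY) (α := c / 2)
    (β := c / 2 * l2norm P (fun ω => X ω - Y ω)) (by positivity)
    (mul_nonneg (by positivity) (l2norm_nonneg _ _)) (Eventually.of_forall fun ω => ?_)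
  · linarith
  · have h1 := hL (X ω) (Y ω) _ hXD _ hYD
    have h2 := mul_le_mul_of_nonneg_left
      (W2_map_le hX.1.aemeasurable hY.1.aemeasurable (hX.sub hY)) (by positivity : 0 ≤ c / 2)
    linarith

/-- Along a segment of random variables whose laws stay in `D`, the lift of `Φ` is differentiable
and its derivative is Lipschitz, hence the second order estimate. -/
lemma expansion_of_segment (hD : StateClass D) (hc : 0 ≤ c)
    (hL : ∀ x₁ x₂, ∀ m₁ ∈ D, ∀ m₂ ∈ D,
      ‖gradX F x₁ m₁ - gradX F x₂ m₂‖ ≤ c / 2 * (‖x₁ - x₂‖ + W2 m₁ m₂))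
    (hF : ∀ m ∈ D, Differentiable ℝ (fun x => F x m))
    (hΦ : ∀ m ∈ D, HasFuncDeriv D Φ m (fun x => F x m))
    {Ω : Type} [MeasurableSpace Ω] {P : Measure Ω} [IsProbabilityMeasure P] {X Δ : Ω → E n}
    (hX : MemLp X 2 P) (hΔ : MemLp Δ 2 P)
    (hmem : ∀ θ : ℝ, P.map (fun ω => X ω + θ • Δ ω) ∈ D) :
    |Φ (P.map (fun ω => X ω + Δ ω)) - Φ (P.map X)
      - ∫ ω, inner ℝ (gradX F (X ω) (P.map X)) (Δ ω) ∂P| ≤ c / 2 * l2norm P Δ ^ 2 := by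
  -- the lift is differentiated along the segment, and a Lipschitz derivative gives the estimate
  set Z : ℝ → Ω → E n := fun θ ω => X ω + θ • Δ ω with hZ
  have hZL : ∀ θ, MemLp (Z θ) 2 P := fun θ => hX.add (hΔ.const_smul θ)
  set g : ℝ → ℝ := fun θ => Φ (P.map (Z θ)) with hg
  set g' : ℝ → ℝ := fun θ => ∫ ω, inner ℝ (gradX F (Z θ ω) (P.map (Z θ))) (Δ ω) ∂P with hg'
  set A := l2norm P Δ with hA
  have hA0 : 0 ≤ A := l2norm_nonneg _ _
  have hdiff : ∀ θ θ' ω, Z θ' ω - Z θ ω = (θ' - θ) • Δ ω := fun θ θ' ω => by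
    simp only [hZ]; module
  have hl2 : ∀ θ θ', l2norm P (fun ω => Z θ' ω - Z θ ω) = |θ' - θ| * A := fun θ θ' => by
    simp only [hdiff, hA, l2norm_smul]
  have hderiv : ∀ θ, HasDerivAt g (g' θ) θ := fun θ => by
    rw [hasDerivAt_iff_isLittleO, Asymptotics.isLittleO_iff]
    intro κ hκ
    obtain ⟨δ, hδ, h⟩ := HasFuncDeriv.expansion hD hc hL (hmem θ) (hF _ (hmem θ))
      (hΦ _ (hmem θ)) (η := κ / (2 * (A + 1))) (by positivity)
    have hlim : Tendsto (fun θ' => |θ' - θ| * A) (𝓝 θ) (𝓝 0) := by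
      have : Continuous (fun θ' => |θ' - θ| * A) := by fun_prop
      simpa using this.tendsto θ
    have hlim2 : Tendsto (fun θ' => c / 2 * |θ' - θ| * A ^ 2) (𝓝 θ) (𝓝 0) := by
      have : Continuous (fun θ' => c / 2 * |θ' - θ| * A ^ 2) := by fun_prop
      simpa using this.tendsto θ
    filter_upwards [hlim.eventually_lt_const hδ,
      hlim2.eventually_lt_const (by positivity : 0 < κ / 2)] with θ' h1 h2
    have h3 := h P (Z θ) (Z θ') (hZL θ) (hZL θ') rfl (hmem θ') (by rwa [hl2])
    have e : ∫ ω, inner ℝ (gradX F (Z θ ω) (P.map (Z θ))) (Z θ' ω - Z θ ω) ∂P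
        = (θ' - θ) • g' θ := by
      simp only [hdiff, inner_smul_right, hg', integral_const_mul, smul_eq_mul]
    rw [hl2] at h3
    change |g θ' - g θ - ∫ ω, inner ℝ (gradX F (Z θ ω) (P.map (Z θ))) (Z θ' ω - Z θ ω) ∂P|
      ≤ _ at h3
    rw [e] at h3
    rw [Real.norm_eq_abs, Real.norm_eq_abs]
    refine h3.trans ?_
    have h4 : κ / (2 * (A + 1)) * (|θ' - θ| * A) ≤ κ / 2 * |θ' - θ| := by
      have : A / (A + 1) ≤ 1 := by rw [div_le_one (by positivity)]; linarith
      calc κ / (2 * (A + 1)) * (|θ' - θ| * A) = κ / 2 * |θ' - θ| * (A / (A + 1)) := by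
            field_simp
        _ ≤ κ / 2 * |θ' - θ| := mul_le_of_le_one_right (by positivity) this
    have h5 : c / 2 * (|θ' - θ| * A) ^ 2 ≤ κ / 2 * |θ' - θ| := by
      calc c / 2 * (|θ' - θ| * A) ^ 2 = (c / 2 * |θ' - θ| * A ^ 2) * |θ' - θ| := by ring
        _ ≤ κ / 2 * |θ' - θ| := mul_le_mul_of_nonneg_right h2.le (abs_nonneg _)
    linarith
  -- the derivative is Lipschitz along the segment
  have hbound : ∀ θ, 0 ≤ θ → |g' θ - g' 0| ≤ c * θ * A ^ 2 := fun θ hθ => by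
    have h1 : MemLp (fun ω => gradX F (Z θ ω) (P.map (Z θ))) 2 P :=
      memLp_gradX hD hL (hmem θ) (hZL θ)
    have h2 : MemLp (fun ω => gradX F (Z 0 ω) (P.map (Z 0))) 2 P :=
      memLp_gradX hD hL (hmem 0) (hZL 0)
    simp only [hg']
    rw [← integral_sub (integrable_inner_of_memLp h1 hΔ) (integrable_inner_of_memLp h2 hΔ)]
    simp only [← inner_sub_left]
    refine (abs_integral_inner_le (h1.sub h2) hΔ).trans ?_
    have h3 := l2norm_gradX_sub_le hc hL (hZL θ) (hZL 0) (hmem θ) (hmem 0)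
    rw [hl2, sub_zero, abs_of_nonneg hθ] at h3
    calc _ ≤ c * (θ * A) * A := mul_le_mul_of_nonneg_right h3 hA0
      _ = _ := by ring
  have hmain := image_norm_le_of_norm_deriv_right_le_deriv_boundary
    (f := fun θ => g θ - g 0 - θ * g' 0) (f' := fun θ => g' θ - g' 0) (a := 0) (b := 1)
    (B := fun θ => c / 2 * θ ^ 2 * A ^ 2) (B' := fun θ => c * θ * A ^ 2)
    (fun θ _ => (((hderiv θ).sub_const (g 0)).sub
      ((hasDerivAt_id θ).mul_const (g' 0))).continuousAt.continuousWithinAt)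
    (fun θ _ => by
      have := (((hderiv θ).sub_const (g 0)).sub
        ((hasDerivAt_id θ).mul_const (g' 0))).hasDerivWithinAt (s := Ici θ)
      refine HasDerivWithinAt.congr_deriv this ?_
      simp)
    (by simp)
    (fun θ => by
      have := (((hasDerivAt_pow 2 θ).const_mul (c / 2)).mul_const (A ^ 2))
      refine this.congr_deriv ?_
      push_cast; ring)
    (fun θ hθ => hbound θ hθ.1) (x := 1) (by simp)
  simpa [hg, hg', hZ] using hmain

/-- A mean cost with Lipschitz gradient has a second order expansion along every coupling. The
laws interpolating between the marginals of the coupling may leave `D`; they are brought back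
into it by a small independent noise, which is then removed. -/
lemma regularCost_of_hasFuncDeriv (hD : StateClass D) (hc : 0 ≤ c)
    (hF : ∀ m ∈ D, Differentiable ℝ (fun x => F x m))
    (hL : ∀ x₁ x₂, ∀ m₁ ∈ D, ∀ m₂ ∈ D,
      ‖gradX F x₁ m₁ - gradX F x₂ m₂‖ ≤ c / 2 * (‖x₁ - x₂‖ + W2 m₁ m₂))
    (hgr : ∀ x, ∀ m ∈ D, ‖gradX F x m‖ ≤ c / 2 * (1 + ‖x‖ + Real.sqrt (secondMoment m)))
    (hΦ : ∀ m ∈ D, HasFuncDeriv D Φ m (fun x => F x m)) : RegularCost D c Φ F where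
  differentiable := hF
  grad_lipschitz := hL
  grad_growth := hgr
  expansion m₁ hm₁ m₂ hm₂ γ hγ := by
    have hp₁ := P2_prob (hD.subset hm₁)
    have hpγ : IsProbabilityMeasure γ := coupling_prob hγ
    set P := γ.prod (noise n) with hP
    let X₁ : (E n × E n) × E n → E n := fun q => q.1.1
    let X₂ : (E n × E n) × E n → E n := fun q => q.1.2
    let N : (E n × E n) × E n → E n := fun q => q.2
    have hf1 : MemLp (fun p : E n × E n => p.1) 2 γ :=
      coupling_memLp_fst hγ (P2_memLp_id (hD.subset hm₁))
    have hf2 : MemLp (fun p : E n × E n => p.2) 2 γ :=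
      coupling_memLp_snd hγ (P2_memLp_id (hD.subset hm₂))
    have hX₁ : MemLp X₁ 2 P := memLp_comp_fst hf1
    have hX₂ : MemLp X₂ 2 P := memLp_comp_fst hf2
    have hN : MemLp N 2 P := memLp_noise γ
    have hΔ : MemLp (fun q => X₂ q - X₁ q) 2 P := hX₂.sub hX₁
    have hl : P.map Prod.fst = γ := by simp [hP]
    have hlaw₁ : P.map X₁ = m₁ := by
      rw [← hγ.1, ← hl, Measure.map_map measurable_fst measurable_fst]; rfl
    have hlaw₂ : P.map X₂ = m₂ := by
      rw [← hγ.2, ← hl, Measure.map_map measurable_snd measurable_fst]; rfl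
    have hY : ∀ {X : (E n × E n) × E n → E n}, MemLp X 2 P → ∀ ε : ℝ,
        MemLp (fun q => X q + ε • N q) 2 P := fun hX ε => hX.add (hN.const_smul ε)
    -- with noise, the whole line through the two variables has its laws in `D`
    have hYD : ∀ θ : ℝ, ∀ ε : ℝ, ε ≠ 0 →
        P.map (fun q => X₁ q + θ • (X₂ q - X₁ q) + ε • N q) ∈ D := fun θ ε hε =>
      hD.add_noise_mem (P := γ) (X := fun p => p.1 + θ • (p.2 - p.1))
        (hf1.add ((hf2.sub hf1).const_smul θ)) hε
    have hD₁ : ∀ ε : ℝ, ε ≠ 0 → P.map (fun q => X₁ q + ε • N q) ∈ D := fun ε hε => by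
      simpa using hYD 0 ε hε
    have hD₂ : ∀ ε : ℝ, ε ≠ 0 → P.map (fun q => X₂ q + ε • N q) ∈ D := fun ε hε => by
      simpa using hYD 1 ε hε
    have hnorm : ∀ X : (E n × E n) × E n → E n, ∀ ε : ℝ,
        l2norm P (fun q => X q + ε • N q - X q) ≤ |ε| := fun X ε => by
      simp only [add_sub_cancel_left, l2norm_smul]
      exact mul_le_of_le_one_right (abs_nonneg _) (l2norm_noise_le γ)
    -- the smoothed values converge to the values at the marginals, by the first order expansion
    have hcont : ∀ X : (E n × E n) × E n → E n, MemLp X 2 P → P.map X ∈ D →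
        (∀ ε : ℝ, ε ≠ 0 → P.map (fun q => X q + ε • N q) ∈ D) →
        Tendsto (fun ε : ℝ => Φ (P.map (fun q => X q + ε • N q))) (𝓝[>] 0)
          (𝓝 (Φ (P.map X))) := fun X hX hXD hXε => by
      obtain ⟨δ, hδ, h⟩ := HasFuncDeriv.expansion hD hc hL hXD (hF _ hXD) (hΦ _ hXD) one_pos
      set B := l2norm P (fun q => gradX F (X q) (P.map X)) with hB
      rw [tendsto_iff_norm_sub_tendsto_zero]
      refine squeeze_zero' (g := fun ε : ℝ => B * |ε| + (1 * |ε| + c / 2 * |ε| ^ 2))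
        (Eventually.of_forall fun _ => norm_nonneg _) ?_ ?_
      · have hlim : Tendsto (fun ε : ℝ => |ε|) (𝓝[>] 0) (𝓝 0) := by
          simpa using (continuous_abs.tendsto (0 : ℝ)).mono_left nhdsWithin_le_nhds
        filter_upwards [hlim.eventually_lt_const hδ, self_mem_nhdsWithin] with ε h1 h2
        have hne : ε ≠ 0 := (mem_Ioi.1 h2).ne'
        have h3 := h P X _ hX (hY hX ε) rfl (hXε ε hne) ((hnorm X ε).trans_lt h1)
        have h4 := abs_integral_inner_le (memLp_gradX hD hL hXD hX) (memLp_fun_sub (hY hX ε) hX)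
        have h5 := mul_le_mul_of_nonneg_left (hnorm X ε) (l2norm_nonneg P
          (fun q => gradX F (X q) (P.map X)))
        have h6 := pow_le_pow_left₀ (l2norm_nonneg _ _) (hnorm X ε) 2
        have h7 := mul_le_mul_of_nonneg_left h6 (by positivity : 0 ≤ c / 2)
        have h8 := hnorm X ε
        rw [Real.norm_eq_abs]
        have h9 := abs_sub_abs_le_abs_sub (Φ (P.map fun q => X q + ε • N q) - Φ (P.map X))
          (∫ q, inner ℝ (gradX F (X q) (P.map X)) (X q + ε • N q - X q) ∂P)
        linarith
      · have : Continuous (fun ε : ℝ => B * |ε| + (1 * |ε| + c / 2 * |ε| ^ 2)) := by fun_prop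
        simpa using (this.tendsto 0).mono_left nhdsWithin_le_nhds
    have hD₁' : P.map X₁ ∈ D := hlaw₁ ▸ hm₁
    have hD₂' : P.map X₂ ∈ D := hlaw₂ ▸ hm₂
    -- so does the first order term, since the gradient is Lipschitz
    have hgrad : Tendsto (fun ε : ℝ => ∫ q, inner ℝ (gradX F (X₁ q + ε • N q)
        (P.map (fun q => X₁ q + ε • N q))) (X₂ q - X₁ q) ∂P) (𝓝[>] 0)
        (𝓝 (∫ q, inner ℝ (gradX F (X₁ q) (P.map X₁)) (X₂ q - X₁ q) ∂P)) := by
      rw [tendsto_iff_norm_sub_tendsto_zero]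
      refine squeeze_zero' (g := fun ε : ℝ => c * |ε| * l2norm P (fun q => X₂ q - X₁ q))
        (Eventually.of_forall fun _ => norm_nonneg _) ?_ ?_
      · filter_upwards [self_mem_nhdsWithin] with ε h2
        have hne : ε ≠ 0 := (mem_Ioi.1 h2).ne'
        have g1 := memLp_gradX hD hL (hD₁ ε hne) (hY hX₁ ε)
        have g2 := memLp_gradX hD hL hD₁' hX₁
        rw [Real.norm_eq_abs, ← integral_sub (integrable_inner_of_memLp g1 hΔ)
          (integrable_inner_of_memLp g2 hΔ)]
        simp only [← inner_sub_left]
        refine (abs_integral_inner_le (g1.sub g2) hΔ).trans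
          (mul_le_mul_of_nonneg_right ?_ (l2norm_nonneg _ _))
        refine (l2norm_gradX_sub_le hc hL (hY hX₁ ε) hX₁ (hD₁ ε hne) hD₁').trans ?_
        exact mul_le_mul_of_nonneg_left (hnorm X₁ ε) hc
      · have : Continuous (fun ε : ℝ => c * |ε| * l2norm P (fun q => X₂ q - X₁ q)) := by fun_prop
        simpa using (this.tendsto 0).mono_left nhdsWithin_le_nhds
    -- the estimate along the smoothed segment passes to the limit
    have hfin := le_of_tendsto
      ((((hcont X₂ hX₂ hD₂' hD₂).sub (hcont X₁ hX₁ hD₁' hD₁)).sub hgrad).abs)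
      (b := c / 2 * l2norm P (fun q => X₂ q - X₁ q) ^ 2) (by
        filter_upwards [self_mem_nhdsWithin] with ε h2
        have hne : ε ≠ 0 := (mem_Ioi.1 h2).ne'
        have h := expansion_of_segment hD hc hL hF hΦ (hY hX₁ ε) hΔ (fun θ => by
          have := hYD θ ε hne
          convert this using 3
          abel)
        have e : ∀ q, X₂ q + ε • N q = X₁ q + ε • N q + (X₂ q - X₁ q) := fun q => by abel
        simpa only [e] using h)
    rw [hlaw₁, hlaw₂, l2norm_sq] at hfin
    have e1 : ∫ q, ‖X₂ q - X₁ q‖ ^ 2 ∂P = ∫ p, ‖p.2 - p.1‖ ^ 2 ∂γ := by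
      conv_rhs => rw [← hl, integral_map measurable_fst.aemeasurable (by fun_prop)]
    have e2 : ∫ q, inner ℝ (gradX F (X₁ q) m₁) (X₂ q - X₁ q) ∂P
        = ∫ p, inner ℝ (gradX F p.1 m₁) (p.2 - p.1) ∂γ := by
      have := continuous_of_norm_sub_le (gradX_lipschitz_left hD hL hm₁)
      conv_rhs => rw [← hl, integral_map measurable_fst.aemeasurable
        ((this.comp continuous_fst).inner (by fun_prop)).aestronglyMeasurable]
    rwa [e1, e2] at hfin

end Expansion

/-! ### Calculus along absolutely continuous curves -/

section Curves

lemma absolutelyContinuousOnInterval_of_dist_le {X Y : Type*} [PseudoMetricSpace X]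
    [PseudoMetricSpace Y] {f : ℝ → X} {g : ℝ → Y} {a b M : ℝ}
    (hg : AbsolutelyContinuousOnInterval g a b)
    (h : ∀ x ∈ uIcc a b, ∀ y ∈ uIcc a b, dist (f x) (f y) ≤ M * dist (g x) (g y)) :
    AbsolutelyContinuousOnInterval f a b := by
  have h0 : Tendsto (fun E : ℕ × (ℕ → ℝ × ℝ) =>
      M * ∑ i ∈ Finset.range E.1, dist (g (E.2 i).1) (g (E.2 i).2))
      (AbsolutelyContinuousOnInterval.totalLengthFilter ⊓
        𝓟 (AbsolutelyContinuousOnInterval.disjWithin a b)) (𝓝 0) := by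
    simpa using Tendsto.const_mul M hg
  refine squeeze_zero' (Eventually.of_forall fun _ => Finset.sum_nonneg fun _ _ => dist_nonneg)
    ?_ h0
  filter_upwards [mem_inf_of_right (mem_principal_self _)] with I hI
  rw [Finset.mul_sum]
  exact Finset.sum_le_sum fun i hi => h _ (hI.1 i hi).1 _ (hI.1 i hi).2

variable {G : Type*} [NormedAddCommGroup G] [NormedSpace ℝ G] [CompleteSpace G]

/-- The fundamental theorem of calculus for a function `k` of a curve `x + ∫ w` with integrable
velocity `w`. -/
lemma integral_eq_sub_of_curve {w : ℝ → G} {t T M : ℝ} (htT : t ≤ T)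
    (hw : IntervalIntegrable w volume t T) (x : G) {k k' : ℝ → ℝ} (hM : 0 ≤ M)
    (hk : ∀ r ∈ Icc t T, ∀ s ∈ Icc t T, r ≤ s → |k s - k r| ≤ M * ∫ σ in r..s, (‖w σ‖ + 1))
    (hk' : ∀ s ∈ Ioo t T, HasDerivAt (fun s => x + ∫ σ in t..s, w σ) (w s) s →
      HasDerivAt k (k' s) s) :
    ∫ s in t..T, k' s = k T - k t := by
  have hI : IntervalIntegrable (fun σ => ‖w σ‖ + 1) volume t T :=
    hw.norm.add intervalIntegrable_const
  have hsub : ∀ {r s}, r ∈ Icc t T → s ∈ Icc t T →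
      IntervalIntegrable (fun σ => ‖w σ‖ + 1) volume r s := fun {r s} hr hs =>
    hI.mono_set (by rw [uIcc_of_le htT]; exact uIcc_subset_Icc hr hs)
  have hle : ∀ r ∈ Icc t T, ∀ s ∈ Icc t T, r ≤ s →
      dist (k r) (k s) ≤ M * dist (∫ σ in t..r, (‖w σ‖ + 1)) (∫ σ in t..s, (‖w σ‖ + 1)) := by
    intro r hr s hs hrs
    have ht : t ∈ Icc t T := left_mem_Icc.2 htT
    rw [dist_comm, Real.dist_eq, dist_comm (∫ σ in t..r, (‖w σ‖ + 1)), Real.dist_eq,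
      intervalIntegral.integral_interval_sub_left (hsub ht hs) (hsub ht hr)]
    exact (hk r hr s hs hrs).trans (mul_le_mul_of_nonneg_left (le_abs_self _) hM)
  have hac : AbsolutelyContinuousOnInterval k t T := by
    refine absolutelyContinuousOnInterval_of_dist_le (M := M)
      (hI.absolutelyContinuousOnInterval_intervalIntegral (c := t) left_mem_uIcc) ?_
    intro r hr s hs
    rw [uIcc_of_le htT] at hr hs
    rcases le_total r s with h | h
    · exact hle r hr s hs h
    · rw [dist_comm (k r), dist_comm (∫ σ in t..r, (‖w σ‖ + 1))]
      exact hle s hs r hr h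
  rw [← hac.integral_deriv_eq_sub]
  refine intervalIntegral.integral_congr_ae ?_
  have hne : ∀ᵐ s : ℝ, s ≠ T := by simp [ae_iff]
  filter_upwards [hw.ae_hasDerivAt_integral, hne] with s hs hsT hmem
  rw [uIoc_of_le htT] at hmem
  rw [uIcc_of_le htT] at hs
  have h1 := hs (Ioc_subset_Icc_self hmem) t (left_mem_Icc.2 htT)
  exact (hk' s ⟨hmem.1, lt_of_le_of_ne hmem.2 hsT⟩ (h1.const_add x)).deriv.symm

lemma sq_intervalIntegral_le {f : ℝ → ℝ} {a b : ℝ} (hab : a ≤ b)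
    (hf : IntervalIntegrable f volume a b)
    (hf2 : IntervalIntegrable (fun s => f s ^ 2) volume a b) :
    (∫ s in a..b, f s) ^ 2 ≤ (b - a) * ∫ s in a..b, f s ^ 2 := by
  rcases hab.eq_or_lt with rfl | hlt
  · simp
  set μ := (∫ s in a..b, f s) / (b - a) with hμ
  have hpos : 0 < b - a := sub_pos.2 hlt
  have h : 0 ≤ ∫ s in a..b, (f s - μ) ^ 2 :=
    intervalIntegral.integral_nonneg hab fun _ _ => by positivity
  have h3 : IntervalIntegrable (fun s => f s ^ 2 - 2 * μ * f s) volume a b :=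
    hf2.sub (hf.const_mul _)
  have e : (fun s => (f s - μ) ^ 2) = fun s => (f s ^ 2 - 2 * μ * f s) + μ ^ 2 := by
    ext s; ring
  rw [e, intervalIntegral.integral_add h3 intervalIntegrable_const,
    intervalIntegral.integral_sub hf2 (hf.const_mul _), intervalIntegral.integral_const_mul,
    intervalIntegral.integral_const, smul_eq_mul] at h
  have e2 : ∫ s in a..b, f s = μ * (b - a) := by rw [hμ]; field_simp
  rw [e2] at h ⊢
  nlinarith

/-- `∫_t^T (s ∧ σ - t) g(σ) dσ` is the primitive of `r ↦ ∫_r^T g`. -/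
lemma integral_min_smul {g : ℝ → G} {t s T : ℝ} (hts : t ≤ s) (hsT : s ≤ T)
    (hg : ContinuousOn g (Icc t T)) :
    ∫ σ in t..T, (min s σ - t) • g σ = ∫ r in t..s, ∫ σ in r..T, g σ := by
  have htT := hts.trans hsT
  set g' : ℝ → G := IccExtend htT ((Icc t T).domRestrict g) with hg'
  have hc : Continuous g' := (continuousOn_iff_continuous_domRestrict.1 hg).Icc_extend'
  have he : ∀ σ ∈ Icc t T, g σ = g' σ := fun σ hσ => by
    rw [hg', IccExtend_of_mem _ _ hσ]; rfl
  have e1 : ∫ σ in t..T, (min s σ - t) • g σ = ∫ σ in t..T, (min s σ - t) • g' σ :=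
    intervalIntegral.integral_congr fun σ hσ => by
      rw [uIcc_of_le htT] at hσ; simp only [he σ hσ]
  have e2 : ∫ r in t..s, ∫ σ in r..T, g σ = ∫ r in t..s, ∫ σ in r..T, g' σ :=
    intervalIntegral.integral_congr fun r hr => by
      rw [uIcc_of_le hts] at hr
      refine intervalIntegral.integral_congr fun σ hσ => ?_
      rw [uIcc_of_le (hr.2.trans hsT)] at hσ
      exact he σ ⟨hr.1.trans hσ.1, hσ.2⟩
  rw [e1, e2]
  have hci : Continuous fun σ => (min s σ - t) • g' σ := by fun_prop
  rw [← intervalIntegral.integral_add_adjacent_intervals (hci.intervalIntegrable t s)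
    (hci.intervalIntegrable s T)]
  have e3 : ∫ σ in t..s, (min s σ - t) • g' σ = ∫ σ in t..s, (σ - t) • g' σ :=
    intervalIntegral.integral_congr fun σ hσ => by
      rw [uIcc_of_le hts] at hσ; simp only [min_eq_right hσ.2]
  have e4 : ∫ σ in s..T, (min s σ - t) • g' σ = (s - t) • ∫ σ in s..T, g' σ := by
    rw [← intervalIntegral.integral_smul]
    exact intervalIntegral.integral_congr fun σ hσ => by
      rw [uIcc_of_le hsT] at hσ; simp only [min_eq_left hσ.1]
  have hv : ∀ r, HasDerivAt (fun r => ∫ σ in r..T, g' σ) (-g' r) r := fun r =>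
    intervalIntegral.integral_hasDerivAt_left (hc.intervalIntegrable _ _)
      (hc.stronglyMeasurableAtFilter _ _) hc.continuousAt
  have hp := intervalIntegral.integral_smul_deriv_eq_deriv_smul (a := t) (b := s)
    (u := fun σ => σ - t) (u' := fun _ => (1 : ℝ)) (v := fun r => ∫ σ in r..T, g' σ)
    (v' := fun r => -g' r) (fun σ _ => (hasDerivAt_id σ).sub_const t) (fun r _ => hv r)
    intervalIntegrable_const (hc.neg.intervalIntegrable _ _)
  simp only [smul_neg, intervalIntegral.integral_neg, one_smul, sub_self, zero_smul,
    sub_zero] at hp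
  rw [e3, e4, ← neg_neg (∫ σ in t..s, (σ - t) • g' σ), hp]
  abel

end Curves

section Pointwise

/-- The adjoint variable `z(s) = g_T + ∫_s^T g`. -/
noncomputable def backward (g : ℝ → E n) (gT : E n) (T s : ℝ) : E n := gT + ∫ σ in s..T, g σ

lemma hasDerivAt_backward {g : ℝ → E n} (gT : E n) {t T s : ℝ} (hg : ContinuousOn g (Icc t T))
    (hs : s ∈ Ioo t T) : HasDerivAt (backward g gT T) (-g s) s := by
  refine HasDerivAt.const_add gT (intervalIntegral.integral_hasDerivAt_left
    ((hg.mono (Icc_subset_Icc hs.1.le le_rfl)).intervalIntegrable_of_Icc hs.2.le) ?_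
    (hg.continuousAt (Icc_mem_nhds hs.1 hs.2)))
  exact (hg.mono Ioo_subset_Icc_self).stronglyMeasurableAtFilter isOpen_Ioo s hs

lemma norm_backward_sub_le {g : ℝ → E n} (gT : E n) {t T r s B : ℝ}
    (hg : ContinuousOn g (Icc t T)) (hB : ∀ σ ∈ Icc t T, ‖g σ‖ ≤ B)
    (hr : r ∈ Icc t T) (hs : s ∈ Icc t T) :
    ‖backward g gT T s - backward g gT T r‖ ≤ B * |s - r| := by
  have hT : T ∈ Icc t T := right_mem_Icc.2 (hr.1.trans hr.2)
  have hi : ∀ {a b}, a ∈ Icc t T → b ∈ Icc t T → IntervalIntegrable g volume a b :=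
    fun ha hb => (hg.mono (uIcc_subset_Icc ha hb)).intervalIntegrable
  rw [backward, backward, add_sub_add_left_eq_sub,
    ← intervalIntegral.integral_add_adjacent_intervals (hi hs hr) (hi hr hT), add_sub_cancel_right,
    abs_sub_comm]
  exact intervalIntegral.norm_integral_le_of_norm_le_const fun σ hσ =>
    hB σ (uIcc_subset_Icc hs hr (uIoc_subset_uIcc hσ))

lemma continuousOn_backward {g : ℝ → E n} (gT : E n) {t T : ℝ} (hg : ContinuousOn g (Icc t T)) :
    ContinuousOn (backward g gT T) (Icc t T) := by
  obtain ⟨B, hB⟩ := isCompact_Icc.exists_bound_of_continuousOn hg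
  refine (LipschitzOnWith.of_dist_le_mul (K := B.toNNReal) fun r hr s hs => ?_).continuousOn
  rw [dist_eq_norm, Real.dist_eq]
  exact (norm_backward_sub_le gT hg hB hs hr).trans
    (mul_le_mul_of_nonneg_right (Real.le_coe_toNNReal B) (abs_nonneg _))

/-- Integration by parts of the adjoint variable against the velocity of a curve. -/
lemma integral_inner_backward {g w : ℝ → E n} (gT W₀ : E n) {t T : ℝ} (htT : t ≤ T)
    (hg : ContinuousOn g (Icc t T)) (hw : IntervalIntegrable w volume t T) :
    ∫ s in t..T, inner ℝ (backward g gT T s) (w s)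
      = inner ℝ gT (W₀ + ∫ σ in t..T, w σ)
        + (∫ s in t..T, inner ℝ (g s) (W₀ + ∫ σ in t..s, w σ))
        - inner ℝ (backward g gT T t) W₀ := by
  obtain ⟨B, hB⟩ := isCompact_Icc.exists_bound_of_continuousOn hg
  obtain ⟨Z, hZ⟩ := isCompact_Icc.exists_bound_of_continuousOn (continuousOn_backward gT hg)
  have hB0 : 0 ≤ B := (norm_nonneg _).trans (hB t (left_mem_Icc.2 htT))
  have hZ0 : 0 ≤ Z := (norm_nonneg _).trans (hZ t (left_mem_Icc.2 htT))
  set W : ℝ → E n := fun s => W₀ + ∫ σ in t..s, w σ with hW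
  have hwi : ∀ {a b}, a ∈ Icc t T → b ∈ Icc t T → IntervalIntegrable w volume a b :=
    fun ha hb => hw.mono_set (by rw [uIcc_of_le htT]; exact uIcc_subset_Icc ha hb)
  have hWc : ContinuousOn W (Icc t T) := by
    have := intervalIntegral.continuousOn_primitive_interval' hw left_mem_uIcc
    rw [uIcc_of_le htT] at this
    exact continuousOn_const.add this
  obtain ⟨A, hA⟩ := isCompact_Icc.exists_bound_of_continuousOn hWc
  have hA0 : 0 ≤ A := (norm_nonneg _).trans (hA t (left_mem_Icc.2 htT))
  have key := integral_eq_sub_of_curve htT hw W₀ (M := Z + B * A)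
    (k := fun s => inner ℝ (backward g gT T s) (W s))
    (k' := fun s => inner ℝ (backward g gT T s) (w s) + inner ℝ (-g s) (W s)) (by positivity)
    (fun r hr s hs hrs => by
      have h1 : W s - W r = ∫ σ in r..s, w σ := by
        simp only [hW, add_sub_add_left_eq_sub]
        exact intervalIntegral.integral_interval_sub_left (hwi (left_mem_Icc.2 htT) hs)
          (hwi (left_mem_Icc.2 htT) hr)
      have h2 : ‖W s - W r‖ ≤ ∫ σ in r..s, ‖w σ‖ := by
        rw [h1]; exact intervalIntegral.norm_integral_le_integral_norm hrs
      have h3 : ∫ σ in r..s, (‖w σ‖ + 1) = (∫ σ in r..s, ‖w σ‖) + (s - r) := by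
        rw [intervalIntegral.integral_add (hwi hr hs).norm intervalIntegrable_const]; simp
      have h4 := norm_backward_sub_le gT hg hB hr hs
      rw [abs_of_nonneg (sub_nonneg.2 hrs)] at h4
      have e : inner ℝ (backward g gT T s) (W s) - inner ℝ (backward g gT T r) (W r)
          = inner ℝ (backward g gT T s) (W s - W r)
            + inner ℝ (backward g gT T s - backward g gT T r) (W r) := by
        rw [inner_sub_right, inner_sub_left]; ring
      rw [e, h3]
      have h5 := abs_real_inner_le_norm (backward g gT T s) (W s - W r)
      have h6 := abs_real_inner_le_norm (backward g gT T s - backward g gT T r) (W r)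
      have h7 : ‖backward g gT T s‖ * ‖W s - W r‖ ≤ Z * ∫ σ in r..s, ‖w σ‖ :=
        mul_le_mul (hZ s hs) h2 (norm_nonneg _) hZ0
      have h8 : ‖backward g gT T s - backward g gT T r‖ * ‖W r‖ ≤ (B * (s - r)) * A :=
        mul_le_mul h4 (hA r hr) (norm_nonneg _) (mul_nonneg hB0 (sub_nonneg.2 hrs))
      have h9 : 0 ≤ ∫ σ in r..s, ‖w σ‖ :=
        intervalIntegral.integral_nonneg hrs fun _ _ => norm_nonneg _
      have h10 : 0 ≤ Z * (s - r) := mul_nonneg hZ0 (sub_nonneg.2 hrs)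
      have h11 : 0 ≤ (B * A) * ∫ σ in r..s, ‖w σ‖ := by positivity
      refine (abs_add_le _ _).trans ?_
      linarith)
    (fun s hs hd => (hasDerivAt_backward gT hg hs).inner ℝ hd)
  have i1 : IntervalIntegrable (fun s => inner ℝ (backward g gT T s) (w s)) volume t T := by
    rw [intervalIntegrable_iff, uIoc_of_le htT] at hw ⊢
    refine Integrable.mono' (hw.norm.const_mul Z) ?_ ?_
    · exact AEStronglyMeasurable.inner
        ((continuousOn_backward gT hg).mono Ioc_subset_Icc_self
          |>.aestronglyMeasurable measurableSet_Ioc) hw.1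
    · refine (ae_restrict_mem measurableSet_Ioc).mono fun s hs => ?_
      exact (abs_real_inner_le_norm _ _).trans
        (mul_le_mul_of_nonneg_right (hZ s (Ioc_subset_Icc_self hs)) (norm_nonneg _))
  have i2 : IntervalIntegrable (fun s => inner ℝ (-g s) (W s)) volume t T :=
    (hg.neg.inner hWc).intervalIntegrable_of_Icc htT
  rw [intervalIntegral.integral_add i1 i2] at key
  simp only [inner_neg_left, intervalIntegral.integral_neg] at key
  have hWt : W t = W₀ := by simp [hW]
  have hbT : backward g gT T T = gT := by simp [backward]
  rw [hWt, hbT] at key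
  linarith

/-- The constant in the quadratic error of the comparison between a trajectory and an optimal
one. -/
noncomputable def compConst (lam T c : ℝ) : ℝ :=
  c / 2 * (1 + T) * (1 + (c * T * (1 + T) + 1) / (lam - c * T * (1 + T)))

lemma compConst_nonneg {lam T c : ℝ} (hc : 0 ≤ c) (hT : 0 < T) (hlam : c * T * (1 + T) < lam) :
    0 ≤ compConst lam T c := by
  have : 0 < lam - c * T * (1 + T) := sub_pos.2 hlam
  unfold compConst
  positivity

/-- Since `λ > cT(1+T)`, the energy of a velocity `w` dominates the concave contributions of the
curve `W₀ + ∫ w`, up to the contribution of the initial position. -/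
lemma energy_dominates {lam T c t : ℝ} (hc : 0 ≤ c) (hT : 0 < T)
    (hlam : c * T * (1 + T) < lam) (ht : t ∈ Icc 0 T) {w : ℝ → E n}
    (hw : IntervalIntegrable w volume t T)
    (hw2 : IntervalIntegrable (fun s => ‖w s‖ ^ 2) volume t T) (W₀ : E n) :
    c / 2 * (∫ s in t..T, ‖W₀ + ∫ σ in t..s, w σ‖ ^ 2)
        + c / 2 * ‖W₀ + ∫ σ in t..T, w σ‖ ^ 2
      ≤ lam / 2 * (∫ s in t..T, ‖w s‖ ^ 2) + compConst lam T c * ‖W₀‖ ^ 2 := by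
  have htT := ht.2
  set κ := c * T * (1 + T) with hκ
  have hκ0 : 0 ≤ κ := by positivity
  -- Young's inequality with parameter `ε` replaces `κ` by `κ (1 + ε)`, which is at most `λ`
  set ε := (lam - κ) / (κ + 1) with hε
  have hε0 : 0 < ε := div_pos (sub_pos.2 hlam) (by positivity)
  have hK : compConst lam T c = c / 2 * (1 + T) * (1 + 1 / ε) := by
    rw [compConst, hε, one_div_div]
  set b := ∫ σ in t..T, ‖w σ‖ with hb
  set I := ∫ s in t..T, ‖w s‖ ^ 2 with hI
  have hI0 : 0 ≤ I := intervalIntegral.integral_nonneg htT fun _ _ => by positivity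
  have hb2 : b ^ 2 ≤ T * I := (sq_intervalIntegral_le htT hw.norm hw2).trans
    (mul_le_mul_of_nonneg_right (by linarith [ht.1]) hI0)
  have hsub : ∀ s ∈ Icc t T, IntervalIntegrable w volume t s := fun s hs =>
    hw.mono_set (by rw [uIcc_of_le htT, uIcc_of_le hs.1]; exact Icc_subset_Icc_right hs.2)
  have hW : ∀ s ∈ Icc t T, ‖W₀ + ∫ σ in t..s, w σ‖ ^ 2
      ≤ (1 + 1 / ε) * ‖W₀‖ ^ 2 + (1 + ε) * (T * I) := by
    intro s hs
    have h1 : ‖W₀ + ∫ σ in t..s, w σ‖ ≤ ‖W₀‖ + b := by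
      refine (norm_add_le _ _).trans (add_le_add_right ?_ _)
      refine (intervalIntegral.norm_integral_le_integral_norm hs.1).trans ?_
      exact intervalIntegral.integral_mono_interval le_rfl hs.1 hs.2
        (Eventually.of_forall fun _ => norm_nonneg _) hw.norm
    have h2 := pow_le_pow_left₀ (norm_nonneg _) h1 2
    have h3 : (‖W₀‖ + b) ^ 2 ≤ (1 + 1 / ε) * ‖W₀‖ ^ 2 + (1 + ε) * b ^ 2 := by
      have h4 : 0 ≤ (1 / ε) * (‖W₀‖ - ε * b) ^ 2 := by positivity
      have h5 : (1 / ε) * (‖W₀‖ - ε * b) ^ 2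
          = (1 / ε) * ‖W₀‖ ^ 2 - 2 * ‖W₀‖ * b + ε * b ^ 2 := by
        field_simp
        ring
      nlinarith
    have h6 := mul_le_mul_of_nonneg_left hb2 (by positivity : 0 ≤ 1 + ε)
    linarith
  have hWc : ContinuousOn (fun s => ‖W₀ + ∫ σ in t..s, w σ‖ ^ 2) (Icc t T) := by
    have := intervalIntegral.continuousOn_primitive_interval' hw left_mem_uIcc
    rw [uIcc_of_le htT] at this
    exact (continuousOn_const.add this).norm.pow 2
  set R := (1 + 1 / ε) * ‖W₀‖ ^ 2 + (1 + ε) * (T * I) with hR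
  have hR0 : 0 ≤ R := by positivity
  have h1 : ∫ s in t..T, ‖W₀ + ∫ σ in t..s, w σ‖ ^ 2 ≤ T * R := by
    have := intervalIntegral.integral_mono_on (μ := volume) htT
      (hWc.intervalIntegrable_of_Icc htT) (g := fun _ => R) intervalIntegrable_const hW
    rw [intervalIntegral.integral_const, smul_eq_mul] at this
    exact this.trans (mul_le_mul_of_nonneg_right (by linarith [ht.1]) hR0)
  have h2 := hW T (right_mem_Icc.2 htT)
  have h3 : κ * (1 + ε) ≤ lam := by
    have : κ * ε ≤ lam - κ := by
      rw [hε, mul_div_assoc', div_le_iff₀ (by positivity)]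
      nlinarith [sub_pos.2 hlam]
    linarith
  have h4 := mul_le_mul_of_nonneg_right h3 hI0
  have h5 : c / 2 * (T * R) + c / 2 * R
      = compConst lam T c * ‖W₀‖ ^ 2 + κ * (1 + ε) * I / 2 := by
    rw [hK, hR, hκ]; ring
  have h6 := mul_le_mul_of_nonneg_left h1 (by positivity : 0 ≤ c / 2)
  have h7 := mul_le_mul_of_nonneg_left h2 (by positivity : 0 ≤ c / 2)
  linarith

/-- Comparison of the velocity `u` with the velocity `-z/λ` given by the adjoint variable: the
linear terms reduce to the initial one, and the quadratic terms have a sign up to the initial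
one. -/
lemma pointwise_comparison {lam T c t : ℝ} (hc : 0 ≤ c) (hT : 0 < T)
    (hlam : c * T * (1 + T) < lam) (ht : t ∈ Icc 0 T) {g u : ℝ → E n} (gT W₀ : E n)
    (hg : ContinuousOn g (Icc t T)) (hu : IntervalIntegrable u volume t T)
    (hu2 : IntervalIntegrable (fun s => ‖u s‖ ^ 2) volume t T) {W : ℝ → E n}
    (hW : ∀ s ∈ Icc t T, W s = W₀ + ∫ σ in t..s, (u σ + (1 / lam) • backward g gT T σ)) :
    inner ℝ (backward g gT T t) W₀ - compConst lam T c * ‖W₀‖ ^ 2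
      ≤ lam / 2 * (∫ s in t..T, ‖u s‖ ^ 2)
        - 1 / (2 * lam) * (∫ s in t..T, ‖backward g gT T s‖ ^ 2)
        + (∫ s in t..T, (inner ℝ (g s) (W s) - c / 2 * ‖W s‖ ^ 2))
        + (inner ℝ gT (W T) - c / 2 * ‖W T‖ ^ 2) := by
  have htT := ht.2
  have hlam0 : 0 < lam := lt_of_le_of_lt (by positivity) hlam
  set z := backward g gT T with hz
  have hzc : ContinuousOn z (Icc t T) := continuousOn_backward gT hg
  have hzi : IntervalIntegrable z volume t T := hzc.intervalIntegrable_of_Icc htT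
  set w : ℝ → E n := fun σ => u σ + (1 / lam) • z σ with hw
  have hwi : IntervalIntegrable w volume t T := hu.add (hzi.smul (1 / lam))
  have hz2 : IntervalIntegrable (fun s => ‖z s‖ ^ 2) volume t T :=
    (hzc.norm.pow 2).intervalIntegrable_of_Icc htT
  have hzw : IntervalIntegrable (fun s => inner ℝ (z s) (w s)) volume t T := by
    obtain ⟨Z, hZ⟩ := isCompact_Icc.exists_bound_of_continuousOn hzc
    rw [intervalIntegrable_iff, uIoc_of_le htT] at hwi ⊢
    refine Integrable.mono' (hwi.norm.const_mul Z) ?_ ?_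
    · exact AEStronglyMeasurable.inner
        (hzc.mono Ioc_subset_Icc_self |>.aestronglyMeasurable measurableSet_Ioc) hwi.1
    · refine (ae_restrict_mem measurableSet_Ioc).mono fun s hs => ?_
      exact (abs_real_inner_le_norm _ _).trans
        (mul_le_mul_of_nonneg_right (hZ s (Ioc_subset_Icc_self hs)) (norm_nonneg _))
  have hpt : ∀ s, ‖w s‖ ^ 2
      = ‖u s‖ ^ 2 - 1 / lam ^ 2 * ‖z s‖ ^ 2 + 2 / lam * inner ℝ (z s) (w s) := by
    intro s
    simp only [hw, norm_add_sq_real, inner_add_right, inner_smul_right,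
      real_inner_self_eq_norm_sq, norm_smul, real_inner_comm (z s) (u s)]
    rw [Real.norm_of_nonneg (by positivity)]
    field_simp
    ring
  have hi1 : IntervalIntegrable (fun s => ‖u s‖ ^ 2 - 1 / lam ^ 2 * ‖z s‖ ^ 2) volume t T :=
    hu2.sub (hz2.const_mul _)
  have hw2 : IntervalIntegrable (fun s => ‖w s‖ ^ 2) volume t T := by
    simp only [hpt]
    exact hi1.add (hzw.const_mul _)
  have hw2i : ∫ s in t..T, ‖w s‖ ^ 2 = (∫ s in t..T, ‖u s‖ ^ 2)
      - 1 / lam ^ 2 * (∫ s in t..T, ‖z s‖ ^ 2) + 2 / lam * ∫ s in t..T, inner ℝ (z s) (w s) := by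
    simp only [hpt]
    rw [intervalIntegral.integral_add hi1 (hzw.const_mul _),
      intervalIntegral.integral_sub hu2 (hz2.const_mul _), intervalIntegral.integral_const_mul,
      intervalIntegral.integral_const_mul]
  have hdom := energy_dominates hc hT hlam ht hwi hw2 W₀
  have hparts := integral_inner_backward gT W₀ htT hg hwi
  have hWc : ContinuousOn W (Icc t T) := by
    have := intervalIntegral.continuousOn_primitive_interval' hwi left_mem_uIcc
    rw [uIcc_of_le htT] at this
    exact (continuousOn_const.add this).congr hW
  have eW : ∀ s ∈ uIcc t T, W s = W₀ + ∫ σ in t..s, w σ := fun s hs => by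
    rw [uIcc_of_le htT] at hs; exact hW s hs
  have e1 : ∫ s in t..T, ‖W₀ + ∫ σ in t..s, w σ‖ ^ 2 = ∫ s in t..T, ‖W s‖ ^ 2 :=
    intervalIntegral.integral_congr fun s hs => by simp only [eW s hs]
  have e2 : ∫ s in t..T, inner ℝ (g s) (W₀ + ∫ σ in t..s, w σ)
      = ∫ s in t..T, inner ℝ (g s) (W s) :=
    intervalIntegral.integral_congr fun s hs => by simp only [eW s hs]
  rw [e1, ← eW T right_mem_uIcc] at hdom
  rw [e2, ← eW T right_mem_uIcc] at hparts
  have hW2 : IntervalIntegrable (fun s => ‖W s‖ ^ 2) volume t T :=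
    (hWc.norm.pow 2).intervalIntegrable_of_Icc htT
  rw [intervalIntegral.integral_sub ((hg.inner hWc).intervalIntegrable_of_Icc htT)
    (hW2.const_mul _), intervalIntegral.integral_const_mul]
  have e3 : lam / 2 * ∫ s in t..T, ‖w s‖ ^ 2 = lam / 2 * (∫ s in t..T, ‖u s‖ ^ 2)
      - 1 / (2 * lam) * (∫ s in t..T, ‖z s‖ ^ 2) + ∫ s in t..T, inner ℝ (z s) (w s) := by
    rw [hw2i]; field_simp
  rw [e3, hparts] at hdom
  linarith

end Pointwise

/-! ### Existence of the optimal flow -/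

/-- The assumptions on the data of the control problem: a class of measures stable under the
operations of the argument, regular running and terminal costs `Φ`, `ΦT` with functional
derivatives `F`, `FT`, and a control cost that dominates their concavity. -/
structure Setup (D : Set (Measure (E n))) (lam T c : ℝ) (Φ ΦT : Measure (E n) → ℝ)
    (F FT : E n → Measure (E n) → ℝ) : Prop where
  state : StateClass D
  c_nonneg : 0 ≤ c
  T_pos : 0 < T
  small : c * T * (1 + T) < lam
  cost : RegularCost D c Φ F
  cost_T : RegularCost D c ΦT FT

section Drift

/-- The displacement `(s-t)/λ g_T + (1/λ) ∫_t^T (s ∧ σ - t) g(σ) dσ` in the integral equation. -/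
noncomputable def drift (lam T t : ℝ) (gT : E n) (g : ℝ → E n) (s : ℝ) : E n :=
  ((s - t) / lam) • gT + (1 / lam) • ∫ σ in t..T, (min s σ - t) • g σ

variable {lam T t : ℝ}

lemma intervalIntegrable_min_smul {g : ℝ → E n} (hg : IntervalIntegrable g volume t T) (s : ℝ) :
    IntervalIntegrable (fun σ => (min s σ - t) • g σ) volume t T :=
  hg.continuousOn_smul (Continuous.continuousOn (by fun_prop))

lemma norm_drift_sub_le {g g' : ℝ → E n} {gT gT' : E n} {s M : ℝ} (hlam : 0 < lam)
    (ht : t ∈ Icc 0 T) (hs : s ∈ Icc t T) (hg : IntervalIntegrable g volume t T)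
    (hg' : IntervalIntegrable g' volume t T) (hT : ‖gT - gT'‖ ≤ M)
    (h : ∀ σ ∈ Icc t T, ‖g σ - g' σ‖ ≤ M) :
    ‖drift lam T t gT g s - drift lam T t gT' g' s‖ ≤ T * (1 + T) / lam * M := by
  have hM : 0 ≤ M := (norm_nonneg _).trans hT
  have hT0 : 0 ≤ T := ht.1.trans ht.2
  have e : drift lam T t gT g s - drift lam T t gT' g' s
      = ((s - t) / lam) • (gT - gT')
        + (1 / lam) • ∫ σ in t..T, (min s σ - t) • (g σ - g' σ) := by
    simp only [drift, smul_sub]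
    rw [intervalIntegral.integral_sub (intervalIntegrable_min_smul hg s)
      (intervalIntegrable_min_smul hg' s), smul_sub]
    abel
  have h1 : ‖((s - t) / lam) • (gT - gT')‖ ≤ T / lam * M := by
    rw [norm_smul, Real.norm_of_nonneg (div_nonneg (sub_nonneg.2 hs.1) hlam.le)]
    gcongr
    linarith [ht.1, hs.2]
  have h2 : ‖∫ σ in t..T, (min s σ - t) • (g σ - g' σ)‖ ≤ T * M * |T - t| := by
    refine intervalIntegral.norm_integral_le_of_norm_le_const fun σ hσ => ?_
    rw [uIoc_of_le ht.2] at hσ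
    have h0 : 0 ≤ min s σ - t := sub_nonneg.2 (le_min hs.1 hσ.1.le)
    rw [norm_smul, Real.norm_of_nonneg h0]
    have := min_le_left s σ
    exact mul_le_mul (by linarith [ht.1, hs.2]) (h σ (Ioc_subset_Icc_self hσ)) (norm_nonneg _) hT0
  rw [abs_of_nonneg (sub_nonneg.2 ht.2)] at h2
  rw [e]
  refine (norm_add_le _ _).trans ?_
  rw [norm_smul (1 / lam), Real.norm_of_nonneg (by positivity)]
  have h3 : T * M * (T - t) ≤ T * M * T :=
    mul_le_mul_of_nonneg_left (by linarith [ht.1]) (by positivity)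
  have h4 := mul_le_mul_of_nonneg_left (h2.trans h3) (by positivity : 0 ≤ 1 / lam)
  calc _ ≤ T / lam * M + 1 / lam * (T * M * T) := add_le_add h1 h4
    _ = _ := by ring

lemma drift_eq {g : ℝ → E n} (gT : E n) {s : ℝ} (hs : s ∈ Icc t T)
    (hg : ContinuousOn g (Icc t T)) :
    drift lam T t gT g s = (1 / lam) • ∫ r in t..s, backward g gT T r := by
  have htT := hs.1.trans hs.2
  have hc : ContinuousOn (fun r => ∫ σ in r..T, g σ) (Icc t s) := by
    have := (continuousOn_backward 0 hg).mono (Icc_subset_Icc_right hs.2)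
    have e : backward g 0 T = fun r => ∫ σ in r..T, g σ := by ext1 r; simp [backward]
    rwa [e] at this
  simp only [drift, backward]
  rw [integral_min_smul hs.1 hs.2 hg, intervalIntegral.integral_add intervalIntegrable_const
    (hc.intervalIntegrable_of_Icc hs.1), intervalIntegral.integral_const]
  module

lemma norm_backward_le {g : ℝ → E n} {gT : E n} {s M : ℝ} (ht : t ∈ Icc 0 T)
    (hs : s ∈ Icc t T) (hT : ‖gT‖ ≤ M) (h : ∀ σ ∈ Icc t T, ‖g σ‖ ≤ M) :
    ‖backward g gT T s‖ ≤ (1 + T) * M := by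
  have hM : 0 ≤ M := (norm_nonneg _).trans hT
  have h2 : ‖∫ σ in s..T, g σ‖ ≤ M * |T - s| := by
    refine intervalIntegral.norm_integral_le_of_norm_le_const fun σ hσ => h σ ?_
    rw [uIoc_of_le hs.2] at hσ
    exact ⟨hs.1.trans hσ.1.le, hσ.2⟩
  rw [abs_of_nonneg (sub_nonneg.2 hs.2)] at h2
  have h3 : M * (T - s) ≤ M * T := mul_le_mul_of_nonneg_left (by linarith [ht.1, hs.1]) hM
  refine (norm_add_le _ _).trans ?_
  linarith

lemma norm_drift_time_sub_le {g : ℝ → E n} {gT : E n} {s s' M : ℝ} (hlam : 0 < lam)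
    (ht : t ∈ Icc 0 T) (hs : s ∈ Icc t T) (hs' : s' ∈ Icc t T) (hg : ContinuousOn g (Icc t T))
    (hT : ‖gT‖ ≤ M) (h : ∀ σ ∈ Icc t T, ‖g σ‖ ≤ M) :
    ‖drift lam T t gT g s - drift lam T t gT g s'‖ ≤ (1 + T) / lam * M * |s - s'| := by
  have hz := continuousOn_backward gT hg
  have hi : ∀ r ∈ Icc t T, IntervalIntegrable (backward g gT T) volume t r := fun r hr =>
    (hz.mono (Icc_subset_Icc_right hr.2)).intervalIntegrable_of_Icc hr.1
  rw [drift_eq gT hs hg, drift_eq gT hs' hg, ← smul_sub,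
    intervalIntegral.integral_interval_sub_left (hi s hs) (hi s' hs'), norm_smul,
    Real.norm_of_nonneg (by positivity)]
  have := intervalIntegral.norm_integral_le_of_norm_le_const (a := s') (b := s)
    (f := backward g gT T) (C := (1 + T) * M) fun σ hσ =>
      norm_backward_le ht (uIcc_subset_Icc hs' hs (uIoc_subset_uIcc hσ)) hT h
  calc _ ≤ 1 / lam * ((1 + T) * M * |s - s'|) :=
        mul_le_mul_of_nonneg_left this (by positivity)
    _ = _ := by ring

end Drift

section Constants

/-- The contraction constant, less than `1/2`. -/
noncomputable def contr (lam T c : ℝ) : ℝ := c * T * (1 + T) / (2 * lam)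

/-- The weight `A + |x|`, where `A` is large enough for the weight to be almost constant in
`L²_m`, in which the integral equation is a contraction. -/
noncomputable def weight (lam T c : ℝ) (m : Measure (E n)) (x : E n) : ℝ :=
  (1 - 2 * contr lam T c)⁻¹ * (1 + √(secondMoment m)) + ‖x‖

/-- A bound for the velocity of the flow, relative to the weight. With `a = contr lam T c`, it is
the fixed point of `K ↦ (1 + T) c / (2λ) · (1 + K T (3 - 2a))`: a curve of velocity `K` is mapped
by the integral equation to a curve of at most this velocity. -/
noncomputable def speed (lam T c : ℝ) : ℝ :=
  (1 + T) * c / (2 * lam) / (1 - contr lam T c * (3 - 2 * contr lam T c))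

variable {D : Set (Measure (E n))} {lam T c : ℝ} {Φ ΦT : Measure (E n) → ℝ}
  {F FT : E n → Measure (E n) → ℝ}

namespace Setup

variable (H : Setup D lam T c Φ ΦT F FT)
include H

lemma lam_pos : 0 < lam := by
  have := H.c_nonneg
  have := H.T_pos
  exact lt_of_le_of_lt (by positivity) H.small

lemma contr_nonneg : 0 ≤ contr lam T c := by
  have := H.c_nonneg
  have := H.T_pos
  have := H.lam_pos
  unfold contr
  positivity

lemma contr_lt : contr lam T c < 1 / 2 := by
  have := H.lam_pos
  rw [contr, div_lt_iff₀ (by positivity)]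
  linarith [H.small]

lemma rate_lt : contr lam T c * (3 - 2 * contr lam T c) < 1 := by
  nlinarith [H.contr_lt, H.contr_nonneg]

lemma rate_nonneg : 0 ≤ contr lam T c * (3 - 2 * contr lam T c) := by
  nlinarith [H.contr_lt, H.contr_nonneg]

lemma speed_nonneg : 0 ≤ speed lam T c := by
  have := H.c_nonneg
  have := H.T_pos
  have := H.lam_pos
  have := H.rate_lt
  exact div_nonneg (by positivity) (by linarith)

lemma le_weight (m : Measure (E n)) (x : E n) :
    1 + √(secondMoment m) + ‖x‖ ≤ weight lam T c m x := by
  have h0 := H.contr_nonneg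
  have h1 := H.contr_lt
  have : 1 ≤ (1 - 2 * contr lam T c)⁻¹ := (one_le_inv₀ (by linarith)).2 (by linarith)
  have h2 : 0 ≤ 1 + √(secondMoment m) := by positivity
  unfold weight
  nlinarith

lemma weight_pos (m : Measure (E n)) (x : E n) : 0 < weight lam T c m x :=
  lt_of_lt_of_le (by positivity) (H.le_weight m x)

omit H in
lemma weight_zero_le (m : Measure (E n)) (x : E n) :
    weight lam T c m 0 ≤ weight lam T c m x := by
  simp [weight]

lemma memLp_weight {m : Measure (E n)} (hm : m ∈ D) : MemLp (weight lam T c m) 2 m := by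
  have hm' := H.state.subset hm
  have := P2_prob hm'
  exact memLp_fun_add (memLp_const _) (P2_memLp_id hm').norm

/-- The weight is almost constant in `L²_m`: the constant `A` in it is large compared with the
norm of the identity. -/
lemma l2norm_weight_le {m : Measure (E n)} (hm : m ∈ D) :
    l2norm m (weight lam T c m) ≤ (2 - 2 * contr lam T c) * weight lam T c m 0 := by
  have hm' := H.state.subset hm
  have := P2_prob hm'
  have h0 := H.contr_nonneg
  have h1 := H.contr_lt
  have h2 : 0 < 1 - 2 * contr lam T c := by linarith
  set A := (1 - 2 * contr lam T c)⁻¹ * (1 + √(secondMoment m)) with hA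
  have hA0 : 0 ≤ A := by positivity
  have h := l2norm_le_affine (f := weight lam T c m) (P2_memLp_id hm') zero_le_one hA0
    (Eventually.of_forall fun x => by
      rw [Real.norm_of_nonneg (H.weight_pos m x).le, weight, ← hA]; linarith)
  rw [← sqrt_secondMoment] at h
  have h3 : √(secondMoment m) ≤ (1 - 2 * contr lam T c) * A := by
    rw [hA, mul_inv_cancel_left₀ h2.ne']; linarith
  have h4 : weight lam T c m 0 = A := by simp [weight, hA]
  rw [h4]
  linarith

/-- A pointwise weighted bound for two maps gives a bound for the distance of their laws. -/
lemma W2_law_le {m : Measure (E n)} (hm : m ∈ D) {f g : E n → E n} (hf : MemLp f 2 m)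
    (hg : MemLp g 2 m) {k : ℝ} (hk : 0 ≤ k) (h : ∀ x, ‖f x - g x‖ ≤ k * weight lam T c m x)
    (x : E n) :
    W2 (m.map f) (m.map g) ≤ k * ((2 - 2 * contr lam T c) * weight lam T c m x) := by
  have := P2_prob (H.state.subset hm)
  refine (W2_map_le hf.1.aemeasurable hg.1.aemeasurable (memLp_fun_sub hf hg)).trans ?_
  have h1 := l2norm_le_affine (f := fun x => f x - g x) (H.memLp_weight hm) hk le_rfl
    (Eventually.of_forall fun x => by
      rw [add_zero, Real.norm_of_nonneg (H.weight_pos m x).le]; exact h x)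
  rw [add_zero] at h1
  refine h1.trans (mul_le_mul_of_nonneg_left ((H.l2norm_weight_le hm).trans ?_) hk)
  exact mul_le_mul_of_nonneg_left (weight_zero_le m x) (by linarith [H.contr_lt])

end Setup

/-- The curves of maps among which the flow is constructed. They are perturbations of the identity
with a constant less than `1`, hence injective and with laws in `D`, and they are Lipschitz in
time. -/
structure IsCandidate (lam T c t : ℝ) (m : Measure (E n)) (Y : E n → ℝ → E n) : Prop where
  pert : ∀ s ∈ Icc t T, ∀ x x', ‖Y x s - Y x' s - (x - x')‖
    ≤ contr lam T c / (1 - contr lam T c) * ‖x - x'‖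
  time : ∀ x, ∀ s ∈ Icc t T, ∀ s' ∈ Icc t T,
    ‖Y x s - Y x s'‖ ≤ speed lam T c * weight lam T c m x * |s - s'|
  start : ∀ x, Y x t = x

namespace Setup

variable (H : Setup D lam T c Φ ΦT F FT)
include H

lemma pert_nonneg : 0 ≤ contr lam T c / (1 - contr lam T c) :=
  div_nonneg H.contr_nonneg (by linarith [H.contr_lt])

lemma pert_lt : contr lam T c / (1 - contr lam T c) < 1 := by
  rw [div_lt_one (by linarith [H.contr_lt])]
  linarith [H.contr_lt]

section Candidate

variable {t : ℝ} (ht : t ∈ Icc 0 T) {m : Measure (E n)} (hm : m ∈ D) {Y : E n → ℝ → E n}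
  (hY : IsCandidate lam T c t m Y)
include hm hY

lemma law_mem {s : ℝ} (hs : s ∈ Icc t T) : law m Y s ∈ D :=
  H.state.map_mem m hm _ _ H.pert_nonneg H.pert_lt (hY.pert s hs)

omit H hm in
lemma continuous_candidate {s : ℝ} (hs : s ∈ Icc t T) : Continuous fun x => Y x s :=
  continuous_of_perturbation (hY.pert s hs)

include ht

omit hm in
lemma norm_candidate_sub_le {s : ℝ} (hs : s ∈ Icc t T) (x : E n) :
    ‖Y x s - x‖ ≤ speed lam T c * T * weight lam T c m x := by
  have h := hY.time x s hs t (left_mem_Icc.2 ht.2)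
  rw [hY.start, abs_of_nonneg (sub_nonneg.2 hs.1)] at h
  have h1 : s - t ≤ T := by linarith [hs.2, ht.1]
  have h2 : 0 ≤ speed lam T c * weight lam T c m x :=
    mul_nonneg H.speed_nonneg (H.weight_pos m x).le
  calc _ ≤ speed lam T c * weight lam T c m x * T := h.trans (mul_le_mul_of_nonneg_left h1 h2)
    _ = _ := by ring

lemma memLp_candidate {s : ℝ} (hs : s ∈ Icc t T) : MemLp (fun x => Y x s) 2 m := by
  have hm' := H.state.subset hm
  have := P2_prob hm'
  have h1 : MemLp (fun x => Y x s - x) 2 m :=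
    memLp_of_affine_bound
      ((continuous_candidate hY hs).sub continuous_id).aestronglyMeasurable
      (H.memLp_weight hm) (speed lam T c * T) 0 (Eventually.of_forall fun x => by
        rw [add_zero, Real.norm_of_nonneg (H.weight_pos m x).le]
        exact H.norm_candidate_sub_le ht hY hs x)
  simpa using memLp_fun_add h1 (P2_memLp_id hm')

lemma W2_candidate_le {s s' : ℝ} (hs : s ∈ Icc t T) (hs' : s' ∈ Icc t T) (x : E n) :
    W2 (law m Y s) (law m Y s') ≤ speed lam T c * |s - s'|
      * ((2 - 2 * contr lam T c) * weight lam T c m x) :=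
  H.W2_law_le hm (H.memLp_candidate ht hm hY hs) (H.memLp_candidate ht hm hY hs')
    (mul_nonneg H.speed_nonneg (abs_nonneg _))
    (fun x => (hY.time x s hs s' hs').trans (le_of_eq (by ring))) x

lemma sqrt_secondMoment_candidate_le {s : ℝ} (hs : s ∈ Icc t T) (x : E n) :
    √(secondMoment (law m Y s)) ≤ √(secondMoment m)
      + speed lam T c * T * ((2 - 2 * contr lam T c) * weight lam T c m x) := by
  have hm' := H.state.subset hm
  have := P2_prob hm'
  have hmem := H.memLp_candidate ht hm hY hs
  rw [law, sqrt_secondMoment_map hmem.1.aemeasurable]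
  have hsub : MemLp (fun x => Y x s - x) 2 m := memLp_fun_sub hmem (P2_memLp_id hm')
  have h1 := l2norm_add_le (P2_memLp_id hm') hsub
  simp only [add_sub_cancel] at h1
  refine h1.trans (add_le_add_right ?_ _)
  have hk : 0 ≤ speed lam T c * T := mul_nonneg H.speed_nonneg H.T_pos.le
  have h2 := l2norm_le_affine (f := fun x => Y x s - x) (H.memLp_weight hm) hk le_rfl
    (Eventually.of_forall fun x => by
      rw [add_zero, Real.norm_of_nonneg (H.weight_pos m x).le]
      exact H.norm_candidate_sub_le ht hY hs x)
  rw [add_zero] at h2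
  refine h2.trans (mul_le_mul_of_nonneg_left ((H.l2norm_weight_le hm).trans ?_) hk)
  exact mul_le_mul_of_nonneg_left (weight_zero_le m x) (by linarith [H.contr_lt])

/-- A gradient along a candidate is bounded by a multiple of the weight. -/
lemma norm_gradX_candidate_le {F' : E n → Measure (E n) → ℝ} {Φ' : Measure (E n) → ℝ}
    (hF : RegularCost D c Φ' F') {s : ℝ} (hs : s ∈ Icc t T) (x : E n) :
    ‖gradX F' (Y x s) (law m Y s)‖
      ≤ speed lam T c * (lam / (1 + T)) * weight lam T c m x := by
  have hc := H.c_nonneg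
  have hT := H.T_pos
  have hl := H.lam_pos
  have hr := H.rate_lt
  have h1 := hF.grad_growth (Y x s) _ (H.law_mem hm hY hs)
  have h2 := H.sqrt_secondMoment_candidate_le ht hm hY hs x
  have h3 := H.norm_candidate_sub_le ht hY hs x
  have h4 := norm_add_le (Y x s - x) x
  rw [sub_add_cancel] at h4
  have h5 := H.le_weight m x
  set K := speed lam T c with hK
  set a := contr lam T c with ha
  set w := weight lam T c m x
  have h6 : 1 + ‖Y x s‖ + √(secondMoment (law m Y s)) ≤ (1 + K * T * (3 - 2 * a)) * w := by
    nlinarith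
  refine h1.trans ((mul_le_mul_of_nonneg_left h6 (by positivity)).trans (le_of_eq ?_))
  have h7 : a = (1 + T) * c / (2 * lam) * T := by rw [ha, contr]; ring
  have h8 : K * (1 - a * (3 - 2 * a)) = (1 + T) * c / (2 * lam) := by
    rw [hK, speed, ← ha]; field_simp [sub_ne_zero.2 hr.ne']
  -- the fixed point equation of `speed`
  have h9 : K = (1 + T) * c / (2 * lam) * (1 + K * T * (3 - 2 * a)) := by
    rw [show (1 + T) * c / (2 * lam) * (1 + K * T * (3 - 2 * a)) = (1 + T) * c / (2 * lam)
      + (1 + T) * c / (2 * lam) * T * (K * (3 - 2 * a)) by ring, ← h7, ← h8]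
    ring
  have h10 : K * (lam / (1 + T)) = c / 2 * (1 + K * T * (3 - 2 * a)) := by
    calc K * (lam / (1 + T))
        = (1 + T) * c / (2 * lam) * (1 + K * T * (3 - 2 * a)) * (lam / (1 + T)) := by rw [← h9]
      _ = _ := by field_simp
  rw [h10]
  ring

lemma norm_gradX_candidate_sub_le {F' : E n → Measure (E n) → ℝ} {Φ' : Measure (E n) → ℝ}
    (hF : RegularCost D c Φ' F') {s s' : ℝ} (hs : s ∈ Icc t T) (hs' : s' ∈ Icc t T) (x : E n) :
    ‖gradX F' (Y x s) (law m Y s) - gradX F' (Y x s') (law m Y s')‖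
      ≤ c / 2 * (3 - 2 * contr lam T c) * speed lam T c * weight lam T c m x * |s - s'| := by
  have hc := H.c_nonneg
  have h1 := hF.grad_lipschitz (Y x s) (Y x s') _ (H.law_mem hm hY hs) _ (H.law_mem hm hY hs')
  have h2 := hY.time x s hs s' hs'
  have h3 := H.W2_candidate_le ht hm hY hs hs' x
  refine h1.trans ((mul_le_mul_of_nonneg_left (add_le_add h2 h3) (by positivity)).trans
    (le_of_eq (by ring)))

lemma continuousOn_gradX_candidate {F' : E n → Measure (E n) → ℝ} {Φ' : Measure (E n) → ℝ}
    (hF : RegularCost D c Φ' F') (x : E n) :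
    ContinuousOn (fun s => gradX F' (Y x s) (law m Y s)) (Icc t T) := by
  refine (LipschitzOnWith.of_dist_le_mul (K := (c / 2 * (3 - 2 * contr lam T c) * speed lam T c
    * weight lam T c m x).toNNReal) fun r hr s hs => ?_).continuousOn
  rw [dist_eq_norm, Real.dist_eq]
  exact (H.norm_gradX_candidate_sub_le ht hm hY hF hr hs x).trans
    (mul_le_mul_of_nonneg_right (Real.le_coe_toNNReal _) (abs_nonneg _))

omit H ht hm hY in
lemma integralRHS_eq (F FT : E n → Measure (E n) → ℝ) (lam T t : ℝ) (m : Measure (E n))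
    (Y : E n → ℝ → E n) (x : E n) (s : ℝ) :
    integralRHS F FT lam T t m Y x s = x - drift lam T t (gradX FT (Y x T) (law m Y T))
      (fun σ => gradX F (Y x σ) (law m Y σ)) s := by
  rw [integralRHS, drift, sub_sub]

/-- The right-hand side of the integral equation maps candidates to candidates. -/
lemma isCandidate_integralRHS : IsCandidate lam T c t m (integralRHS F FT lam T t m Y) where
  pert s hs x x' := by
    have hc := H.c_nonneg
    have hTm : T ∈ Icc t T := right_mem_Icc.2 ht.2
    have ha := H.contr_lt
    set ρ := contr lam T c / (1 - contr lam T c) with hρ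
    have hg : ∀ {F' : E n → Measure (E n) → ℝ} {Φ' : Measure (E n) → ℝ}, RegularCost D c Φ' F' →
        ∀ σ ∈ Icc t T, ‖gradX F' (Y x' σ) (law m Y σ) - gradX F' (Y x σ) (law m Y σ)‖
          ≤ c / 2 * ((1 + ρ) * ‖x - x'‖) := fun hF σ hσ => by
      refine (gradX_lipschitz_left H.state hF.grad_lipschitz (H.law_mem hm hY hσ) _ _).trans ?_
      rw [norm_sub_rev x x']
      exact mul_le_mul_of_nonneg_left (lipschitz_of_perturbation (hY.pert σ hσ) x' x)
        (by positivity)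
    rw [integralRHS_eq, integralRHS_eq]
    have e : ∀ a b : E n, x - a - (x' - b) - (x - x') = b - a := fun a b => by abel
    rw [e]
    refine (norm_drift_sub_le H.lam_pos ht hs
      ((H.continuousOn_gradX_candidate ht hm hY H.cost x').intervalIntegrable_of_Icc ht.2)
      ((H.continuousOn_gradX_candidate ht hm hY H.cost x).intervalIntegrable_of_Icc ht.2)
      (hg H.cost_T T hTm) (hg H.cost)).trans (le_of_eq ?_)
    have h1 : contr lam T c * (1 + ρ) = ρ := by
      rw [hρ]
      field_simp [(by linarith : (1 - contr lam T c) ≠ 0)]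
      ring
    calc _ = contr lam T c * (1 + ρ) * ‖x - x'‖ := by rw [contr]; ring
      _ = _ := by rw [h1]
  time x s hs s' hs' := by
    have hTm : T ∈ Icc t T := right_mem_Icc.2 ht.2
    have hl := H.lam_pos
    have hT := H.T_pos
    rw [integralRHS_eq, integralRHS_eq, sub_sub_sub_cancel_left, norm_sub_rev]
    refine (norm_drift_time_sub_le H.lam_pos ht hs hs'
      (H.continuousOn_gradX_candidate ht hm hY H.cost x)
      (H.norm_gradX_candidate_le ht hm hY H.cost_T hTm x)
      (fun σ hσ => H.norm_gradX_candidate_le ht hm hY H.cost hσ x)).trans (le_of_eq ?_)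
    field_simp
  start x := by
    rw [integralRHS_eq, drift_eq _ (left_mem_Icc.2 ht.2)
      (H.continuousOn_gradX_candidate ht hm hY H.cost x)]
    simp

/-- The right-hand side of the integral equation is a contraction for the weighted uniform norm,
with rate `a (3 - 2a) < 1` where `a < 1/2` is the contraction constant. The term `1` in `3 - 2a`
comes from the positions and the term `2 - 2a` from the laws. -/
lemma norm_integralRHS_sub_le {Y' : E n → ℝ → E n} (hY' : IsCandidate lam T c t m Y') {k : ℝ}
    (hk : 0 ≤ k) (h : ∀ x, ∀ s ∈ Icc t T, ‖Y x s - Y' x s‖ ≤ k * weight lam T c m x)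
    (x : E n) {s : ℝ} (hs : s ∈ Icc t T) :
    ‖integralRHS F FT lam T t m Y x s - integralRHS F FT lam T t m Y' x s‖
      ≤ contr lam T c * (3 - 2 * contr lam T c) * k * weight lam T c m x := by
  have hc := H.c_nonneg
  have hTm : T ∈ Icc t T := right_mem_Icc.2 ht.2
  have hg : ∀ {F' : E n → Measure (E n) → ℝ} {Φ' : Measure (E n) → ℝ}, RegularCost D c Φ' F' →
      ∀ σ ∈ Icc t T, ‖gradX F' (Y x σ) (law m Y σ) - gradX F' (Y' x σ) (law m Y' σ)‖
        ≤ c / 2 * (k * (3 - 2 * contr lam T c) * weight lam T c m x) := fun hF σ hσ => by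
    refine (hF.grad_lipschitz _ _ _ (H.law_mem hm hY hσ) _ (H.law_mem hm hY' hσ)).trans
      (mul_le_mul_of_nonneg_left ?_ (by positivity))
    have h1 := h x σ hσ
    have h2 := H.W2_law_le hm (H.memLp_candidate ht hm hY hσ) (H.memLp_candidate ht hm hY' hσ)
      hk (fun x => h x σ hσ) x
    calc _ ≤ _ := add_le_add h1 h2
      _ = _ := by ring
  rw [integralRHS_eq, integralRHS_eq, sub_sub_sub_cancel_left, norm_sub_rev]
  refine (norm_drift_sub_le H.lam_pos ht hs
    ((H.continuousOn_gradX_candidate ht hm hY H.cost x).intervalIntegrable_of_Icc ht.2)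
    ((H.continuousOn_gradX_candidate ht hm hY' H.cost x).intervalIntegrable_of_Icc ht.2)
    (hg H.cost_T T hTm) (hg H.cost)).trans (le_of_eq ?_)
  rw [contr]; ring

end Candidate

end Setup

/-- The optimal flow from the initial law `m` at time `t`: a candidate that solves the integral
equation at every point. -/
structure IsFlow (F FT : E n → Measure (E n) → ℝ) (lam T c t : ℝ) (m : Measure (E n))
    (y : E n → ℝ → E n) : Prop extends IsCandidate lam T c t m y where
  equation : ∀ x, ∀ s ∈ Icc t T, y x s = integralRHS F FT lam T t m y x s

/-- The successive approximations of the flow. -/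
noncomputable def picard (F FT : E n → Measure (E n) → ℝ) (lam T t : ℝ) (m : Measure (E n)) :
    ℕ → E n → ℝ → E n
  | 0 => fun x _ => x
  | k + 1 => integralRHS F FT lam T t m (picard F FT lam T t m k)

namespace Setup

variable (H : Setup D lam T c Φ ΦT F FT) {t : ℝ} (ht : t ∈ Icc 0 T) {m : Measure (E n)}
  (hm : m ∈ D)
include H ht hm

lemma isCandidate_picard (k : ℕ) : IsCandidate lam T c t m (picard F FT lam T t m k) := by
  induction k with
  | zero =>
    refine ⟨fun s _ x x' => ?_, fun x s _ s' _ => ?_, fun x => rfl⟩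
    · simp only [picard, sub_self, norm_zero]
      exact mul_nonneg H.pert_nonneg (norm_nonneg _)
    · simp only [picard, sub_self, norm_zero]
      exact mul_nonneg (mul_nonneg H.speed_nonneg (H.weight_pos m x).le) (abs_nonneg _)
  | succ k ih => exact H.isCandidate_integralRHS ht hm ih

lemma norm_picard_sub_le (k : ℕ) : ∀ x, ∀ s ∈ Icc t T,
    ‖picard F FT lam T t m k x s - picard F FT lam T t m (k + 1) x s‖
      ≤ (speed lam T c * T) * (contr lam T c * (3 - 2 * contr lam T c)) ^ k
        * weight lam T c m x := by
  induction k with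
  | zero =>
    intro x s hs
    have := H.norm_candidate_sub_le ht (H.isCandidate_picard ht hm 1) hs x
    rw [norm_sub_rev] at this
    simpa [picard] using this
  | succ k ih =>
    intro x s hs
    refine (H.norm_integralRHS_sub_le ht hm (H.isCandidate_picard ht hm k)
      (H.isCandidate_picard ht hm (k + 1)) (mul_nonneg (mul_nonneg H.speed_nonneg H.T_pos.le)
        (pow_nonneg H.rate_nonneg _)) ih x hs).trans (le_of_eq (by ring))

/-- The successive approximations converge, and the bounds that define candidates pass to the
limit. -/
theorem exists_isFlow : ∃ y, IsFlow F FT lam T c t m y := by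
  set r := contr lam T c * (3 - 2 * contr lam T c) with hr
  have hr0 : 0 ≤ r := H.rate_nonneg
  have hr1 : r < 1 := H.rate_lt
  set p := picard F FT lam T t m with hp
  have hcand := H.isCandidate_picard ht hm
  have hdist : ∀ x, ∀ s ∈ Icc t T, ∀ k, dist (p k x s) (p (k + 1) x s)
      ≤ (speed lam T c * T * weight lam T c m x) * r ^ k := fun x s hs k => by
    rw [dist_eq_norm]
    exact (H.norm_picard_sub_le ht hm k x s hs).trans (le_of_eq (by ring))
  let y : E n → ℝ → E n := fun x s => limUnder atTop fun k => p k x s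
  have hlim : ∀ x, ∀ s ∈ Icc t T, Tendsto (fun k => p k x s) atTop (𝓝 (y x s)) :=
    fun x s hs => (cauchySeq_of_le_geometric r _ hr1 (hdist x s hs)).tendsto_limUnder
  have hy : IsCandidate lam T c t m y := by
    refine ⟨fun s hs x x' => ?_, fun x s hs s' hs' => ?_, fun x => ?_⟩
    · exact le_of_tendsto (((hlim x s hs).sub (hlim x' s hs)).sub_const _).norm
        (Eventually.of_forall fun k => (hcand k).pert s hs x x')
    · exact le_of_tendsto ((hlim x s hs).sub (hlim x s' hs')).norm
        (Eventually.of_forall fun k => (hcand k).time x s hs s' hs')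
    · exact tendsto_nhds_unique (hlim x t (left_mem_Icc.2 ht.2))
        (tendsto_const_nhds.congr fun k => ((hcand k).start x).symm)
  refine ⟨y, hy, fun x s hs => ?_⟩
  have hclose : ∀ k, ∀ x, ∀ s ∈ Icc t T, ‖p k x s - y x s‖
      ≤ (speed lam T c * T * r ^ k / (1 - r)) * weight lam T c m x := fun k x s hs => by
    rw [← dist_eq_norm]
    exact (dist_le_of_le_geometric_of_tendsto r _ hr1 (hdist x s hs) (hlim x s hs) k).trans
      (le_of_eq (by ring))
  have hk0 : ∀ k, 0 ≤ speed lam T c * T * r ^ k / (1 - r) := fun k =>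
    div_nonneg (mul_nonneg (mul_nonneg H.speed_nonneg H.T_pos.le) (pow_nonneg hr0 _))
      (by linarith)
  have h1 : Tendsto (fun k => p (k + 1) x s) atTop
      (𝓝 (integralRHS F FT lam T t m y x s)) := by
    rw [tendsto_iff_norm_sub_tendsto_zero]
    refine squeeze_zero (fun _ => norm_nonneg _) (fun k =>
      H.norm_integralRHS_sub_le ht hm (hcand k) hy (hk0 k) (hclose k) x hs) ?_
    have := (tendsto_pow_atTop_nhds_zero_of_lt_one hr0 hr1).const_mul
      (r * (speed lam T c * T / (1 - r)) * weight lam T c m x)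
    rw [mul_zero] at this
    exact this.congr fun k => by rw [← hr]; ring
  exact tendsto_nhds_unique ((tendsto_add_atTop_iff_nat 1).2 (hlim x s hs)) h1

end Setup

end Constants

/-! ### Stability of the solutions of the integral equation -/

section Stability

variable {Ω : Type*} [MeasurableSpace Ω]

lemma abs_l2norm_sub_le {G : Type*} [NormedAddCommGroup G] {P : Measure Ω} {f g : Ω → G}
    (hf : MemLp f 2 P) (hg : MemLp g 2 P) :
    |l2norm P f - l2norm P g| ≤ l2norm P (fun ω => f ω - g ω) := by
  have h1 := l2norm_add_le (memLp_fun_sub hf hg) hg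
  have h2 := l2norm_add_le (memLp_fun_sub hg hf) hf
  simp only [sub_add_cancel] at h1 h2
  rw [l2norm_sub_comm P g f] at h2
  rw [abs_le]
  constructor <;> linarith

/-- Exchange of the almost everywhere quantifiers in an inequality, by Tonelli's theorem. -/
lemma ae_ae_le_of_ae_ae_le {P : Measure Ω} [SFinite P] {ν : Measure ℝ} [SFinite ν]
    {u v : Ω × ℝ → ℝ} (hu : AEMeasurable u (P.prod ν)) (hv : AEMeasurable v (P.prod ν))
    (h : ∀ᵐ σ ∂ν, ∀ᵐ ω ∂P, u (ω, σ) ≤ v (ω, σ)) :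
    ∀ᵐ ω ∂P, ∀ᵐ σ ∂ν, u (ω, σ) ≤ v (ω, σ) := by
  have hm : AEMeasurable (fun q => ENNReal.ofReal (u q - v q)) (P.prod ν) :=
    (hu.sub hv).ennreal_ofReal
  have h0 : ∫⁻ q, ENNReal.ofReal (u q - v q) ∂(P.prod ν) = 0 := by
    rw [lintegral_prod_symm _ hm, ← lintegral_zero (μ := ν)]
    refine lintegral_congr_ae (h.mono fun σ hσ => ?_)
    simp only
    rw [← lintegral_zero (μ := P)]
    refine lintegral_congr_ae (hσ.mono fun ω hω => ?_)
    exact ENNReal.ofReal_of_nonpos (sub_nonpos.2 hω)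
  rw [lintegral_eq_zero_iff' hm] at h0
  refine (Measure.ae_ae_of_ae_prod h0).mono fun ω hω => hω.mono fun σ hσ => ?_
  exact sub_nonpos.1 (ENNReal.ofReal_eq_zero.1 hσ)

/-- `Y` solves the integral equation on `[t, T]` with random initial position `ξ`. -/
structure IsSolution (D : Set (Measure (E n))) (F FT : E n → Measure (E n) → ℝ)
    (lam T t : ℝ) (P : Measure Ω) (ξ : Ω → E n) (Y : Ω → ℝ → E n) : Prop where
  jointly_measurable :
    AEStronglyMeasurable (Function.uncurry Y) (P.prod (volume.restrict (Icc t T)))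
  memLp : ∀ s ∈ Icc t T, MemLp (fun ω => Y ω s) 2 P
  continuous : ∀ s₀ ∈ Icc t T,
    Tendsto (fun s => l2norm P (fun ω => Y ω s - Y ω s₀)) (𝓝[Icc t T] s₀) (𝓝 0)
  law_mem : ∀ s ∈ Icc t T, P.map (fun ω => Y ω s) ∈ D
  equation : ∀ s ∈ Icc t T, ∀ᵐ ω ∂P, Y ω s = ξ ω
    - drift lam T t (gradX FT (Y ω T) (P.map (fun ω => Y ω T)))
      (fun σ => gradX F (Y ω σ) (P.map (fun ω => Y ω σ))) s

variable {D : Set (Measure (E n))} {lam T c t : ℝ} {Φ ΦT : Measure (E n) → ℝ}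
  {F FT : E n → Measure (E n) → ℝ} {P : Measure Ω} [IsProbabilityMeasure P]

omit [IsProbabilityMeasure P] in
lemma IsSolution.continuousOn_l2norm {ξ : Ω → E n} {Y : Ω → ℝ → E n}
    (hY : IsSolution D F FT lam T t P ξ Y) :
    ContinuousOn (fun s => l2norm P (fun ω => Y ω s)) (Icc t T) := by
  intro s₀ hs₀
  rw [ContinuousWithinAt, tendsto_iff_norm_sub_tendsto_zero]
  refine squeeze_zero' (Eventually.of_forall fun _ => norm_nonneg _) ?_ (hY.continuous s₀ hs₀)
  filter_upwards [self_mem_nhdsWithin] with s hs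
  exact abs_l2norm_sub_le (hY.memLp s hs) (hY.memLp s₀ hs₀)

omit [IsProbabilityMeasure P] in
lemma IsSolution.exists_bound {ξ : Ω → E n} {Y : Ω → ℝ → E n}
    (hY : IsSolution D F FT lam T t P ξ Y) :
    ∃ B, ∀ s ∈ Icc t T, l2norm P (fun ω => Y ω s) ≤ B := by
  obtain ⟨B, hB⟩ := isCompact_Icc.exists_bound_of_continuousOn hY.continuousOn_l2norm
  exact ⟨B, fun s hs => (le_abs_self _).trans (hB s hs)⟩

lemma IsSolution.integrable_uncurry {ξ : Ω → E n} {Y : Ω → ℝ → E n}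
    (hY : IsSolution D F FT lam T t P ξ Y) :
    Integrable (Function.uncurry Y) (P.prod (volume.restrict (Icc t T))) := by
  obtain ⟨B, hB⟩ := hY.exists_bound
  rw [integrable_prod_iff' hY.jointly_measurable]
  constructor
  · refine (ae_restrict_mem measurableSet_Icc).mono fun s hs => ?_
    exact (hY.memLp s hs).integrable (by norm_num)
  · refine Integrable.mono' (integrable_const B)
      (hY.jointly_measurable.norm.prod_swap.integral_prod_right') ?_
    refine (ae_restrict_mem measurableSet_Icc).mono fun s hs => ?_
    rw [Real.norm_of_nonneg (integral_nonneg fun _ => norm_nonneg _)]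
    exact (integral_norm_le_l2norm (hY.memLp s hs)).trans (hB s hs)

/-- For a curve of laws continuous in the Wasserstein distance, the gradient of the cost is
jointly continuous. -/
lemma continuous_gradX_curve (hD : StateClass D) {F' : E n → Measure (E n) → ℝ}
    {Φ' : Measure (E n) → ℝ} (hc : 0 ≤ c)
    (hF : RegularCost D c Φ' F') (htT : t ≤ T) {μ : ℝ → Measure (E n)}
    (hμ : ∀ s ∈ Icc t T, μ s ∈ D)
    (hμc : ∀ s₀ ∈ Icc t T, Tendsto (fun s => W2 (μ s) (μ s₀)) (𝓝[Icc t T] s₀) (𝓝 0)) :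
    Continuous (fun q : E n × ℝ => gradX F' q.1 (μ (projIcc t T htT q.2))) := by
  have hmem : ∀ r : ℝ, μ (projIcc t T htT r) ∈ D := fun r => hμ _ (projIcc t T htT r).2
  refine continuous_prod_of_continuous_lipschitzWith _ (Real.toNNReal (c / 2)) (fun x => ?_)
    (fun r => ?_)
  rotate_left
  · refine LipschitzWith.of_dist_le_mul fun x y => ?_
    rw [dist_eq_norm, dist_eq_norm, Real.coe_toNNReal _ (by positivity)]
    exact gradX_lipschitz_left hD hF.grad_lipschitz (hmem r) x y
  · have : ContinuousOn (fun s => gradX F' x (μ s)) (Icc t T) := by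
      intro s₀ hs₀
      rw [ContinuousWithinAt, tendsto_iff_norm_sub_tendsto_zero]
      refine squeeze_zero' (g := fun s => c / 2 * W2 (μ s) (μ s₀))
        (Eventually.of_forall fun _ => norm_nonneg _) ?_ ?_
      · filter_upwards [self_mem_nhdsWithin] with s hs
        simpa using hF.grad_lipschitz x x _ (hμ s hs) _ (hμ s₀ hs₀)
      · simpa using (hμc s₀ hs₀).const_mul (c / 2)
    exact (continuousOn_iff_continuous_domRestrict.1 this).comp continuous_projIcc

omit [IsProbabilityMeasure P] in
lemma IsSolution.W2_tendsto {ξ : Ω → E n} {Y : Ω → ℝ → E n}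
    (hY : IsSolution D F FT lam T t P ξ Y) : ∀ s₀ ∈ Icc t T,
    Tendsto (fun s => W2 (P.map (fun ω => Y ω s)) (P.map (fun ω => Y ω s₀)))
      (𝓝[Icc t T] s₀) (𝓝 0) := fun s₀ hs₀ => by
  refine squeeze_zero' (Eventually.of_forall fun _ => W2_nonneg _ _) ?_ (hY.continuous s₀ hs₀)
  filter_upwards [self_mem_nhdsWithin] with s hs
  exact W2_map_le (hY.memLp s hs).1.aemeasurable (hY.memLp s₀ hs₀).1.aemeasurable
    (memLp_fun_sub (hY.memLp s hs) (hY.memLp s₀ hs₀))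

lemma IsSolution.ae_intervalIntegrable_gradX (H : Setup D lam T c Φ ΦT F FT)
    (ht : t ∈ Icc 0 T) {ξ : Ω → E n} {Y : Ω → ℝ → E n}
    (hY : IsSolution D F FT lam T t P ξ Y) :
    ∀ᵐ ω ∂P, IntervalIntegrable
      (fun σ => gradX F (Y ω σ) (P.map (fun ω => Y ω σ))) volume t T := by
  have hc := H.c_nonneg
  obtain ⟨B, hB⟩ := hY.exists_bound
  have hcont := continuous_gradX_curve H.state hc H.cost ht.2 hY.law_mem hY.W2_tendsto
  have hsnd : ∀ᵐ q ∂(P.prod (volume.restrict (Icc t T))), q.2 ∈ Icc t T :=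
    Measure.quasiMeasurePreserving_snd.ae (ae_restrict_mem measurableSet_Icc)
  have hint : Integrable (fun q : Ω × ℝ => gradX F (Y q.1 q.2) (P.map (fun ω => Y ω q.2)))
      (P.prod (volume.restrict (Icc t T))) := by
    refine Integrable.mono' (g := fun q => c / 2 * (1 + ‖Y q.1 q.2‖ + B))
      ((((integrable_const 1).add hY.integrable_uncurry.norm).add
        (integrable_const B)).const_mul _) ?_ ?_
    · have hq : AEStronglyMeasurable (fun q : Ω × ℝ => (Y q.1 q.2, q.2))
          (P.prod (volume.restrict (Icc t T))) :=
        hY.jointly_measurable.prodMk measurable_snd.aestronglyMeasurable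
      refine (hcont.comp_aestronglyMeasurable hq).congr (hsnd.mono fun q hq => ?_)
      simp only [projIcc_of_mem ht.2 hq]
    · refine hsnd.mono fun q hq => ?_
      refine (H.cost.grad_growth _ _ (hY.law_mem _ hq)).trans
        (mul_le_mul_of_nonneg_left ?_ (by positivity))
      rw [sqrt_secondMoment_map (hY.memLp _ hq).1.aemeasurable]
      linarith [hB _ hq]
  refine hint.prod_right_ae.mono fun ω hω => ?_
  rw [intervalIntegrable_iff, uIoc_of_le ht.2]
  exact hω.mono_measure (Measure.restrict_mono Ioc_subset_Icc_self le_rfl)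

lemma norm_drift_sub_le_integral {g g' : ℝ → E n} {gT gT' : E n} {s : ℝ} (hlam : 0 < lam)
    (ht : t ∈ Icc 0 T) (hs : s ∈ Icc t T) (hg : IntervalIntegrable g volume t T)
    (hg' : IntervalIntegrable g' volume t T) :
    ‖drift lam T t gT g s - drift lam T t gT' g' s‖
      ≤ T / lam * (‖gT - gT'‖ + ∫ σ in t..T, ‖g σ - g' σ‖) := by
  have hT0 : 0 ≤ T := ht.1.trans ht.2
  have e : drift lam T t gT g s - drift lam T t gT' g' s
      = ((s - t) / lam) • (gT - gT')
        + (1 / lam) • ∫ σ in t..T, (min s σ - t) • (g σ - g' σ) := by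
    simp only [drift, smul_sub]
    rw [intervalIntegral.integral_sub (intervalIntegrable_min_smul hg s)
      (intervalIntegrable_min_smul hg' s), smul_sub]
    abel
  have h1 : ‖((s - t) / lam) • (gT - gT')‖ ≤ T / lam * ‖gT - gT'‖ := by
    rw [norm_smul, Real.norm_of_nonneg (div_nonneg (sub_nonneg.2 hs.1) hlam.le)]
    gcongr
    linarith [ht.1, hs.2]
  have hi : IntervalIntegrable (fun σ => T * ‖g σ - g' σ‖) volume t T :=
    (hg.sub hg').norm.const_mul T
  have h2 : ‖∫ σ in t..T, (min s σ - t) • (g σ - g' σ)‖ ≤ ∫ σ in t..T, T * ‖g σ - g' σ‖ := by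
    refine intervalIntegral.norm_integral_le_of_norm_le ht.2
      (Eventually.of_forall fun σ hσ => ?_) hi
    have h0 : 0 ≤ min s σ - t := sub_nonneg.2 (le_min hs.1 hσ.1.le)
    rw [norm_smul, Real.norm_of_nonneg h0]
    have := min_le_left s σ
    exact mul_le_mul_of_nonneg_right (by linarith [ht.1, hs.2]) (norm_nonneg _)
  rw [intervalIntegral.integral_const_mul] at h2
  rw [e]
  refine (norm_add_le _ _).trans ?_
  rw [norm_smul (1 / lam), Real.norm_of_nonneg (by positivity)]
  have h4 := mul_le_mul_of_nonneg_left h2 (by positivity : 0 ≤ 1 / lam)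
  calc _ ≤ T / lam * ‖gT - gT'‖ + 1 / lam * (T * ∫ σ in t..T, ‖g σ - g' σ‖) := add_le_add h1 h4
    _ = _ := by ring

/-- Two solutions of the integral equation are as close, in `L²`, as their initial positions, and
their adjoint variables are almost surely close. -/
theorem IsSolution.stability (H : Setup D lam T c Φ ΦT F FT) (ht : t ∈ Icc 0 T)
    {ξ₁ ξ₂ : Ω → E n} {Y₁ Y₂ : Ω → ℝ → E n} (h₁ : IsSolution D F FT lam T t P ξ₁ Y₁)
    (h₂ : IsSolution D F FT lam T t P ξ₂ Y₂) (hξ : MemLp (fun ω => ξ₁ ω - ξ₂ ω) 2 P) :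
    (∀ s ∈ Icc t T, l2norm P (fun ω => Y₁ ω s - Y₂ ω s)
      ≤ (1 - 2 * contr lam T c)⁻¹ * l2norm P (fun ω => ξ₁ ω - ξ₂ ω)) ∧
    ∀ᵐ ω ∂P, ∀ s ∈ Icc t T,
      ‖backward (fun σ => gradX F (Y₁ ω σ) (P.map (fun ω => Y₁ ω σ)))
          (gradX FT (Y₁ ω T) (P.map (fun ω => Y₁ ω T))) T s
        - backward (fun σ => gradX F (Y₂ ω σ) (P.map (fun ω => Y₂ ω σ)))
          (gradX FT (Y₂ ω T) (P.map (fun ω => Y₂ ω T))) T s‖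
      ≤ c / 2 * (1 + T) * (1 - contr lam T c)⁻¹ * (‖ξ₁ ω - ξ₂ ω‖
        + (1 - 2 * contr lam T c)⁻¹ * l2norm P (fun ω => ξ₁ ω - ξ₂ ω)) := by
  have hc := H.c_nonneg
  have hT := H.T_pos
  have hl := H.lam_pos
  have ha0 := H.contr_nonneg
  have ha1 := H.contr_lt
  have htm : t ∈ Icc t T := left_mem_Icc.2 ht.2
  have hTm : T ∈ Icc t T := right_mem_Icc.2 ht.2
  set a := contr lam T c with ha
  set Δ : Ω → ℝ → E n := fun ω s => Y₁ ω s - Y₂ ω s with hΔ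
  set δ : Ω → E n := fun ω => ξ₁ ω - ξ₂ ω with hδ
  have hΔL : ∀ s ∈ Icc t T, MemLp (fun ω => Δ ω s) 2 P := fun s hs =>
    memLp_fun_sub (h₁.memLp s hs) (h₂.memLp s hs)
  -- `S` bounds the distances of the laws
  set S := sSup ((fun s => l2norm P (fun ω => Δ ω s)) '' Icc t T) with hS
  obtain ⟨B₁, hB₁⟩ := h₁.exists_bound
  obtain ⟨B₂, hB₂⟩ := h₂.exists_bound
  have hbdd : BddAbove ((fun s => l2norm P (fun ω => Δ ω s)) '' Icc t T) := by
    refine ⟨B₁ + B₂, ?_⟩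
    rintro _ ⟨s, hs, rfl⟩
    have h := l2norm_add_le (h₁.memLp s hs) (h₂.memLp s hs).neg
    simp only [Pi.neg_apply, ← sub_eq_add_neg] at h
    have h' : l2norm P (-fun ω => Y₂ ω s) = l2norm P (fun ω => Y₂ ω s) := l2norm_neg P _
    rw [h'] at h
    exact h.trans (add_le_add (hB₁ s hs) (hB₂ s hs))
  have hSle : ∀ s ∈ Icc t T, l2norm P (fun ω => Δ ω s) ≤ S := fun s hs =>
    le_csSup hbdd (mem_image_of_mem _ hs)
  have hS0 : 0 ≤ S := (l2norm_nonneg _ _).trans (hSle t htm)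
  have hW : ∀ s ∈ Icc t T, W2 (P.map (fun ω => Y₁ ω s)) (P.map (fun ω => Y₂ ω s)) ≤ S :=
    fun s hs => (W2_map_le (h₁.memLp s hs).1.aemeasurable (h₂.memLp s hs).1.aemeasurable
      (hΔL s hs)).trans (hSle s hs)
  have hgrad : ∀ {F' : E n → Measure (E n) → ℝ} {Φ' : Measure (E n) → ℝ}, RegularCost D c Φ' F' →
      ∀ s ∈ Icc t T, ∀ ω, ‖gradX F' (Y₁ ω s) (P.map (fun ω => Y₁ ω s))
        - gradX F' (Y₂ ω s) (P.map (fun ω => Y₂ ω s))‖ ≤ c / 2 * (‖Δ ω s‖ + S) :=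
    fun hF s hs ω => (hF.grad_lipschitz _ _ _ (h₁.law_mem s hs) _ (h₂.law_mem s hs)).trans
      (mul_le_mul_of_nonneg_left (add_le_add_right (hW s hs) _) (by positivity))
  -- `h` collects what drives the difference of the two trajectories of `ω`
  set h : Ω → ℝ := fun ω => ‖Δ ω T‖ + (∫ σ in t..T, ‖Δ ω σ‖) + (1 + T) * S with hh
  have hΔint : Integrable (fun q : Ω × ℝ => Δ q.1 q.2) (P.prod (volume.restrict (Icc t T))) :=
    h₁.integrable_uncurry.sub h₂.integrable_uncurry
  have hΔω : ∀ᵐ ω ∂P, IntervalIntegrable (fun σ => ‖Δ ω σ‖) volume t T := by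
    refine hΔint.prod_right_ae.mono fun ω hω => ?_
    rw [intervalIntegrable_iff, uIoc_of_le ht.2]
    exact (hω.mono_measure (Measure.restrict_mono Ioc_subset_Icc_self le_rfl)).norm
  -- the gradients along the two solutions differ by at most a multiple of `h`
  have hdiff : ∀ᵐ ω ∂P, ‖gradX FT (Y₁ ω T) (P.map (fun ω => Y₁ ω T))
        - gradX FT (Y₂ ω T) (P.map (fun ω => Y₂ ω T))‖
      + (∫ σ in t..T, ‖gradX F (Y₁ ω σ) (P.map (fun ω => Y₁ ω σ))
        - gradX F (Y₂ ω σ) (P.map (fun ω => Y₂ ω σ))‖) ≤ c / 2 * h ω := by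
    filter_upwards [hΔω, h₁.ae_intervalIntegrable_gradX H ht,
      h₂.ae_intervalIntegrable_gradX H ht] with ω h3 h4 h5
    have h6 : ∫ σ in t..T, ‖gradX F (Y₁ ω σ) (P.map (fun ω => Y₁ ω σ))
        - gradX F (Y₂ ω σ) (P.map (fun ω => Y₂ ω σ))‖
        ≤ ∫ σ in t..T, c / 2 * (‖Δ ω σ‖ + S) :=
      intervalIntegral.integral_mono_on ht.2 (h4.sub h5).norm
        ((h3.add intervalIntegrable_const).const_mul _) fun σ hσ => hgrad H.cost σ hσ ω
    rw [intervalIntegral.integral_const_mul,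
      intervalIntegral.integral_add h3 intervalIntegrable_const, intervalIntegral.integral_const,
      smul_eq_mul] at h6
    have h7 := hgrad H.cost_T T hTm ω
    have h8 : c / 2 * ((T - t) * S) ≤ c / 2 * (T * S) := by
      gcongr
      linarith [ht.1]
    simp only [hh]
    linarith
  -- the equations bound the difference of the trajectories by `h`
  have hpt : ∀ s ∈ Icc t T, ∀ᵐ ω ∂P, ‖Δ ω s‖ ≤ ‖δ ω‖ + T * c / (2 * lam) * h ω := by
    intro s hs
    filter_upwards [hdiff, h₁.ae_intervalIntegrable_gradX H ht,
      h₂.ae_intervalIntegrable_gradX H ht, h₁.equation s hs, h₂.equation s hs]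
      with ω h3 h4 h5 e₁ e₂
    have h6 := norm_drift_sub_le_integral (gT := gradX FT (Y₁ ω T) (P.map (fun ω => Y₁ ω T)))
      (gT' := gradX FT (Y₂ ω T) (P.map (fun ω => Y₂ ω T))) hl ht hs h4 h5
    have h7 := mul_le_mul_of_nonneg_left h3 (by positivity : 0 ≤ T / lam)
    have h8 : ∀ y y' a b a' b' : E n, y = a - b → y' = a' - b' →
        ‖y - y'‖ ≤ ‖a - a'‖ + ‖b - b'‖ := fun y y' a b a' b' e e' => by
      rw [e, e', show a - b - (a' - b') = (a - a') - (b - b') by abel]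
      exact norm_sub_le _ _
    have h9 := h8 _ _ _ _ _ _ e₁ e₂
    change ‖Δ ω s‖ ≤ ‖δ ω‖ + _ at h9
    calc ‖Δ ω s‖ ≤ ‖δ ω‖ + T / lam * (c / 2 * h ω) := by linarith
      _ = _ := by ring
  have hhm : AEMeasurable h P := by
    refine AEMeasurable.add (AEMeasurable.add (hΔL T hTm).1.norm.aemeasurable ?_)
      aemeasurable_const
    have h3 := hΔint.1.norm.integral_prod_right'
    simp only [intervalIntegral.integral_of_le ht.2, ← integral_Icc_eq_integral_Ioc]
    exact h3.aemeasurable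
  -- the exceptional sets of `hpt` depend on the time; they are replaced by a single one
  have hae := ae_ae_le_of_ae_ae_le (P := P) (ν := volume.restrict (Icc t T))
    (u := fun q => ‖Δ q.1 q.2‖) (v := fun q => ‖δ q.1‖ + T * c / (2 * lam) * h q.1)
    hΔint.1.norm.aemeasurable
    ((hξ.1.norm.aemeasurable.comp_fst).add (hhm.comp_fst.const_mul _))
    ((ae_restrict_mem measurableSet_Icc).mono hpt)
  have hab : (1 + T) * (T * c / (2 * lam)) = a := by rw [ha, contr]; ring
  -- inserting the bound in the definition of `h`, one absorbs `h` since `a < 1`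
  have hhle : ∀ᵐ ω ∂P, h ω ≤ (1 + T) * ((1 - a)⁻¹ * (‖δ ω‖ + S)) := by
    filter_upwards [hae, hpt T hTm, hΔω] with ω h3 h4 h5
    set v := ‖δ ω‖ + T * c / (2 * lam) * h ω with hv
    have hv0 : 0 ≤ v := (norm_nonneg _).trans h4
    have h6 : ∫ σ in t..T, ‖Δ ω σ‖ ≤ ∫ σ in t..T, v :=
      intervalIntegral.integral_mono_ae_restrict ht.2 h5 intervalIntegrable_const h3
    rw [intervalIntegral.integral_const, smul_eq_mul] at h6
    have h7 : (T - t) * v ≤ T * v := mul_le_mul_of_nonneg_right (by linarith [ht.1]) hv0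
    have h8 : h ω ≤ (1 + T) * (v + S) := by
      have : h ω = ‖Δ ω T‖ + (∫ σ in t..T, ‖Δ ω σ‖) + (1 + T) * S := rfl
      linarith
    have h9 : (1 + T) * (v + S) = (1 + T) * (‖δ ω‖ + S) + a * h ω := by
      rw [hv, ← hab]; ring
    have h10 : 0 < 1 - a := by linarith
    rw [inv_mul_eq_div, ← mul_div_assoc, le_div_iff₀ h10]
    linarith
  have hpt' : ∀ s ∈ Icc t T, ∀ᵐ ω ∂P, ‖Δ ω s‖ ≤ (1 - a)⁻¹ * ‖δ ω‖ + (1 - a)⁻¹ * (a * S) := by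
    intro s hs
    filter_upwards [hpt s hs, hhle] with ω h3 h4
    have h5 := mul_le_mul_of_nonneg_left h4 (by positivity : 0 ≤ T * c / (2 * lam))
    have h6 : T * c / (2 * lam) * ((1 + T) * ((1 - a)⁻¹ * (‖δ ω‖ + S)))
        = a * (1 - a)⁻¹ * (‖δ ω‖ + S) := by rw [← hab]; ring
    have h7 : (1 - a)⁻¹ = 1 + a * (1 - a)⁻¹ := by
      have : (1 - a) ≠ 0 := by linarith
      field_simp
      ring
    calc ‖Δ ω s‖ ≤ ‖δ ω‖ + a * (1 - a)⁻¹ * (‖δ ω‖ + S) := by linarith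
      _ = (1 + a * (1 - a)⁻¹) * ‖δ ω‖ + (1 - a)⁻¹ * (a * S) := by ring
      _ = _ := by rw [← h7]
  have hinv : 0 ≤ (1 - a)⁻¹ := by
    rw [inv_nonneg]; linarith
  -- taking `L²` norms, one absorbs `S` since `2a < 1`
  have hSS : S ≤ (1 - a)⁻¹ * l2norm P δ + (1 - a)⁻¹ * (a * S) := by
    refine csSup_le ((nonempty_Icc.2 ht.2).image _) ?_
    rintro _ ⟨s, hs, rfl⟩
    exact l2norm_le_affine hξ hinv (by positivity) (hpt' s hs)
  have hSfin : S ≤ (1 - 2 * a)⁻¹ * l2norm P δ := by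
    have h3 : 0 < 1 - a := by linarith
    have h4 : 0 < 1 - 2 * a := by linarith
    rw [← mul_add, inv_mul_eq_div, le_div_iff₀ h3] at hSS
    rw [inv_mul_eq_div, le_div_iff₀ h4]
    linarith
  refine ⟨fun s hs => (hSle s hs).trans hSfin, ?_⟩
  filter_upwards [hdiff, hhle, h₁.ae_intervalIntegrable_gradX H ht,
    h₂.ae_intervalIntegrable_gradX H ht] with ω h3 h4 h5 h6 s hs
  have h5' := h5.mono_set (uIcc_subset_uIcc (by rw [uIcc_of_le ht.2]; exact hs) right_mem_uIcc)
  have h6' := h6.mono_set (uIcc_subset_uIcc (by rw [uIcc_of_le ht.2]; exact hs) right_mem_uIcc)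
  have h7 := intervalIntegral.norm_integral_le_integral_norm (μ := volume)
    (f := fun σ => gradX F (Y₁ ω σ) (P.map (fun ω => Y₁ ω σ))
        - gradX F (Y₂ ω σ) (P.map (fun ω => Y₂ ω σ))) hs.2
  have h8 : ∫ σ in s..T, ‖gradX F (Y₁ ω σ) (P.map (fun ω => Y₁ ω σ))
        - gradX F (Y₂ ω σ) (P.map (fun ω => Y₂ ω σ))‖
      ≤ ∫ σ in t..T, ‖gradX F (Y₁ ω σ) (P.map (fun ω => Y₁ ω σ))
        - gradX F (Y₂ ω σ) (P.map (fun ω => Y₂ ω σ))‖ :=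
    intervalIntegral.integral_mono_interval hs.1 hs.2 le_rfl
      (Eventually.of_forall fun _ => norm_nonneg _) (h5.sub h6).norm
  rw [intervalIntegral.integral_sub h5' h6'] at h7
  have h9 : ‖δ ω‖ + S ≤ ‖δ ω‖ + (1 - 2 * a)⁻¹ * l2norm P δ := add_le_add_right hSfin _
  calc _ ≤ c / 2 * h ω := by
        simp only [backward, add_sub_add_comm]
        refine (norm_add_le _ _).trans ?_
        linarith
    _ ≤ c / 2 * ((1 + T) * ((1 - a)⁻¹ * (‖δ ω‖ + (1 - 2 * a)⁻¹ * l2norm P δ))) := by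
        refine mul_le_mul_of_nonneg_left (h4.trans ?_) (by positivity)
        exact mul_le_mul_of_nonneg_left (mul_le_mul_of_nonneg_left h9 hinv) (by positivity)
    _ = _ := by ring

end Stability

/-! ### The optimal flow and its adjoint variable -/

section Flow

/-- The adjoint variable `z(x, s)` along the curves `y`. -/
noncomputable def costate (F FT : E n → Measure (E n) → ℝ) (T : ℝ) (m : Measure (E n))
    (y : E n → ℝ → E n) (x : E n) (s : ℝ) : E n :=
  backward (fun σ => gradX F (y x σ) (law m y σ)) (gradX FT (y x T) (law m y T)) T s

variable {D : Set (Measure (E n))} {lam T c t : ℝ} {Φ ΦT : Measure (E n) → ℝ}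
  {F FT : E n → Measure (E n) → ℝ}

lemma norm_backward_sub_backward_le {g g' : ℝ → E n} {gT gT' : E n} {s M : ℝ}
    (ht : t ∈ Icc 0 T) (hs : s ∈ Icc t T) (hg : IntervalIntegrable g volume s T)
    (hg' : IntervalIntegrable g' volume s T) (hT : ‖gT - gT'‖ ≤ M)
    (h : ∀ σ ∈ Icc t T, ‖g σ - g' σ‖ ≤ M) :
    ‖backward g gT T s - backward g' gT' T s‖ ≤ (1 + T) * M := by
  have e : backward g gT T s - backward g' gT' T s
      = backward (fun σ => g σ - g' σ) (gT - gT') T s := by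
    simp only [backward]
    rw [intervalIntegral.integral_sub hg hg']
    abel
  rw [e]
  exact norm_backward_le ht hs hT h

namespace Setup

variable (H : Setup D lam T c Φ ΦT F FT) (ht : t ∈ Icc 0 T) {m : Measure (E n)} (hm : m ∈ D)
  {y : E n → ℝ → E n} (hy : IsFlow F FT lam T c t m y)
include H ht hm hy

lemma continuousOn_costate (x : E n) : ContinuousOn (costate F FT T m y x) (Icc t T) :=
  continuousOn_backward _ (H.continuousOn_gradX_candidate ht hm hy.toIsCandidate H.cost x)

lemma flow_eq (x : E n) {s : ℝ} (hs : s ∈ Icc t T) :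
    y x s = x - (1 / lam) • ∫ r in t..s, costate F FT T m y x r := by
  rw [hy.equation x s hs, integralRHS_eq, drift_eq _ hs
    (H.continuousOn_gradX_candidate ht hm hy.toIsCandidate H.cost x)]
  rfl

lemma flow_restart (x : E n) {r s : ℝ} (hr : r ∈ Icc t T) (hs : s ∈ Icc r T) :
    y x s = y x r - drift lam T r (gradX FT (y x T) (law m y T))
      (fun σ => gradX F (y x σ) (law m y σ)) s := by
  have hs' : s ∈ Icc t T := ⟨hr.1.trans hs.1, hs.2⟩
  have hg := H.continuousOn_gradX_candidate ht hm hy.toIsCandidate H.cost x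
  have hc := H.continuousOn_costate ht hm hy x
  rw [drift_eq _ hs (hg.mono (Icc_subset_Icc_left hr.1)), H.flow_eq ht hm hy x hs',
    H.flow_eq ht hm hy x hr, ← intervalIntegral.integral_add_adjacent_intervals (b := r)
    ((hc.mono (Icc_subset_Icc_right hr.2)).intervalIntegrable_of_Icc hr.1)
    ((hc.mono (Icc_subset_Icc hr.1 hs.2)).intervalIntegrable_of_Icc hs.1), smul_add,
      sub_add_eq_sub_sub]
  rfl

lemma norm_costate_le (x : E n) {s : ℝ} (hs : s ∈ Icc t T) :
    ‖costate F FT T m y x s‖ ≤ lam * speed lam T c * weight lam T c m x := by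
  have hT := H.T_pos
  refine (norm_backward_le ht hs
    (H.norm_gradX_candidate_le ht hm hy.toIsCandidate H.cost_T (right_mem_Icc.2 ht.2) x)
    (fun _ hσ => H.norm_gradX_candidate_le ht hm hy.toIsCandidate H.cost hσ x)).trans
    (le_of_eq ?_)
  field_simp

lemma norm_costate_sub_le (x : E n) {s s' : ℝ} (hs : s ∈ Icc t T) (hs' : s' ∈ Icc t T) :
    ‖costate F FT T m y x s - costate F FT T m y x s'‖
      ≤ speed lam T c * (lam / (1 + T)) * weight lam T c m x * |s - s'| :=
  norm_backward_sub_le _ (H.continuousOn_gradX_candidate ht hm hy.toIsCandidate H.cost x)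
    (fun _ hσ => H.norm_gradX_candidate_le ht hm hy.toIsCandidate H.cost hσ x) hs' hs

lemma norm_costate_sub_left_le (x x' : E n) {s : ℝ} (hs : s ∈ Icc t T) :
    ‖costate F FT T m y x s - costate F FT T m y x' s‖ ≤ (1 + T) * c * ‖x - x'‖ := by
  have hc := H.c_nonneg
  have hY := hy.toIsCandidate
  have hT := H.T_pos
  have hg : ∀ {F' : E n → Measure (E n) → ℝ} {Φ' : Measure (E n) → ℝ}, RegularCost D c Φ' F' →
      ∀ σ ∈ Icc t T, ‖gradX F' (y x σ) (law m y σ) - gradX F' (y x' σ) (law m y σ)‖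
        ≤ c * ‖x - x'‖ := fun hF σ hσ => by
    refine (gradX_lipschitz_left H.state hF.grad_lipschitz (H.law_mem hm hY hσ) _ _).trans ?_
    have h1 := lipschitz_of_perturbation (hY.pert σ hσ) x x'
    have h2 : (1 + contr lam T c / (1 - contr lam T c)) * ‖x - x'‖ ≤ 2 * ‖x - x'‖ :=
      mul_le_mul_of_nonneg_right (by linarith [H.pert_lt]) (norm_nonneg _)
    have h3 := mul_le_mul_of_nonneg_left (h1.trans h2) (by positivity : 0 ≤ c / 2)
    linarith
  have hi : ∀ x, IntervalIntegrable (fun σ => gradX F (y x σ) (law m y σ)) volume s T :=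
    fun x => ((H.continuousOn_gradX_candidate ht hm hY H.cost x).mono
      (Icc_subset_Icc_left hs.1)).intervalIntegrable_of_Icc hs.2
  refine (norm_backward_sub_backward_le ht hs (hi x) (hi x')
    (hg H.cost_T T (right_mem_Icc.2 ht.2)) (hg H.cost)).trans (le_of_eq (by ring))

lemma hasDerivWithinAt_flow (x : E n) {s : ℝ} (hs : s ∈ Icc t T) :
    HasDerivWithinAt (y x) (-((1 / lam) • costate F FT T m y x s)) (Icc t T) s := by
  have hc := H.continuousOn_costate ht hm hy x
  have : Fact (s ∈ Icc t T) := ⟨hs⟩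
  have h1 : HasDerivWithinAt (fun s => ∫ r in t..s, costate F FT T m y x r)
      (costate F FT T m y x s) (Icc t T) s :=
    intervalIntegral.integral_hasDerivWithinAt_right
      ((hc.mono (Icc_subset_Icc_right hs.2)).intervalIntegrable_of_Icc hs.1)
      (hc.stronglyMeasurableAtFilter_nhdsWithin measurableSet_Icc s) (hc s hs)
  have h2 := (h1.const_smul (1 / lam)).const_sub x
  exact h2.congr (fun r hr => H.flow_eq ht hm hy x hr) (H.flow_eq ht hm hy x hs)

lemma adjoint_eq_costate (htT : t < T) (x : E n) {s : ℝ} (hs : s ∈ Icc t T) :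
    adjoint lam T t y x s = costate F FT T m y x s := by
  have h := (H.hasDerivWithinAt_flow ht hm hy x hs).derivWithin (uniqueDiffOn_Icc htT s hs)
  have h' : derivWithin (fun σ => y x σ) (Icc t T) s
      = -((1 / lam) • costate F FT T m y x s) := h
  rw [adjoint, h', smul_neg, neg_neg, smul_smul, mul_one_div_cancel H.lam_pos.ne', one_smul]

omit hm in
lemma continuous_flow_projIcc :
    Continuous (fun q : E n × ℝ => y q.1 (projIcc t T ht.2 q.2)) := by
  refine continuous_prod_of_continuous_lipschitzWith _ (Real.toNNReal 2) (fun x => ?_)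
    (fun r => ?_)
  · have : ContinuousOn (y x) (Icc t T) := by
      refine (LipschitzOnWith.of_dist_le_mul (K := (speed lam T c * weight lam T c m x).toNNReal)
        fun r hr s hs => ?_).continuousOn
      rw [dist_eq_norm, Real.dist_eq]
      exact (hy.time x r hr s hs).trans
        (mul_le_mul_of_nonneg_right (Real.le_coe_toNNReal _) (abs_nonneg _))
    exact (continuousOn_iff_continuous_domRestrict.1 this).comp continuous_projIcc
  · refine LipschitzWith.of_dist_le_mul fun x x' => ?_
    rw [dist_eq_norm, dist_eq_norm, Real.coe_toNNReal _ (by positivity)]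
    refine (lipschitz_of_perturbation (hy.pert _ (projIcc t T ht.2 r).2) x x').trans ?_
    exact mul_le_mul_of_nonneg_right (by linarith [H.pert_lt]) (norm_nonneg _)

lemma continuous_costate_projIcc :
    Continuous (fun q : E n × ℝ => costate F FT T m y q.1 (projIcc t T ht.2 q.2)) := by
  refine continuous_prod_of_continuous_lipschitzWith _ (Real.toNNReal ((1 + T) * c)) (fun x => ?_)
    (fun r => ?_)
  · exact (continuousOn_iff_continuous_domRestrict.1
      (H.continuousOn_costate ht hm hy x)).comp continuous_projIcc
  · refine LipschitzWith.of_dist_le_mul fun x x' => ?_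
    have := H.c_nonneg
    have := H.T_pos
    rw [dist_eq_norm, dist_eq_norm, Real.coe_toNNReal _ (by positivity)]
    exact H.norm_costate_sub_left_le ht hm hy x x' (projIcc t T ht.2 r).2

lemma continuous_costate {s : ℝ} (hs : s ∈ Icc t T) :
    Continuous (fun x => costate F FT T m y x s) :=
  continuous_of_norm_sub_le fun x x' => H.norm_costate_sub_left_le ht hm hy x x' hs

section Random

variable {Ω : Type*} [MeasurableSpace Ω] {P : Measure Ω} [IsProbabilityMeasure P] {ξ : Ω → E n}
  (hξm : AEMeasurable ξ P) (hξ : P.map ξ = m)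
include hξm hξ

omit H ht hm hy [IsProbabilityMeasure P] in
lemma map_flow {g : E n → E n} (hg : Continuous g) : P.map (fun ω => g (ξ ω)) = m.map g := by
  rw [← hξ, AEMeasurable.map_map_of_aemeasurable hg.measurable.aemeasurable hξm]
  rfl

omit ht hm hy [IsProbabilityMeasure P] H in
lemma memLp_comp {G : Type*} [NormedAddCommGroup G] {g : E n → G} (hg : MemLp g 2 m) :
    MemLp (fun ω => g (ξ ω)) 2 P := by
  rw [← hξ] at hg
  exact hg.comp_of_map hξm

omit ht hm hy [IsProbabilityMeasure P] H in
lemma l2norm_comp {G : Type*} [NormedAddCommGroup G] {g : E n → G}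
    (hg : AEStronglyMeasurable g m) : l2norm P (fun ω => g (ξ ω)) = l2norm m g := by
  unfold l2norm
  rw [← hξ, integral_map hξm]
  rw [hξ]
  exact (hg.norm.aemeasurable.pow_const 2).aestronglyMeasurable

omit H ht hm [IsProbabilityMeasure P] in
lemma law_flow {s : ℝ} (hs : s ∈ Icc t T) :
    P.map (fun ω => y (ξ ω) s) = law m y s :=
  map_flow hξm hξ (continuous_candidate hy.toIsCandidate hs)

/-- The flow, restarted at any intermediate time, solves the integral equation along every random
initial position with law `m`. -/
lemma isSolution_flow {r : ℝ} (hr : r ∈ Icc t T) :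
    IsSolution D F FT lam T r P (fun ω => y (ξ ω) r) (fun ω s => y (ξ ω) s) := by
  have hsub : ∀ {s}, s ∈ Icc r T → s ∈ Icc t T := fun hs => ⟨hr.1.trans hs.1, hs.2⟩
  have hmem : ∀ s ∈ Icc t T, MemLp (fun ω => y (ξ ω) s) 2 P := fun s hs =>
    memLp_comp hξm hξ (H.memLp_candidate ht hm hy.toIsCandidate hs)
  refine ⟨?_, fun s hs => hmem s (hsub hs), fun s₀ hs₀ => ?_, fun s hs => ?_, fun s hs => ?_⟩
  · have hq : AEStronglyMeasurable (fun q : Ω × ℝ => (ξ q.1, q.2))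
        (P.prod (volume.restrict (Icc r T))) :=
      (hξm.aestronglyMeasurable.comp_fst).prodMk measurable_snd.aestronglyMeasurable
    refine ((H.continuous_flow_projIcc ht hy).comp_aestronglyMeasurable hq).congr ?_
    have hsnd : ∀ᵐ q ∂(P.prod (volume.restrict (Icc r T))), q.2 ∈ Icc r T :=
      Measure.quasiMeasurePreserving_snd.ae (ae_restrict_mem measurableSet_Icc)
    refine hsnd.mono fun q hq => ?_
    simp only [projIcc_of_mem ht.2 (hsub hq), Function.uncurry]
  · have hw := memLp_comp (P := P) hξm hξ (H.memLp_weight hm)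
    have hlim : Tendsto (fun s => speed lam T c * |s - s₀|
        * l2norm P (fun ω => weight lam T c m (ξ ω))) (𝓝[Icc r T] s₀) (𝓝 0) := by
      have : Continuous (fun s => speed lam T c * |s - s₀|
        * l2norm P (fun ω => weight lam T c m (ξ ω))) := by fun_prop
      simpa using (this.tendsto s₀).mono_left nhdsWithin_le_nhds
    refine squeeze_zero' (Eventually.of_forall fun _ => l2norm_nonneg _ _) ?_ hlim
    filter_upwards [self_mem_nhdsWithin] with s hs
    have h := l2norm_le_affine (f := fun ω => y (ξ ω) s - y (ξ ω) s₀) hw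
      (mul_nonneg H.speed_nonneg (abs_nonneg (s - s₀))) le_rfl (Eventually.of_forall fun ω => by
        rw [add_zero, Real.norm_of_nonneg (H.weight_pos m _).le]
        exact (hy.time (ξ ω) s (hsub hs) s₀ (hsub hs₀)).trans (le_of_eq (by ring)))
    rwa [add_zero] at h
  · rw [law_flow hy hξm hξ (hsub hs)]
    exact H.law_mem hm hy.toIsCandidate (hsub hs)
  · refine Eventually.of_forall fun ω => ?_
    rw [H.flow_restart ht hm hy (ξ ω) hr hs,
      law_flow hy hξm hξ (right_mem_Icc.2 ht.2)]
    congr 1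
    have hrT : r ≤ T := hr.2
    simp only [drift]
    congr 2
    refine intervalIntegral.integral_congr fun σ hσ => ?_
    rw [uIcc_of_le hrT] at hσ
    simp only [law_flow hy hξm hξ (hsub hσ)]

omit H hm [IsProbabilityMeasure P] in
lemma backward_flow_eq {ω : Ω} {s : ℝ} (hs : s ∈ Icc t T) :
    backward (fun σ => gradX F (y (ξ ω) σ) (P.map (fun ω => y (ξ ω) σ)))
      (gradX FT (y (ξ ω) T) (P.map (fun ω => y (ξ ω) T))) T s = costate F FT T m y (ξ ω) s := by
  rw [costate, law_flow hy hξm hξ (right_mem_Icc.2 ht.2)]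
  simp only [backward]
  congr 1
  refine intervalIntegral.integral_congr fun σ hσ => ?_
  rw [uIcc_of_le hs.2] at hσ
  simp only [law_flow hy hξm hξ ⟨hs.1.trans hσ.1, hσ.2⟩]

end Random

lemma memLp_costate {s : ℝ} (hs : s ∈ Icc t T) :
    MemLp (fun x => costate F FT T m y x s) 2 m := by
  have := P2_prob (H.state.subset hm)
  refine memLp_of_affine_bound (H.continuous_costate ht hm hy hs).aestronglyMeasurable
    (H.memLp_weight hm) (lam * speed lam T c) 0 (Eventually.of_forall fun x => ?_)
  rw [add_zero, Real.norm_of_nonneg (H.weight_pos m x).le]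
  exact H.norm_costate_le ht hm hy x hs

end Setup

/-- The Lipschitz constant of the adjoint variable with respect to the initial position. -/
noncomputable def lipConst (lam T c : ℝ) : ℝ := c * (1 + T) * (1 - 2 * contr lam T c)⁻¹

namespace Setup

variable (H : Setup D lam T c Φ ΦT F FT) (ht : t ∈ Icc 0 T)
include H

lemma lipConst_nonneg : 0 ≤ lipConst lam T c := by
  have := H.c_nonneg
  have := H.T_pos
  have : 0 ≤ 1 - 2 * contr lam T c := by linarith [H.contr_lt]
  unfold lipConst
  positivity

include ht

/-- The adjoint variables of two flows are Lipschitz functions of the initial positions, in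
`L²`. -/
lemma l2norm_costate_sub_le {m₁ m₂ : Measure (E n)} (hm₁ : m₁ ∈ D) (hm₂ : m₂ ∈ D)
    {y₁ y₂ : E n → ℝ → E n} (hy₁ : IsFlow F FT lam T c t m₁ y₁)
    (hy₂ : IsFlow F FT lam T c t m₂ y₂) {Ω : Type*} [MeasurableSpace Ω] {P : Measure Ω}
    [IsProbabilityMeasure P] {ξ₁ ξ₂ : Ω → E n} (h₁ : AEMeasurable ξ₁ P) (h₂ : AEMeasurable ξ₂ P)
    (e₁ : P.map ξ₁ = m₁) (e₂ : P.map ξ₂ = m₂) {s : ℝ} (hs : s ∈ Icc t T) :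
    l2norm P (fun ω => costate F FT T m₁ y₁ (ξ₁ ω) s - costate F FT T m₂ y₂ (ξ₂ ω) s)
      ≤ lipConst lam T c * l2norm P (fun ω => ξ₁ ω - ξ₂ ω) := by
  have hc := H.c_nonneg
  have hT := H.T_pos
  have ha0 := H.contr_nonneg
  have ha1 := H.contr_lt
  have htm : t ∈ Icc t T := left_mem_Icc.2 ht.2
  have hd : MemLp (fun ω => ξ₁ ω - ξ₂ ω) 2 P :=
    memLp_fun_sub (memLp_comp h₁ e₁ (P2_memLp_id (H.state.subset hm₁)))
      (memLp_comp h₂ e₂ (P2_memLp_id (H.state.subset hm₂)))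
  have e : ∀ ω, y₁ (ξ₁ ω) t - y₂ (ξ₂ ω) t = ξ₁ ω - ξ₂ ω := fun ω => by
    rw [hy₁.start, hy₂.start]
  have hst := ((H.isSolution_flow ht hm₁ hy₁ h₁ e₁ htm).stability H ht
    (H.isSolution_flow ht hm₂ hy₂ h₂ e₂ htm) (by simpa only [e] using hd)).2
  simp only [e] at hst
  have h1 : 0 ≤ (1 - contr lam T c)⁻¹ := by rw [inv_nonneg]; linarith
  have h2 : 0 ≤ (1 - 2 * contr lam T c)⁻¹ := by rw [inv_nonneg]; linarith
  refine (l2norm_le_affine (α := c / 2 * (1 + T) * (1 - contr lam T c)⁻¹)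
    (β := c / 2 * (1 + T) * (1 - contr lam T c)⁻¹ * ((1 - 2 * contr lam T c)⁻¹
      * l2norm P (fun ω => ξ₁ ω - ξ₂ ω))) hd (by positivity)
    (mul_nonneg (by positivity) (mul_nonneg h2 (l2norm_nonneg _ _))) ?_).trans (le_of_eq ?_)
  · refine hst.mono fun ω hω => ?_
    have := hω s hs
    rw [backward_flow_eq ht hy₁ h₁ e₁ hs, backward_flow_eq ht hy₂ h₂ e₂ hs] at this
    rwa [← mul_add]
  · have h3 : 1 - contr lam T c ≠ 0 := by linarith
    have h4 : 1 - 2 * contr lam T c ≠ 0 := by linarith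
    rw [lipConst]
    field_simp
    ring

/-- The flow property: restarting the flow at time `r` from its law at that time. -/
lemma flow_property {m : Measure (E n)} (hm : m ∈ D) {y y' : E n → ℝ → E n}
    (hy : IsFlow F FT lam T c t m y) {r : ℝ} (hr : r ∈ Icc t T)
    (hy' : IsFlow F FT lam T c r (law m y r) y') :
    (∀ s ∈ Icc r T, law (law m y r) y' s = law m y s) ∧
    ∀ᵐ x ∂m, ∀ s ∈ Icc r T,
      costate F FT T (law m y r) y' (y x r) s = costate F FT T m y x s := by
  have hpm := P2_prob (H.state.subset hm)
  have hr0 : r ∈ Icc 0 T := ⟨ht.1.trans hr.1, hr.2⟩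
  have hrm : r ∈ Icc r T := left_mem_Icc.2 hr.2
  have hm' : law m y r ∈ D := H.law_mem hm hy.toIsCandidate hr
  have hym : AEMeasurable (fun x => y x r) m :=
    (continuous_candidate hy.toIsCandidate hr).measurable.aemeasurable
  have h₁ := H.isSolution_flow ht hm hy (P := m) (ξ := fun x => x) aemeasurable_id' (by simp) hr
  have h₂ := H.isSolution_flow hr0 hm' hy' (P := m) (ξ := fun x => y x r) hym rfl hrm
  have e : ∀ x, y x r - y' (y x r) r = 0 := fun x => by rw [hy'.start, sub_self]
  have hst := h₁.stability H hr0 h₂ (by simp only [e]; exact memLp_const 0)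
  have e0 : l2norm m (fun _ : E n => (0 : E n)) = 0 := by simp [l2norm]
  simp only [e, e0, mul_zero, norm_zero, add_zero] at hst
  refine ⟨fun s hs => ?_, ?_⟩
  · have h3 : l2norm m (fun x => y x s - y' (y x r) s) = 0 :=
      le_antisymm (hst.1 s hs) (l2norm_nonneg _ _)
    have h4 : MemLp (fun x => y x s - y' (y x r) s) 2 m :=
      memLp_fun_sub (h₁.memLp s hs) (h₂.memLp s hs)
    have h5 : (fun x => ‖y x s - y' (y x r) s‖ ^ 2) =ᵐ[m] 0 := by
      rw [← integral_eq_zero_iff_of_nonneg (fun _ => by positivity) (integrable_sq_of_memLp h4),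
        ← l2norm_sq, h3]
      simp
    rw [← law_flow hy' hym rfl hs]
    refine Measure.map_congr (h5.mono fun x hx => ?_)
    have : y x s - y' (y x r) s = 0 := by simpa using hx
    exact (sub_eq_zero.1 this).symm
  · refine hst.2.mono fun x hx s hs => ?_
    have h3 := hx s hs
    have h4 := backward_flow_eq ht hy (P := m) (ξ := fun x => x) (ω := x) aemeasurable_id'
      (by simp) (s := s) ⟨hr.1.trans hs.1, hs.2⟩
    have h5 := backward_flow_eq hr0 hy' (P := m) (ξ := fun x => y x r) (ω := x) hym rfl hs
    rw [h4, h5] at h3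
    exact (sub_eq_zero.1 (norm_le_zero_iff.1 h3)).symm

end Setup

end Flow

/-! ### Comparison of the cost of a process with the cost of the optimal flow -/

section Control

variable {Ω : Type*} [MeasurableSpace Ω]

lemma RegularCost.expansion_map {D : Set (Measure (E n))} {c : ℝ} {Φ : Measure (E n) → ℝ}
    {F : E n → Measure (E n) → ℝ} (hD : StateClass D) (hF : RegularCost D c Φ F) {P : Measure Ω}
    [IsProbabilityMeasure P] {X Y : Ω → E n} (hX : MemLp X 2 P) (hY : MemLp Y 2 P)
    (hXD : P.map X ∈ D) (hYD : P.map Y ∈ D) :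
    |Φ (P.map Y) - Φ (P.map X) - ∫ ω, inner ℝ (gradX F (X ω) (P.map X)) (Y ω - X ω) ∂P|
      ≤ c / 2 * l2norm P (fun ω => Y ω - X ω) ^ 2 := by
  have h := hF.expansion _ hXD _ hYD _
    (map_prodMk_mem_couplings hX.1.aemeasurable hY.1.aemeasurable)
  have hm := hX.1.aemeasurable.prodMk hY.1.aemeasurable
  have hc := continuous_of_norm_sub_le (gradX_lipschitz_left hD hF.grad_lipschitz hXD)
  rw [integral_map hm (Continuous.aestronglyMeasurable
      (by fun_prop : Continuous fun p : E n × E n => ‖p.2 - p.1‖ ^ 2)), integral_map hm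
    ((hc.comp continuous_fst).inner (by fun_prop)).aestronglyMeasurable] at h
  rwa [l2norm_sq]

lemma RegularCost.abs_sub_le {D : Set (Measure (E n))} {c : ℝ} {Φ : Measure (E n) → ℝ}
    {F : E n → Measure (E n) → ℝ} (hD : StateClass D) (hF : RegularCost D c Φ F) {P : Measure Ω}
    [IsProbabilityMeasure P] {X Y : Ω → E n} (hX : MemLp X 2 P) (hY : MemLp Y 2 P)
    (hXD : P.map X ∈ D) (hYD : P.map Y ∈ D) :
    |Φ (P.map Y) - Φ (P.map X)|
      ≤ l2norm P (fun ω => gradX F (X ω) (P.map X)) * l2norm P (fun ω => Y ω - X ω)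
        + c / 2 * l2norm P (fun ω => Y ω - X ω) ^ 2 := by
  have h1 := hF.expansion_map hD hX hY hXD hYD
  have h2 := abs_integral_inner_le (memLp_gradX hD hF.grad_lipschitz hXD hX) (memLp_fun_sub hY hX)
  have h3 := abs_sub_abs_le_abs_sub (Φ (P.map Y) - Φ (P.map X))
    (∫ ω, inner ℝ (gradX F (X ω) (P.map X)) (Y ω - X ω) ∂P)
  linarith

lemma RegularCost.continuousOn_curve {D : Set (Measure (E n))} {c : ℝ} {Φ : Measure (E n) → ℝ}
    {F : E n → Measure (E n) → ℝ} (hD : StateClass D) (hF : RegularCost D c Φ F) {P : Measure Ω}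
    [IsProbabilityMeasure P] {X : Ω → ℝ → E n} {t T : ℝ}
    (hX : ∀ s ∈ Icc t T, MemLp (fun ω => X ω s) 2 P)
    (hXD : ∀ s ∈ Icc t T, P.map (fun ω => X ω s) ∈ D)
    (hXc : ∀ s₀ ∈ Icc t T,
      Tendsto (fun s => l2norm P (fun ω => X ω s - X ω s₀)) (𝓝[Icc t T] s₀) (𝓝 0)) :
    ContinuousOn (fun s => Φ (P.map (fun ω => X ω s))) (Icc t T) := by
  intro s₀ hs₀
  rw [ContinuousWithinAt, tendsto_iff_norm_sub_tendsto_zero]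
  have h := ((hXc s₀ hs₀).const_mul
    (l2norm P (fun ω => gradX F (X ω s₀) (P.map (fun ω => X ω s₀))))).add
    (((hXc s₀ hs₀).pow 2).const_mul (c / 2))
  simp only [mul_zero, add_zero, ne_eq, OfNat.ofNat_ne_zero, not_false_eq_true, zero_pow] at h
  refine squeeze_zero' (Eventually.of_forall fun _ => norm_nonneg _) ?_ h
  filter_upwards [self_mem_nhdsWithin] with s hs
  exact hF.abs_sub_le hD (hX s₀ hs₀) (hX s hs) (hXD s₀ hs₀) (hXD s hs)

/-- `X` is a process with square integrable velocity `u` on `[t, T]`, with laws in `D`. -/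
structure IsControlled (D : Set (Measure (E n))) (T t : ℝ) (P : Measure Ω) (X u : Ω → ℝ → E n) :
    Prop where
  memLp_velocity : MemLp (Function.uncurry u) 2 (P.prod (volume.restrict (Ioc t T)))
  memLp_start : MemLp (fun ω => X ω t) 2 P
  path : ∀ᵐ ω ∂P, ∀ s ∈ Icc t T, X ω s = X ω t + ∫ σ in t..s, u ω σ
  law_mem : ∀ s ∈ Icc t T, P.map (fun ω => X ω s) ∈ D

variable {D : Set (Measure (E n))} {t T : ℝ} {P : Measure Ω} [IsProbabilityMeasure P]
  {X u : Ω → ℝ → E n}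

/-- Fubini's theorem on `Ω × [t, T]`. -/
lemma integral_swap_of_integrable {f : Ω × ℝ → ℝ} (htT : t ≤ T)
    (hf : Integrable f (P.prod (volume.restrict (Ioc t T)))) :
    IntervalIntegrable (fun s => ∫ ω, f (ω, s) ∂P) volume t T ∧
    Integrable (fun ω => ∫ s in t..T, f (ω, s)) P ∧
    (∀ᵐ ω ∂P, IntervalIntegrable (fun s => f (ω, s)) volume t T) ∧
    ∫ s in t..T, ∫ ω, f (ω, s) ∂P = ∫ ω, (∫ s in t..T, f (ω, s)) ∂P := by
  simp only [intervalIntegral.integral_of_le htT, intervalIntegrable_iff, uIoc_of_le htT]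
  exact ⟨hf.integral_prod_right, hf.integral_prod_left, hf.prod_right_ae,
    (integral_prod_symm f hf).symm.trans (integral_prod f hf)⟩

namespace IsControlled

lemma ae_velocity (h : IsControlled D T t P X u) (htT : t ≤ T) :
    ∀ᵐ ω ∂P, IntervalIntegrable (u ω) volume t T ∧
      IntervalIntegrable (fun s => ‖u ω s‖ ^ 2) volume t T := by
  simp only [intervalIntegrable_iff, uIoc_of_le htT]
  filter_upwards [(h.memLp_velocity.integrable (by norm_num)).prod_right_ae,
    (integrable_sq_of_memLp h.memLp_velocity).prod_right_ae] with ω h1 h2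
  exact ⟨h1, h2⟩

/-- A square integrable variable that dominates the process. -/
lemma memLp_sup (h : IsControlled D T t P X u) (htT : t ≤ T) :
    MemLp (fun ω => ‖X ω t‖ + ∫ s in t..T, ‖u ω s‖) 2 P := by
  refine memLp_fun_add h.memLp_start.norm ?_
  have h1 := integral_swap_of_integrable htT
    (h.memLp_velocity.integrable (by norm_num : (1 : ℝ≥0∞) ≤ 2)).norm
  have h2 := integral_swap_of_integrable htT (integrable_sq_of_memLp h.memLp_velocity)
  simp only [Function.uncurry] at h1 h2
  rw [memLp_two_iff_integrable_sq_norm h1.2.1.1]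
  refine Integrable.mono' (h2.2.1.const_mul (T - t)) (h1.2.1.1.norm.pow 2) ?_
  filter_upwards [h.ae_velocity htT] with ω hω
  rw [Real.norm_of_nonneg (by positivity), Real.norm_eq_abs, sq_abs]
  exact sq_intervalIntegral_le htT hω.1.norm hω.2

lemma ae_norm_le_sup (h : IsControlled D T t P X u) (htT : t ≤ T) :
    ∀ᵐ ω ∂P, ∀ s ∈ Icc t T, ‖X ω s‖ ≤ ‖X ω t‖ + ∫ s in t..T, ‖u ω s‖ := by
  filter_upwards [h.path, h.ae_velocity htT] with ω h1 h2 s hs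
  rw [h1 s hs]
  refine (norm_add_le _ _).trans (add_le_add_right ?_ _)
  refine (intervalIntegral.norm_integral_le_integral_norm hs.1).trans ?_
  exact intervalIntegral.integral_mono_interval le_rfl hs.1 hs.2
    (Eventually.of_forall fun _ => norm_nonneg _) h2.1.norm

omit [IsProbabilityMeasure P] in
/-- A jointly measurable version of the displacement of the process. -/
lemma exists_measurable_displacement (h : IsControlled D T t P X u) :
    ∃ R : Ω × ℝ → E n, StronglyMeasurable R ∧
      ∀ᵐ ω ∂P, ∀ s ∈ Icc t T, X ω s = X ω t + R (ω, s) := by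
  set u' := h.memLp_velocity.1.mk (Function.uncurry u) with hu'
  have hu'm : StronglyMeasurable u' := h.memLp_velocity.1.stronglyMeasurable_mk
  let f : (Ω × ℝ) × ℝ → E n := {q : (Ω × ℝ) × ℝ | q.2 ≤ q.1.2}.indicator fun q => u' (q.1.1, q.2)
  have hf : StronglyMeasurable f := by
    refine StronglyMeasurable.indicator (hu'm.comp_measurable (by fun_prop)) ?_
    exact measurableSet_le measurable_snd (measurable_snd.comp measurable_fst)
  refine ⟨fun q => ∫ σ in Ioc t T, f (q, σ), hf.integral_prod_right', ?_⟩
  filter_upwards [h.path, Measure.ae_ae_of_ae_prod h.memLp_velocity.1.ae_eq_mk] with ω h1 h2 s hs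
  rw [h1 s hs]
  congr 1
  have e : (fun σ => f ((ω, s), σ)) = (Iic s).indicator fun σ => u' (ω, σ) := by
    ext1 σ
    simp [f, Set.indicator]
  rw [intervalIntegral.integral_of_le hs.1, e, integral_indicator measurableSet_Iic,
    Measure.restrict_restrict measurableSet_Iic, inter_comm, Ioc_inter_Iic, min_eq_right hs.2]
  refine integral_congr_ae ?_
  exact (ae_restrict_of_ae_restrict_of_subset (Ioc_subset_Ioc_right hs.2) h2)

lemma memLp (h : IsControlled D T t P X u) {s : ℝ} (hs : s ∈ Icc t T) :
    MemLp (fun ω => X ω s) 2 P := by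
  have htT := hs.1.trans hs.2
  obtain ⟨R, hR, hXR⟩ := h.exists_measurable_displacement
  refine memLp_of_affine_bound ?_ (h.memLp_sup htT) 1 0 ?_
  · exact (h.memLp_start.1.add
      (hR.comp_measurable measurable_prodMk_right).aestronglyMeasurable).congr
      (hXR.mono fun ω hω => (hω s hs).symm)
  · filter_upwards [h.ae_norm_le_sup htT] with ω hω
    rw [one_mul, add_zero]
    exact (hω s hs).trans (le_abs_self _)

lemma memLp_uncurry (h : IsControlled D T t P X u) (htT : t ≤ T) :
    MemLp (fun q : Ω × ℝ => X q.1 q.2) 2 (P.prod (volume.restrict (Ioc t T))) := by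
  obtain ⟨R, hR, hXR⟩ := h.exists_measurable_displacement
  have hsnd : ∀ᵐ q ∂(P.prod (volume.restrict (Ioc t T))), q.2 ∈ Icc t T :=
    Measure.quasiMeasurePreserving_snd.ae ((ae_restrict_mem measurableSet_Ioc).mono
      fun s hs => Ioc_subset_Icc_self hs)
  refine memLp_of_affine_bound (g := fun q : Ω × ℝ => ‖X q.1 t‖ + ∫ s in t..T, ‖u q.1 s‖)
    ?_ ((h.memLp_sup htT).comp_fst _) 1 0 ?_
  · refine (h.memLp_start.1.comp_fst.add hR.aestronglyMeasurable).congr ?_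
    filter_upwards [hsnd, Measure.quasiMeasurePreserving_fst.ae hXR] with q h1 h2
    exact (h2 q.2 h1).symm
  · filter_upwards [hsnd, Measure.quasiMeasurePreserving_fst.ae (h.ae_norm_le_sup htT)] with q h1 h2
    rw [one_mul, add_zero]
    exact (h2 q.2 h1).trans (le_abs_self _)

lemma l2norm_sub_le (h : IsControlled D T t P X u) {r s : ℝ} (hr : r ∈ Icc t T)
    (hs : s ∈ Icc t T) : l2norm P (fun ω => X ω s - X ω r)
      ≤ √(|s - r| * ∫ ω, (∫ σ in t..T, ‖u ω σ‖ ^ 2) ∂P) := by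
  wlog hrs : r ≤ s generalizing r s
  · rw [l2norm_sub_comm, abs_sub_comm]
    exact this hs hr (le_of_not_ge hrs)
  have htT := hr.1.trans hr.2
  have h2 := integral_swap_of_integrable htT (integrable_sq_of_memLp h.memLp_velocity)
  rw [abs_of_nonneg (sub_nonneg.2 hrs)]
  refine Real.sqrt_le_sqrt ?_
  rw [← integral_const_mul]
  refine integral_mono_of_nonneg (Eventually.of_forall fun _ => by positivity)
    (h2.2.1.const_mul _) ?_
  filter_upwards [h.path, h.ae_velocity htT] with ω h3 h4
  have hsub : ∀ {a b}, a ∈ Icc t T → b ∈ Icc t T → uIcc a b ⊆ uIcc t T := fun ha hb => by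
    rw [uIcc_of_le htT]; exact uIcc_subset_Icc ha hb
  have htm : t ∈ Icc t T := left_mem_Icc.2 htT
  have e : X ω s - X ω r = ∫ σ in r..s, u ω σ := by
    rw [h3 s hs, h3 r hr, add_sub_add_left_eq_sub]
    exact intervalIntegral.integral_interval_sub_left (h4.1.mono_set (hsub htm hs))
      (h4.1.mono_set (hsub htm hr))
  rw [e]
  have h5 := pow_le_pow_left₀ (norm_nonneg _)
    (intervalIntegral.norm_integral_le_integral_norm (μ := volume) (f := u ω) hrs) 2
  have h6 := sq_intervalIntegral_le hrs (h4.1.mono_set (hsub hr hs)).norm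
    (h4.2.mono_set (hsub hr hs))
  refine (h5.trans h6).trans (mul_le_mul_of_nonneg_left ?_ (sub_nonneg.2 hrs))
  exact intervalIntegral.integral_mono_interval hr.1 hrs hs.2
    (Eventually.of_forall fun _ => by positivity) h4.2

lemma tendsto_l2norm (h : IsControlled D T t P X u) : ∀ s₀ ∈ Icc t T,
    Tendsto (fun s => l2norm P (fun ω => X ω s - X ω s₀)) (𝓝[Icc t T] s₀) (𝓝 0) :=
    fun s₀ hs₀ => by
  refine squeeze_zero' (Eventually.of_forall fun _ => l2norm_nonneg _ _)
    (g := fun s => √(|s - s₀| * ∫ ω, (∫ σ in t..T, ‖u ω σ‖ ^ 2) ∂P)) ?_ ?_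
  · filter_upwards [self_mem_nhdsWithin] with s hs
    exact h.l2norm_sub_le hs₀ hs
  · have : Continuous (fun s => √(|s - s₀| * ∫ ω, (∫ σ in t..T, ‖u ω σ‖ ^ 2) ∂P)) := by fun_prop
    simpa using (this.tendsto s₀).mono_left nhdsWithin_le_nhds

end IsControlled

/-- The cost of a process with velocity `u`. -/
noncomputable def processCost (Φ ΦT : Measure (E n) → ℝ) (lam T t : ℝ) (P : Measure Ω)
    (X u : Ω → ℝ → E n) : ℝ :=
  lam / 2 * (∫ s in t..T, ∫ ω, ‖u ω s‖ ^ 2 ∂P)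
    + (∫ s in t..T, Φ (P.map (fun ω => X ω s))) + ΦT (P.map (fun ω => X ω T))

/-- The cost of the flow `y`, expressed with the adjoint variable. -/
noncomputable def flowCost (Φ ΦT : Measure (E n) → ℝ) (F FT : E n → Measure (E n) → ℝ)
    (lam T t : ℝ) (m : Measure (E n)) (y : E n → ℝ → E n) : ℝ :=
  1 / (2 * lam) * (∫ s in t..T, ∫ x, ‖costate F FT T m y x s‖ ^ 2 ∂m)
    + (∫ s in t..T, Φ (law m y s)) + ΦT (law m y T)

namespace Setup

variable {lam c : ℝ} {Φ ΦT : Measure (E n) → ℝ} {F FT : E n → Measure (E n) → ℝ}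
  (H : Setup D lam T c Φ ΦT F FT) (ht : t ∈ Icc 0 T) {m : Measure (E n)} (hm : m ∈ D)
  {y : E n → ℝ → E n} (hy : IsFlow F FT lam T c t m y) {ξ : Ω → E n}
  (hξm : AEMeasurable ξ P) (hξ : P.map ξ = m)
include H ht hm hy hξm hξ

omit hy in
lemma memLp_joint {g : E n → ℝ → E n}
    (hg : Continuous (fun q : E n × ℝ => g q.1 (projIcc t T ht.2 q.2))) {C : ℝ}
    (hC : ∀ x, ∀ s ∈ Icc t T, ‖g x s‖ ≤ C * weight lam T c m x) :
    MemLp (fun q : Ω × ℝ => g (ξ q.1) q.2) 2 (P.prod (volume.restrict (Ioc t T))) := by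
  have hsnd : ∀ᵐ q ∂(P.prod (volume.restrict (Ioc t T))), q.2 ∈ Icc t T :=
    Measure.quasiMeasurePreserving_snd.ae ((ae_restrict_mem measurableSet_Ioc).mono
      fun s hs => Ioc_subset_Icc_self hs)
  have hw : MemLp (fun q : Ω × ℝ => weight lam T c m (ξ q.1)) 2
      (P.prod (volume.restrict (Ioc t T))) :=
    (memLp_comp hξm hξ (H.memLp_weight hm)).comp_fst _
  refine memLp_of_affine_bound ?_ hw C 0 ?_
  · have hq : AEStronglyMeasurable (fun q : Ω × ℝ => (ξ q.1, q.2))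
        (P.prod (volume.restrict (Ioc t T))) :=
      (hξm.aestronglyMeasurable.comp_fst).prodMk measurable_snd.aestronglyMeasurable
    refine (hg.comp_aestronglyMeasurable hq).congr (hsnd.mono fun q hq => ?_)
    simp only [projIcc_of_mem ht.2 hq]
  · refine hsnd.mono fun q hq => ?_
    rw [add_zero, Real.norm_of_nonneg (H.weight_pos m _).le]
    exact hC _ _ hq

lemma memLp_joint_flow :
    MemLp (fun q : Ω × ℝ => y (ξ q.1) q.2) 2 (P.prod (volume.restrict (Ioc t T))) := by
  refine H.memLp_joint ht hm hξm hξ (H.continuous_flow_projIcc ht hy)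
    (C := 1 + speed lam T c * T) fun x s hs => ?_
  have h1 := H.norm_candidate_sub_le ht hy.toIsCandidate hs x
  have h2 := norm_add_le (y x s - x) x
  rw [sub_add_cancel] at h2
  have h3 := H.le_weight m x
  have h4 := Real.sqrt_nonneg (secondMoment m)
  linarith

lemma memLp_joint_costate :
    MemLp (fun q : Ω × ℝ => costate F FT T m y (ξ q.1) q.2) 2
      (P.prod (volume.restrict (Ioc t T))) :=
  H.memLp_joint ht hm hξm hξ (H.continuous_costate_projIcc ht hm hy)
    fun x _ hs => H.norm_costate_le ht hm hy x hs

omit hξm hξ in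
lemma continuous_gradX_flow {F' : E n → Measure (E n) → ℝ} {Φ' : Measure (E n) → ℝ}
    (hF : RegularCost D c Φ' F') : Continuous (fun q : E n × ℝ =>
      gradX F' (y q.1 (projIcc t T ht.2 q.2)) (law m y (projIcc t T ht.2 q.2))) := by
  have hpm := P2_prob (H.state.subset hm)
  have h1 := (H.isSolution_flow ht hm hy (P := m) (ξ := fun x => x) aemeasurable_id' (by simp)
    (left_mem_Icc.2 ht.2)).W2_tendsto
  exact (continuous_gradX_curve H.state H.c_nonneg hF ht.2 (μ := law m y)
    (fun s hs => H.law_mem hm hy.toIsCandidate hs) h1).comp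
    ((H.continuous_flow_projIcc ht hy).prodMk continuous_snd)

lemma memLp_joint_gradX :
    MemLp (fun q : Ω × ℝ => gradX F (y (ξ q.1) q.2) (law m y q.2)) 2
      (P.prod (volume.restrict (Ioc t T))) :=
  H.memLp_joint ht hm hξm hξ (g := fun x s => gradX F (y x s) (law m y s))
    (H.continuous_gradX_flow ht hm hy H.cost)
    fun x _ hs => H.norm_gradX_candidate_le ht hm hy.toIsCandidate H.cost hs x

/-- The cost of every process is at least the cost of the flow issued from any other initial
position, corrected by the first order term given by the adjoint variable and by a quadratic
error. Without difference of the initial positions this is the optimality of the flow. -/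
theorem flowCost_add_le_processCost {X u : Ω → ℝ → E n} (hX : IsControlled D T t P X u) :
    flowCost Φ ΦT F FT lam T t m y
        + (∫ ω, inner ℝ (costate F FT T m y (ξ ω) t) (X ω t - ξ ω) ∂P)
        - compConst lam T c * l2norm P (fun ω => X ω t - ξ ω) ^ 2
      ≤ processCost Φ ΦT lam T t P X u := by
  have htT := ht.2
  have hc := H.c_nonneg
  have htm : t ∈ Icc t T := left_mem_Icc.2 htT
  have hTm : T ∈ Icc t T := right_mem_Icc.2 htT
  have hY := hy.toIsCandidate
  have hlawY : ∀ s ∈ Icc t T, P.map (fun ω => y (ξ ω) s) = law m y s := fun s hs =>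
    law_flow hy hξm hξ hs
  have hYL : ∀ s ∈ Icc t T, MemLp (fun ω => y (ξ ω) s) 2 P := fun s hs =>
    memLp_comp hξm hξ (H.memLp_candidate ht hm hY hs)
  have hW : ∀ s ∈ Icc t T, MemLp (fun ω => X ω s - y (ξ ω) s) 2 P := fun s hs =>
    memLp_fun_sub (hX.memLp hs) (hYL s hs)
  have hWQ : MemLp (fun q : Ω × ℝ => X q.1 q.2 - y (ξ q.1) q.2) 2
      (P.prod (volume.restrict (Ioc t T))) :=
    memLp_fun_sub (hX.memLp_uncurry htT) (H.memLp_joint_flow ht hm hy hξm hξ)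
  have hGQ := H.memLp_joint_gradX ht hm hy hξm hξ
  have hzQ := H.memLp_joint_costate ht hm hy hξm hξ
  have e0 : ∀ ω, y (ξ ω) t = ξ ω := fun ω => hy.start _
  have hstart : MemLp (fun ω => X ω t - ξ ω) 2 P := by simpa only [e0] using hW t htm
  -- the expansion of the two costs
  have hexp : ∀ {F' : E n → Measure (E n) → ℝ} {Φ' : Measure (E n) → ℝ}, RegularCost D c Φ' F' →
      ∀ s ∈ Icc t T, ∫ ω, (inner ℝ (gradX F' (y (ξ ω) s) (law m y s)) (X ω s - y (ξ ω) s)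
        - c / 2 * ‖X ω s - y (ξ ω) s‖ ^ 2) ∂P
        ≤ Φ' (P.map (fun ω => X ω s)) - Φ' (law m y s) := by
    intro F' Φ' hF s hs
    have hD' : P.map (fun ω => y (ξ ω) s) ∈ D := by
      rw [hlawY s hs]; exact H.law_mem hm hY hs
    have h1 := hF.expansion_map H.state (hYL s hs) (hX.memLp hs) hD' (hX.law_mem s hs)
    have h2 := memLp_gradX H.state hF.grad_lipschitz hD' (hYL s hs)
    rw [hlawY s hs] at h1 h2
    rw [integral_sub (integrable_inner_of_memLp h2 (hW s hs))
      ((integrable_sq_of_memLp (hW s hs)).const_mul _), integral_const_mul, ← l2norm_sq]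
    linarith [(abs_le.1 h1).1]
  have hfQ : Integrable (fun q : Ω × ℝ =>
      inner ℝ (gradX F (y (ξ q.1) q.2) (law m y q.2)) (X q.1 q.2 - y (ξ q.1) q.2)
        - c / 2 * ‖X q.1 q.2 - y (ξ q.1) q.2‖ ^ 2) (P.prod (volume.restrict (Ioc t T))) :=
    (integrable_inner_of_memLp hGQ hWQ).sub ((integrable_sq_of_memLp hWQ).const_mul _)
  obtain ⟨i1, i2, -, i4⟩ := integral_swap_of_integrable htT hfQ
  obtain ⟨-, j2, -, j4⟩ := integral_swap_of_integrable htT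
    (integrable_sq_of_memLp hX.memLp_velocity)
  obtain ⟨-, k2, -, k4⟩ := integral_swap_of_integrable htT (integrable_sq_of_memLp hzQ)
  simp only [Function.uncurry] at j2 j4 k2 k4 i1 i2 i4
  have hΦX : ContinuousOn (fun s => Φ (P.map (fun ω => X ω s))) (Icc t T) :=
    H.cost.continuousOn_curve H.state (fun s hs => hX.memLp hs) hX.law_mem hX.tendsto_l2norm
  have hΦY : ContinuousOn (fun s => Φ (law m y s)) (Icc t T) := by
    have hs := H.isSolution_flow ht hm hy hξm hξ htm
    refine (H.cost.continuousOn_curve H.state hs.memLp hs.law_mem hs.continuous).congr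
      fun s hs => ?_
    simp only [hlawY s hs]
  have hrun : ∫ ω, (∫ s in t..T, (inner ℝ (gradX F (y (ξ ω) s) (law m y s)) (X ω s - y (ξ ω) s)
        - c / 2 * ‖X ω s - y (ξ ω) s‖ ^ 2)) ∂P
      ≤ (∫ s in t..T, Φ (P.map (fun ω => X ω s))) - ∫ s in t..T, Φ (law m y s) := by
    rw [← i4, ← intervalIntegral.integral_sub (hΦX.intervalIntegrable_of_Icc htT)
      (hΦY.intervalIntegrable_of_Icc htT)]
    exact intervalIntegral.integral_mono_on htT i1
      ((hΦX.intervalIntegrable_of_Icc htT).sub (hΦY.intervalIntegrable_of_Icc htT))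
      (hexp H.cost)
  have hterm := hexp H.cost_T T hTm
  have hTi : Integrable (fun ω => inner ℝ (gradX FT (y (ξ ω) T) (law m y T)) (X ω T - y (ξ ω) T)
        - c / 2 * ‖X ω T - y (ξ ω) T‖ ^ 2) P := by
    have h2 := memLp_gradX H.state H.cost_T.grad_lipschitz (H.law_mem hm hY hTm) (hYL T hTm)
    exact (integrable_inner_of_memLp h2 (hW T hTm)).sub
      ((integrable_sq_of_memLp (hW T hTm)).const_mul _)
  have hz0 : MemLp (fun ω => costate F FT T m y (ξ ω) t) 2 P :=
    memLp_comp hξm hξ (H.memLp_costate ht hm hy htm)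
  have hz0i : Integrable (fun ω => inner ℝ (costate F FT T m y (ξ ω) t) (X ω t - ξ ω)) P :=
    integrable_inner_of_memLp hz0 hstart
  -- the comparison, path by path
  have hpath : ∀ᵐ ω ∂P, inner ℝ (costate F FT T m y (ξ ω) t) (X ω t - ξ ω)
      - compConst lam T c * ‖X ω t - ξ ω‖ ^ 2
      ≤ lam / 2 * (∫ s in t..T, ‖u ω s‖ ^ 2)
        - 1 / (2 * lam) * (∫ s in t..T, ‖costate F FT T m y (ξ ω) s‖ ^ 2)
        + (∫ s in t..T, (inner ℝ (gradX F (y (ξ ω) s) (law m y s)) (X ω s - y (ξ ω) s)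
          - c / 2 * ‖X ω s - y (ξ ω) s‖ ^ 2))
        + (inner ℝ (gradX FT (y (ξ ω) T) (law m y T)) (X ω T - y (ξ ω) T)
          - c / 2 * ‖X ω T - y (ξ ω) T‖ ^ 2) := by
    filter_upwards [hX.path, hX.ae_velocity htT] with ω h1 h2
    refine pointwise_comparison hc H.T_pos H.small ht (gradX FT (y (ξ ω) T) (law m y T))
      (X ω t - ξ ω) (H.continuousOn_gradX_candidate ht hm hY H.cost (ξ ω)) h2.1 h2.2
      (W := fun s => X ω s - y (ξ ω) s) fun s hs => ?_
    have hzc := H.continuousOn_costate ht hm hy (ξ ω)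
    have hu : IntervalIntegrable (u ω) volume t s := h2.1.mono_set (by
      rw [uIcc_of_le hs.1, uIcc_of_le htT]; exact Icc_subset_Icc_right hs.2)
    have hzi : IntervalIntegrable (costate F FT T m y (ξ ω)) volume t s :=
      (hzc.mono (Icc_subset_Icc_right hs.2)).intervalIntegrable_of_Icc hs.1
    rw [h1 s hs, H.flow_eq ht hm hy (ξ ω) hs]
    change _ = _ + ∫ σ in t..s, (u ω σ + (1 / lam) • costate F FT T m y (ξ ω) σ)
    have e1 := intervalIntegral.integral_add hu (hzi.smul (1 / lam))
    simp only [Pi.smul_apply, intervalIntegral.integral_smul] at e1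
    rw [e1]
    abel
  have l1 : Integrable (fun ω => inner ℝ (costate F FT T m y (ξ ω) t) (X ω t - ξ ω)
      - compConst lam T c * ‖X ω t - ξ ω‖ ^ 2) P :=
    hz0i.sub ((integrable_sq_of_memLp hstart).const_mul _)
  have r1 : Integrable (fun ω => lam / 2 * (∫ s in t..T, ‖u ω s‖ ^ 2)
        - 1 / (2 * lam) * (∫ s in t..T, ‖costate F FT T m y (ξ ω) s‖ ^ 2)) P :=
    (j2.const_mul _).sub (k2.const_mul _)
  have r2 := r1.add i2
  have hint : ∫ ω, (inner ℝ (costate F FT T m y (ξ ω) t) (X ω t - ξ ω)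
      - compConst lam T c * ‖X ω t - ξ ω‖ ^ 2) ∂P
      ≤ lam / 2 * (∫ s in t..T, ∫ ω, ‖u ω s‖ ^ 2 ∂P)
        - 1 / (2 * lam) * (∫ s in t..T, ∫ ω, ‖costate F FT T m y (ξ ω) s‖ ^ 2 ∂P)
        + (∫ ω, (∫ s in t..T, (inner ℝ (gradX F (y (ξ ω) s) (law m y s)) (X ω s - y (ξ ω) s)
          - c / 2 * ‖X ω s - y (ξ ω) s‖ ^ 2)) ∂P)
        + ∫ ω, (inner ℝ (gradX FT (y (ξ ω) T) (law m y T)) (X ω T - y (ξ ω) T)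
          - c / 2 * ‖X ω T - y (ξ ω) T‖ ^ 2) ∂P := by
    refine (integral_mono_ae l1 (r2.add hTi) hpath).trans_eq ?_
    rw [integral_add' r2 hTi, integral_add' r1 i2, integral_sub (j2.const_mul _) (k2.const_mul _),
      integral_const_mul, integral_const_mul, j4, k4]
  rw [integral_sub hz0i ((integrable_sq_of_memLp hstart).const_mul _), integral_const_mul,
    ← l2norm_sq] at hint
  have ez : ∫ s in t..T, ∫ ω, ‖costate F FT T m y (ξ ω) s‖ ^ 2 ∂P
      = ∫ s in t..T, ∫ x, ‖costate F FT T m y x s‖ ^ 2 ∂m := by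
    refine intervalIntegral.integral_congr fun s hs => ?_
    rw [uIcc_of_le htT] at hs
    have h1 := l2norm_comp hξm hξ (H.continuous_costate ht hm hy hs).aestronglyMeasurable
    simp only [← l2norm_sq]
    rw [h1]
  rw [ez] at hint
  rw [flowCost, processCost]
  linarith

end Setup

end Control

/-! ### Feedback controls -/

section Admissible

variable {D : Set (Measure (E n))} {T t : ℝ} {m : Measure (E n)} {v X : E n → ℝ → E n}

/-- A process with almost surely continuous paths, whose variables are measurable, is jointly
measurable: it is the limit of its discretizations in time. -/
lemma aestronglyMeasurable_uncurry_of_continuousOn [SFinite m]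
    (hX : ∀ s ∈ Icc t T, AEMeasurable (fun x => X x s) m)
    (hc : ∀ᵐ x ∂m, ContinuousOn (X x) (Icc t T)) :
    AEStronglyMeasurable (fun q : E n × ℝ => X q.1 q.2) (m.prod (volume.restrict (Ioc t T))) := by
  classical
  -- measurable versions of the process at the times `t + j / (k + 1)`
  have hex : ∀ k j : ℕ, ∃ g : E n → E n, Measurable g ∧
      (t + j / (k + 1) ∈ Icc t T → (fun x => X x (t + j / (k + 1))) =ᵐ[m] g) := fun k j => by
    by_cases h : t + (j : ℝ) / (k + 1) ∈ Icc t T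
    · exact ⟨(hX _ h).mk _, (hX _ h).measurable_mk, fun _ => (hX _ h).ae_eq_mk⟩
    · exact ⟨fun _ => 0, measurable_const, fun h' => absurd h' h⟩
  choose g hg hgX using hex
  have hae : ∀ᵐ x ∂m, ∀ k j : ℕ, t + (j : ℝ) / (k + 1) ∈ Icc t T →
      X x (t + j / (k + 1)) = g k j x := by
    refine ae_all_iff.2 fun k => ae_all_iff.2 fun j => ?_
    by_cases h : t + (j : ℝ) / (k + 1) ∈ Icc t T
    · exact (hgX k j h).mono fun x hx _ => hx
    · exact Eventually.of_forall fun x h' => absurd h' h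
  have hsnd : ∀ᵐ q ∂(m.prod (volume.restrict (Ioc t T))), q.2 ∈ Ioc t T :=
    Measure.quasiMeasurePreserving_snd.ae (ae_restrict_mem measurableSet_Ioc)
  refine aestronglyMeasurable_of_tendsto_ae atTop
    (f := fun (k : ℕ) (q : E n × ℝ) => g k ⌊(q.2 - t) * (k + 1)⌋₊ q.1) (fun k => ?_) ?_
  · have h1 : Measurable (fun p : E n × ℕ => g k p.2 p.1) :=
      measurable_from_prod_countable_left fun j => hg k j
    have h2 : Measurable (fun q : E n × ℝ => (q.1, ⌊(q.2 - t) * (k + 1)⌋₊)) :=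
      measurable_fst.prodMk (Nat.measurable_floor.comp (by fun_prop))
    exact (h1.comp h2).aestronglyMeasurable
  · filter_upwards [hsnd, Measure.quasiMeasurePreserving_fst.ae hae,
      Measure.quasiMeasurePreserving_fst.ae hc] with q hq h1 h2
    have hpos : ∀ k : ℕ, (0 : ℝ) < k + 1 := fun k => by positivity
    have hle : ∀ k : ℕ, t + (⌊(q.2 - t) * (k + 1)⌋₊ : ℝ) / (k + 1) ≤ q.2 := fun k => by
      have := Nat.floor_le (mul_nonneg (sub_nonneg.2 hq.1.le) (hpos k).le)
      have := (div_le_iff₀ (hpos k)).2 this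
      linarith
    have hge : ∀ k : ℕ, q.2 - 1 / (k + 1) ≤ t + (⌊(q.2 - t) * (k + 1)⌋₊ : ℝ) / (k + 1) :=
      fun k => by
      have := (Nat.lt_floor_add_one ((q.2 - t) * (k + 1))).le
      have := (le_div_iff₀ (hpos k)).2 this
      rw [add_div] at this
      linarith
    have hmem : ∀ k : ℕ, t + (⌊(q.2 - t) * (k + 1)⌋₊ : ℝ) / (k + 1) ∈ Icc t T := fun k =>
      ⟨le_add_of_nonneg_right (by positivity), (hle k).trans hq.2⟩
    have hlim : Tendsto (fun k : ℕ => t + (⌊(q.2 - t) * (k + 1)⌋₊ : ℝ) / (k + 1)) atTop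
        (𝓝[Icc t T] q.2) := by
      refine tendsto_nhdsWithin_iff.2 ⟨?_, Eventually.of_forall hmem⟩
      refine tendsto_of_tendsto_of_tendsto_of_le_of_le ?_ tendsto_const_nhds hge hle
      simpa using (tendsto_const_nhds (x := q.2)).sub
        (tendsto_one_div_add_atTop_nhds_zero_nat (𝕜 := ℝ))
    refine ((h2 q.2 (Ioc_subset_Icc_self hq)).tendsto.comp hlim).congr fun k => ?_
    exact h1 k _ (hmem k)

namespace IsAdmissible

lemma continuousOn_path (h : IsAdmissible D T t m v X) (htT : t ≤ T) :
    ∀ᵐ x ∂m, ContinuousOn (X x) (Icc t T) := by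
  filter_upwards [h.dynamics] with x hx
  have h1 := intervalIntegral.continuousOn_primitive_interval' hx.1 left_mem_uIcc
  rw [uIcc_of_le htT] at h1
  exact (h1.const_add x).congr fun s hs => hx.2 s hs

lemma isControlled [SFinite m] (h : IsAdmissible D T t m v X) (hm : m ∈ P2 n) (htT : t ≤ T) :
    IsControlled D T t m X (fun x s => v (X x s) s) where
  memLp_velocity := by
    have hX := aestronglyMeasurable_uncurry_of_continuousOn h.aemeasurable (h.continuousOn_path htT)
    have hv : AEStronglyMeasurable (Function.uncurry fun x s => v (X x s) s)
        (m.prod (volume.restrict (Ioc t T))) :=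
      (h.measurable_feedback.comp_aemeasurable
        (hX.aemeasurable.prodMk measurable_snd.aemeasurable)).aestronglyMeasurable
    rw [memLp_two_iff_integrable_sq_norm hv]
    refine ⟨(hv.norm.aemeasurable.pow_const 2).aestronglyMeasurable, ?_⟩
    rw [hasFiniteIntegral_iff_enorm]
    have e : ∀ q : E n × ℝ, ‖‖Function.uncurry (fun x s => v (X x s) s) q‖ ^ 2‖ₑ
        = ‖v (X q.1 q.2) q.2‖ₑ ^ 2 := fun q => by
      rw [enorm_pow, enorm_norm]; rfl
    simp only [e]
    rw [lintegral_prod_symm (fun q : E n × ℝ => ‖v (X q.1 q.2) q.2‖ₑ ^ 2) (hv.enorm.pow_const 2)]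
    refine lt_of_le_of_lt ?_ h.energy
    exact lintegral_mono' (Measure.restrict_mono Ioc_subset_Icc_self le_rfl) le_rfl
  memLp_start := by
    refine (memLp_congr_ae ?_).2 (P2_memLp_id hm)
    filter_upwards [h.dynamics] with x hx
    simpa using hx.2 t (left_mem_Icc.2 htT)
  path := by
    filter_upwards [h.dynamics] with x hx s hs
    have h1 := hx.2 t (left_mem_Icc.2 htT)
    rw [intervalIntegral.integral_same, add_zero] at h1
    rw [h1]
    exact hx.2 s hs
  law_mem := h.law_mem

lemma start_ae (h : IsAdmissible D T t m v X) (htT : t ≤ T) : ∀ᵐ x ∂m, X x t = x := by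
  filter_upwards [h.dynamics] with x hx
  simpa using hx.2 t (left_mem_Icc.2 htT)

lemma law_start (h : IsAdmissible D T t m v X) (htT : t ≤ T) : law m X t = m := by
  rw [law, Measure.map_congr (h.start_ae htT)]
  exact Measure.map_id

variable {f g : E n → Measure (E n) → ℝ} {lam : ℝ}

lemma integral_law (h : IsAdmissible D T t m v X) (hf : ∀ m ∈ D, Integrable (fun x => f x m) m)
    {s : ℝ} (hs : s ∈ Icc t T) :
    ∫ x, f (X x s) (law m X s) ∂m = meanCost f (law m X s) :=
  (integral_map (h.aemeasurable s hs) (hf _ (h.law_mem s hs)).1).symm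

lemma cost_eq_processCost (h : IsAdmissible D T t m v X) (htT : t ≤ T)
    (hf : ∀ m ∈ D, Integrable (fun x => f x m) m) (hg : ∀ m ∈ D, Integrable (fun x => g x m) m) :
    cost f g lam T t m v X
      = processCost (meanCost f) (meanCost g) lam T t m X (fun x s => v (X x s) s) := by
  rw [cost, processCost, h.integral_law hg (right_mem_Icc.2 htT)]
  congr 2
  refine intervalIntegral.integral_congr fun s hs => ?_
  rw [uIcc_of_le htT] at hs
  exact h.integral_law hf hs

lemma cost_eq_costOnLaws (h : IsAdmissible D T t m v X) (htT : t ≤ T)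
    (hf : ∀ m ∈ D, Integrable (fun x => f x m) m) (hg : ∀ m ∈ D, Integrable (fun x => g x m) m) :
    cost f g lam T t m v X = costOnLaws f g lam T t v (law m X) := by
  rw [h.cost_eq_processCost htT hf hg, processCost, costOnLaws]
  congr 3
  refine intervalIntegral.integral_congr fun s hs => ?_
  rw [uIcc_of_le htT] at hs
  have hv : Measurable (fun x => v x s) := h.measurable_feedback.comp measurable_prodMk_right
  exact (integral_map (h.aemeasurable s hs)
    (hv.norm.pow_const 2).aestronglyMeasurable).symm

/-- Along the trajectories of an admissible feedback the laws solve the Fokker–Planck equation, by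
the chain rule for a test function and Fubini's theorem. -/
lemma solvesFokkerPlanck (h : IsAdmissible D T t m v X) (hm : m ∈ P2 n) (htT : t ≤ T) :
    SolvesFokkerPlanck T t m v (law m X) := by
  have := P2_prob hm
  have hp := h.isControlled hm htT
  refine ⟨h.law_start htT, fun φ hφ hφc s hs => ?_⟩
  obtain ⟨K, hK⟩ := hφ.lipschitzWith_of_hasCompactSupport hφc (by simp)
  have hdiff : Differentiable ℝ φ := hφ.differentiable (by simp)
  have hgrad : Continuous (gradient φ) := by
    change Continuous fun x => (InnerProductSpace.toDual ℝ (E n)).symm (fderiv ℝ φ x)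
    exact (LinearIsometryEquiv.continuous _).comp (hφ.continuous_fderiv (by simp))
  have hgb : ∀ x, ‖gradient φ x‖ ≤ K := fun x => by
    rw [gradient, LinearIsometryEquiv.norm_map]
    exact norm_fderiv_le_of_lipschitz ℝ hK
  have hφi : ∀ r ∈ Icc t T, Integrable (fun x => φ (X x r)) m := fun r hr => by
    obtain ⟨B, hB⟩ := hφc.exists_bound_of_continuous hφ.continuous
    exact Integrable.of_bound
      (hφ.continuous.measurable.comp_aemeasurable (h.aemeasurable r hr)).aestronglyMeasurable B
      (Eventually.of_forall fun x => hB _)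
  have hpath : ∀ᵐ x ∂m, ∫ σ in t..s, inner ℝ (gradient φ (X x σ)) (v (X x σ) σ)
      = φ (X x s) - φ x := by
    filter_upwards [h.dynamics] with x hx
    have hsub : uIcc t s ⊆ uIcc t T := by
      rw [uIcc_of_le hs.1, uIcc_of_le htT]; exact Icc_subset_Icc_right hs.2
    have hi := hx.1.mono_set hsub
    have e : ∀ r ∈ Icc t s, X x r = x + ∫ σ in t..r, v (X x σ) σ := fun r hr =>
      hx.2 r ⟨hr.1, hr.2.trans hs.2⟩
    have hxt : X x t = x := by simpa using e t (left_mem_Icc.2 hs.1)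
    have key := integral_eq_sub_of_curve hs.1 hi x (M := (K : ℝ)) (k := fun r => φ (X x r))
      (k' := fun r => inner ℝ (gradient φ (X x r)) (v (X x r) r)) K.2 (fun r hr r' hr' hrr => ?_)
      (fun r hr hd => ?_)
    · rw [key, hxt]
    · have hsub' : ∀ {a b}, a ∈ Icc t s → b ∈ Icc t s →
          IntervalIntegrable (fun σ => v (X x σ) σ) volume a b := fun ha hb =>
        hi.mono_set (by rw [uIcc_of_le hs.1]; exact uIcc_subset_Icc ha hb)
      have hts := left_mem_Icc.2 hs.1
      have h1 : X x r' - X x r = ∫ σ in r..r', v (X x σ) σ := by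
        rw [e r' hr', e r hr, add_sub_add_left_eq_sub]
        exact intervalIntegral.integral_interval_sub_left (hsub' hts hr') (hsub' hts hr)
      have h2 := hK.dist_le_mul (X x r') (X x r)
      rw [Real.dist_eq, dist_eq_norm, h1] at h2
      refine h2.trans (mul_le_mul_of_nonneg_left ?_ K.2)
      refine (intervalIntegral.norm_integral_le_integral_norm hrr).trans ?_
      exact intervalIntegral.integral_mono_on hrr (hsub' hr hr').norm
        ((hsub' hr hr').norm.add intervalIntegrable_const) fun σ _ => by simp
    · have h1 : HasDerivAt (X x) (v (X x r) r) r := hd.congr_of_eventuallyEq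
        (Filter.eventuallyEq_of_mem (Icc_mem_nhds hr.1 hr.2) fun r' hr' => e r' hr')
      have h2 := (hdiff (X x r)).hasGradientAt.hasFDerivAt.comp_hasDerivAt r h1
      rw [InnerProductSpace.toDual_apply_apply] at h2
      exact h2
  have hQ : Integrable (fun q : E n × ℝ => inner ℝ (gradient φ (X q.1 q.2)) (v (X q.1 q.2) q.2))
      (m.prod (volume.restrict (Ioc t s))) := by
    have hle : m.prod (volume.restrict (Ioc t s)) ≤ m.prod (volume.restrict (Ioc t T)) :=
      Measure.prod_mono le_rfl (Measure.restrict_mono (Ioc_subset_Ioc_right hs.2) le_rfl)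
    have hX := aestronglyMeasurable_uncurry_of_continuousOn h.aemeasurable (h.continuousOn_path htT)
    have hv := hp.memLp_velocity.integrable (by norm_num : (1 : ℝ≥0∞) ≤ 2)
    refine Integrable.mono_measure ?_ hle
    refine Integrable.mono' (hv.norm.const_mul (K : ℝ))
      ((hgrad.comp_aestronglyMeasurable hX).inner hv.1) (Eventually.of_forall fun q => ?_)
    exact (norm_inner_le_norm _ _).trans (mul_le_mul_of_nonneg_right (hgb _) (norm_nonneg _))
  have hswap := (integral_swap_of_integrable hs.1 hQ).2.2.2
  have hlaw : ∀ r ∈ Icc t T, ∀ g : E n → ℝ, Measurable g →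
      ∫ x, g x ∂(law m X r) = ∫ x, g (X x r) ∂m := fun r hr g hg =>
    integral_map (h.aemeasurable r hr) hg.aestronglyMeasurable
  have e1 : ∫ σ in t..s, ∫ x, inner ℝ (gradient φ x) (v x σ) ∂(law m X σ)
      = ∫ σ in t..s, ∫ x, inner ℝ (gradient φ (X x σ)) (v (X x σ) σ) ∂m := by
    refine intervalIntegral.integral_congr fun σ hσ => ?_
    rw [uIcc_of_le hs.1] at hσ
    exact hlaw σ ⟨hσ.1, hσ.2.trans hs.2⟩ _ (hgrad.measurable.inner
      (h.measurable_feedback.comp measurable_prodMk_right))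
  have hφ0 : Integrable φ m := (hφi t (left_mem_Icc.2 htT)).congr
    ((h.start_ae htT).mono fun x hx => by simp only [hx])
  rw [e1, hswap, integral_congr_ae hpath, integral_sub (hφi s hs) hφ0,
    hlaw s hs φ hφ.continuous.measurable]

end IsAdmissible

namespace Setup

variable {lam c : ℝ} {Φ ΦT : Measure (E n) → ℝ} {F FT : E n → Measure (E n) → ℝ}
  (H : Setup D lam T c Φ ΦT F FT) (ht : t ∈ Icc 0 T) (hm : m ∈ D)
  {y : E n → ℝ → E n} (hy : IsFlow F FT lam T c t m y)
include H ht hm hy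

/-- The flow is generated by a feedback: its trajectories do not cross, so that the velocity is a
measurable function of time and position. -/
lemma exists_isAdmissible_flow : ∃ v, IsAdmissible D T t m v y ∧
    ∀ x, ∀ s ∈ Icc t T, v (y x s) s = -((1 / lam) • costate F FT T m y x s) := by
  have := P2_prob (H.state.subset hm)
  -- `Ψ` is injective and continuous between Polish spaces, hence a measurable embedding, and the
  -- velocity is carried by `Ψ` to a measurable function on the range
  let Ψ : E n × ℝ → E n × ℝ := fun q => (y q.1 (projIcc t T ht.2 q.2), q.2)
  have hΨc : Continuous Ψ := (H.continuous_flow_projIcc ht hy).prodMk continuous_snd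
  have hΨi : Function.Injective Ψ := by
    rintro ⟨x, s⟩ ⟨x', s'⟩ hq
    obtain ⟨h1, h2⟩ := Prod.mk.inj hq
    simp only at h1 h2
    subst h2
    have h3 := antilipschitz_of_perturbation (hy.pert _ (projIcc t T ht.2 s).2) x x'
    rw [h1, sub_self, norm_zero] at h3
    have h4 : ‖x - x'‖ = 0 := le_antisymm (nonpos_of_mul_nonpos_right h3
      (by linarith [H.pert_lt])) (norm_nonneg _)
    rw [sub_eq_zero.1 (norm_eq_zero.1 h4)]
  have hz := (H.continuous_costate_projIcc ht hm hy).const_smul (-(1 / lam))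
  obtain ⟨w, hwm, hw⟩ := (hΨc.measurableEmbedding hΨi).exists_measurable_extend hz.measurable
    fun _ => ⟨0⟩
  have hwy : ∀ x, ∀ s ∈ Icc t T, w (y x s, s) = -((1 / lam) • costate F FT T m y x s) :=
    fun x s hs => by
    have h1 := congrFun hw (x, s)
    simp only [Function.comp_apply, Ψ, projIcc_of_mem ht.2 hs, neg_smul,
      Pi.smul_apply] at h1
    exact h1
  have hcost : ∀ x, IntervalIntegrable (costate F FT T m y x) volume t T := fun x =>
    (H.continuousOn_costate ht hm hy x).intervalIntegrable_of_Icc ht.2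
  refine ⟨fun x s => w (x, s), ⟨hwm, fun s hs => ?_, Eventually.of_forall fun x => ⟨?_, ?_⟩, ?_,
    fun s hs => H.law_mem hm hy.toIsCandidate hs⟩, hwy⟩
  · exact (continuous_candidate hy.toIsCandidate hs).measurable.aemeasurable
  · refine ((hcost x).smul (1 / lam)).neg.congr fun s hs => ?_
    rw [uIoc_of_le ht.2] at hs
    exact (hwy x s (Ioc_subset_Icc_self hs)).symm
  · intro s hs
    rw [H.flow_eq ht hm hy x hs, sub_eq_add_neg, ← intervalIntegral.integral_smul,
      ← intervalIntegral.integral_neg]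
    congr 1
    refine intervalIntegral.integral_congr fun σ hσ => ?_
    rw [uIcc_of_le hs.1] at hσ
    exact (hwy x σ ⟨hσ.1, hσ.2.trans hs.2⟩).symm
  · have hL : MemLp (fun q : E n × ℝ => -((1 / lam) • costate F FT T m y q.1 q.2)) 2
        (m.prod (volume.restrict (Ioc t T))) :=
      ((H.memLp_joint_costate ht hm hy (P := m) (ξ := fun x => x) aemeasurable_id'
        (by simp)).const_smul (1 / lam)).neg
    have h1 := (integrable_sq_of_memLp hL).2
    rw [hasFiniteIntegral_iff_enorm, lintegral_prod_symm
      (fun q : E n × ℝ => ‖‖-((1 / lam) • costate F FT T m y q.1 q.2)‖ ^ 2‖ₑ)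
      (integrable_sq_of_memLp hL).1.enorm] at h1
    rw [setLIntegral_congr Ioc_ae_eq_Icc.symm]
    refine lt_of_le_of_lt (le_of_eq ?_) h1
    refine setLIntegral_congr_fun measurableSet_Ioc fun s hs => lintegral_congr fun x => ?_
    rw [hwy x s (Ioc_subset_Icc_self hs), enorm_pow, enorm_norm]

/-- The flow realizes the infimum of the cost. -/
lemma isLeast_costSet {f h : E n → Measure (E n) → ℝ} (hΦ : Φ = meanCost f) (hΦT : ΦT = meanCost h)
    (hf : ∀ m ∈ D, Integrable (fun x => f x m) m) (hh : ∀ m ∈ D, Integrable (fun x => h x m) m) :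
    IsLeast (costSet D f h lam T m t) (flowCost Φ ΦT F FT lam T t m y) := by
  have := P2_prob (H.state.subset hm)
  constructor
  · obtain ⟨v, hv, hvy⟩ := H.exists_isAdmissible_flow ht hm hy
    refine ⟨v, y, hv, ?_⟩
    rw [hv.cost_eq_processCost ht.2 hf hh, processCost, flowCost, hΦ, hΦT]
    congr 2
    rw [← intervalIntegral.integral_const_mul, ← intervalIntegral.integral_const_mul]
    refine intervalIntegral.integral_congr fun s hs => ?_
    rw [uIcc_of_le ht.2] at hs
    simp only [← integral_const_mul]
    refine integral_congr_ae (Eventually.of_forall fun x => ?_)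
    simp only [hvy x s hs, norm_neg, norm_smul, Real.norm_eq_abs, mul_pow, sq_abs]
    have := H.lam_pos
    field_simp
  · rintro _ ⟨v, X, hv, rfl⟩
    have h1 := H.flowCost_add_le_processCost ht hm hy (P := m) (ξ := fun x => x) aemeasurable_id'
      (by simp) (hv.isControlled (H.state.subset hm) ht.2)
    rw [hv.cost_eq_processCost ht.2 hf hh, ← hΦ, ← hΦT]
    have e0 : ∀ᵐ x ∂m, X x t - x = 0 := (hv.start_ae ht.2).mono fun x hx => by rw [hx, sub_self]
    have e1 : ∫ x, inner ℝ (costate F FT T m y x t) (X x t - x) ∂m = 0 := by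
      rw [← integral_zero (E n) ℝ (μ := m)]
      exact integral_congr_ae (e0.mono fun x hx => by simp [hx])
    have e2 : l2norm m (fun x => X x t - x) = 0 := by
      rw [l2norm_congr (g := fun _ => (0 : E n)) (e0.mono fun x hx => by rw [hx])]
      simp [l2norm]
    rw [e1, e2] at h1
    simpa using h1

lemma explicitValue_eq_flowCost {f h : E n → Measure (E n) → ℝ} (hΦ : Φ = meanCost f)
    (hΦT : ΦT = meanCost h)
    (hf : ∀ m ∈ D, Integrable (fun x => f x m) m) (hh : ∀ m ∈ D, Integrable (fun x => h x m) m) :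
    explicitValue f h lam T t m y = flowCost Φ ΦT F FT lam T t m y := by
  obtain ⟨v, hv, -⟩ := H.exists_isAdmissible_flow ht hm hy
  rw [explicitValue, flowCost, hΦ, hΦT, hv.integral_law hh (right_mem_Icc.2 ht.2)]
  congr 2
  · rcases ht.2.eq_or_lt with rfl | htT
    · simp
    · congr 1
      refine intervalIntegral.integral_congr fun s hs => ?_
      rw [uIcc_of_le ht.2] at hs
      simp only [H.adjoint_eq_costate ht hm hy htT _ hs]
  · refine intervalIntegral.integral_congr fun s hs => ?_
    rw [uIcc_of_le ht.2] at hs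
    exact hv.integral_law hf hs

end Setup

end Admissible

/-! ### The integral equation -/

section IntegralEquation

variable {D : Set (Measure (E n))} {T t lam c : ℝ} {m : Measure (E n)}
  {F FT : E n → Measure (E n) → ℝ} {y : E n → ℝ → E n}

/-- The continuity in `L²_m` is stated with the extended seminorm on one side and with the real
norm on the other. -/
lemma solvesIntegralEq_iff :
    SolvesIntegralEq D F FT lam T t m y ↔ IsSolution D F FT lam T t m (fun x => x) y := by
  have hc : (∀ s ∈ Icc t T, MemLp (fun x => y x s) 2 m) →
      ((∀ s₀ ∈ Icc t T,
        Tendsto (fun s => eLpNorm (fun x => y x s - y x s₀) 2 m) (𝓝[Icc t T] s₀) (𝓝 0)) ↔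
      ∀ s₀ ∈ Icc t T,
        Tendsto (fun s => l2norm m (fun x => y x s - y x s₀)) (𝓝[Icc t T] s₀) (𝓝 0)) := by
    intro hL
    refine forall₂_congr fun s₀ hs₀ => ?_
    have hev : ∀ᶠ s in 𝓝[Icc t T] s₀, eLpNorm (fun x => y x s - y x s₀) 2 m
        = ENNReal.ofReal (l2norm m (fun x => y x s - y x s₀)) := by
      filter_upwards [self_mem_nhdsWithin] with s hs
      have h := memLp_fun_sub (hL s hs) (hL s₀ hs₀)
      rw [l2norm_eq_toReal h, ENNReal.ofReal_toReal h.2.ne]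
    rw [tendsto_congr' hev]
    refine ⟨fun h => ?_, fun h => by simpa using ENNReal.tendsto_ofReal h⟩
    refine ((ENNReal.tendsto_toReal ENNReal.zero_ne_top).comp h).congr fun s => ?_
    rw [Function.comp_apply, ENNReal.toReal_ofReal (l2norm_nonneg _ _)]
  constructor
  · rintro ⟨h1, h2, h3, h4, h5⟩
    exact ⟨h1, h2, (hc h2).1 h3, h4, fun s hs => (h5 s hs).mono fun x hx => by
      rw [hx, Setup.integralRHS_eq]; rfl⟩
  · rintro ⟨h1, h2, h3, h4, h5⟩
    exact ⟨h1, h2, (hc h2).2 h3, h4, fun s hs => (h5 s hs).mono fun x hx => by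
      rw [hx, Setup.integralRHS_eq]; rfl⟩

namespace Setup

variable {Φ ΦT : Measure (E n) → ℝ} (H : Setup D lam T c Φ ΦT F FT) (ht : t ∈ Icc 0 T) (hm : m ∈ D)
  (hy : IsFlow F FT lam T c t m y)
include H ht hm hy

lemma solvesIntegralEq_flow : SolvesIntegralEq D F FT lam T t m y := by
  have := P2_prob (H.state.subset hm)
  have h := H.isSolution_flow ht hm hy (P := m) (ξ := fun x => x) aemeasurable_id' (by simp)
    (left_mem_Icc.2 ht.2)
  simp only [hy.start] at h
  exact solvesIntegralEq_iff.2 h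

/-- Uniqueness is the stability estimate with equal initial positions. -/
lemma ae_eq_flow_of_solvesIntegralEq {y' : E n → ℝ → E n}
    (hy' : SolvesIntegralEq D F FT lam T t m y') : ∀ s ∈ Icc t T, ∀ᵐ x ∂m, y' x s = y x s := by
  have := P2_prob (H.state.subset hm)
  intro s hs
  have h1 := solvesIntegralEq_iff.1 hy'
  have h2 := solvesIntegralEq_iff.1 (H.solvesIntegralEq_flow ht hm hy)
  have h3 := (h1.stability H ht h2 (by simp)).1 s hs
  simp only [sub_self] at h3
  have h4 : l2norm m (fun _ : E n => (0 : E n)) = 0 := by simp [l2norm]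
  rw [h4, mul_zero] at h3
  have hL := memLp_fun_sub (h1.memLp s hs) (h2.memLp s hs)
  have h5 : ∫ x, ‖y' x s - y x s‖ ^ 2 ∂m = 0 := by
    rw [← l2norm_sq, le_antisymm h3 (l2norm_nonneg _ _)]; simp
  rw [integral_eq_zero_iff_of_nonneg (fun _ => by positivity) (integrable_sq_of_memLp hL)] at h5
  filter_upwards [h5] with x hx
  simpa [sub_eq_zero] using hx

end Setup

end IntegralEquation

/-! ### The functional derivative of the value function -/

lemma hasGradientAt_of_abs_sub_le {φ : E n → ℝ} {x g : E n} {K : ℝ}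
    (h : ∀ x', |φ x' - φ x - inner ℝ g (x' - x)| ≤ K * ‖x' - x‖ ^ 2) : HasGradientAt φ g x := by
  rw [hasGradientAt_iff_isLittleO]
  have ho := (Asymptotics.isLittleO_norm_pow_id (E' := E n) one_lt_two).comp_tendsto
    (tendsto_sub_nhds_zero_iff.2 (tendsto_id (x := 𝓝 x)))
  refine (Asymptotics.IsBigO.of_bound K (Eventually.of_forall fun x' => ?_)).trans_isLittleO ho
  rw [Real.norm_eq_abs, Function.comp_apply, Real.norm_of_nonneg (by positivity)]
  exact h x'

section Frozen

variable {D : Set (Measure (E n))} {c : ℝ} {Φ : Measure (E n) → ℝ} {F : E n → Measure (E n) → ℝ}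
  (hD : StateClass D) (hc : 0 ≤ c) (hF : RegularCost D c Φ F)
include hD hc hF

namespace RegularCost

/-- Taylor estimate in the position, at a fixed measure. -/
lemma taylor {m : Measure (E n)} (hm : m ∈ D) (x x' : E n) :
    |F x' m - F x m - inner ℝ (gradX F x m) (x' - x)| ≤ c / 2 * ‖x' - x‖ ^ 2 :=
  abs_sub_sub_inner_gradient_le (hF.differentiable m hm) (by positivity)
    (gradX_lipschitz_left hD hF.grad_lipschitz hm) x x'

lemma abs_sub_zero_le {m : Measure (E n)} (hm : m ∈ D) (x : E n) :
    |F x m - F 0 m| ≤ ‖gradX F x m‖ * ‖x‖ + c / 2 * ‖x‖ ^ 2 := by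
  have h1 := hF.taylor hD hc hm x 0
  have h2 := abs_real_inner_le_norm (gradX F x m) (0 - x)
  rw [zero_sub, norm_neg] at h1 h2
  rw [abs_le] at *
  constructor <;> linarith

omit hD hc in
/-- The functional derivative is only determined up to a constant, and the assumption on its
gradient controls its dependence on the measure once it is normalized at the origin. -/
lemma abs_sub_zero_sub_le {m m' : Measure (E n)} (hm : m ∈ D) (hm' : m' ∈ D) (x : E n) :
    |F x m - F 0 m - (F x m' - F 0 m')| ≤ c / 2 * W2 m m' * ‖x‖ := by
  have h := Convex.norm_image_sub_le_of_norm_fderiv_le (𝕜 := ℝ) (s := univ)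
    (f := fun x => F x m - F x m') (C := c / 2 * W2 m m') (x := 0) (y := x)
    (fun z _ => (hF.differentiable m hm z).sub (hF.differentiable m' hm' z)) (fun z _ => ?_)
    convex_univ (mem_univ _) (mem_univ _)
  · rw [sub_zero, Real.norm_eq_abs] at h
    refine le_trans (le_of_eq ?_) h
    congr 1
    ring
  · have h1 := hF.grad_lipschitz z z m hm m' hm'
    rw [sub_self, norm_zero, zero_add] at h1
    rw [fderiv_fun_sub (hF.differentiable m hm z) (hF.differentiable m' hm' z)]
    refine le_trans (le_of_eq ?_) h1
    rw [gradX, gradX, gradient, gradient, ← map_sub, LinearIsometryEquiv.norm_map]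

omit hc in
/-- The functional has at most quadratic growth, by its expansion along the product coupling with a
fixed measure. -/
lemma exists_growth (hne : D.Nonempty) :
    ∃ C, 0 ≤ C ∧ ∀ m ∈ D, |Φ m| ≤ C * (1 + secondMoment m) := by
  obtain ⟨m₀, h₀⟩ := hne
  have hc : 0 ≤ c := by
    have h1 := (norm_nonneg _).trans (hF.grad_growth 0 m₀ h₀)
    have h2 : 0 < 1 + ‖(0 : E n)‖ + √(secondMoment m₀) := by positivity
    linarith [nonneg_of_mul_nonneg_left h1 h2]
  have hp := P2_prob (hD.subset h₀)
  set a := l2norm m₀ (fun x => gradX F x m₀) with ha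
  have ha0 : 0 ≤ a := l2norm_nonneg _ _
  set b := √(secondMoment m₀) with hb
  have hb0 : 0 ≤ b := Real.sqrt_nonneg _
  refine ⟨|Φ m₀| + a * (1 + b) + c * (1 + b ^ 2), by positivity, fun m hm => ?_⟩
  have hpm := P2_prob (hD.subset hm)
  have e1 : (m₀.prod m).map Prod.fst = m₀ := (prod_mem_couplings m₀ m).1
  have e2 : (m₀.prod m).map Prod.snd = m := (prod_mem_couplings m₀ m).2
  have hX : MemLp (fun p : E n × E n => p.1) 2 (m₀.prod m) :=
    coupling_memLp_fst (prod_mem_couplings m₀ m) (P2_memLp_id (hD.subset h₀))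
  have hY : MemLp (fun p : E n × E n => p.2) 2 (m₀.prod m) :=
    coupling_memLp_snd (prod_mem_couplings m₀ m) (P2_memLp_id (hD.subset hm))
  have e1' : (m₀.prod m).map (fun p => p.1) = m₀ := e1
  have e2' : (m₀.prod m).map (fun p => p.2) = m := e2
  have h := hF.abs_sub_le hD hX hY (by rw [e1']; exact h₀) (by rw [e2']; exact hm)
  rw [e1', e2'] at h
  have hg : l2norm (m₀.prod m) (fun p => gradX F p.1 m₀) = a :=
    Setup.l2norm_comp (ξ := fun p : E n × E n => p.1) measurable_fst.aemeasurable e1'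
      (continuous_of_norm_sub_le
        (gradX_lipschitz_left hD hF.grad_lipschitz h₀)).aestronglyMeasurable
  have hx1 : l2norm (m₀.prod m) (fun p => p.1) = b := by
    rw [← sqrt_secondMoment_map hX.1.aemeasurable, e1']
  have hx2 : l2norm (m₀.prod m) (fun p => p.2) = √(secondMoment m) := by
    rw [← sqrt_secondMoment_map hY.1.aemeasurable, e2']
  set d := l2norm (m₀.prod m) (fun p : E n × E n => p.2 - p.1) with hd
  have hd0 : 0 ≤ d := l2norm_nonneg _ _
  have hdle : d ≤ √(secondMoment m) + b := by
    have h1 := l2norm_add_le hY hX.neg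
    simp only [Pi.neg_apply, ← sub_eq_add_neg] at h1
    rw [hx2] at h1
    have h2 := l2norm_neg (m₀.prod m) (fun p : E n × E n => p.1)
    rw [hx1] at h2
    refine h1.trans (le_of_eq ?_)
    rw [← h2]
    rfl
  rw [hg] at h
  set q := √(secondMoment m) with hq
  have hq0 : 0 ≤ q := Real.sqrt_nonneg _
  have hq2 : secondMoment m = q ^ 2 := (Real.sq_sqrt (secondMoment_nonneg m)).symm
  have h3 : |Φ m| ≤ |Φ m₀| + (a * d + c / 2 * d ^ 2) := by
    have := abs_sub_abs_le_abs_sub (Φ m) (Φ m₀)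
    linarith
  have h4 : a * d ≤ a * (1 + b) * (1 + q ^ 2) := by
    rw [mul_assoc]
    refine mul_le_mul_of_nonneg_left (hdle.trans ?_) ha0
    nlinarith [sq_nonneg (q - 1), mul_nonneg hb0 (sq_nonneg q)]
  have h5 : d ^ 2 ≤ 2 * ((1 + b ^ 2) * (1 + q ^ 2)) := by
    have : d ^ 2 ≤ (q + b) ^ 2 := pow_le_pow_left₀ hd0 hdle 2
    nlinarith [sq_nonneg (q - b), mul_nonneg (sq_nonneg b) (sq_nonneg q)]
  have h6 := mul_le_mul_of_nonneg_left h5 (by positivity : 0 ≤ c / 2)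
  rw [hq2]
  nlinarith [mul_nonneg (abs_nonneg (Φ m₀)) (sq_nonneg q)]

end RegularCost

end Frozen

section Potential

/-- The value, for one agent starting at `x`, of the control problem along the frozen flow of laws
of `y`. The running and terminal costs are normalized to vanish at the origin, which changes the
function by a constant and makes them continuous functions of the laws. -/
noncomputable def potential (F FT : E n → Measure (E n) → ℝ) (lam T t : ℝ) (m : Measure (E n))
    (y : E n → ℝ → E n) (x : E n) : ℝ :=
  1 / (2 * lam) * (∫ s in t..T, ‖costate F FT T m y x s‖ ^ 2)
    + (∫ s in t..T, (F (y x s) (law m y s) - F 0 (law m y s)))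
    + (FT (y x T) (law m y T) - FT 0 (law m y T))

variable {D : Set (Measure (E n))} {lam T c t : ℝ} {Φ ΦT : Measure (E n) → ℝ}
  {F FT : E n → Measure (E n) → ℝ}

namespace Setup

variable (H : Setup D lam T c Φ ΦT F FT) (ht : t ∈ Icc 0 T) {m : Measure (E n)} (hm : m ∈ D)
  {y : E n → ℝ → E n} (hy : IsFlow F FT lam T c t m y)
include H ht hm hy

lemma continuousOn_normalized_cost (x : E n) :
    ContinuousOn (fun s => F (y x s) (law m y s) - F 0 (law m y s)) (Icc t T) := by
  have hY := hy.toIsCandidate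
  have hyc : ContinuousOn (y x) (Icc t T) := fun s hs =>
    (H.hasDerivWithinAt_flow ht hm hy x hs).continuousWithinAt
  intro s₀ hs₀
  have h0 := H.law_mem hm hY hs₀
  rw [ContinuousWithinAt, tendsto_iff_norm_sub_tendsto_zero]
  set B := speed lam T c * ((2 - 2 * contr lam T c) * weight lam T c m x) with hB
  have hlim : Tendsto (fun s => c / 2 * (B * |s - s₀|) * ‖y x s‖
      + |F (y x s) (law m y s₀) - F (y x s₀) (law m y s₀)|) (𝓝[Icc t T] s₀) (𝓝 0) := by
    have h1 : Tendsto (fun s => |s - s₀|) (𝓝[Icc t T] s₀) (𝓝 0) := by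
      have : Continuous (fun s => |s - s₀|) := by fun_prop
      simpa using (this.tendsto s₀).mono_left nhdsWithin_le_nhds
    have h2 : Tendsto (fun s => F (y x s) (law m y s₀)) (𝓝[Icc t T] s₀)
        (𝓝 (F (y x s₀) (law m y s₀))) :=
      ((H.cost.differentiable _ h0).continuous.tendsto _).comp (hyc s₀ hs₀)
    have h3 := (((h1.const_mul B).const_mul (c / 2)).mul (hyc s₀ hs₀).norm).add
      (tendsto_iff_norm_sub_tendsto_zero.1 h2)
    simpa using h3
  refine squeeze_zero' (Eventually.of_forall fun _ => norm_nonneg _) ?_ hlim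
  filter_upwards [self_mem_nhdsWithin] with s hs
  have h1 := H.cost.abs_sub_zero_sub_le (H.law_mem hm hY hs) h0 (y x s)
  have h2 := H.W2_candidate_le ht hm hY hs hs₀ x
  have h3 : c / 2 * W2 (law m y s) (law m y s₀) * ‖y x s‖ ≤ c / 2 * (B * |s - s₀|) * ‖y x s‖ := by
    refine mul_le_mul_of_nonneg_right (mul_le_mul_of_nonneg_left (h2.trans (le_of_eq ?_)) ?_)
      (norm_nonneg _)
    · rw [hB]; ring
    · have := H.c_nonneg; positivity
  rw [Real.norm_eq_abs]
  have h4 := abs_add_le (F (y x s) (law m y s) - F 0 (law m y s)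
    - (F (y x s) (law m y s₀) - F 0 (law m y s₀)))
    (F (y x s) (law m y s₀) - F (y x s₀) (law m y s₀))
  refine le_trans (le_of_eq ?_) (h4.trans (add_le_add (h1.trans h3) le_rfl))
  congr 1
  ring

/-- The lower expansion of the potential: the competitor issued from `x` follows the trajectory
that is optimal for `x'`. -/
lemma potential_ge (x x' : E n) :
    inner ℝ (costate F FT T m y x t) (x' - x) - compConst lam T c * ‖x' - x‖ ^ 2
      ≤ potential F FT lam T t m y x' - potential F FT lam T t m y x := by
  have hY := hy.toIsCandidate
  have hc := H.c_nonneg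
  have hl := H.lam_pos
  have hTm : T ∈ Icc t T := right_mem_Icc.2 ht.2
  have hzc := fun x => H.continuousOn_costate ht hm hy x
  have hyc : ∀ x, ContinuousOn (y x) (Icc t T) := fun x s hs =>
    (H.hasDerivWithinAt_flow ht hm hy x hs).continuousWithinAt
  have hgc := H.continuousOn_gradX_candidate ht hm hY H.cost x
  have hu := (hzc x').const_smul (-(1 / lam))
  have key := pointwise_comparison hc H.T_pos H.small ht (gradX FT (y x T) (law m y T)) (x' - x)
    hgc (u := fun s => -(1 / lam) • costate F FT T m y x' s) (hu.intervalIntegrable_of_Icc ht.2)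
    ((hu.norm.pow 2).intervalIntegrable_of_Icc ht.2) (W := fun s => y x' s - y x s) fun s hs => by
      have hi : ∀ x, IntervalIntegrable (costate F FT T m y x) volume t s := fun x =>
        ((hzc x).mono (Icc_subset_Icc_right hs.2)).intervalIntegrable_of_Icc hs.1
      have e1 := intervalIntegral.integral_add ((hi x').smul (-(1 / lam)))
        ((hi x).smul (1 / lam))
      simp only [Pi.smul_apply, intervalIntegral.integral_smul] at e1
      rw [H.flow_eq ht hm hy x hs, H.flow_eq ht hm hy x' hs]
      change _ = _ + ∫ σ in t..s, (-(1 / lam) • costate F FT T m y x' σ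
        + (1 / lam) • costate F FT T m y x σ)
      rw [e1, neg_smul]
      abel
  have e2 : lam / 2 * (∫ s in t..T, ‖-(1 / lam) • costate F FT T m y x' s‖ ^ 2)
      = 1 / (2 * lam) * ∫ s in t..T, ‖costate F FT T m y x' s‖ ^ 2 := by
    rw [← intervalIntegral.integral_const_mul, ← intervalIntegral.integral_const_mul]
    refine intervalIntegral.integral_congr fun s _ => ?_
    simp only [norm_smul, norm_neg, Real.norm_eq_abs, mul_pow, sq_abs]
    field_simp
  rw [e2] at key
  have hT := H.cost_T.taylor H.state hc (H.law_mem hm hY hTm) (y x T) (y x' T)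
  have hrun : ∫ s in t..T, (inner ℝ (gradX F (y x s) (law m y s)) (y x' s - y x s)
      - c / 2 * ‖y x' s - y x s‖ ^ 2)
      ≤ (∫ s in t..T, (F (y x' s) (law m y s) - F 0 (law m y s)))
        - ∫ s in t..T, (F (y x s) (law m y s) - F 0 (law m y s)) := by
    have i1 := (H.continuousOn_normalized_cost ht hm hy x').intervalIntegrable_of_Icc
      (μ := volume) ht.2
    have i2 := (H.continuousOn_normalized_cost ht hm hy x).intervalIntegrable_of_Icc
      (μ := volume) ht.2
    rw [← intervalIntegral.integral_sub i1 i2]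
    refine intervalIntegral.integral_mono_on ht.2 (ContinuousOn.intervalIntegrable_of_Icc ht.2 ?_)
      (i1.sub i2) fun s hs => ?_
    · exact (hgc.inner ((hyc x').sub (hyc x))).sub
        ((((hyc x').sub (hyc x)).norm.pow 2).const_smul (c / 2))
    · have := (abs_le.1 (H.cost.taylor H.state hc (H.law_mem hm hY hs) (y x s) (y x' s))).1
      linarith
  have h1 : inner ℝ (backward (fun s => gradX F (y x s) (law m y s)) (gradX FT (y x T) (law m y T))
    T t) (x' - x) = inner ℝ (costate F FT T m y x t) (x' - x) := rfl
  rw [h1] at key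
  have h2 : ∫ s in t..T, ‖backward (fun s => gradX F (y x s) (law m y s))
      (gradX FT (y x T) (law m y T)) T s‖ ^ 2 = ∫ s in t..T, ‖costate F FT T m y x s‖ ^ 2 := rfl
  rw [h2] at key
  have h3 := (abs_le.1 hT).1
  simp only [potential]
  linarith

/-- The potential is differentiable, with gradient the initial value of the adjoint variable. The
upper bound is the lower bound with `x` and `x'` exchanged, since the adjoint variable is
Lipschitz. -/
lemma abs_potential_sub_le (x x' : E n) :
    |potential F FT lam T t m y x' - potential F FT lam T t m y x
      - inner ℝ (costate F FT T m y x t) (x' - x)|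
      ≤ (compConst lam T c + (1 + T) * c) * ‖x' - x‖ ^ 2 := by
  have h1 := H.potential_ge ht hm hy x x'
  have h2 := H.potential_ge ht hm hy x' x
  have h3 := H.norm_costate_sub_left_le ht hm hy x' x (left_mem_Icc.2 ht.2)
  have h4 := (real_inner_le_norm (costate F FT T m y x' t - costate F FT T m y x t)
    (x' - x)).trans (mul_le_mul_of_nonneg_right h3 (norm_nonneg _))
  rw [inner_sub_left] at h4
  have e : inner ℝ (costate F FT T m y x' t) (x - x')
      = -inner ℝ (costate F FT T m y x' t) (x' - x) := by
    rw [← inner_neg_right, neg_sub]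
  rw [e, norm_sub_rev] at h2
  have hT := H.T_pos
  have hc := H.c_nonneg
  have h5 : 0 ≤ (1 + T) * c * ‖x' - x‖ ^ 2 := by positivity
  rw [abs_le]
  constructor <;> nlinarith

lemma hasGradientAt_potential (x : E n) :
    HasGradientAt (potential F FT lam T t m y) (costate F FT T m y x t) x :=
  hasGradientAt_of_abs_sub_le fun x' => H.abs_potential_sub_le ht hm hy x x'

omit hm in
lemma norm_flow_le (x : E n) {s : ℝ} (hs : s ∈ Icc t T) :
    ‖y x s‖ ≤ (1 + speed lam T c * T) * weight lam T c m x := by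
  have h1 := H.norm_candidate_sub_le ht hy.toIsCandidate hs x
  have h2 := norm_add_le (y x s - x) x
  rw [sub_add_cancel] at h2
  have h3 := H.le_weight m x
  have h4 := Real.sqrt_nonneg (secondMoment m)
  linarith

omit hm hy ht in
lemma weight_sq_le (m : Measure (E n)) (x : E n) : weight lam T c m x ^ 2
    ≤ 3 * ((1 - 2 * contr lam T c)⁻¹) ^ 2 * (1 + ‖x‖ ^ 2 + secondMoment m) := by
  set A := (1 - 2 * contr lam T c)⁻¹ with hA
  have h1 : weight lam T c m x ≤ A * (1 + √(secondMoment m) + ‖x‖) := by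
    have h0 := H.contr_nonneg
    have h1 := H.contr_lt
    have : 1 ≤ (1 - 2 * contr lam T c)⁻¹ := (one_le_inv₀ (by linarith)).2 (by linarith)
    have h2 : 0 ≤ 1 + √(secondMoment m) := by positivity
    rw [weight, ← hA]
    nlinarith [norm_nonneg x]
  refine (pow_le_pow_left₀ (H.weight_pos m x).le h1 2).trans ?_
  rw [mul_pow, mul_comm 3, mul_assoc]
  refine mul_le_mul_of_nonneg_left ?_ (sq_nonneg _)
  have h2 := Real.sq_sqrt (secondMoment_nonneg m)
  nlinarith [sq_nonneg (1 - √(secondMoment m)), sq_nonneg (1 - ‖x‖),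
    sq_nonneg (√(secondMoment m) - ‖x‖)]

omit ht hm hy in
lemma exists_potential_growth : ∃ C, 0 ≤ C ∧ ∀ t ∈ Icc 0 T, ∀ m ∈ D, ∀ y,
    IsFlow F FT lam T c t m y → ∀ x, |potential F FT lam T t m y x|
      ≤ C * (1 + ‖x‖ ^ 2 + secondMoment m) := by
  have hc := H.c_nonneg
  have hl := H.lam_pos
  have hT := H.T_pos
  have hsp := H.speed_nonneg
  set a := lam * speed lam T c with ha
  set b := 1 + speed lam T c * T with hb
  set g := speed lam T c * (lam / (1 + T)) with hg
  set q := g * b + c / 2 * b ^ 2 with hq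
  have hq0 : 0 ≤ q := by positivity
  set A := 3 * ((1 - 2 * contr lam T c)⁻¹) ^ 2 with hA
  refine ⟨(1 / (2 * lam) * (a ^ 2 * T) + q * T + q) * A, by positivity,
    fun t ht m hm y hy x => ?_⟩
  have hY := hy.toIsCandidate
  have hTm : T ∈ Icc t T := right_mem_Icc.2 ht.2
  set w := weight lam T c m x with hw
  have hw0 : 0 ≤ w := (H.weight_pos m x).le
  have hF : ∀ {F' : E n → Measure (E n) → ℝ} {Φ' : Measure (E n) → ℝ}, RegularCost D c Φ' F' →
      ∀ s ∈ Icc t T, |F' (y x s) (law m y s) - F' 0 (law m y s)| ≤ q * w ^ 2 := by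
    intro F' Φ' hF s hs
    have h1 := hF.abs_sub_zero_le H.state hc (H.law_mem hm hY hs) (y x s)
    have h2 := H.norm_gradX_candidate_le ht hm hY hF hs x
    have h3 := H.norm_flow_le ht hy x hs
    have h4 := mul_le_mul h2 h3 (norm_nonneg _) (by positivity)
    have h5 := mul_le_mul_of_nonneg_left (pow_le_pow_left₀ (norm_nonneg _) h3 2)
      (by positivity : 0 ≤ c / 2)
    refine (h1.trans (add_le_add h4 h5)).trans (le_of_eq ?_)
    rw [hq]; ring
  have hlen : |T - t| ≤ T := by rw [abs_of_nonneg (sub_nonneg.2 ht.2)]; linarith [ht.1]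
  have i1 : |∫ s in t..T, ‖costate F FT T m y x s‖ ^ 2| ≤ a ^ 2 * T * w ^ 2 := by
    have := intervalIntegral.norm_integral_le_of_norm_le_const (a := t) (b := T)
      (f := fun s => ‖costate F FT T m y x s‖ ^ 2) (C := a ^ 2 * w ^ 2) fun s hs => by
        rw [uIoc_of_le ht.2] at hs
        rw [norm_pow, norm_norm, ← mul_pow]
        exact pow_le_pow_left₀ (norm_nonneg _)
          (H.norm_costate_le ht hm hy x (Ioc_subset_Icc_self hs)) 2
    refine (this.trans (mul_le_mul_of_nonneg_left hlen (by positivity))).trans (le_of_eq (by ring))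
  have i2 : |∫ s in t..T, (F (y x s) (law m y s) - F 0 (law m y s))| ≤ q * T * w ^ 2 := by
    have := intervalIntegral.norm_integral_le_of_norm_le_const (a := t) (b := T)
      (f := fun s => F (y x s) (law m y s) - F 0 (law m y s)) (C := q * w ^ 2) fun s hs => by
        rw [uIoc_of_le ht.2] at hs
        exact hF H.cost s (Ioc_subset_Icc_self hs)
    refine (this.trans (mul_le_mul_of_nonneg_left hlen (by positivity))).trans (le_of_eq (by ring))
  have i3 := hF H.cost_T T hTm
  have i4 : |1 / (2 * lam) * ∫ s in t..T, ‖costate F FT T m y x s‖ ^ 2|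
      ≤ 1 / (2 * lam) * (a ^ 2 * T * w ^ 2) := by
    rw [abs_mul, abs_of_nonneg (by positivity : 0 ≤ 1 / (2 * lam))]
    exact mul_le_mul_of_nonneg_left i1 (by positivity)
  rw [potential, mul_assoc]
  refine (abs_add_le _ _).trans ((add_le_add ((abs_add_le _ _).trans (add_le_add i4 i2))
    i3).trans ?_)
  have h6 : (1 / (2 * lam) * (a ^ 2 * T) + q * T + q) * w ^ 2 ≤
      (1 / (2 * lam) * (a ^ 2 * T) + q * T + q) * (A * (1 + ‖x‖ ^ 2 + secondMoment m)) :=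
    mul_le_mul_of_nonneg_left (H.weight_sq_le m x) (by positivity)
  linarith

end Setup

end Potential

section Value

variable {D : Set (Measure (E n))} {lam T c t : ℝ} {Φ ΦT : Measure (E n) → ℝ}
  {F FT : E n → Measure (E n) → ℝ}

namespace Setup

section Compare

variable (H : Setup D lam T c Φ ΦT F FT) (ht : t ∈ Icc 0 T) {m₁ m₂ : Measure (E n)} (hm₁ : m₁ ∈ D)
  (hm₂ : m₂ ∈ D) {y₁ y₂ : E n → ℝ → E n} (hy₁ : IsFlow F FT lam T c t m₁ y₁)
  (hy₂ : IsFlow F FT lam T c t m₂ y₂)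
  {Ω : Type*} [MeasurableSpace Ω] {P : Measure Ω} [IsProbabilityMeasure P] {ξ₁ ξ₂ : Ω → E n}
  (h₁ : AEMeasurable ξ₁ P) (h₂ : AEMeasurable ξ₂ P) (e₁ : P.map ξ₁ = m₁) (e₂ : P.map ξ₂ = m₂)
include H ht hm₁ hy₁ h₁ e₁

lemma isControlled_flow : IsControlled D T t P (fun ω s => y₁ (ξ₁ ω) s)
    (fun ω s => -((1 / lam) • costate F FT T m₁ y₁ (ξ₁ ω) s)) where
  memLp_velocity := ((H.memLp_joint_costate ht hm₁ hy₁ h₁ e₁).const_smul (1 / lam)).neg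
  memLp_start := memLp_comp h₁ e₁ (H.memLp_candidate ht hm₁ hy₁.toIsCandidate
    (left_mem_Icc.2 ht.2))
  path := Eventually.of_forall fun ω s hs => by
    rw [H.flow_eq ht hm₁ hy₁ _ hs, hy₁.start, intervalIntegral.integral_neg,
      intervalIntegral.integral_smul, sub_eq_add_neg]
  law_mem := fun s hs => by
    rw [law_flow hy₁ h₁ e₁ hs]
    exact H.law_mem hm₁ hy₁.toIsCandidate hs

omit [IsProbabilityMeasure P] in
lemma processCost_flow : processCost Φ ΦT lam T t P (fun ω s => y₁ (ξ₁ ω) s)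
    (fun ω s => -((1 / lam) • costate F FT T m₁ y₁ (ξ₁ ω) s))
      = flowCost Φ ΦT F FT lam T t m₁ y₁ := by
  have hl := H.lam_pos
  rw [processCost, flowCost, law_flow hy₁ h₁ e₁ (right_mem_Icc.2 ht.2)]
  congr 2
  · rw [← intervalIntegral.integral_const_mul, ← intervalIntegral.integral_const_mul]
    refine intervalIntegral.integral_congr fun s hs => ?_
    rw [uIcc_of_le ht.2] at hs
    have h := l2norm_comp h₁ e₁ (H.continuous_costate ht hm₁ hy₁ hs).aestronglyMeasurable
    simp only [← l2norm_sq, l2norm_neg, l2norm_smul]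
    rw [h, mul_pow, sq_abs]
    field_simp
  · refine intervalIntegral.integral_congr fun s hs => ?_
    rw [uIcc_of_le ht.2] at hs
    simp only [law_flow hy₁ h₁ e₁ hs]

include hm₂ hy₂ h₂ e₂

/-- The cost of the flow is a function of class `C^{1,1}` of the random initial position, whose
gradient is the initial value of the adjoint variable. -/
theorem abs_flowCost_sub_le :
    |flowCost Φ ΦT F FT lam T t m₂ y₂ - flowCost Φ ΦT F FT lam T t m₁ y₁
      - ∫ ω, inner ℝ (costate F FT T m₁ y₁ (ξ₁ ω) t) (ξ₂ ω - ξ₁ ω) ∂P|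
      ≤ (compConst lam T c + lipConst lam T c) * l2norm P (fun ω => ξ₂ ω - ξ₁ ω) ^ 2 := by
  have htm : t ∈ Icc t T := left_mem_Icc.2 ht.2
  have hL₁ : MemLp ξ₁ 2 P := memLp_comp h₁ e₁ (P2_memLp_id (H.state.subset hm₁))
  have hL₂ : MemLp ξ₂ 2 P := memLp_comp h₂ e₂ (P2_memLp_id (H.state.subset hm₂))
  have hd := memLp_fun_sub hL₂ hL₁
  have z₁ : MemLp (fun ω => costate F FT T m₁ y₁ (ξ₁ ω) t) 2 P :=
    memLp_comp h₁ e₁ (H.memLp_costate ht hm₁ hy₁ htm)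
  have z₂ : MemLp (fun ω => costate F FT T m₂ y₂ (ξ₂ ω) t) 2 P :=
    memLp_comp h₂ e₂ (H.memLp_costate ht hm₂ hy₂ htm)
  -- each flow competes with the other; the two first order terms are compared by the Lipschitz
  -- dependence of the adjoint variable
  have k₁ := H.flowCost_add_le_processCost ht hm₁ hy₁ h₁ e₁ (H.isControlled_flow ht hm₂ hy₂ h₂ e₂)
  have k₂ := H.flowCost_add_le_processCost ht hm₂ hy₂ h₂ e₂ (H.isControlled_flow ht hm₁ hy₁ h₁ e₁)
  rw [H.processCost_flow ht hm₂ hy₂ h₂ e₂] at k₁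
  rw [H.processCost_flow ht hm₁ hy₁ h₁ e₁] at k₂
  simp only [hy₁.start, hy₂.start] at k₁ k₂
  rw [l2norm_sub_comm] at k₂
  have e : ∫ ω, inner ℝ (costate F FT T m₂ y₂ (ξ₂ ω) t) (ξ₁ ω - ξ₂ ω) ∂P
      = -∫ ω, inner ℝ (costate F FT T m₂ y₂ (ξ₂ ω) t) (ξ₂ ω - ξ₁ ω) ∂P := by
    rw [← integral_neg]
    refine integral_congr_ae (Eventually.of_forall fun ω => ?_)
    simp only [← inner_neg_right, neg_sub]
  rw [e] at k₂
  have k₃ := abs_integral_inner_le (memLp_fun_sub z₂ z₁) hd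
  simp only [inner_sub_left] at k₃
  rw [integral_sub (integrable_inner_of_memLp z₂ hd) (integrable_inner_of_memLp z₁ hd)] at k₃
  have k₄ := mul_le_mul_of_nonneg_right
    (H.l2norm_costate_sub_le ht hm₂ hm₁ hy₂ hy₁ h₂ h₁ e₂ e₁ htm)
    (l2norm_nonneg P (fun ω => ξ₂ ω - ξ₁ ω))
  have k₅ := (abs_le.1 (k₃.trans k₄)).2
  have k₆ := H.lipConst_nonneg
  set d := l2norm P (fun ω => ξ₂ ω - ξ₁ ω) with hd'
  have k₇ : 0 ≤ lipConst lam T c * d ^ 2 := by positivity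
  rw [abs_le]
  constructor <;> nlinarith

end Compare

end Setup

/-- A choice of the flow issued from `m` at time `t`, meaningful where a flow exists. -/
noncomputable def optFlow (F FT : E n → Measure (E n) → ℝ) (lam T c t : ℝ) (m : Measure (E n)) :
    E n → ℝ → E n :=
  Classical.epsilon fun y => IsFlow F FT lam T c t m y

/-- The value function, as the cost of the flow. -/
noncomputable def optValue (Φ ΦT : Measure (E n) → ℝ) (F FT : E n → Measure (E n) → ℝ)
    (lam T c : ℝ) (m : Measure (E n)) (t : ℝ) : ℝ :=
  flowCost Φ ΦT F FT lam T t m (optFlow F FT lam T c t m)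

/-- The functional derivative of the value function. -/
noncomputable def optPotential (F FT : E n → Measure (E n) → ℝ) (lam T c : ℝ) (x : E n)
    (m : Measure (E n)) (t : ℝ) : ℝ :=
  potential F FT lam T t m (optFlow F FT lam T c t m) x

/-- The gradient of the functional derivative of the value function. -/
noncomputable def optCostate (F FT : E n → Measure (E n) → ℝ) (lam T c : ℝ) (m : Measure (E n))
    (t : ℝ) (x : E n) : E n :=
  costate F FT T m (optFlow F FT lam T c t m) x t

namespace Setup

variable (H : Setup D lam T c Φ ΦT F FT)
include H

lemma isFlow_optFlow (ht : t ∈ Icc 0 T) {m : Measure (E n)} (hm : m ∈ D) :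
    IsFlow F FT lam T c t m (optFlow F FT lam T c t m) :=
  Classical.epsilon_spec (H.exists_isFlow ht hm)

lemma hasGradientAt_optPotential (ht : t ∈ Icc 0 T) {m : Measure (E n)} (hm : m ∈ D) (x : E n) :
    HasGradientAt (fun x => optPotential F FT lam T c x m t) (optCostate F FT lam T c m t x) x :=
  H.hasGradientAt_potential ht hm (H.isFlow_optFlow ht hm) x

/-- Along every coupling the value function and the integral of the potential have the same first
order term, with quadratic errors; so they agree up to a multiple of the squared distance. -/
lemma hasFuncDeriv_optValue (ht : t ∈ Icc 0 T) {m : Measure (E n)} (hm : m ∈ D) :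
    HasFuncDeriv D (fun μ => optValue Φ ΦT F FT lam T c μ t) m
      (fun x => optPotential F FT lam T c x m t) := by
  have hc := H.c_nonneg
  have hT := H.T_pos
  have hy := H.isFlow_optFlow ht hm
  have hcont : Continuous (fun x => optPotential F FT lam T c x m t) :=
    continuous_iff_continuousAt.2 fun x => (H.hasGradientAt_optPotential ht hm x).continuousAt
  have hint : ∀ μ ∈ D, Integrable (fun x => optPotential F FT lam T c x m t) μ := by
    intro μ hμ
    have hμ' := H.state.subset hμ
    have := P2_prob hμ'
    obtain ⟨C, -, hC⟩ := H.exists_potential_growth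
    refine Integrable.mono' (g := fun x => C * (1 + ‖x‖ ^ 2 + secondMoment m)) ?_
      hcont.aestronglyMeasurable (Eventually.of_forall fun x => hC t ht m hm _ hy x)
    exact (((integrable_const _).add hμ'.2).add (integrable_const _)).const_mul C
  refine ⟨hint, fun ε hε => ?_⟩
  have hK₁ := compConst_nonneg hc hT H.small
  have hK₂ := H.lipConst_nonneg
  set K := compConst lam T c + lipConst lam T c + (compConst lam T c + (1 + T) * c) + 1 with hK
  have hKpos : 0 < K := by positivity
  refine ⟨ε / K, by positivity, fun μ hμ hW => ?_⟩
  have key : |optValue Φ ΦT F FT lam T c μ t - optValue Φ ΦT F FT lam T c m t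
      - (∫ x, optPotential F FT lam T c x m t ∂μ - ∫ x, optPotential F FT lam T c x m t ∂m)|
      ≤ K * W2 μ m ^ 2 := by
    refine le_W2_sq_of_forall_coupling (H.state.subset hμ) (H.state.subset hm) hKpos fun γ hγ => ?_
    have := P2_prob (H.state.subset hμ)
    have := P2_prob (H.state.subset hm)
    have := coupling_prob hγ
    have hd : MemLp (fun p : E n × E n => p.1 - p.2) 2 γ :=
      memLp_fun_sub (coupling_memLp_fst hγ (P2_memLp_id (H.state.subset hμ)))
        (coupling_memLp_snd hγ (P2_memLp_id (H.state.subset hm)))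
    have hz : MemLp (fun p : E n × E n => optCostate F FT lam T c m t p.2) 2 γ :=
      coupling_memLp_snd hγ (H.memLp_costate ht hm hy (left_mem_Icc.2 ht.2))
    have k₁ := H.abs_flowCost_sub_le ht hm hμ hy (H.isFlow_optFlow ht hμ) (P := γ)
      (ξ₁ := fun p => p.2) (ξ₂ := fun p => p.1) measurable_snd.aemeasurable
      measurable_fst.aemeasurable hγ.2 hγ.1
    have i₁ : Integrable (fun p : E n × E n => optPotential F FT lam T c p.1 m t) γ := by
      have h := hint μ hμ
      rw [← hγ.1] at h
      exact h.comp_measurable measurable_fst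
    have i₂ : Integrable (fun p : E n × E n => optPotential F FT lam T c p.2 m t) γ := by
      have h : Integrable (fun x => optPotential F FT lam T c x m t) (γ.map Prod.snd) := by
        rw [hγ.2]; exact hint m hm
      exact h.comp_measurable measurable_snd
    have j₁ : ∫ x, optPotential F FT lam T c x m t ∂μ
        = ∫ p, optPotential F FT lam T c p.1 m t ∂γ := by
      rw [← hγ.1]
      exact integral_map measurable_fst.aemeasurable hcont.aestronglyMeasurable
    have j₂ : ∫ x, optPotential F FT lam T c x m t ∂m
        = ∫ p, optPotential F FT lam T c p.2 m t ∂γ := by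
      have h := integral_map (μ := γ) measurable_snd.aemeasurable
        (f := fun x => optPotential F FT lam T c x m t) hcont.aestronglyMeasurable
      rwa [hγ.2] at h
    have i₃ := integrable_inner_of_memLp hz hd
    have k₂ : |∫ p, optPotential F FT lam T c p.1 m t ∂γ
        - ∫ p, optPotential F FT lam T c p.2 m t ∂γ
        - ∫ p, inner ℝ (optCostate F FT lam T c m t p.2) (p.1 - p.2) ∂γ|
        ≤ (compConst lam T c + (1 + T) * c) * l2norm γ (fun p => p.1 - p.2) ^ 2 := by
      have e₁ := integral_sub (i₁.sub i₂) i₃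
      simp only [Pi.sub_apply] at e₁
      rw [← integral_sub i₁ i₂, ← e₁, l2norm_sq, ← integral_const_mul]
      refine (abs_integral_le_integral_abs).trans (integral_mono_of_nonneg
        (Eventually.of_forall fun _ => abs_nonneg _)
        ((integrable_sq_of_memLp hd).const_mul _) (Eventually.of_forall fun p => ?_))
      exact H.abs_potential_sub_le ht hm hy p.2 p.1
    have e : ∫ p, ‖p.2 - p.1‖ ^ 2 ∂γ = l2norm γ (fun p => p.1 - p.2) ^ 2 := by
      rw [l2norm_sq]
      simp only [norm_sub_rev]
    change |optValue Φ ΦT F FT lam T c μ t - optValue Φ ΦT F FT lam T c m t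
      - ∫ p, inner ℝ (optCostate F FT lam T c m t p.2) (p.1 - p.2) ∂γ| ≤ _ at k₁
    rw [j₁, j₂, e]
    have h1 : 0 ≤ l2norm γ (fun p => p.1 - p.2) ^ 2 := sq_nonneg _
    rw [abs_le] at *
    constructor <;> nlinarith
  refine key.trans ?_
  have hW0 := W2_nonneg μ m
  rw [pow_two, ← mul_assoc]
  refine mul_le_mul_of_nonneg_right ?_ hW0
  have := (lt_div_iff₀ hKpos).1 hW
  linarith

lemma exists_flowCost_growth (hne : D.Nonempty) : ∃ C, 0 ≤ C ∧ ∀ t ∈ Icc 0 T, ∀ m ∈ D, ∀ y,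
    IsFlow F FT lam T c t m y → |flowCost Φ ΦT F FT lam T t m y| ≤ C * (1 + secondMoment m) := by
  have hl := H.lam_pos
  have hT := H.T_pos
  have hsp := H.speed_nonneg
  have hk0 : 0 ≤ 2 - 2 * contr lam T c := by linarith [H.contr_lt]
  obtain ⟨C₁, hC₁, h₁⟩ := H.cost.exists_growth H.state hne
  obtain ⟨C₂, hC₂, h₂⟩ := H.cost_T.exists_growth H.state hne
  set a := lam * speed lam T c * (2 - 2 * contr lam T c) with ha
  set b := 1 + speed lam T c * T * (2 - 2 * contr lam T c) with hb
  set A := 3 * ((1 - 2 * contr lam T c)⁻¹) ^ 2 with hA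
  refine ⟨1 / (2 * lam) * (a ^ 2 * A * T) + C₁ * (1 + b ^ 2 * A) * T + C₂ * (1 + b ^ 2 * A),
    by positivity, fun t ht m hm y hy => ?_⟩
  have hY := hy.toIsCandidate
  have := P2_prob (H.state.subset hm)
  set M := 1 + secondMoment m with hM
  have hM0 : 0 ≤ secondMoment m := secondMoment_nonneg m
  have hw := H.weight_sq_le m 0
  simp only [norm_zero, ne_eq, OfNat.ofNat_ne_zero, not_false_eq_true, zero_pow, add_zero] at hw
  rw [← hA, ← hM] at hw
  have hw0 := (H.weight_pos m 0).le
  set w := weight lam T c m 0 with hwdef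
  have hz : ∀ s ∈ Icc t T, ∫ x, ‖costate F FT T m y x s‖ ^ 2 ∂m ≤ a ^ 2 * A * M := fun s hs => by
    have h1 := l2norm_le_affine (f := fun x => costate F FT T m y x s) (H.memLp_weight hm)
      (α := lam * speed lam T c) (by positivity) le_rfl (Eventually.of_forall fun x => by
        rw [add_zero, Real.norm_of_nonneg (H.weight_pos m x).le]
        exact H.norm_costate_le ht hm hy x hs)
    have h2 := mul_le_mul_of_nonneg_left (H.l2norm_weight_le hm)
      (by positivity : 0 ≤ lam * speed lam T c)
    have h3 : l2norm m (fun x => costate F FT T m y x s) ≤ a * w := by rw [ha]; linarith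
    have h4 := pow_le_pow_left₀ (l2norm_nonneg _ _) h3 2
    rw [l2norm_sq, mul_pow] at h4
    rw [mul_assoc]
    exact h4.trans (mul_le_mul_of_nonneg_left hw (sq_nonneg _))
  have hlaw : ∀ s ∈ Icc t T, 1 + secondMoment (law m y s) ≤ (1 + b ^ 2 * A) * M := fun s hs => by
    have h1 := H.sqrt_secondMoment_candidate_le ht hm hY hs 0
    have h2 := H.le_weight m 0
    have h3 : √(secondMoment (law m y s)) ≤ b * w := by
      rw [norm_zero] at h2
      have : √(secondMoment m) ≤ w := by linarith
      rw [hb]; linarith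
    have h4 := pow_le_pow_left₀ (Real.sqrt_nonneg _) h3 2
    rw [Real.sq_sqrt (secondMoment_nonneg _), mul_pow] at h4
    have h5 := h4.trans (mul_le_mul_of_nonneg_left hw (sq_nonneg _))
    linarith
  have hlen : |T - t| ≤ T := by rw [abs_of_nonneg (sub_nonneg.2 ht.2)]; linarith [ht.1]
  have hMp : 0 ≤ M := by positivity
  have hA0 : 0 ≤ A := by positivity
  have i1 : |∫ s in t..T, ∫ x, ‖costate F FT T m y x s‖ ^ 2 ∂m| ≤ a ^ 2 * A * M * T := by
    rw [← Real.norm_eq_abs]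
    refine (intervalIntegral.norm_integral_le_of_norm_le_const (C := a ^ 2 * A * M)
      fun s hs => ?_).trans (mul_le_mul_of_nonneg_left hlen (by positivity))
    rw [uIoc_of_le ht.2] at hs
    rw [Real.norm_of_nonneg (integral_nonneg fun _ => by positivity)]
    exact hz s (Ioc_subset_Icc_self hs)
  have i2 : |∫ s in t..T, Φ (law m y s)| ≤ C₁ * ((1 + b ^ 2 * A) * M) * T := by
    rw [← Real.norm_eq_abs]
    refine (intervalIntegral.norm_integral_le_of_norm_le_const (C := C₁ * ((1 + b ^ 2 * A) * M))
      fun s hs => ?_).trans (mul_le_mul_of_nonneg_left hlen (by positivity))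
    rw [uIoc_of_le ht.2] at hs
    have hs' := Ioc_subset_Icc_self hs
    exact (h₁ _ (H.law_mem hm hY hs')).trans (mul_le_mul_of_nonneg_left (hlaw s hs') hC₁)
  have hTm : T ∈ Icc t T := right_mem_Icc.2 ht.2
  have i3 := (h₂ _ (H.law_mem hm hY hTm)).trans (mul_le_mul_of_nonneg_left (hlaw T hTm) hC₂)
  have i4 : |1 / (2 * lam) * ∫ s in t..T, ∫ x, ‖costate F FT T m y x s‖ ^ 2 ∂m|
      ≤ 1 / (2 * lam) * (a ^ 2 * A * M * T) := by
    rw [abs_mul, abs_of_nonneg (by positivity : 0 ≤ 1 / (2 * lam))]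
    exact mul_le_mul_of_nonneg_left i1 (by positivity)
  rw [flowCost]
  refine (abs_add_le _ _).trans ((add_le_add ((abs_add_le _ _).trans (add_le_add i4 i2))
    i3).trans (le_of_eq (by ring)))

lemma growthBounds (hne : D.Nonempty) : GrowthBounds D T (optValue Φ ΦT F FT lam T c)
    (optPotential F FT lam T c) := by
  obtain ⟨C₁, hC₁, h₁⟩ := H.exists_flowCost_growth hne
  obtain ⟨C₂, hC₂, h₂⟩ := H.exists_potential_growth
  have hl := H.lam_pos
  have hsp := H.speed_nonneg
  set A := (1 - 2 * contr lam T c)⁻¹ with hA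
  have hA1 : 1 ≤ A := (one_le_inv₀ (by linarith [H.contr_lt])).2 (by linarith [H.contr_nonneg])
  refine ⟨C₁ + C₂ + lam * speed lam T c * A, fun t ht m hm => ⟨?_, fun x => ⟨?_, ?_⟩⟩⟩
  · have h := secondMoment_nonneg m
    refine (h₁ t ht m hm _ (H.isFlow_optFlow ht hm)).trans (mul_le_mul_of_nonneg_right ?_
      (by positivity))
    have : 0 ≤ lam * speed lam T c * A := by positivity
    linarith
  · have h := secondMoment_nonneg m
    refine (h₂ t ht m hm _ (H.isFlow_optFlow ht hm) x).trans (mul_le_mul_of_nonneg_right ?_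
      (by positivity))
    have : 0 ≤ lam * speed lam T c * A := by positivity
    linarith
  · rw [(H.hasGradientAt_optPotential ht hm x).gradient]
    have h3 := H.norm_costate_le ht hm (H.isFlow_optFlow ht hm) x (left_mem_Icc.2 ht.2)
    have h4 : weight lam T c m x ≤ A * (1 + ‖x‖ + √(secondMoment m)) := by
      have h5 := norm_nonneg x
      rw [weight, ← hA]
      nlinarith
    refine h3.trans ((mul_le_mul_of_nonneg_left h4 (by positivity)).trans ?_)
    rw [← mul_assoc]
    exact mul_le_mul_of_nonneg_right (by linarith) (by positivity)

lemma lipschitzGradient : LipschitzGradient D T (optPotential F FT lam T c) := by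
  refine ⟨lipConst lam T c, fun t ht m₁ hm₁ m₂ hm₂ γ hγ => ?_⟩
  have := P2_prob (H.state.subset hm₁)
  have := coupling_prob hγ
  have h := H.l2norm_costate_sub_le ht hm₁ hm₂ (H.isFlow_optFlow ht hm₁) (H.isFlow_optFlow ht hm₂)
    (P := γ) measurable_fst.aemeasurable measurable_snd.aemeasurable hγ.1 hγ.2
    (left_mem_Icc.2 ht.2)
  have h2 := pow_le_pow_left₀ (l2norm_nonneg _ _) h 2
  rw [mul_pow, l2norm_sq, l2norm_sq] at h2
  simp only [(H.hasGradientAt_optPotential ht hm₁ _).gradient,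
    (H.hasGradientAt_optPotential ht hm₂ _).gradient]
  exact h2

end Setup

end Value

/-! ### The Bellman equation -/

lemma hasDerivWithinAt_of_abs_sub_le {φ : ℝ → ℝ} {φ' C t : ℝ} {S : Set ℝ}
    (h : ∀ s ∈ S, |φ s - φ t - (s - t) * φ'| ≤ C * |s - t| ^ 2) : HasDerivWithinAt φ φ' S t := by
  rw [hasDerivWithinAt_iff_isLittleO]
  have ho := ((Asymptotics.isLittleO_norm_pow_id (E' := ℝ) one_lt_two).comp_tendsto
    (tendsto_sub_nhds_zero_iff.2 (tendsto_id (x := 𝓝 t)))).mono (nhdsWithin_le_nhds (s := S))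
  refine (Asymptotics.IsBigO.of_bound C ?_).trans_isLittleO ho
  filter_upwards [self_mem_nhdsWithin] with s hs
  rw [Real.norm_eq_abs, Function.comp_apply, Real.norm_of_nonneg (by positivity)]
  exact h s hs

section TimeDerivative

variable {D : Set (Measure (E n))} {lam T c t r : ℝ} {Φ ΦT : Measure (E n) → ℝ}
  {F FT : E n → Measure (E n) → ℝ}

/-- A bound for the weight in `L²_m`. -/
noncomputable def weightBound (lam T c : ℝ) (m : Measure (E n)) : ℝ :=
  (2 - 2 * contr lam T c) * weight lam T c m 0

namespace Setup

variable (H : Setup D lam T c Φ ΦT F FT)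
include H

lemma weightBound_nonneg (m : Measure (E n)) : 0 ≤ weightBound lam T c m :=
  mul_nonneg (by linarith [H.contr_lt]) (H.weight_pos m 0).le

lemma l2norm_le_of_weight {m : Measure (E n)} (hm : m ∈ D) {f : E n → E n} {k : ℝ} (hk : 0 ≤ k)
    (h : ∀ x, ‖f x‖ ≤ k * weight lam T c m x) : l2norm m f ≤ k * weightBound lam T c m := by
  have := P2_prob (H.state.subset hm)
  have h1 := l2norm_le_affine (f := f) (H.memLp_weight hm) hk le_rfl
    (Eventually.of_forall fun x => by
      rw [add_zero, Real.norm_of_nonneg (H.weight_pos m x).le]; exact h x)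
  rw [add_zero] at h1
  exact h1.trans (mul_le_mul_of_nonneg_left (H.l2norm_weight_le hm) hk)

/-- The variation in time of the adjoint variable, relative to the weight. -/
noncomputable def _root_.MFC.costateSpeed (lam T c : ℝ) : ℝ := speed lam T c * (lam / (1 + T))

lemma costateSpeed_nonneg : 0 ≤ costateSpeed lam T c := by
  have := H.speed_nonneg
  have := H.lam_pos
  have := H.T_pos
  unfold costateSpeed
  positivity

variable (ht : t ∈ Icc 0 T) {m : Measure (E n)} (hm : m ∈ D)
  {y : E n → ℝ → E n} (hy : IsFlow F FT lam T c t m y)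
include ht hm hy

lemma l2norm_flow_sub_le {s : ℝ} (hs : s ∈ Icc t T) :
    l2norm m (fun x => y x s - x) ≤ speed lam T c * (s - t) * weightBound lam T c m := by
  refine H.l2norm_le_of_weight hm (mul_nonneg H.speed_nonneg (sub_nonneg.2 hs.1)) fun x => ?_
  have h := hy.time x s hs t (left_mem_Icc.2 ht.2)
  rw [hy.start, abs_of_nonneg (sub_nonneg.2 hs.1)] at h
  linarith

lemma l2norm_costate_le {s : ℝ} (hs : s ∈ Icc t T) :
    l2norm m (fun x => costate F FT T m y x s) ≤ lam * speed lam T c * weightBound lam T c m :=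
  H.l2norm_le_of_weight hm (mul_nonneg H.lam_pos.le H.speed_nonneg)
    fun x => H.norm_costate_le ht hm hy x hs

lemma l2norm_costate_time_sub_le {s s' : ℝ} (hs : s ∈ Icc t T) (hs' : s' ∈ Icc t T) :
    l2norm m (fun x => costate F FT T m y x s - costate F FT T m y x s')
      ≤ costateSpeed lam T c * |s - s'| * weightBound lam T c m :=
  H.l2norm_le_of_weight hm (mul_nonneg H.costateSpeed_nonneg (abs_nonneg _)) fun x =>
    (H.norm_costate_sub_le ht hm hy x hs hs').trans (le_of_eq (by rw [costateSpeed]; ring))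

lemma continuousOn_integral_costate_sq :
    ContinuousOn (fun s => ∫ x, ‖costate F FT T m y x s‖ ^ 2 ∂m) (Icc t T) := by
  have hl : ContinuousOn (fun s => l2norm m (fun x => costate F FT T m y x s)) (Icc t T) := by
    refine (LipschitzOnWith.of_dist_le_mul
      (K := (costateSpeed lam T c * weightBound lam T c m).toNNReal)
      fun s hs s' hs' => ?_).continuousOn
    rw [Real.dist_eq, Real.dist_eq]
    refine (abs_l2norm_sub_le (H.memLp_costate ht hm hy hs)
      (H.memLp_costate ht hm hy hs')).trans ?_
    refine (H.l2norm_costate_time_sub_le ht hm hy hs hs').trans ?_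
    rw [mul_right_comm]
    exact mul_le_mul_of_nonneg_right (Real.le_coe_toNNReal _) (abs_nonneg _)
  exact (hl.pow 2).congr fun s _ => (l2norm_sq _ _).symm

lemma continuousOn_cost_flow : ContinuousOn (fun s => Φ (law m y s)) (Icc t T) := by
  have := P2_prob (H.state.subset hm)
  have hs := H.isSolution_flow ht hm hy (P := m) (ξ := fun x => x) aemeasurable_id' (by simp)
    (left_mem_Icc.2 ht.2)
  exact H.cost.continuousOn_curve H.state hs.memLp hs.law_mem hs.continuous

/-- The dynamic programming principle. -/
lemma flowCost_eq_add (hr : r ∈ Icc t T) {y' : E n → ℝ → E n}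
    (hy' : IsFlow F FT lam T c r (law m y r) y') :
    flowCost Φ ΦT F FT lam T t m y
      = 1 / (2 * lam) * (∫ s in t..r, ∫ x, ‖costate F FT T m y x s‖ ^ 2 ∂m)
        + (∫ s in t..r, Φ (law m y s)) + flowCost Φ ΦT F FT lam T r (law m y r) y' := by
  have hr0 : r ∈ Icc 0 T := ⟨ht.1.trans hr.1, hr.2⟩
  have hm' := H.law_mem hm hy.toIsCandidate hr
  obtain ⟨hlaw, hcos⟩ := H.flow_property ht hm hy hr hy'
  have hsplit : ∀ {φ : ℝ → ℝ}, ContinuousOn φ (Icc t T) →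
      ∫ s in t..T, φ s = (∫ s in t..r, φ s) + ∫ s in r..T, φ s := fun hφ =>
    (intervalIntegral.integral_add_adjacent_intervals
      ((hφ.mono (Icc_subset_Icc_right hr.2)).intervalIntegrable_of_Icc hr.1)
      ((hφ.mono (Icc_subset_Icc_left hr.1)).intervalIntegrable_of_Icc hr.2)).symm
  have e1 : ∫ s in r..T, ∫ x, ‖costate F FT T m y x s‖ ^ 2 ∂m
      = ∫ s in r..T, ∫ x, ‖costate F FT T (law m y r) y' x s‖ ^ 2 ∂(law m y r) := by
    refine intervalIntegral.integral_congr fun s hs => ?_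
    rw [uIcc_of_le hr.2] at hs
    have h1 : ∫ x, ‖costate F FT T (law m y r) y' x s‖ ^ 2 ∂(law m y r)
        = ∫ x, ‖costate F FT T (law m y r) y' (y x r) s‖ ^ 2 ∂m :=
      integral_map (continuous_candidate hy.toIsCandidate hr).measurable.aemeasurable
        ((H.continuous_costate hr0 hm' hy' hs).norm.pow 2).aestronglyMeasurable
    simp only [h1]
    exact integral_congr_ae (hcos.mono fun x hx => by simp only [hx s hs])
  have e2 : ∫ s in r..T, Φ (law m y s) = ∫ s in r..T, Φ (law (law m y r) y' s) := by
    refine intervalIntegral.integral_congr fun s hs => ?_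
    rw [uIcc_of_le hr.2] at hs
    simp only [hlaw s hs]
  rw [flowCost, flowCost, hsplit (H.continuousOn_integral_costate_sq ht hm hy),
    hsplit (H.continuousOn_cost_flow ht hm hy), e1, e2, hlaw T (right_mem_Icc.2 hr.2)]
  ring

/-- Along a flow and at a later time, the adjoint variable is close to the one of the flow issued
at that time from the same measure. -/
lemma l2norm_costate_sub_restart_le (hr : r ∈ Icc t T) {y' : E n → ℝ → E n}
    (hy' : IsFlow F FT lam T c r m y') {s : ℝ} (hs : s ∈ Icc t r) :
    l2norm m (fun x => costate F FT T m y x s - costate F FT T m y' x r)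
      ≤ (costateSpeed lam T c + lipConst lam T c * speed lam T c) * weightBound lam T c m
        * (r - t) := by
  have := P2_prob (H.state.subset hm)
  have hr0 : r ∈ Icc 0 T := ⟨ht.1.trans hr.1, hr.2⟩
  have hrm : r ∈ Icc r T := left_mem_Icc.2 hr.2
  have hs' : s ∈ Icc t T := ⟨hs.1, hs.2.trans hr.2⟩
  have hm' := H.law_mem hm hy.toIsCandidate hr
  obtain ⟨y'', hy''⟩ := H.exists_isFlow hr0 hm'
  obtain ⟨-, hcos⟩ := H.flow_property ht hm hy hr hy''
  have hym : AEMeasurable (fun x => y x r) m :=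
    (continuous_candidate hy.toIsCandidate hr).measurable.aemeasurable
  have k1 := H.l2norm_costate_time_sub_le ht hm hy hs' hr
  have k2 : l2norm m (fun x => costate F FT T m y x r - costate F FT T m y' x r)
      ≤ lipConst lam T c * l2norm m (fun x => y x r - x) := by
    have h1 := H.l2norm_costate_sub_le hr0 hm' hm hy'' hy' hym aemeasurable_id' rfl
      (Measure.map_id' (μ := m)) hrm
    refine le_trans (le_of_eq (l2norm_congr ?_)) h1
    exact hcos.mono fun x hx => by rw [hx r hrm]
  have k3 := mul_le_mul_of_nonneg_left (H.l2norm_flow_sub_le ht hm hy hr) H.lipConst_nonneg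
  have k4 := l2norm_add_le
    (memLp_fun_sub (H.memLp_costate ht hm hy hs') (H.memLp_costate ht hm hy hr))
    (memLp_fun_sub (H.memLp_costate ht hm hy hr) (H.memLp_costate hr0 hm hy' hrm))
  simp only [sub_add_sub_cancel] at k4
  have k5 : |s - r| ≤ r - t := by rw [abs_le]; constructor <;> linarith [hs.1, hs.2]
  have k6 := mul_le_mul_of_nonneg_right
    (mul_le_mul_of_nonneg_left k5 H.costateSpeed_nonneg) (H.weightBound_nonneg m)
  linarith

/-- The displacement of the flow to first order in time. -/
lemma l2norm_flow_sub_add_le (hr : r ∈ Icc t T) {y' : E n → ℝ → E n}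
    (hy' : IsFlow F FT lam T c r m y') :
    l2norm m (fun x => y x r - x + ((r - t) / lam) • costate F FT T m y' x r)
      ≤ (2 * costateSpeed lam T c + lipConst lam T c * speed lam T c) * weightBound lam T c m / lam
        * (r - t) ^ 2 := by
  have hl := H.lam_pos
  have hp := P2_prob (H.state.subset hm)
  have hr0 : r ∈ Icc 0 T := ⟨ht.1.trans hr.1, hr.2⟩
  have hrm : r ∈ Icc r T := left_mem_Icc.2 hr.2
  have hrt : 0 ≤ r - t := sub_nonneg.2 hr.1
  have hκ := H.costateSpeed_nonneg
  have hb : ∀ x, ‖y x r - x + ((r - t) / lam) • costate F FT T m y x r‖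
      ≤ costateSpeed lam T c / lam * (r - t) ^ 2 * weight lam T c m x := fun x => by
    have hzc := (H.continuousOn_costate ht hm hy x).mono (Icc_subset_Icc_right hr.2)
    have hzi : IntervalIntegrable (costate F FT T m y x) volume t r :=
      hzc.intervalIntegrable_of_Icc hr.1
    have e : y x r - x + ((r - t) / lam) • costate F FT T m y x r
        = -((1 / lam) • ∫ s in t..r, (costate F FT T m y x s - costate F FT T m y x r)) := by
      rw [intervalIntegral.integral_sub hzi intervalIntegrable_const,
        intervalIntegral.integral_const, H.flow_eq ht hm hy x hr, smul_sub, smul_smul,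
        one_div_mul_eq_div]
      abel
    have hi := intervalIntegral.norm_integral_le_of_norm_le_const (a := t) (b := r)
      (f := fun s => costate F FT T m y x s - costate F FT T m y x r)
      (C := costateSpeed lam T c * weight lam T c m x * (r - t)) fun s hs => by
        rw [uIoc_of_le hr.1] at hs
        refine (H.norm_costate_sub_le ht hm hy x ⟨hs.1.le, hs.2.trans hr.2⟩ hr).trans ?_
        have : |s - r| ≤ r - t := by rw [abs_le]; constructor <;> linarith [hs.1, hs.2]
        exact mul_le_mul_of_nonneg_left this (mul_nonneg hκ (H.weight_pos m x).le)
    rw [e, norm_neg, norm_smul, Real.norm_of_nonneg (by positivity)]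
    rw [abs_of_nonneg hrt] at hi
    refine (mul_le_mul_of_nonneg_left hi (by positivity)).trans (le_of_eq ?_)
    field_simp
  have k1 := H.l2norm_le_of_weight hm (by positivity) hb
  have k2 := H.l2norm_costate_sub_restart_le ht hm hy hr hy' (right_mem_Icc.2 hr.1)
  have hyL : MemLp (fun x => y x r - x) 2 m :=
    memLp_fun_sub (H.memLp_candidate ht hm hy.toIsCandidate hr) (P2_memLp_id (H.state.subset hm))
  have hzL := H.memLp_costate ht hm hy hr
  have hzL' := H.memLp_costate hr0 hm hy' hrm
  have k3 : _ ≤ _ + l2norm m (fun x =>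
      -((r - t) / lam) • (costate F FT T m y x r - costate F FT T m y' x r)) :=
    l2norm_add_le (memLp_fun_add hyL (hzL.const_smul ((r - t) / lam)))
      ((memLp_fun_sub hzL hzL').const_smul (-((r - t) / lam)))
  simp only [Pi.smul_apply] at k3
  rw [l2norm_smul, abs_neg, abs_of_nonneg (by positivity)] at k3
  have e2 : ∀ x, y x r - x + ((r - t) / lam) • costate F FT T m y x r
      + -((r - t) / lam) • (costate F FT T m y x r - costate F FT T m y' x r)
      = y x r - x + ((r - t) / lam) • costate F FT T m y' x r := fun x => by module
  simp only [e2] at k3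
  have k4 := mul_le_mul_of_nonneg_left k2 (by positivity : 0 ≤ (r - t) / lam)
  refine k3.trans ((add_le_add k1 k4).trans (le_of_eq ?_))
  field_simp
  ring

omit ht hm hy in
/-- The variation in time of the value function, with an error of second order. -/
lemma exists_abs_optValue_sub_le {m : Measure (E n)} (hm : m ∈ D) :
    ∃ C, ∀ t ∈ Icc 0 T, ∀ r ∈ Icc t T,
      |optValue Φ ΦT F FT lam T c m r - optValue Φ ΦT F FT lam T c m t
        - (r - t) * (1 / (2 * lam) * l2norm m (optCostate F FT lam T c m r) ^ 2 - Φ m)|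
      ≤ C * (r - t) ^ 2 := by
  have hl := H.lam_pos
  have hT := H.T_pos
  have hp := P2_prob (H.state.subset hm)
  have hc := H.c_nonneg
  have hw := H.weightBound_nonneg m
  have hsp := H.speed_nonneg
  have hcs := H.costateSpeed_nonneg
  have hlc := H.lipConst_nonneg
  set w := weightBound lam T c m with hwdef
  set κ := (costateSpeed lam T c + lipConst lam T c * speed lam T c) * w with hκ
  set κ' := (2 * costateSpeed lam T c + lipConst lam T c * speed lam T c) * w / lam with hκ'
  set B := lam * speed lam T c * w with hB
  set S := speed lam T c * w with hS
  set G := l2norm m (fun x => gradX F x m) with hG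
  have hG0 : 0 ≤ G := l2norm_nonneg _ _
  have hκ0 : 0 ≤ κ := by positivity
  have hS0 : 0 ≤ S := by positivity
  have hB0 : 0 ≤ B := by positivity
  refine ⟨1 / (2 * lam) * (κ * (2 * B)) + (G * S + c / 2 * S ^ 2 * T)
    + (compConst lam T c + lipConst lam T c) * S ^ 2 + B * κ', fun t ht r hr => ?_⟩
  have hr0 : r ∈ Icc 0 T := ⟨ht.1.trans hr.1, hr.2⟩
  have hrm : r ∈ Icc r T := left_mem_Icc.2 hr.2
  have hrt : 0 ≤ r - t := sub_nonneg.2 hr.1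
  have hy := H.isFlow_optFlow ht hm
  have hy' := H.isFlow_optFlow hr0 hm
  set y := optFlow F FT lam T c t m with hydef
  have hm' := H.law_mem hm hy.toIsCandidate hr
  have hy'' := H.isFlow_optFlow hr0 hm'
  set Z := optCostate F FT lam T c m r with hZ
  have hZL : MemLp Z 2 m := H.memLp_costate hr0 hm hy' hrm
  set N := l2norm m Z with hN
  have hNB : N ≤ B := H.l2norm_costate_le hr0 hm hy' hrm
  have hN0 : 0 ≤ N := l2norm_nonneg _ _
  set h := r - t with hh
  have hysub : ∀ s ∈ Icc t r, l2norm m (fun x => y x s - x) ≤ S * h := fun s hs => by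
    refine (H.l2norm_flow_sub_le ht hm hy ⟨hs.1, hs.2.trans hr.2⟩).trans ?_
    rw [mul_right_comm, ← hS]
    exact mul_le_mul_of_nonneg_left (sub_le_sub_right hs.2 t) hS0
  -- the kinetic energy
  have a1 : |(∫ s in t..r, ∫ x, ‖costate F FT T m y x s‖ ^ 2 ∂m) - h * N ^ 2|
      ≤ κ * (2 * B) * h ^ 2 := by
    have hi : IntervalIntegrable (fun s => ∫ x, ‖costate F FT T m y x s‖ ^ 2 ∂m) volume t r :=
      ((H.continuousOn_integral_costate_sq ht hm hy).mono
        (Icc_subset_Icc_right hr.2)).intervalIntegrable_of_Icc hr.1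
    have e : (∫ s in t..r, ∫ x, ‖costate F FT T m y x s‖ ^ 2 ∂m) - h * N ^ 2
        = ∫ s in t..r, ((∫ x, ‖costate F FT T m y x s‖ ^ 2 ∂m) - N ^ 2) := by
      rw [intervalIntegral.integral_sub hi intervalIntegrable_const,
        intervalIntegral.integral_const,
        smul_eq_mul]
    have hb := intervalIntegral.norm_integral_le_of_norm_le_const (a := t) (b := r)
      (f := fun s => (∫ x, ‖costate F FT T m y x s‖ ^ 2 ∂m) - N ^ 2) (C := κ * h * (2 * B))
      fun s hs => by
        rw [uIoc_of_le hr.1] at hs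
        have hs' : s ∈ Icc t T := ⟨hs.1.le, hs.2.trans hr.2⟩
        have h1 := (abs_l2norm_sub_le (H.memLp_costate ht hm hy hs') hZL).trans
          (H.l2norm_costate_sub_restart_le ht hm hy hr hy' ⟨hs.1.le, hs.2⟩)
        have h2 := H.l2norm_costate_le ht hm hy hs'
        have h3 : 0 ≤ l2norm m (fun x => costate F FT T m y x s) := l2norm_nonneg _ _
        rw [Real.norm_eq_abs, ← l2norm_sq, sq_sub_sq, mul_comm, abs_mul, abs_of_nonneg (by linarith
          : 0 ≤ l2norm m (fun x => costate F FT T m y x s) + N)]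
        exact mul_le_mul h1 (by linarith) (by linarith) (by positivity)
    rw [e]
    rw [← hh, abs_of_nonneg hrt] at hb
    exact hb.trans (le_of_eq (by ring))
  -- the running cost
  have hid : m.map (fun x => x) = m := Measure.map_id'
  have a2 : |(∫ s in t..r, Φ (law m y s)) - h * Φ m| ≤ (G * S + c / 2 * S ^ 2 * T) * h ^ 2 := by
    have hi : IntervalIntegrable (fun s => Φ (law m y s)) volume t r :=
      ((H.continuousOn_cost_flow ht hm hy).mono
        (Icc_subset_Icc_right hr.2)).intervalIntegrable_of_Icc hr.1
    have e : (∫ s in t..r, Φ (law m y s)) - h * Φ m = ∫ s in t..r, (Φ (law m y s) - Φ m) := by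
      rw [intervalIntegral.integral_sub hi intervalIntegrable_const,
        intervalIntegral.integral_const,
        smul_eq_mul]
    have hb := intervalIntegral.norm_integral_le_of_norm_le_const (a := t) (b := r)
      (f := fun s => Φ (law m y s) - Φ m) (C := G * (S * h) + c / 2 * (S * h) ^ 2)
      fun s hs => by
        rw [uIoc_of_le hr.1] at hs
        have hs' : s ∈ Icc t T := ⟨hs.1.le, hs.2.trans hr.2⟩
        have h1 := H.cost.abs_sub_le H.state (P2_memLp_id (H.state.subset hm))
          (H.memLp_candidate ht hm hy.toIsCandidate hs') (by rw [hid]; exact hm)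
          (H.law_mem hm hy.toIsCandidate hs')
        rw [hid] at h1
        have h2 := hysub s ⟨hs.1.le, hs.2⟩
        exact h1.trans (add_le_add (mul_le_mul_of_nonneg_left h2 hG0)
          (mul_le_mul_of_nonneg_left (pow_le_pow_left₀ (l2norm_nonneg _ _) h2 2) (by positivity)))
    rw [e]
    rw [← hh, abs_of_nonneg hrt] at hb
    have hhT : h ≤ T := by linarith [hr.2, ht.1]
    have h4 := mul_le_mul_of_nonneg_left hhT (by positivity : 0 ≤ c / 2 * S ^ 2 * h ^ 2)
    exact hb.trans (by linarith)
  -- the variation of the initial position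
  have hyL : MemLp (fun x => y x r - x) 2 m :=
    memLp_fun_sub (H.memLp_candidate ht hm hy.toIsCandidate hr) (P2_memLp_id (H.state.subset hm))
  have a3 : |optValue Φ ΦT F FT lam T c (law m y r) r - optValue Φ ΦT F FT lam T c m r
      - ∫ x, inner ℝ (Z x) (y x r - x) ∂m|
      ≤ (compConst lam T c + lipConst lam T c) * S ^ 2 * h ^ 2 := by
    have h1 := H.abs_flowCost_sub_le hr0 hm hm' hy' hy'' (P := m) (ξ₁ := fun x => x)
      (ξ₂ := fun x => y x r) aemeasurable_id'
      (continuous_candidate hy.toIsCandidate hr).measurable.aemeasurable hid rfl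
    refine h1.trans ?_
    have h2 := pow_le_pow_left₀ (l2norm_nonneg _ _) (hysub r (right_mem_Icc.2 hr.1)) 2
    have h3 := mul_le_mul_of_nonneg_left h2
      (add_nonneg (compConst_nonneg hc hT H.small) hlc)
    exact h3.trans (le_of_eq (by ring))
  have a4 : |(∫ x, inner ℝ (Z x) (y x r - x) ∂m) + h / lam * N ^ 2| ≤ B * κ' * h ^ 2 := by
    have e : (∫ x, inner ℝ (Z x) (y x r - x) ∂m) + h / lam * N ^ 2
        = ∫ x, inner ℝ (Z x) (y x r - x + (h / lam) • Z x) ∂m := by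
      simp only [inner_add_right, inner_smul_right, real_inner_self_eq_norm_sq]
      rw [integral_add (integrable_inner_of_memLp hZL hyL)
        ((integrable_sq_of_memLp hZL).const_mul _), integral_const_mul, hN, l2norm_sq]
    rw [e]
    refine (abs_integral_inner_le hZL (memLp_fun_add hyL (hZL.const_smul (h / lam)))).trans ?_
    have h1 := H.l2norm_flow_sub_add_le ht hm hy hr hy'
    rw [mul_assoc]
    exact mul_le_mul hNB h1 (l2norm_nonneg _ _) hB0
  have hdp : optValue Φ ΦT F FT lam T c m t
      = 1 / (2 * lam) * (∫ s in t..r, ∫ x, ‖costate F FT T m y x s‖ ^ 2 ∂m)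
        + (∫ s in t..r, Φ (law m y s)) + optValue Φ ΦT F FT lam T c (law m y r) r :=
    H.flowCost_eq_add ht hm hy hr hy''
  have a1' := mul_le_mul_of_nonneg_left a1 (by positivity : 0 ≤ 1 / (2 * lam))
  rw [← abs_of_nonneg (by positivity : 0 ≤ 1 / (2 * lam)), ← abs_mul,
    abs_of_nonneg (by positivity : 0 ≤ 1 / (2 * lam))] at a1'
  have e5 : h / lam * N ^ 2 = 2 * (1 / (2 * lam) * (h * N ^ 2)) := by field_simp
  rw [e5] at a4
  rw [mul_sub] at a1'
  have e6 : h * (1 / (2 * lam) * N ^ 2 - Φ m) = 1 / (2 * lam) * (h * N ^ 2) - h * Φ m := by ring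
  rw [hdp, e6]
  rw [abs_le] at *
  constructor <;> linarith

omit ht hm hy in
lemma hasDerivWithinAt_optValue (ht : t ∈ Icc 0 T) {m : Measure (E n)} (hm : m ∈ D) :
    HasDerivWithinAt (optValue Φ ΦT F FT lam T c m)
      (1 / (2 * lam) * l2norm m (optCostate F FT lam T c m t) ^ 2 - Φ m) (Icc 0 T) t := by
  have hl := H.lam_pos
  have hw := H.weightBound_nonneg m
  have hsp := H.speed_nonneg
  have hcs := H.costateSpeed_nonneg
  have hlc := H.lipConst_nonneg
  obtain ⟨C, hC⟩ := H.exists_abs_optValue_sub_le hm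
  set κ := (costateSpeed lam T c + lipConst lam T c * speed lam T c) * weightBound lam T c m with hκ
  set B := lam * speed lam T c * weightBound lam T c m with hB
  have hκ0 : 0 ≤ κ := by positivity
  set N : ℝ → ℝ := fun s => l2norm m (optCostate F FT lam T c m s) with hN
  have hN0 : ∀ s, 0 ≤ N s := fun s => l2norm_nonneg _ _
  have hNB : ∀ s ∈ Icc 0 T, N s ≤ B := fun s hs =>
    H.l2norm_costate_le hs hm (H.isFlow_optFlow hs hm) (left_mem_Icc.2 hs.2)
  -- the right-hand side is Lipschitz in time
  have hNL : ∀ s ∈ Icc 0 T, ∀ r ∈ Icc s T, |N r ^ 2 - N s ^ 2| ≤ κ * (2 * B) * (r - s) := by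
    intro s hs r hr
    have hr0 : r ∈ Icc 0 T := ⟨hs.1.trans hr.1, hr.2⟩
    have h1 := (abs_l2norm_sub_le
      (H.memLp_costate hs hm (H.isFlow_optFlow hs hm) (left_mem_Icc.2 hs.2))
      (H.memLp_costate hr0 hm (H.isFlow_optFlow hr0 hm) (left_mem_Icc.2 hr.2))).trans
      (H.l2norm_costate_sub_restart_le hs hm (H.isFlow_optFlow hs hm) hr
        (H.isFlow_optFlow hr0 hm) (left_mem_Icc.2 hr.1))
    have h2 : |N r - N s| ≤ κ * (r - s) := by rw [abs_sub_comm]; exact h1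
    rw [sq_sub_sq, mul_comm, abs_mul, abs_of_nonneg (add_nonneg (hN0 r) (hN0 s))]
    have h3 := mul_le_mul h2 (by linarith [hNB s hs, hNB r hr0] : N r + N s ≤ 2 * B)
      (add_nonneg (hN0 r) (hN0 s)) (mul_nonneg hκ0 (sub_nonneg.2 hr.1))
    linarith
  refine hasDerivWithinAt_of_abs_sub_le (C := C + 1 / (2 * lam) * (κ * (2 * B))) fun s hs => ?_
  have hl2 : 0 ≤ 1 / (2 * lam) := by positivity
  rcases le_total t s with hts | hst
  · have h1 := hC t ht s ⟨hts, hs.2⟩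
    have h2 := mul_le_mul_of_nonneg_left (hNL t ht s ⟨hts, hs.2⟩)
      (mul_nonneg hl2 (sub_nonneg.2 hts))
    rw [← abs_of_nonneg (mul_nonneg hl2 (sub_nonneg.2 hts)), ← abs_mul,
      abs_of_nonneg (mul_nonneg hl2 (sub_nonneg.2 hts))] at h2
    rw [sq_abs]
    rw [abs_le] at *
    constructor <;> linarith
  · have h1 := hC s hs t ⟨hst, ht.2⟩
    have h2 : 0 ≤ 1 / (2 * lam) * (κ * (2 * B)) * (s - t) ^ 2 := by
      have := (hN0 t).trans (hNB t ht)
      positivity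
    rw [sq_abs]
    rw [abs_le] at *
    constructor <;> linarith

omit ht hm hy in
/-- The value function solves the Bellman equation. -/
theorem solvesBellman_optValue {f h : E n → Measure (E n) → ℝ} (hΦ : Φ = meanCost f)
    (hΦT : ΦT = meanCost h) :
    SolvesBellman D f h lam T (optValue Φ ΦT F FT lam T c) (optPotential F FT lam T c) where
  funcDeriv := fun _ ht _ hm => H.hasFuncDeriv_optValue ht hm
  differentiable := fun _ ht _ hm x => (H.hasGradientAt_optPotential ht hm x).differentiableAt
  equation := fun t ht m hm => by
    refine ⟨_, H.hasDerivWithinAt_optValue ht hm, ?_⟩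
    simp only [(H.hasGradientAt_optPotential ht hm _).gradient]
    rw [l2norm_sq, hΦ, meanCost]
    ring
  terminal := fun m hm => by
    have hTm : T ∈ Icc 0 T := right_mem_Icc.2 H.T_pos.le
    have hid : law m (optFlow F FT lam T c T m) T = m := by
      rw [law]
      simp only [(H.isFlow_optFlow hTm hm).start]
      exact Measure.map_id'
    rw [optValue, flowCost, hid, hΦT]
    simp [meanCost]

end Setup

end TimeDerivative

/-! ### A maximum principle in Hilbert spaces -/

/-- Ekeland's variational principle, for continuous functions. -/
theorem exists_ekeland {α : Type*} [MetricSpace α] [CompleteSpace α] {f : α → ℝ}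
    (hf : Continuous f) (hbdd : BddBelow (range f)) {ε : ℝ} (hε : 0 < ε) (x₀ : α) :
    ∃ x, f x ≤ f x₀ ∧ ∀ y, f x ≤ f y + ε * dist y x := by
  let S : α → Set α := fun x => {y | f y + ε * dist y x ≤ f x}
  have hself : ∀ x, x ∈ S x := fun x => by simp [S]
  have htrans : ∀ {x y z}, y ∈ S x → z ∈ S y → z ∈ S x := fun {x y z} hy hz => by
    have h1 := mul_le_mul_of_nonneg_left (dist_triangle z y x) hε.le
    have hy' : f y + ε * dist y x ≤ f x := hy
    have hz' : f z + ε * dist z y ≤ f y := hz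
    change f z + ε * dist z x ≤ f x
    linarith
  have hb : ∀ x, BddBelow (f '' S x) := fun x => hbdd.mono (image_subset_range _ _)
  -- at each step, the value is decreased almost as much as possible
  have hstep : ∀ (k : ℕ) (x : α), ∃ y ∈ S x, f y < sInf (f '' S x) + 1 / ((k : ℝ) + 1) :=
    fun k x => by
    obtain ⟨_, ⟨y, hy, rfl⟩, h⟩ := exists_lt_of_csInf_lt (s := f '' S x) ⟨_, x, hself x, rfl⟩
      (lt_add_of_pos_right (sInf (f '' S x)) (by positivity : 0 < 1 / ((k : ℝ) + 1)))
    exact ⟨y, hy, h⟩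
  choose step hstepS hstepf using hstep
  let u : ℕ → α := fun k => Nat.rec x₀ (fun k x => step k x) k
  have hu : ∀ k, u (k + 1) = step k (u k) := fun k => rfl
  have hmem : ∀ k l, k ≤ l → u l ∈ S (u k) := fun k l hkl => by
    induction l, hkl using Nat.le_induction with
    | base => exact hself _
    | succ l _ ih => exact htrans ih (hu l ▸ hstepS l (u l))
  have hanti : Antitone (fun k => f (u k)) := fun k l hkl => by
    have h1 : f (u l) + ε * dist (u l) (u k) ≤ f (u k) := hmem k l hkl
    have h2 : 0 ≤ ε * dist (u l) (u k) := by positivity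
    change f (u l) ≤ f (u k)
    linarith
  obtain ⟨v, hv⟩ : ∃ v, Tendsto (fun k => f (u k)) atTop (𝓝 v) :=
    ⟨_, tendsto_atTop_ciInf hanti (hbdd.mono (range_subset_iff.2 fun k => mem_range_self _))⟩
  have hcauchy : CauchySeq u := by
    refine cauchySeq_of_le_tendsto_0' (fun k => (f (u k) - v) / ε) (fun k l hkl => ?_) ?_
    · rw [le_div_iff₀ hε, dist_comm]
      have h1 : f (u l) + ε * dist (u l) (u k) ≤ f (u k) := hmem k l hkl
      have h2 := hanti.le_of_tendsto hv l
      linarith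
    · simpa using (hv.sub_const v).div_const ε
  obtain ⟨x, hx⟩ := cauchySeq_tendsto_of_complete hcauchy
  have hfx : f x = v := tendsto_nhds_unique ((hf.tendsto x).comp hx) hv
  have hxS : ∀ k, x ∈ S (u k) := fun k => by
    have hclosed : IsClosed (S (u k)) := isClosed_le (by fun_prop) continuous_const
    exact hclosed.mem_of_tendsto hx ((eventually_ge_atTop k).mono fun l hl => hmem k l hl)
  refine ⟨x, ?_, fun y => ?_⟩
  · have h1 : f x + ε * dist x x₀ ≤ f x₀ := hxS 0
    have h2 : 0 ≤ ε * dist x x₀ := by positivity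
    linarith
  · by_contra! hlt
    have hle : v ≤ f y := by
      have hlim : Tendsto (fun k : ℕ => f (u (k + 1)) - 1 / ((k : ℝ) + 1)) atTop (𝓝 v) := by
        simpa using (hv.comp (tendsto_add_atTop_nat 1)).sub
          (tendsto_one_div_add_atTop_nhds_zero_nat (𝕜 := ℝ))
      refine le_of_tendsto hlim (Eventually.of_forall fun k => ?_)
      have h1 : sInf (f '' S (u k)) ≤ f y :=
        csInf_le (hb _) ⟨y, htrans (hxS k) hlt.le, rfl⟩
      have h2 := hstepf k (u k)
      rw [← hu] at h2
      linarith
    have h3 : 0 ≤ ε * dist y x := by positivity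
    linarith

lemma deriv_le_of_forall_sub_le {φ : ℝ → ℝ} {φ' t T ε : ℝ} (htT : t < T)
    (h : HasDerivWithinAt φ φ' (Icc t T) t)
    (hle : ∀ s ∈ Icc t T, φ s - φ t ≤ ε * (s - t)) : φ' ≤ ε := by
  have h1 := hasDerivWithinAt_iff_tendsto_slope.1 h
  rw [Icc_sdiff_left] at h1
  have : (𝓝[Ioc t T] t).NeBot := by
    rw [nhdsWithin_Ioc_eq_nhdsGT htT]; infer_instance
  refine le_of_tendsto h1 ?_
  filter_upwards [self_mem_nhdsWithin] with s hs
  rw [slope_def_field, div_le_iff₀ (sub_pos.2 hs.1)]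
  exact hle s (Ioc_subset_Icc_self hs)

section Hilbert

variable {G : Type*} [NormedAddCommGroup G] [InnerProductSpace ℝ G]

/-- Bounds for the directional derivatives give a local Lipschitz estimate. -/
lemma abs_sub_le_of_directional {e : G → ℝ} {l : G → G → ℝ} {A : ℝ}
    (hA : 0 ≤ A) (hl : ∀ X W, HasDerivAt (fun θ : ℝ => e (X + θ • W)) (l X W) 0)
    (hlb : ∀ X W, |l X W| ≤ A * (1 + ‖X‖) * ‖W‖) (X Y : G) :
    |e Y - e X| ≤ A * (1 + ‖X‖ + ‖Y - X‖) * ‖Y - X‖ := by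
  have hd : ∀ θ : ℝ, HasDerivAt (fun θ : ℝ => e (X + θ • (Y - X)))
      (l (X + θ • (Y - X)) (Y - X)) θ := fun θ => by
    have h1 := hl (X + θ • (Y - X)) (Y - X)
    have h2 := HasDerivAt.comp_sub_const (x := θ) (a := θ)
      (f := fun θ' : ℝ => e (X + θ • (Y - X) + θ' • (Y - X))) (by rw [sub_self]; exact h1)
    refine h2.congr_of_eventuallyEq (Eventually.of_forall fun θ' => ?_)
    simp only
    congr 1
    module
  have h := (convex_Icc (0 : ℝ) 1).norm_image_sub_le_of_norm_hasDerivWithin_le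
    (f := fun θ : ℝ => e (X + θ • (Y - X))) (C := A * (1 + ‖X‖ + ‖Y - X‖) * ‖Y - X‖)
    (fun θ _ => (hd θ).hasDerivWithinAt) (fun θ hθ => ?_) (left_mem_Icc.2 zero_le_one)
    (right_mem_Icc.2 zero_le_one)
  · simpa using h
  · rw [Real.norm_eq_abs]
    refine (hlb _ _).trans (mul_le_mul_of_nonneg_right (mul_le_mul_of_nonneg_left ?_ hA)
      (norm_nonneg _))
    have h1 := norm_add_le X (θ • (Y - X))
    rw [norm_smul, Real.norm_of_nonneg hθ.1] at h1
    have h2 := mul_le_of_le_one_left (norm_nonneg (Y - X)) hθ.2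
    linarith

/-- Bounds for the partial derivatives, each at fixed values of the other variable, give joint
continuity. -/
lemma continuous_of_partial_bounds {T A : ℝ} (hA : 0 ≤ A) {e d : G → ℝ → ℝ} {l : G → ℝ → G → ℝ}
    (hd : ∀ X, ∀ t ∈ Icc 0 T, HasDerivWithinAt (e X) (d X t) (Icc 0 T) t)
    (hdb : ∀ X, ∀ t ∈ Icc 0 T, |d X t| ≤ A * (1 + ‖X‖ ^ 2))
    (hl : ∀ X, ∀ t ∈ Icc 0 T, ∀ W, HasDerivAt (fun θ : ℝ => e (X + θ • W) t) (l X t W) 0)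
    (hlb : ∀ X, ∀ t ∈ Icc 0 T, ∀ W, |l X t W| ≤ A * (1 + ‖X‖) * ‖W‖) :
    Continuous fun q : G × Icc (0 : ℝ) T => e q.1 q.2 := by
  refine continuous_iff_continuousAt.2 fun q₀ => ?_
  rw [ContinuousAt, tendsto_iff_norm_sub_tendsto_zero]
  have hlim : Tendsto (fun q : G × Icc (0 : ℝ) T => A * (1 + ‖q₀.1‖ + ‖q.1 - q₀.1‖) * ‖q.1 - q₀.1‖
      + A * (1 + ‖q₀.1‖ ^ 2) * |(q.2 : ℝ) - q₀.2|) (𝓝 q₀) (𝓝 0) := by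
    have hc : Continuous (fun q : G × Icc (0 : ℝ) T =>
      A * (1 + ‖q₀.1‖ + ‖q.1 - q₀.1‖) * ‖q.1 - q₀.1‖
        + A * (1 + ‖q₀.1‖ ^ 2) * |(q.2 : ℝ) - q₀.2|) := by fun_prop
    simpa using hc.tendsto q₀
  refine squeeze_zero (fun _ => norm_nonneg _) (fun q => ?_) hlim
  have h1 := abs_sub_le_of_directional (e := fun X => e X q.2)
    (l := fun X W => l X q.2 W) hA (fun X W => hl X q.2 q.2.2 W)
    (fun X W => hlb X q.2 q.2.2 W) q₀.1 q.1
  have h2 := (convex_Icc (0 : ℝ) T).norm_image_sub_le_of_norm_hasDerivWithin_le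
    (f := e q₀.1) (hd q₀.1) (fun s hs => hdb q₀.1 s hs) q₀.2.2 q.2.2
  rw [Real.norm_eq_abs, Real.norm_eq_abs] at *
  exact (abs_sub_le _ (e q₀.1 q.2) _).trans (add_le_add h1 h2)

/-- The slopes of the penalized function at an approximate maximum bound the penalty. -/
lemma le_of_penalized_slopes {A κ η ε g d l : ℝ} {Y v : G} (hA : 0 ≤ A) (hκ : 0 ≤ κ) (hη : 0 < η)
    (hε : 0 ≤ ε) (hg : 1 ≤ g) (hv : ‖v‖ ≤ A * (1 + ‖Y‖))
    (htime : d + η * (8 * A + 1) * g * (1 + ‖Y‖ ^ 2) ^ 2 ≤ ε)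
    (hspace : -(ε * ‖v‖) ≤ l - η * g * (4 * (1 + ‖Y‖ ^ 2) * inner ℝ Y v))
    (hdl : l - κ * (1 + ‖Y‖ ^ 2) ≤ d) : η ≤ ε * (1 + 2 * A) + κ := by
  have hR := norm_nonneg Y
  set a := 1 + ‖Y‖ ^ 2 with ha
  have ha1 : 1 ≤ a := by rw [ha]; nlinarith
  have haa : a ≤ a ^ 2 := by nlinarith
  have hin : -(‖Y‖ * ‖v‖) ≤ inner ℝ Y v := (abs_le.1 (abs_real_inner_le_norm Y v)).1
  have hR1 : 1 + ‖Y‖ ≤ 2 * a := by rw [ha]; nlinarith [sq_nonneg (‖Y‖ - 1)]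
  have hR2 : ‖Y‖ * (1 + ‖Y‖) ≤ 2 * a := by rw [ha]; nlinarith [sq_nonneg (‖Y‖ - 1)]
  have h1 : ‖v‖ ≤ 2 * A * a ^ 2 := by
    have := mul_le_mul_of_nonneg_left (hR1.trans (mul_le_mul_of_nonneg_left haa zero_le_two)) hA
    linarith
  have h2 : ‖Y‖ * ‖v‖ ≤ 2 * A * a := by
    have h3 := mul_le_mul_of_nonneg_left hv hR
    have h4 := mul_le_mul_of_nonneg_left hR2 hA
    linarith
  have h3 : -(8 * A * (η * g * a ^ 2)) ≤ η * g * (4 * a * inner ℝ Y v) := by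
    have h4 : -(2 * A * a) ≤ inner ℝ Y v := by linarith
    have h5 := mul_le_mul_of_nonneg_left h4 (by positivity : 0 ≤ η * g * (4 * a))
    linarith
  have h4 : η * a ^ 2 ≤ η * g * a ^ 2 := by
    have := mul_le_mul_of_nonneg_left hg (by positivity : 0 ≤ η * a ^ 2)
    linarith
  have h5 : ε * ‖v‖ ≤ ε * (2 * A * a ^ 2) := mul_le_mul_of_nonneg_left h1 hε
  have h6 : κ * a ≤ κ * a ^ 2 := mul_le_mul_of_nonneg_left haa hκ
  have h7 : ε ≤ ε * a ^ 2 := le_mul_of_one_le_right hε (by nlinarith)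
  have h8 : η * a ^ 2 ≤ (ε * (1 + 2 * A) + κ) * a ^ 2 := by linarith
  exact le_of_mul_le_mul_right h8 (by positivity)

/-- A maximum principle for a function `e(X, t)` with terminal value `e(X, T) ≤ 0`, whose time
derivative is, up to an error `κ (1 + ‖X‖²)`, at least its derivative in a direction of linear
growth. Only derivatives in `X` at fixed `t` and in `t` at fixed `X` are available, and bounded
sets are not compact: the sum of `e` and of a penalty has an approximate maximum, in the sense of
Ekeland's principle, at which both derivatives have a sign. -/
theorem le_of_maximum_principle [CompleteSpace G] {T A κ : ℝ} (hA : 0 ≤ A)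
    (hκ : 0 ≤ κ) {e d : G → ℝ → ℝ} {l : G → ℝ → G → ℝ} {b : G → ℝ → G}
    (he : ∀ X, ∀ t ∈ Icc 0 T, |e X t| ≤ A * (1 + ‖X‖ ^ 2))
    (hd : ∀ X, ∀ t ∈ Icc 0 T, HasDerivWithinAt (e X) (d X t) (Icc 0 T) t)
    (hdb : ∀ X, ∀ t ∈ Icc 0 T, |d X t| ≤ A * (1 + ‖X‖ ^ 2))
    (hl : ∀ X, ∀ t ∈ Icc 0 T, ∀ W, HasDerivAt (fun θ : ℝ => e (X + θ • W) t) (l X t W) 0)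
    (hlb : ∀ X, ∀ t ∈ Icc 0 T, ∀ W, |l X t W| ≤ A * (1 + ‖X‖) * ‖W‖)
    (hb : ∀ X, ∀ t ∈ Icc 0 T, ‖b X t‖ ≤ A * (1 + ‖X‖))
    (hdl : ∀ X, ∀ t ∈ Icc 0 T, l X t (b X t) - κ * (1 + ‖X‖ ^ 2) ≤ d X t)
    (heT : ∀ X, e X T ≤ 0) {η : ℝ} (hη : κ < η) (X : G) {t : ℝ} (ht : t ∈ Icc 0 T) :
    e X t ≤ η * Real.exp ((8 * A + 1) * (T - t)) * (1 + ‖X‖ ^ 2) ^ 2 := by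
  by_contra! hlt
  have hη0 : 0 < η := hκ.trans_lt hη
  -- the rate of the penalty in time exceeds by `1` its relative variation in the direction `b`,
  -- which is at most `8A`
  set K := 8 * A + 1 with hK
  let g : ℝ → ℝ := fun s => Real.exp (K * (T - s))
  let f : G × Icc (0 : ℝ) T → ℝ := fun q => η * g q.2 * (1 + ‖q.1‖ ^ 2) ^ 2 - e q.1 q.2
  have hg1 : ∀ s ∈ Icc 0 T, 1 ≤ g s := fun s hs =>
    Real.one_le_exp (mul_nonneg (by positivity) (sub_nonneg.2 hs.2))
  have hec : Continuous fun q : G × Icc (0 : ℝ) T => e q.1 q.2 :=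
    continuous_of_partial_bounds hA hd hdb hl hlb
  have hfc : Continuous f := by
    refine Continuous.sub ?_ hec
    have : Continuous fun q : G × Icc (0 : ℝ) T => g q.2 := by fun_prop
    fun_prop
  have hbdd : BddBelow (range f) := by
    -- the penalty is quadratic in `1 + ‖X‖²` and `e` is linear in it: complete the square
    refine ⟨-(A ^ 2 / (4 * η)), ?_⟩
    rintro _ ⟨q, rfl⟩
    have h1 := (abs_le.1 (he q.1 q.2 q.2.2)).2
    have h2 := hg1 q.2 q.2.2
    set a := 1 + ‖q.1‖ ^ 2 with ha
    have h3 : η * a ^ 2 ≤ η * g q.2 * a ^ 2 := by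
      have : 0 ≤ η * a ^ 2 := by positivity
      nlinarith
    have h4 : 0 ≤ η * (a - A / (2 * η)) ^ 2 := by positivity
    have h5 : η * (a - A / (2 * η)) ^ 2 = η * a ^ 2 - A * a + A ^ 2 / (4 * η) := by
      field_simp
      ring
    change -(A ^ 2 / (4 * η)) ≤ η * g q.2 * a ^ 2 - e q.1 q.2
    linarith
  -- the slope `ε` contradicts the bound `η ≤ ε (1 + 2A) + κ` that it is shown to imply
  set ε := (η - κ) / (2 * (1 + 2 * A)) with hε
  have hε0 : 0 < ε := div_pos (sub_pos.2 hη) (by positivity)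
  obtain ⟨⟨Y, s⟩, hYs, hmin⟩ := exists_ekeland hfc hbdd hε0 (X, ⟨t, ht⟩)
  have hneg : η * g s * (1 + ‖Y‖ ^ 2) ^ 2 - e Y s < 0 := by
    have h1 : η * g s * (1 + ‖Y‖ ^ 2) ^ 2 - e Y s
      ≤ η * g t * (1 + ‖X‖ ^ 2) ^ 2 - e X t := hYs
    have h2 : η * g t * (1 + ‖X‖ ^ 2) ^ 2 < e X t := hlt
    linarith
  set a := 1 + ‖Y‖ ^ 2 with ha
  have ha1 : 1 ≤ a := by rw [ha]; nlinarith [sq_nonneg ‖Y‖]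
  obtain ⟨s, hs⟩ := s
  change η * g s * a ^ 2 - e Y s < 0 at hneg
  have hgs := hg1 s hs
  have hsT : s < T := by
    refine lt_of_le_of_ne hs.2 fun h => ?_
    rw [h] at hneg
    have h1 := heT Y
    have h2 : 0 ≤ η * g T * a ^ 2 := by have := Real.exp_pos (K * (T - T)); positivity
    linarith
  -- the time derivative at the approximate maximum
  have htime : d Y s + η * K * g s * a ^ 2 ≤ ε := by
    have hgd : HasDerivAt g (-(K * g s)) s := by
      have h1 : HasDerivAt (fun s => K * (T - s)) (-K) s := by
        simpa using ((hasDerivAt_id s).const_sub T).const_mul K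
      have h2 := h1.exp
      refine h2.congr_deriv ?_
      simp only [g]
      ring
    have hder := (((hd Y s hs).mono (Icc_subset_Icc_left hs.1)).sub
      ((hgd.hasDerivWithinAt (s := Icc s T)).const_mul (η * a ^ 2)))
    refine le_trans (le_of_eq (by ring)) (deriv_le_of_forall_sub_le (ε := ε) hsT hder
      fun r hr => ?_)
    have h1 := hmin (Y, ⟨r, hs.1.trans hr.1, hr.2⟩)
    have h2 : dist ((Y, ⟨r, hs.1.trans hr.1, hr.2⟩) : G × Icc (0 : ℝ) T) (Y, ⟨s, hs⟩) = r - s := by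
      rw [Prod.dist_eq, dist_self, Subtype.dist_eq, Real.dist_eq,
        abs_of_nonneg (sub_nonneg.2 hr.1), max_eq_right (sub_nonneg.2 hr.1)]
    rw [h2] at h1
    change η * g s * a ^ 2 - e Y s ≤ η * g r * a ^ 2 - e Y r + ε * (r - s) at h1
    simp only [Pi.sub_apply]
    linarith
  -- the derivative in the direction `b` at the approximate maximum
  set v := b Y s with hv
  have hspace : -(ε * ‖v‖) ≤ l Y s v - η * g s * (4 * a * inner ℝ Y v) := by
    have hp : HasDerivAt (fun θ : ℝ => (1 + ‖Y + θ • v‖ ^ 2) ^ 2) (4 * a * inner ℝ Y v) 0 := by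
      have h1 : HasDerivAt (fun θ : ℝ => Y + θ • v) v 0 := by
        simpa using ((hasDerivAt_id (0 : ℝ)).smul_const v).const_add Y
      have h2 := (h1.norm_sq.const_add 1).pow 2
      simp only [zero_smul, add_zero] at h2
      refine h2.congr_deriv ?_
      rw [ha]
      push_cast
      ring
    have hder := ((hl Y s hs v).sub (hp.const_mul (η * g s)))
    have hder' : HasDerivAt (fun θ : ℝ => e (Y + (-θ) • v) s
        - η * g s * (1 + ‖Y + (-θ) • v‖ ^ 2) ^ 2)
        (-(l Y s v - η * g s * (4 * a * inner ℝ Y v))) 0 := by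
      have h1 : HasDerivAt (fun θ : ℝ => -θ) (-1) 0 := (hasDerivAt_id 0).neg
      have h2 := HasDerivAt.comp (0 : ℝ) (by rw [neg_zero]; exact hder) h1
      rw [mul_neg_one] at h2
      exact h2
    have h3 := deriv_le_of_forall_sub_le (ε := ε * ‖v‖) zero_lt_one
      (hder'.hasDerivWithinAt (s := Icc 0 1)) fun θ hθ => ?_
    · linarith
    · have h1 := hmin (Y + (-θ) • v, ⟨s, hs⟩)
      have h2 : dist ((Y + (-θ) • v, ⟨s, hs⟩) : G × Icc (0 : ℝ) T) (Y, ⟨s, hs⟩) = θ * ‖v‖ := by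
        rw [Prod.dist_eq, dist_self, dist_eq_norm, max_eq_left (norm_nonneg _)]
        simp [norm_smul, abs_of_nonneg hθ.1]
      rw [h2] at h1
      change η * g s * a ^ 2 - e Y s
        ≤ η * g s * (1 + ‖Y + (-θ) • v‖ ^ 2) ^ 2 - e (Y + (-θ) • v) s + ε * (θ * ‖v‖) at h1
      simp only [neg_zero, zero_smul, add_zero, sub_zero]
      linarith
  have hdl' := hdl Y s hs
  have hge := le_of_penalized_slopes hA hκ hη0 hε0.le hgs (hb Y s hs) htime hspace hdl'
  have h10 : ε * (1 + 2 * A) = (η - κ) / 2 := by rw [hε]; field_simp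
  linarith

end Hilbert

/-! ### Uniqueness for the Bellman equation -/

lemma measurable_gradient (g : E n → ℝ) : Measurable (gradient g) :=
  (LinearIsometryEquiv.continuous _).measurable.comp (measurable_fderiv ℝ g)

section Derivative

variable {Ω : Type*} [MeasurableSpace Ω] {P : Measure Ω} [IsProbabilityMeasure P]

lemma memLp_gradient {g : E n → ℝ} {B : ℝ} (hB : ∀ x, ‖gradient g x‖ ≤ B * (1 + ‖x‖))
    {Y : Ω → E n} (hY : MemLp Y 2 P) : MemLp (fun ω => gradient g (Y ω)) 2 P := by
  refine memLp_of_affine_bound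
    ((measurable_gradient g).comp_aemeasurable hY.1.aemeasurable).aestronglyMeasurable hY B B
    (Eventually.of_forall fun ω => (hB _).trans (le_of_eq (by ring)))

/-- Differentiation of the expectation of `g(Y + θ W)`. -/
lemma hasDerivAt_integral_comp {g : E n → ℝ} (hg : Differentiable ℝ g) {B : ℝ}
    (hB : ∀ x, ‖gradient g x‖ ≤ B * (1 + ‖x‖)) {Y W : Ω → E n} (hY : MemLp Y 2 P)
    (hW : MemLp W 2 P) (hgY : Integrable (fun ω => g (Y ω)) P) :
    HasDerivAt (fun θ : ℝ => ∫ ω, g (Y ω + θ • W ω) ∂P)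
      (∫ ω, inner ℝ (gradient g (Y ω)) (W ω) ∂P) 0 := by
  have hB0 : 0 ≤ B := by
    have := (norm_nonneg _).trans (hB 0)
    simpa using this
  have hbound : Integrable (fun ω => B * (1 + ‖Y ω‖ + ‖W ω‖) * ‖W ω‖) P := by
    have h1 : MemLp (fun ω => B * (1 + ‖Y ω‖ + ‖W ω‖)) 2 P :=
      (((memLp_const (1 : ℝ)).add hY.norm).add hW.norm).const_mul B
    exact h1.integrable_mul hW.norm
  have key := hasDerivAt_integral_of_dominated_loc_of_deriv_le (μ := P) (𝕜 := ℝ)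
    (F := fun θ ω => g (Y ω + θ • W ω))
    (F' := fun θ ω => inner ℝ (gradient g (Y ω + θ • W ω)) (W ω)) (x₀ := 0)
    (s := Metric.ball 0 1) (bound := fun ω => B * (1 + ‖Y ω‖ + ‖W ω‖) * ‖W ω‖)
    (Metric.ball_mem_nhds 0 one_pos) (Eventually.of_forall fun θ => ?_) (by simpa using hgY) ?_
    (Eventually.of_forall fun ω θ hθ => ?_) hbound (Eventually.of_forall fun ω θ _ => ?_)
  · simpa using key.2
  · exact (hg.continuous.comp_aestronglyMeasurable (hY.1.add (hW.1.const_smul θ)))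
  · simp only [zero_smul, add_zero]
    exact (memLp_gradient hB hY).1.inner hW.1
  · refine (norm_inner_le_norm _ _).trans (mul_le_mul_of_nonneg_right ((hB _).trans
      (mul_le_mul_of_nonneg_left ?_ hB0)) (norm_nonneg _))
    have h1 := norm_add_le (Y ω) (θ • W ω)
    rw [norm_smul] at h1
    have h2 : ‖θ‖ ≤ 1 := (mem_ball_zero_iff.1 hθ).le
    have h3 := mul_le_of_le_one_left (norm_nonneg (W ω)) h2
    linarith
  · have h1 : HasDerivAt (fun θ : ℝ => Y ω + θ • W ω) (W ω) θ := by
      simpa using ((hasDerivAt_id θ).smul_const (W ω)).const_add (Y ω)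
    have h2 := (hg (Y ω + θ • W ω)).hasGradientAt.hasFDerivAt.comp_hasDerivAt θ h1
    rw [InnerProductSpace.toDual_apply_apply] at h2
    exact h2

/-- Along a line of random variables, a functional of the law is differentiable as long as the
law stays in the class, and its derivative is given by the gradient of the functional
derivative. -/
lemma HasFuncDeriv.hasDerivWithinAt_line {D : Set (Measure (E n))} {G : Measure (E n) → ℝ}
    {g : E n → ℝ} {Y W : Ω → E n} (hY : MemLp Y 2 P) (hW : MemLp W 2 P)
    (hYD : P.map Y ∈ D) (h : HasFuncDeriv D G (P.map Y) g) (hg : Differentiable ℝ g) {B : ℝ}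
    (hB : ∀ x, ‖gradient g x‖ ≤ B * (1 + ‖x‖)) :
    HasDerivWithinAt (fun θ : ℝ => G (P.map (fun ω => Y ω + θ • W ω)))
      (∫ ω, inner ℝ (gradient g (Y ω)) (W ω) ∂P)
      {θ | P.map (fun ω => Y ω + θ • W ω) ∈ D} 0 := by
  have hgc := hg.continuous
  have hYθ : ∀ θ : ℝ, MemLp (fun ω => Y ω + θ • W ω) 2 P := fun θ => hY.add (hW.const_smul θ)
  have hmap : ∀ θ : ℝ, ∫ x, g x ∂(P.map (fun ω => Y ω + θ • W ω)) = ∫ ω, g (Y ω + θ • W ω) ∂P :=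
    fun θ => integral_map (hYθ θ).1.aemeasurable hgc.aestronglyMeasurable
  have hk := hasDerivAt_integral_comp hg hB hY hW ((h.1 _ hYD).comp_aemeasurable hY.1.aemeasurable)
  rw [hasDerivWithinAt_iff_isLittleO]
  have h1 := (hasDerivAt_iff_isLittleO.1 hk).mono
    (nhdsWithin_le_nhds (s := {θ | P.map (fun ω => Y ω + θ • W ω) ∈ D}))
  have h2 : (fun θ : ℝ => G (P.map (fun ω => Y ω + θ • W ω)) - G (P.map Y)
      - (∫ ω, g (Y ω + θ • W ω) ∂P - ∫ ω, g (Y ω) ∂P))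
      =o[𝓝[{θ | P.map (fun ω => Y ω + θ • W ω) ∈ D}] 0] fun θ => θ - 0 := by
    rw [Asymptotics.isLittleO_iff]
    intro κ hκ
    set w := l2norm P W with hw
    have hw0 : 0 ≤ w := l2norm_nonneg _ _
    obtain ⟨δ, hδ, hδG⟩ := h.2 (κ / (w + 1)) (by positivity)
    have hlim : Tendsto (fun θ : ℝ => |θ| * w)
        (𝓝[{θ | P.map (fun ω => Y ω + θ • W ω) ∈ D}] 0) (𝓝 0) := by
      have : Continuous (fun θ : ℝ => |θ| * w) := by fun_prop
      simpa using (this.tendsto 0).mono_left nhdsWithin_le_nhds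
    filter_upwards [hlim.eventually_lt_const hδ, self_mem_nhdsWithin] with θ hθ hθD
    have hW2 : W2 (P.map (fun ω => Y ω + θ • W ω)) (P.map Y) ≤ |θ| * w := by
      refine (W2_map_le (hYθ θ).1.aemeasurable hY.1.aemeasurable
        (memLp_fun_sub (hYθ θ) hY)).trans (le_of_eq ?_)
      simp only [add_sub_cancel_left]
      exact l2norm_smul _ _ _
    have h3 := hδG _ hθD (hW2.trans_lt hθ)
    have hY0 : ∫ x, g x ∂(P.map Y) = ∫ ω, g (Y ω) ∂P :=
      integral_map hY.1.aemeasurable hgc.aestronglyMeasurable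
    rw [hmap, hY0] at h3
    rw [Real.norm_eq_abs, Real.norm_eq_abs, sub_zero]
    refine h3.trans ((mul_le_mul_of_nonneg_left hW2 (by positivity)).trans ?_)
    have h4 : w / (w + 1) ≤ 1 := (div_le_one (by positivity)).2 (by linarith)
    calc κ / (w + 1) * (|θ| * w) = κ * |θ| * (w / (w + 1)) := by ring
      _ ≤ κ * |θ| := mul_le_of_le_one_right (by positivity) h4
  refine (h2.add h1).congr_left fun θ => ?_
  simp only [zero_smul, add_zero]
  change G (P.map fun ω => Y ω + θ • W ω) - G (P.map Y) - _ + _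
    = G (P.map fun ω => Y ω + θ • W ω) - G (P.map Y) - _
  ring

end Derivative

/-- A solution of the Bellman equation that satisfies the growth estimates with a given
constant. -/
structure IsBoundedSolution (D : Set (Measure (E n))) (f h : E n → Measure (E n) → ℝ)
    (lam T C : ℝ) (V : Measure (E n) → ℝ → ℝ) (U : E n → Measure (E n) → ℝ → ℝ) : Prop where
  solves : SolvesBellman D f h lam T V U
  value_growth : ∀ t ∈ Icc 0 T, ∀ m ∈ D, |V m t| ≤ C * (1 + secondMoment m)
  grad_growth : ∀ t ∈ Icc 0 T, ∀ m ∈ D, ∀ x,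
    ‖gradient (fun x' => U x' m t) x‖ ≤ C * (1 + ‖x‖ + √(secondMoment m))

section Bounded

variable {D : Set (Measure (E n))} {f h : E n → Measure (E n) → ℝ} {lam T C : ℝ}
  {V : Measure (E n) → ℝ → ℝ} {U : E n → Measure (E n) → ℝ → ℝ}

namespace IsBoundedSolution

lemma grad_affine (hV : IsBoundedSolution D f h lam T C V U) (hC : 0 ≤ C) {t : ℝ}
    (ht : t ∈ Icc 0 T) {m : Measure (E n)} (hm : m ∈ D) (x : E n) :
    ‖gradient (fun x' => U x' m t) x‖ ≤ C * (1 + √(secondMoment m)) * (1 + ‖x‖) := by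
  refine (hV.grad_growth t ht m hm x).trans ?_
  rw [mul_assoc]
  refine mul_le_mul_of_nonneg_left ?_ hC
  nlinarith [mul_nonneg (norm_nonneg x) (Real.sqrt_nonneg (secondMoment m))]

variable {Ω : Type*} [MeasurableSpace Ω] {P : Measure Ω} [IsProbabilityMeasure P]

lemma memLp_grad (hV : IsBoundedSolution D f h lam T C V U) (hC : 0 ≤ C) {t : ℝ}
    (ht : t ∈ Icc 0 T) {m : Measure (E n)} (hm : m ∈ D) {Y : Ω → E n} (hY : MemLp Y 2 P) :
    MemLp (fun ω => gradient (fun x => U x m t) (Y ω)) 2 P :=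
  memLp_gradient (hV.grad_affine hC ht hm) hY

lemma l2norm_grad_le (hV : IsBoundedSolution D f h lam T C V U) (hC : 0 ≤ C) {t : ℝ}
    (ht : t ∈ Icc 0 T) {Y : Ω → E n} (hY : MemLp Y 2 P) (hYD : P.map Y ∈ D) :
    l2norm P (fun ω => gradient (fun x => U x (P.map Y) t) (Y ω))
      ≤ C * (1 + 2 * l2norm P Y) := by
  have h1 := l2norm_le_affine (f := fun ω => gradient (fun x => U x (P.map Y) t) (Y ω)) hY hC
    (β := C * (1 + l2norm P Y)) (mul_nonneg hC (by linarith [l2norm_nonneg P Y]))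
    (Eventually.of_forall fun ω => by
      have h1 := hV.grad_growth t ht _ hYD (Y ω)
      rw [sqrt_secondMoment_map hY.1.aemeasurable] at h1
      linarith)
  linarith

omit [IsProbabilityMeasure P] in
/-- The time derivative in the Bellman equation, on random variables. -/
lemma hasDerivWithinAt_value (hV : IsBoundedSolution D f h lam T C V U) {t : ℝ}
    (ht : t ∈ Icc 0 T) {Y : Ω → E n} (hY : MemLp Y 2 P) (hYD : P.map Y ∈ D) :
    HasDerivWithinAt (V (P.map Y)) (1 / (2 * lam)
      * l2norm P (fun ω => gradient (fun x => U x (P.map Y) t) (Y ω)) ^ 2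
      - ∫ ξ, f ξ (P.map Y) ∂(P.map Y)) (Icc 0 T) t := by
  obtain ⟨Vt, h1, h2⟩ := hV.solves.equation t ht _ hYD
  have e : l2norm P (fun ω => gradient (fun x => U x (P.map Y) t) (Y ω)) ^ 2
      = ∫ ξ, ‖gradient (fun x => U x (P.map Y) t) ξ‖ ^ 2 ∂(P.map Y) := by
    rw [l2norm_sq]
    exact (integral_map hY.1.aemeasurable
      ((measurable_gradient _).norm.pow_const 2).aestronglyMeasurable).symm
  rw [e]
  refine h1.congr_deriv ?_
  linarith

end IsBoundedSolution

end Bounded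

section Approximation

variable {D : Set (Measure (E n))} {T L₁ L₂ δ t : ℝ} {U₁ U₂ : E n → Measure (E n) → ℝ → ℝ}
  {m : Measure (E n)} [IsProbabilityMeasure m]

/-- The law of a random variable with an additional independent noise. -/
noncomputable def noisyLaw (m : Measure (E n)) (δ : ℝ) (X : E n → E n) : Measure (E n) :=
  (m.prod (noise n)).map (fun ω => X ω.1 + δ • ω.2)

lemma memLp_noisy {X : E n → E n} (hX : MemLp X 2 m) (δ : ℝ) :
    MemLp (fun ω : E n × E n => X ω.1 + δ • ω.2) 2 (m.prod (noise n)) :=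
  (memLp_comp_fst hX).add ((memLp_noise m).const_smul δ)

/-- Two copies of a variable with independent noises: a gradient that is Lipschitz in `L²` varies
little between them. -/
lemma l2norm_two_noises_le {U : E n → Measure (E n) → ℝ → ℝ} {L : ℝ}
    (hL : ∀ μ ∈ D, ∀ γ ∈ couplings μ μ,
      ∫ p, ‖gradient (fun x => U x μ t) p.1 - gradient (fun x => U x μ t) p.2‖ ^ 2 ∂γ
        ≤ L ^ 2 * ∫ p, ‖p.1 - p.2‖ ^ 2 ∂γ) {X : E n → E n} (hX : MemLp X 2 m)
    (hXD : noisyLaw m δ X ∈ D) (hδ : 0 ≤ δ) :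
    l2norm ((m.prod (noise n)).prod (noise n))
      (fun q => gradient (fun x => U x (noisyLaw m δ X) t) (X q.1.1 + δ • q.1.2)
        - gradient (fun x => U x (noisyLaw m δ X) t) (X q.1.1 + δ • q.2)) ≤ 2 * |L| * δ := by
  set Q := (m.prod (noise n)).prod (noise n) with hQ
  set g := fun x => U x (noisyLaw m δ X) t with hg
  have hpres : MeasurePreserving (fun q : (E n × E n) × E n => (q.1.1, q.2)) Q
      (m.prod (noise n)) := measurePreserving_fst.prod (MeasurePreserving.id _)
  have hY := memLp_noisy hX δ
  have h1 : MemLp (fun q : (E n × E n) × E n => X q.1.1 + δ • q.1.2) 2 Q :=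
    hY.comp_measurePreserving measurePreserving_fst
  have h2 : MemLp (fun q : (E n × E n) × E n => X q.1.1 + δ • q.2) 2 Q :=
    hY.comp_measurePreserving hpres
  have e1 : Q.map (fun q => X q.1.1 + δ • q.1.2) = noisyLaw m δ X := by
    rw [noisyLaw, ← measurePreserving_fst (μ := m.prod (noise n)) (ν := noise n) |>.map_eq,
      AEMeasurable.map_map_of_aemeasurable _ measurable_fst.aemeasurable]
    · rfl
    · rw [measurePreserving_fst.map_eq]; exact hY.1.aemeasurable
  have e2 : Q.map (fun q => X q.1.1 + δ • q.2) = noisyLaw m δ X := by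
    rw [noisyLaw, ← hpres.map_eq,
      AEMeasurable.map_map_of_aemeasurable _ hpres.measurable.aemeasurable]
    · rfl
    · rw [hpres.map_eq]; exact hY.1.aemeasurable
  have hγ := map_prodMk_mem_couplings (P := Q) h1.1.aemeasurable h2.1.aemeasurable
  rw [e1, e2] at hγ
  have h3 := hL _ hXD _ hγ
  have hpm := h1.1.aemeasurable.prodMk h2.1.aemeasurable
  have hgm := measurable_gradient g
  have hmeas : Measurable fun p : E n × E n => ‖gradient g p.1 - gradient g p.2‖ ^ 2 :=
    ((hgm.comp measurable_fst).sub (hgm.comp measurable_snd)).norm.pow_const 2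
  rw [integral_map hpm hmeas.aestronglyMeasurable,
    integral_map hpm (Measurable.aestronglyMeasurable (by fun_prop :
      Measurable fun p : E n × E n => ‖p.1 - p.2‖ ^ 2))] at h3
  have h4 : l2norm Q (fun q => X q.1.1 + δ • q.1.2 - (X q.1.1 + δ • q.2)) ≤ 2 * δ := by
    have h5 := l2norm_mono (P := Q) (f := fun q => X q.1.1 + δ • q.1.2 - (X q.1.1 + δ • q.2))
      (g := fun _ => 2 * δ) (memLp_const _) ?_
    · rwa [l2norm_const, Real.norm_of_nonneg (by positivity)] at h5
    · filter_upwards [Measure.quasiMeasurePreserving_fst.ae (norm_noise_le_one_ae m),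
        norm_noise_le_one_ae (m.prod (noise n))] with q hq1 hq2
      rw [add_sub_add_left_eq_sub, ← smul_sub, norm_smul, Real.norm_of_nonneg hδ,
        Real.norm_of_nonneg (by positivity), mul_comm]
      exact mul_le_mul_of_nonneg_right ((norm_sub_le _ _).trans (by linarith)) hδ
  have h5 := pow_le_pow_left₀ (l2norm_nonneg _ _) h4 2
  rw [l2norm_sq] at h5
  have h6 : l2norm Q (fun q =>
      gradient g (X q.1.1 + δ • q.1.2) - gradient g (X q.1.1 + δ • q.2)) ^ 2
      ≤ (2 * |L| * δ) ^ 2 := by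
    rw [l2norm_sq]
    refine h3.trans ((mul_le_mul_of_nonneg_left h5 (sq_nonneg L)).trans (le_of_eq ?_))
    rw [mul_pow, mul_pow, mul_pow, sq_abs]
    ring
  exact (pow_le_pow_iff_left₀ (l2norm_nonneg _ _) (by positivity) two_ne_zero).1 h6

/-- A square integrable function of `X + δν`, with `ν` an independent noise, that varies little
between two copies of the noise is close to a function of the underlying variable. -/
lemma exists_l2norm_sub_le {B X : E n → E n} {ρ : ℝ} (hX : MemLp X 2 m) (hBm : Measurable B)
    {β : ℝ} (hB : ∀ x, ‖B x‖ ≤ β * (1 + ‖x‖))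
    (h : l2norm ((m.prod (noise n)).prod (noise n))
      (fun q => B (X q.1.1 + δ • q.1.2) - B (X q.1.1 + δ • q.2)) ≤ ρ) :
    ∃ W : E n → E n, MemLp W 2 m ∧
      l2norm (m.prod (noise n)) (fun ω => B (X ω.1 + δ • ω.2) - W ω.1) ≤ ρ := by
  set Q := (m.prod (noise n)).prod (noise n) with hQ
  have hpres : MeasurePreserving (fun q : (E n × E n) × E n => (q.1.1, q.2)) Q
      (m.prod (noise n)) := measurePreserving_fst.prod (MeasurePreserving.id _)
  have hY := memLp_noisy hX δ
  have hBY : MemLp (fun ω : E n × E n => B (X ω.1 + δ • ω.2)) 2 (m.prod (noise n)) :=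
    memLp_of_affine_bound (hBm.comp_aemeasurable hY.1.aemeasurable).aestronglyMeasurable hY β β
      (Eventually.of_forall fun ω => (hB _).trans (le_of_eq (by ring)))
  have h1 : MemLp (fun q : (E n × E n) × E n => B (X q.1.1 + δ • q.1.2)) 2 Q :=
    hBY.comp_measurePreserving measurePreserving_fst
  have h2 : MemLp (fun q : (E n × E n) × E n => B (X q.1.1 + δ • q.2)) 2 Q :=
    hBY.comp_measurePreserving hpres
  have hint := integrable_sq_of_memLp (memLp_fun_sub h1 h2)
  have e : ∫ ν, ∫ ω, ‖B (X ω.1 + δ • ω.2) - B (X ω.1 + δ • ν)‖ ^ 2 ∂(m.prod (noise n))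
      ∂(noise n) ≤ ρ ^ 2 := by
    rw [← integral_prod_symm _ hint, ← l2norm_sq]
    exact pow_le_pow_left₀ (l2norm_nonneg _ _) h 2
  -- freeze the second noise at a value where the error is at most its average
  obtain ⟨ν, hν⟩ := exists_le_integral (hint.integral_prod_right)
  have hXν : MemLp (fun x => X x + δ • ν) 2 m := hX.add (memLp_const _)
  refine ⟨fun x => B (X x + δ • ν), memLp_of_affine_bound
    (hBm.comp_aemeasurable hXν.1.aemeasurable).aestronglyMeasurable hXν β β
    (Eventually.of_forall fun ω => (hB _).trans (le_of_eq (by ring))), ?_⟩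
  refine (pow_le_pow_iff_left₀ (l2norm_nonneg _ _) ((l2norm_nonneg _ _).trans h) two_ne_zero).1 ?_
  rw [l2norm_sq]
  exact hν.trans e

end Approximation

section Noisy

variable {D : Set (Measure (E n))} {f h : E n → Measure (E n) → ℝ} {lam T C δ : ℝ}
  {V : Measure (E n) → ℝ → ℝ} {U : E n → Measure (E n) → ℝ → ℝ} {m : Measure (E n)}

/-- The gradient of the functional derivative at the law of `X + δν`, with `ν` an independent noise,
evaluated at this random variable. -/
noncomputable def noisyGrad (U : E n → Measure (E n) → ℝ → ℝ) (m : Measure (E n)) (δ t : ℝ)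
    (X : E n → E n) (ω : E n × E n) : E n :=
  gradient (fun x => U x (noisyLaw m δ X) t) (X ω.1 + δ • ω.2)

lemma norm_Lp_eq_l2norm (X : Lp (E n) 2 m) : ‖X‖ = l2norm m X := by
  rw [l2norm_eq_toReal (Lp.memLp X), Lp.norm_def]

lemma norm_toLp_eq_l2norm {X : E n → E n} (hX : MemLp X 2 m) : ‖hX.toLp X‖ = l2norm m X := by
  rw [Lp.norm_toLp, l2norm_eq_toReal hX]

variable [IsProbabilityMeasure m]

omit [IsProbabilityMeasure m] in
lemma noisyLaw_congr {X Y : E n → E n} (h : X =ᵐ[m] Y) : noisyLaw m δ X = noisyLaw m δ Y := by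
  refine Measure.map_congr ?_
  filter_upwards [(Measure.quasiMeasurePreserving_fst (μ := m) (ν := noise n)).ae h] with ω hω
  rw [hω]

omit [IsProbabilityMeasure m] in
lemma noisyLaw_zero {X : E n → E n} (hX : AEMeasurable X m) : noisyLaw m 0 X = m.map X := by
  have h1 := measurePreserving_fst (μ := m) (ν := noise n)
  have h2 : (m.prod (noise n)).map (fun ω => X ω.1) = m.map X := by
    have h3 : AEMeasurable X ((m.prod (noise n)).map Prod.fst) := by rwa [h1.map_eq]
    have := AEMeasurable.map_map_of_aemeasurable h3 measurable_fst.aemeasurable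
    rw [h1.map_eq] at this
    exact this.symm
  simpa [noisyLaw] using h2

omit [IsProbabilityMeasure m] in
lemma l2norm_comp_fst {X : E n → E n} (hX : MemLp X 2 m) :
    l2norm (m.prod (noise n)) (fun ω => X ω.1) = l2norm m X := by
  rw [l2norm_eq_toReal hX, l2norm_eq_toReal (memLp_comp_fst hX)]
  congr 1
  exact eLpNorm_comp_measurePreserving hX.1 measurePreserving_fst

lemma l2norm_noisy_le {X : E n → E n} (hX : MemLp X 2 m) (hδ : δ ∈ Icc (0 : ℝ) 1) :
    l2norm (m.prod (noise n)) (fun ω => X ω.1 + δ • ω.2) ≤ l2norm m X + 1 := by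
  have h1 : MemLp (fun ω : E n × E n => δ • ω.2) 2 (m.prod (noise n)) :=
    (memLp_noise m).const_smul δ
  refine (l2norm_add_le (memLp_comp_fst hX) h1).trans ?_
  rw [l2norm_comp_fst hX, l2norm_smul, abs_of_nonneg hδ.1]
  have := mul_le_one₀ hδ.2 (l2norm_nonneg _ _) (l2norm_noise_le (n := n) m)
  linarith

namespace IsBoundedSolution

lemma memLp_noisyGrad (hV : IsBoundedSolution D f h lam T C V U) (hC : 0 ≤ C) {t : ℝ}
    (ht : t ∈ Icc 0 T) {X : E n → E n} (hX : MemLp X 2 m) (hXD : noisyLaw m δ X ∈ D) :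
    MemLp (noisyGrad U m δ t X) 2 (m.prod (noise n)) :=
  hV.memLp_grad hC ht hXD (memLp_noisy hX δ)

lemma l2norm_noisyGrad_le (hV : IsBoundedSolution D f h lam T C V U) (hC : 0 ≤ C) {t : ℝ}
    (ht : t ∈ Icc 0 T) (hδ : δ ∈ Icc (0 : ℝ) 1) {X : E n → E n} (hX : MemLp X 2 m)
    (hXD : noisyLaw m δ X ∈ D) :
    l2norm (m.prod (noise n)) (noisyGrad U m δ t X) ≤ 3 * C * (1 + l2norm m X) := by
  have h1 := hV.l2norm_grad_le hC ht (memLp_noisy hX δ) hXD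
  refine h1.trans ?_
  have h2 := l2norm_noisy_le hX hδ
  nlinarith [l2norm_nonneg m X]

lemma abs_value_noisyLaw_le (hV : IsBoundedSolution D f h lam T C V U) (hC : 0 ≤ C) {t : ℝ}
    (ht : t ∈ Icc 0 T) (hδ : δ ∈ Icc (0 : ℝ) 1) {X : E n → E n} (hX : MemLp X 2 m)
    (hXD : noisyLaw m δ X ∈ D) :
    |V (noisyLaw m δ X) t| ≤ 3 * C * (1 + l2norm m X ^ 2) := by
  refine (hV.value_growth t ht _ hXD).trans ?_
  have h1 : secondMoment (noisyLaw m δ X) ≤ (l2norm m X + 1) ^ 2 := by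
    rw [noisyLaw, secondMoment_map (memLp_noisy hX δ).1.aemeasurable, ← l2norm_sq]
    exact pow_le_pow_left₀ (l2norm_nonneg _ _) (l2norm_noisy_le hX hδ) 2
  have h2 : 1 + secondMoment (noisyLaw m δ X) ≤ 3 * (1 + l2norm m X ^ 2) := by
    nlinarith [sq_nonneg (l2norm m X - 1)]
  nlinarith

lemma hasDerivAt_noisyLaw (hV : IsBoundedSolution D f h lam T C V U) (hC : 0 ≤ C) {t : ℝ}
    (ht : t ∈ Icc 0 T) (hD : ∀ X : E n → E n, MemLp X 2 m → noisyLaw m δ X ∈ D)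
    (X W : Lp (E n) 2 m) :
    HasDerivAt (fun θ : ℝ => V (noisyLaw m δ (X + θ • W : Lp (E n) 2 m)) t)
      (∫ ω, inner ℝ (noisyGrad U m δ t X ω) (W ω.1) ∂(m.prod (noise n))) 0 := by
  have hX := Lp.memLp X
  have hW := Lp.memLp W
  have hXD := hD _ hX
  have e : ∀ θ : ℝ, noisyLaw m δ (X + θ • W : Lp (E n) 2 m)
      = (m.prod (noise n)).map (fun ω => X ω.1 + δ • ω.2 + θ • W ω.1) := by
    intro θ
    refine Measure.map_congr ?_
    have h1 : (X + θ • W : Lp (E n) 2 m) =ᵐ[m] fun x => X x + θ • W x := by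
      filter_upwards [Lp.coeFn_add X (θ • W), Lp.coeFn_smul θ W] with x h1 h2
      rw [h1, Pi.add_apply, h2, Pi.smul_apply]
    filter_upwards [(Measure.quasiMeasurePreserving_fst (μ := m) (ν := noise n)).ae h1] with ω hω
    rw [hω]
    abel
  have key := HasFuncDeriv.hasDerivWithinAt_line (memLp_noisy hX δ) (memLp_comp_fst hW) hXD
    (hV.solves.funcDeriv t ht _ hXD) (hV.solves.differentiable t ht _ hXD)
    (hV.grad_affine hC ht hXD)
  have hu : {θ : ℝ | (m.prod (noise n)).map (fun ω => X ω.1 + δ • ω.2 + θ • W ω.1) ∈ D}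
      = univ := eq_univ_of_forall fun θ => by
    change _ ∈ D
    rw [← e]
    exact hD _ (Lp.memLp _)
  rw [hu, hasDerivWithinAt_univ] at key
  simp only [e]
  exact key

end IsBoundedSolution

end Noisy

section Comparison

variable {D : Set (Measure (E n))} {f h : E n → Measure (E n) → ℝ} {lam T C δ ρ : ℝ}
  {V₁ V₂ : Measure (E n) → ℝ → ℝ} {U₁ U₂ : E n → Measure (E n) → ℝ → ℝ}
  {m : Measure (E n)} [IsProbabilityMeasure m]

/-- The comparison of two solutions along the laws of `X + δν`, with `ν` an independent noise. The
difference `V₁ - V₂` solves a transport equation in `X` with velocity `(DU₁ + DU₂) / 2λ`, up to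
an error of order `δ`, since a velocity field on the variables `X` must not see the noise. -/
theorem IsBoundedSolution.sub_le (hlam : 0 < lam) (hC : 0 ≤ C) (hρ : 0 ≤ ρ)
    (hV₁ : IsBoundedSolution D f h lam T C V₁ U₁) (hV₂ : IsBoundedSolution D f h lam T C V₂ U₂)
    (hδ : δ ∈ Icc (0 : ℝ) 1) (hD : ∀ X : E n → E n, MemLp X 2 m → noisyLaw m δ X ∈ D)
    (happ : ∀ X : E n → E n, MemLp X 2 m → ∀ t ∈ Icc 0 T, ∃ W : E n → E n, MemLp W 2 m ∧
      l2norm (m.prod (noise n))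
        (fun ω => noisyGrad U₁ m δ t X ω + noisyGrad U₂ m δ t X ω - W ω.1) ≤ ρ * δ)
    {η : ℝ} (hη : 6 * C * ρ / lam * δ < η) {X : E n → E n} (hX : MemLp X 2 m) {t : ℝ}
    (ht : t ∈ Icc 0 T) :
    V₁ (noisyLaw m δ X) t - V₂ (noisyLaw m δ X) t
      ≤ η * Real.exp ((8 * (6 * C + 18 * C ^ 2 / lam + (6 * C + ρ) / (2 * lam)) + 1) * (T - t))
        * (1 + l2norm m X ^ 2) ^ 2 := by
  set P := m.prod (noise n) with hP
  -- `A` bounds all the data of the transport equation, independently of `δ`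
  set A := 6 * C + 18 * C ^ 2 / lam + (6 * C + ρ) / (2 * lam) with hAdef
  have hA1 : 6 * C ≤ A := by
    have : 0 ≤ 18 * C ^ 2 / lam + (6 * C + ρ) / (2 * lam) := by positivity
    rw [hAdef]; linarith
  have hA2 : 18 * C ^ 2 / lam ≤ A := by
    have : 0 ≤ (6 * C + ρ) / (2 * lam) := by positivity
    rw [hAdef]; linarith
  have hA3 : (6 * C + ρ) / (2 * lam) ≤ A := by
    have : 0 ≤ 18 * C ^ 2 / lam := by positivity
    rw [hAdef]; linarith
  have hA : 0 ≤ A := by linarith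
  have hmem : ∀ X : Lp (E n) 2 m, noisyLaw m δ X ∈ D := fun X => hD _ (Lp.memLp X)
  have hz₁ : ∀ X : Lp (E n) 2 m, ∀ t ∈ Icc 0 T, MemLp (noisyGrad U₁ m δ t X) 2 P :=
    fun X t ht => hV₁.memLp_noisyGrad hC ht (Lp.memLp X) (hmem X)
  have hz₂ : ∀ X : Lp (E n) 2 m, ∀ t ∈ Icc 0 T, MemLp (noisyGrad U₂ m δ t X) 2 P :=
    fun X t ht => hV₂.memLp_noisyGrad hC ht (Lp.memLp X) (hmem X)
  have hn₁ : ∀ X : Lp (E n) 2 m, ∀ t ∈ Icc 0 T,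
      l2norm P (noisyGrad U₁ m δ t X) ≤ 3 * C * (1 + ‖X‖) := fun X t ht => by
    rw [norm_Lp_eq_l2norm]
    exact hV₁.l2norm_noisyGrad_le hC ht hδ (Lp.memLp X) (hmem X)
  have hn₂ : ∀ X : Lp (E n) 2 m, ∀ t ∈ Icc 0 T,
      l2norm P (noisyGrad U₂ m δ t X) ≤ 3 * C * (1 + ‖X‖) := fun X t ht => by
    rw [norm_Lp_eq_l2norm]
    exact hV₂.l2norm_noisyGrad_le hC ht hδ (Lp.memLp X) (hmem X)
  have hsub : ∀ X : Lp (E n) 2 m, ∀ t ∈ Icc 0 T,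
      l2norm P (fun ω => noisyGrad U₁ m δ t X ω - noisyGrad U₂ m δ t X ω)
        ≤ 6 * C * (1 + ‖X‖) := fun X t ht => by
    have h1 := l2norm_add_le (hz₁ X t ht) (hz₂ X t ht).neg
    have h2 : l2norm P (-noisyGrad U₂ m δ t X) = l2norm P (noisyGrad U₂ m δ t X) := l2norm_neg _ _
    have h3 : (fun ω => noisyGrad U₁ m δ t X ω - noisyGrad U₂ m δ t X ω)
        = fun ω => noisyGrad U₁ m δ t X ω + (-noisyGrad U₂ m δ t X) ω := by
      funext ω; simp [sub_eq_add_neg]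
    rw [h3]
    linarith [hn₁ X t ht, hn₂ X t ht]
  choose! W hWm hW using fun (X : Lp (E n) 2 m) (t : ℝ) (ht : t ∈ Icc 0 T) =>
    happ X (Lp.memLp X) t ht
  have hsq : ∀ X : Lp (E n) 2 m, (1 + ‖X‖) ^ 2 ≤ 2 * (1 + ‖X‖ ^ 2) := fun X => by
    nlinarith [sq_nonneg (‖X‖ - 1)]
  have hlin : ∀ X : Lp (E n) 2 m, 1 + ‖X‖ ≤ 2 * (1 + ‖X‖ ^ 2) := fun X => by
    nlinarith [sq_nonneg (‖X‖ - 1), norm_nonneg X]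
  classical
  have key := le_of_maximum_principle (G := Lp (E n) 2 m) (T := T) (A := A)
    (κ := 6 * C * ρ / lam * δ) hA (mul_nonneg (by positivity) hδ.1)
    (e := fun X t => V₁ (noisyLaw m δ X) t - V₂ (noisyLaw m δ X) t)
    (d := fun X t => 1 / (2 * lam)
      * (l2norm P (noisyGrad U₁ m δ t X) ^ 2 - l2norm P (noisyGrad U₂ m δ t X) ^ 2))
    (l := fun X t Z => ∫ ω, inner ℝ (noisyGrad U₁ m δ t X ω - noisyGrad U₂ m δ t X ω) (Z ω.1) ∂P)
    (b := fun X t => if ht : t ∈ Icc 0 T then (1 / (2 * lam)) • (hWm X t ht).toLp (W X t) else 0)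
    ?_ ?_ ?_ ?_ ?_ ?_ ?_ ?_ hη (hX.toLp X) ht
  · rwa [noisyLaw_congr hX.coeFn_toLp, norm_toLp_eq_l2norm] at key
  · intro X t ht
    have h1 := hV₁.abs_value_noisyLaw_le hC ht hδ (Lp.memLp X) (hmem X)
    have h2 := hV₂.abs_value_noisyLaw_le hC ht hδ (Lp.memLp X) (hmem X)
    rw [← norm_Lp_eq_l2norm] at h1 h2
    have h3 := abs_sub (V₁ (noisyLaw m δ X) t) (V₂ (noisyLaw m δ X) t)
    have h4 : 6 * C * (1 + ‖X‖ ^ 2) ≤ A * (1 + ‖X‖ ^ 2) :=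
      mul_le_mul_of_nonneg_right hA1 (by positivity)
    linarith
  · intro X t ht
    have h1 := hV₁.hasDerivWithinAt_value ht (memLp_noisy (Lp.memLp X) δ) (hmem X)
    have h2 := hV₂.hasDerivWithinAt_value ht (memLp_noisy (Lp.memLp X) δ) (hmem X)
    refine (h1.sub h2).congr_deriv ?_
    change (1 / (2 * lam) * l2norm P (noisyGrad U₁ m δ t X) ^ 2 - _)
      - (1 / (2 * lam) * l2norm P (noisyGrad U₂ m δ t X) ^ 2 - _) = _
    rw [mul_sub, sub_sub_sub_cancel_right]
  · intro X t ht
    have h1 := pow_le_pow_left₀ (l2norm_nonneg _ _) (hn₁ X t ht) 2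
    have h2 := pow_le_pow_left₀ (l2norm_nonneg _ _) (hn₂ X t ht) 2
    have h3 : |l2norm P (noisyGrad U₁ m δ t X) ^ 2 - l2norm P (noisyGrad U₂ m δ t X) ^ 2|
        ≤ (3 * C * (1 + ‖X‖)) ^ 2 := by
      rw [abs_le]
      constructor <;> nlinarith [sq_nonneg (l2norm P (noisyGrad U₁ m δ t X)),
        sq_nonneg (l2norm P (noisyGrad U₂ m δ t X))]
    rw [abs_mul, abs_of_nonneg (by positivity : 0 ≤ 1 / (2 * lam))]
    calc 1 / (2 * lam) * _ ≤ 1 / (2 * lam) * (9 * C ^ 2 * (4 * (1 + ‖X‖ ^ 2))) := by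
          refine mul_le_mul_of_nonneg_left (h3.trans ?_) (by positivity)
          have := mul_le_mul_of_nonneg_left (hsq X) (by positivity : 0 ≤ 9 * C ^ 2)
          have h5 : 0 ≤ 9 * C ^ 2 * (1 + ‖X‖ ^ 2) := by positivity
          nlinarith
      _ = 18 * C ^ 2 / lam * (1 + ‖X‖ ^ 2) := by field_simp; ring
      _ ≤ A * (1 + ‖X‖ ^ 2) := mul_le_mul_of_nonneg_right hA2 (by positivity)
  · intro X t ht Z
    have hZ := memLp_comp_fst (Q := noise n) (Lp.memLp Z)
    refine ((hV₁.hasDerivAt_noisyLaw hC ht hD X Z).sub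
      (hV₂.hasDerivAt_noisyLaw hC ht hD X Z)).congr_deriv ?_
    rw [← integral_sub (integrable_inner_of_memLp (hz₁ X t ht) hZ)
      (integrable_inner_of_memLp (hz₂ X t ht) hZ)]
    simp only [inner_sub_left]
  · intro X t ht Z
    have hZ := memLp_comp_fst (Q := noise n) (Lp.memLp Z)
    refine (abs_integral_inner_le (memLp_fun_sub (hz₁ X t ht) (hz₂ X t ht)) hZ).trans ?_
    rw [l2norm_comp_fst (Lp.memLp Z), ← norm_Lp_eq_l2norm]
    refine mul_le_mul_of_nonneg_right ((hsub X t ht).trans ?_) (norm_nonneg _)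
    exact mul_le_mul_of_nonneg_right hA1 (by positivity)
  · intro X t ht
    simp only [dif_pos ht]
    rw [norm_smul, norm_toLp_eq_l2norm, ← l2norm_comp_fst (hWm X t ht),
      Real.norm_of_nonneg (by positivity)]
    have hadd := memLp_fun_add (hz₁ X t ht) (hz₂ X t ht)
    have h1 := l2norm_add_le hadd
      (memLp_fun_sub (memLp_comp_fst (Q := noise n) (hWm X t ht)) hadd)
    simp only [add_sub_cancel] at h1
    rw [l2norm_sub_comm P (fun ω => W X t ω.1)] at h1
    have h2 := l2norm_add_le (hz₁ X t ht) (hz₂ X t ht)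
    have h3 : ρ * δ ≤ ρ := mul_le_of_le_one_right hρ hδ.2
    have h4 : l2norm P (fun ω => W X t ω.1) ≤ (6 * C + ρ) * (1 + ‖X‖) := by
      have h5 := mul_nonneg hρ (norm_nonneg X)
      linarith [hn₁ X t ht, hn₂ X t ht, hW X t ht]
    calc 1 / (2 * lam) * _ ≤ 1 / (2 * lam) * ((6 * C + ρ) * (1 + ‖X‖)) :=
          mul_le_mul_of_nonneg_left h4 (by positivity)
      _ = (6 * C + ρ) / (2 * lam) * (1 + ‖X‖) := by ring
      _ ≤ A * (1 + ‖X‖) := mul_le_mul_of_nonneg_right hA3 (by positivity)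
  · intro X t ht
    simp only [dif_pos ht]
    have hWf := memLp_comp_fst (Q := noise n) (hWm X t ht)
    have hadd := memLp_fun_add (hz₁ X t ht) (hz₂ X t ht)
    have hdiff := memLp_fun_sub (hz₁ X t ht) (hz₂ X t ht)
    have e1 : ∫ ω, inner ℝ (noisyGrad U₁ m δ t X ω - noisyGrad U₂ m δ t X ω)
        (((1 / (2 * lam)) • (hWm X t ht).toLp (W X t) : Lp (E n) 2 m) ω.1) ∂P
        = 1 / (2 * lam) * ∫ ω, inner ℝ (noisyGrad U₁ m δ t X ω - noisyGrad U₂ m δ t X ω)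
          (W X t ω.1) ∂P := by
      rw [← integral_const_mul]
      refine integral_congr_ae ?_
      have h1 : ((1 / (2 * lam)) • (hWm X t ht).toLp (W X t) : Lp (E n) 2 m)
          =ᵐ[m] fun x => (1 / (2 * lam)) • W X t x := by
        filter_upwards [Lp.coeFn_smul (1 / (2 * lam)) ((hWm X t ht).toLp (W X t)),
          (hWm X t ht).coeFn_toLp] with x h1 h2
        rw [h1, Pi.smul_apply, h2]
      filter_upwards [(Measure.quasiMeasurePreserving_fst (μ := m) (ν := noise n)).ae h1]
        with ω hω
      rw [hω, real_inner_smul_right]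
    -- `|z₁|² - |z₂|² = ⟨z₁ - z₂, z₁ + z₂⟩`, where `W`, which does not depend on the noise, replaces
    -- `z₁ + z₂` with an error `ρ δ`
    have e2 : l2norm P (noisyGrad U₁ m δ t X) ^ 2 - l2norm P (noisyGrad U₂ m δ t X) ^ 2
        = ∫ ω, inner ℝ (noisyGrad U₁ m δ t X ω - noisyGrad U₂ m δ t X ω)
          (noisyGrad U₁ m δ t X ω + noisyGrad U₂ m δ t X ω) ∂P := by
      rw [l2norm_sq, l2norm_sq, ← integral_sub (integrable_sq_of_memLp (hz₁ X t ht))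
        (integrable_sq_of_memLp (hz₂ X t ht))]
      refine integral_congr_ae (Eventually.of_forall fun ω => ?_)
      simp only [inner_sub_left, inner_add_right, real_inner_self_eq_norm_sq]
      rw [real_inner_comm]
      ring
    have e3 := abs_integral_inner_le hdiff (memLp_fun_sub hadd hWf)
    have e4 : ∫ ω, inner ℝ (noisyGrad U₁ m δ t X ω - noisyGrad U₂ m δ t X ω)
          (noisyGrad U₁ m δ t X ω + noisyGrad U₂ m δ t X ω - W X t ω.1) ∂P
        = ∫ ω, inner ℝ (noisyGrad U₁ m δ t X ω - noisyGrad U₂ m δ t X ω)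
          (noisyGrad U₁ m δ t X ω + noisyGrad U₂ m δ t X ω) ∂P
        - ∫ ω, inner ℝ (noisyGrad U₁ m δ t X ω - noisyGrad U₂ m δ t X ω) (W X t ω.1) ∂P := by
      rw [← integral_sub (integrable_inner_of_memLp hdiff hadd)
        (integrable_inner_of_memLp hdiff hWf)]
      simp only [inner_sub_right]
    rw [e1, e2]
    have e5 := e3.trans (mul_le_mul (hsub X t ht) (hW X t ht) (l2norm_nonneg _ _) (by positivity))
    rw [e4] at e5
    have e6 := mul_le_mul_of_nonneg_left (abs_le.1 e5).1 (by positivity : 0 ≤ 1 / (2 * lam))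
    have e7 : 1 / (2 * lam) * (6 * C * (1 + ‖X‖) * (ρ * δ))
        ≤ 6 * C * ρ / lam * δ * (1 + ‖X‖ ^ 2) := by
      have h1 : 0 ≤ 6 * C * ρ * δ := mul_nonneg (by positivity) hδ.1
      calc 1 / (2 * lam) * (6 * C * (1 + ‖X‖) * (ρ * δ))
          = 6 * C * ρ * δ / (2 * lam) * (1 + ‖X‖) := by ring
        _ ≤ 6 * C * ρ * δ / (2 * lam) * (2 * (1 + ‖X‖ ^ 2)) :=
            mul_le_mul_of_nonneg_left (hlin X) (by positivity)
        _ = 6 * C * ρ / lam * δ * (1 + ‖X‖ ^ 2) := by field_simp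
    linarith
  · intro X
    rw [hV₁.solves.terminal _ (hmem X), hV₂.solves.terminal _ (hmem X), sub_self]

end Comparison

section Uniqueness

variable {D : Set (Measure (E n))} {f h : E n → Measure (E n) → ℝ} {lam T C δ : ℝ}
  {V V₁ V₂ : Measure (E n) → ℝ → ℝ} {U U₁ U₂ : E n → Measure (E n) → ℝ → ℝ}
  {m : Measure (E n)}

lemma GrowthBounds.exists_isBoundedSolution (hG : GrowthBounds D T V U)
    (hV : SolvesBellman D f h lam T V U) :
    ∃ C₀, 0 ≤ C₀ ∧ ∀ C, C₀ ≤ C → IsBoundedSolution D f h lam T C V U := by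
  obtain ⟨C₀, hC₀⟩ := hG
  refine ⟨|C₀|, abs_nonneg _, fun C hC => ⟨hV, fun t ht m hm => ?_, fun t ht m hm x => ?_⟩⟩
  · refine (hC₀ t ht m hm).1.trans (mul_le_mul_of_nonneg_right ((le_abs_self _).trans hC) ?_)
    linarith [secondMoment_nonneg m]
  · exact ((hC₀ t ht m hm).2 x).2.trans
      (mul_le_mul_of_nonneg_right ((le_abs_self _).trans hC) (by positivity))

/-- Lipschitz gradients along `X + δν` are, up to an error of order `δ`, functions of the underlying
variable only. -/
lemma IsBoundedSolution.exists_noisyGrad_approx [IsProbabilityMeasure m] (hC : 0 ≤ C)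
    (hV₁ : IsBoundedSolution D f h lam T C V₁ U₁) (hV₂ : IsBoundedSolution D f h lam T C V₂ U₂)
    {L₁ L₂ t : ℝ} (ht : t ∈ Icc 0 T) (hδ : 0 ≤ δ)
    (h₁ : ∀ μ ∈ D, ∀ γ ∈ couplings μ μ,
      ∫ p, ‖gradient (fun x => U₁ x μ t) p.1 - gradient (fun x => U₁ x μ t) p.2‖ ^ 2 ∂γ
        ≤ L₁ ^ 2 * ∫ p, ‖p.1 - p.2‖ ^ 2 ∂γ)
    (h₂ : ∀ μ ∈ D, ∀ γ ∈ couplings μ μ,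
      ∫ p, ‖gradient (fun x => U₂ x μ t) p.1 - gradient (fun x => U₂ x μ t) p.2‖ ^ 2 ∂γ
        ≤ L₂ ^ 2 * ∫ p, ‖p.1 - p.2‖ ^ 2 ∂γ)
    {X : E n → E n} (hX : MemLp X 2 m) (hXD : noisyLaw m δ X ∈ D) :
    ∃ W : E n → E n, MemLp W 2 m ∧ l2norm (m.prod (noise n))
      (fun ω => noisyGrad U₁ m δ t X ω + noisyGrad U₂ m δ t X ω - W ω.1)
        ≤ 2 * (|L₁| + |L₂|) * δ := by
  set g₁ := gradient fun x => U₁ x (noisyLaw m δ X) t with hg₁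
  set g₂ := gradient fun x => U₂ x (noisyLaw m δ X) t with hg₂
  refine exists_l2norm_sub_le (B := fun x => g₁ x + g₂ x) (ρ := 2 * (|L₁| + |L₂|) * δ) hX
    ((measurable_gradient _).add (measurable_gradient _))
    (β := 2 * (C * (1 + √(secondMoment (noisyLaw m δ X))))) (fun x => ?_) ?_
  · have h1 := hV₁.grad_affine hC ht hXD x
    have h2 := hV₂.grad_affine hC ht hXD x
    refine (norm_add_le _ _).trans ?_
    linarith
  · have hmem : ∀ {g : E n → E n}, Measurable g → (∀ x, ‖g x‖
        ≤ C * (1 + √(secondMoment (noisyLaw m δ X))) * (1 + ‖x‖)) →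
        MemLp (fun q : (E n × E n) × E n => g (X q.1.1 + δ • q.1.2) - g (X q.1.1 + δ • q.2)) 2
          ((m.prod (noise n)).prod (noise n)) := by
      intro g hg hB
      have hY := memLp_noisy hX δ
      have hgY : MemLp (fun ω : E n × E n => g (X ω.1 + δ • ω.2)) 2 (m.prod (noise n)) :=
        memLp_of_affine_bound (hg.comp_aemeasurable hY.1.aemeasurable).aestronglyMeasurable hY
          (C * (1 + √(secondMoment (noisyLaw m δ X)))) (C * (1 + √(secondMoment (noisyLaw m δ X))))
          (Eventually.of_forall fun ω => (hB _).trans (le_of_eq (by ring)))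
      exact memLp_fun_sub (hgY.comp_measurePreserving measurePreserving_fst)
        (hgY.comp_measurePreserving (measurePreserving_fst.prod (MeasurePreserving.id _)))
    have h1 := l2norm_add_le (hmem (measurable_gradient _) (hV₁.grad_affine hC ht hXD))
      (hmem (measurable_gradient _) (hV₂.grad_affine hC ht hXD))
    have h2 := l2norm_two_noises_le h₁ hX hXD hδ
    have h3 := l2norm_two_noises_le h₂ hX hXD hδ
    simp only [add_sub_add_comm]
    refine h1.trans ((add_le_add h2 h3).trans (le_of_eq ?_))
    ring

/-- The value along a vanishing noise. -/
lemma IsBoundedSolution.tendsto_noisyLaw [IsProbabilityMeasure m] (hC : 0 ≤ C)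
    (hV : IsBoundedSolution D f h lam T C V U) (hD : StateClass D) (hm : m ∈ D) {t : ℝ}
    (ht : t ∈ Icc 0 T) :
    Tendsto (fun δ : ℝ => V (noisyLaw m δ fun x => x) t) (𝓝[>] 0) (𝓝 (V m t)) := by
  have hX : MemLp (fun x : E n => x) 2 m :=
    (memLp_two_iff_integrable_sq_norm aestronglyMeasurable_id).2 (hD.subset hm).2
  have hfst := memLp_comp_fst (Q := noise n) hX
  have e : (m.prod (noise n)).map (fun ω => ω.1) = m := measurePreserving_fst.map_eq
  have hm' : (m.prod (noise n)).map (fun ω => ω.1) ∈ D := by rwa [e]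
  have key := HasFuncDeriv.hasDerivWithinAt_line hfst (memLp_noise m) hm'
    (hV.solves.funcDeriv t ht _ hm') (hV.solves.differentiable t ht _ hm')
    (hV.grad_affine hC ht hm')
  have h1 := key.continuousWithinAt.tendsto
  simp only [zero_smul, add_zero] at h1
  rw [e] at h1
  refine h1.mono_left (nhdsWithin_mono _ fun δ hδ => ?_)
  exact hD.add_noise_mem hX (ne_of_gt hδ)

/-- One half of the uniqueness for the Bellman equation. On `P2 n` no noise is needed; otherwise
the noise keeps the laws in the class and is removed in the end. -/
theorem IsBoundedSolution.le (hlam : 0 < lam) (hC : 0 ≤ C) (hD : StateClass D)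
    (hV₁ : IsBoundedSolution D f h lam T C V₁ U₁) (hV₂ : IsBoundedSolution D f h lam T C V₂ U₂)
    (hU : D = P2 n ∨ LipschitzGradient D T U₁ ∧ LipschitzGradient D T U₂)
    {t : ℝ} (ht : t ∈ Icc 0 T) (hm : m ∈ D) : V₁ m t ≤ V₂ m t := by
  have := (hD.subset hm).1
  have hX : MemLp (fun x : E n => x) 2 m :=
    (memLp_two_iff_integrable_sq_norm aestronglyMeasurable_id).2 (hD.subset hm).2
  rcases hU with rfl | ⟨⟨L₁, hL₁⟩, ⟨L₂, hL₂⟩⟩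
  -- without noise the velocity is a function of the underlying variable, and `η` tends to `0`
  · have hmem : ∀ X : E n → E n, MemLp X 2 m → noisyLaw m 0 X ∈ P2 n := fun X hX => by
      rw [noisyLaw_zero hX.1.aemeasurable]
      exact map_mem_P2 hX
    have key : ∀ η : ℝ, 0 < η → _ := fun η hη => IsBoundedSolution.sub_le (δ := 0) (ρ := 0) hlam hC
      le_rfl hV₁ hV₂ ⟨le_rfl, zero_le_one⟩ hmem (fun X hX s hs => by
        refine ⟨fun x => gradient (fun x => U₁ x (noisyLaw m 0 X) s) (X x)
          + gradient (fun x => U₂ x (noisyLaw m 0 X) s) (X x),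
          memLp_fun_add (hV₁.memLp_grad hC hs (hmem X hX) hX)
            (hV₂.memLp_grad hC hs (hmem X hX) hX), le_of_eq ?_⟩
        simp [noisyGrad, l2norm]) (η := η) (by simpa using hη) hX ht
    rw [noisyLaw_zero hX.1.aemeasurable, Measure.map_id'] at key
    set K := Real.exp ((8 * (6 * C + 18 * C ^ 2 / lam + (6 * C + 0) / (2 * lam)) + 1) * (T - t))
      * (1 + l2norm m (fun x => x) ^ 2) ^ 2 with hK
    have h1 : Tendsto (fun η : ℝ => η * K) (𝓝[>] 0) (𝓝 0) := by
      have : Continuous fun η : ℝ => η * K := by fun_prop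
      simpa using (this.tendsto 0).mono_left nhdsWithin_le_nhds
    refine sub_nonpos.1 (ge_of_tendsto h1 ?_)
    filter_upwards [self_mem_nhdsWithin] with η hη
    rw [hK, ← mul_assoc]
    exact key η hη
  -- with noise of size `δ`, `η` is proportional to `δ`, which tends to `0`
  · set ρ := 2 * (|L₁| + |L₂|) with hρ
    have hρ0 : 0 ≤ ρ := by positivity
    set K := Real.exp ((8 * (6 * C + 18 * C ^ 2 / lam + (6 * C + ρ) / (2 * lam)) + 1) * (T - t))
      * (1 + l2norm m (fun x => x) ^ 2) ^ 2 with hK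
    have key : ∀ δ ∈ Ioc (0 : ℝ) 1, V₁ (noisyLaw m δ fun x => x) t - V₂ (noisyLaw m δ fun x => x) t
        ≤ (6 * C * ρ / lam + 1) * δ * K := by
      intro δ hδ
      have hmem : ∀ X : E n → E n, MemLp X 2 m → noisyLaw m δ X ∈ D :=
        fun X hX => hD.add_noise_mem hX hδ.1.ne'
      rw [hK, ← mul_assoc]
      refine IsBoundedSolution.sub_le hlam hC hρ0 hV₁ hV₂ ⟨hδ.1.le, hδ.2⟩ hmem
        (fun X hX s hs => hV₁.exists_noisyGrad_approx hC hV₂ hs hδ.1.le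
          (fun μ hμ γ hγ => hL₁ s hs μ hμ μ hμ γ hγ) (fun μ hμ γ hγ => hL₂ s hs μ hμ μ hμ γ hγ) hX
          (hmem X hX)) ?_ hX ht
      linarith [hδ.1]
    have h1 : Tendsto (fun δ : ℝ => (6 * C * ρ / lam + 1) * δ * K) (𝓝[>] 0) (𝓝 0) := by
      have : Continuous fun δ : ℝ => (6 * C * ρ / lam + 1) * δ * K := by fun_prop
      simpa using (this.tendsto 0).mono_left nhdsWithin_le_nhds
    refine sub_nonpos.1 (le_of_tendsto_of_tendsto ((hV₁.tendsto_noisyLaw hC hD hm ht).sub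
      (hV₂.tendsto_noisyLaw hC hD hm ht)) h1 ?_)
    filter_upwards [Ioc_mem_nhdsGT one_pos] with δ hδ
    exact key δ hδ

/-- Uniqueness for the Bellman equation. -/
theorem SolvesBellman.unique (hlam : 0 < lam) (hD : StateClass D)
    (hV₁ : SolvesBellman D f h lam T V₁ U₁) (hV₂ : SolvesBellman D f h lam T V₂ U₂)
    (hG₁ : GrowthBounds D T V₁ U₁) (hG₂ : GrowthBounds D T V₂ U₂)
    (hU : D = P2 n ∨ LipschitzGradient D T U₁ ∧ LipschitzGradient D T U₂)
    {t : ℝ} (ht : t ∈ Icc 0 T) (hm : m ∈ D) : V₁ m t = V₂ m t := by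
  obtain ⟨C₁, hC₁, h₁⟩ := hG₁.exists_isBoundedSolution hV₁
  obtain ⟨C₂, hC₂, h₂⟩ := hG₂.exists_isBoundedSolution hV₂
  have h₁' := h₁ (C₁ + C₂) (by linarith)
  have h₂' := h₂ (C₁ + C₂) (by linarith)
  exact le_antisymm (h₁'.le hlam (add_nonneg hC₁ hC₂) hD h₂' hU ht hm)
    (h₂'.le hlam (add_nonneg hC₁ hC₂) hD h₁' (hU.imp_right And.symm) ht hm)

end Uniqueness

/-! ### Identification of the value function -/

section Value

variable {D : Set (Measure (E n))} {f h F FT : E n → Measure (E n) → ℝ} {lam T c C : ℝ}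
  {dF dFT : E n → Measure (E n) → E n → ℝ} {V V' : Measure (E n) → ℝ → ℝ}
  {U : E n → Measure (E n) → ℝ → ℝ}

lemma StateClass.nonempty (hD : StateClass D) : D.Nonempty :=
  ⟨_, hD.noise_mem (Measure.dirac 0) ⟨inferInstance, integrable_dirac (by simp)⟩ 1 one_ne_zero⟩

lemma HasFuncDeriv.congr {G G' : Measure (E n) → ℝ} {m : Measure (E n)} {g : E n → ℝ}
    (hG : HasFuncDeriv D G m g) (hm : m ∈ D) (e : ∀ μ ∈ D, G' μ = G μ) :
    HasFuncDeriv D G' m g := by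
  refine ⟨hG.1, fun ε hε => ?_⟩
  obtain ⟨δ, hδ, hδG⟩ := hG.2 ε hε
  refine ⟨δ, hδ, fun μ hμ hW => ?_⟩
  rw [e μ hμ, e m hm]
  exact hδG μ hμ hW

lemma SolvesBellman.congr (hT : 0 ≤ T) (hV : SolvesBellman D f h lam T V U)
    (e : ∀ t ∈ Icc 0 T, ∀ m ∈ D, V' m t = V m t) : SolvesBellman D f h lam T V' U where
  funcDeriv t ht m hm := (hV.funcDeriv t ht m hm).congr hm (e t ht)
  differentiable := hV.differentiable
  equation t ht m hm := by
    obtain ⟨Vt, h1, h2⟩ := hV.equation t ht m hm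
    exact ⟨Vt, h1.congr (fun s hs => e s hs m hm) (e t ht m hm), h2⟩
  terminal m hm := by
    rw [e T (right_mem_Icc.2 hT) m hm]
    exact hV.terminal m hm

lemma GrowthBounds.congr (hV : GrowthBounds D T V U)
    (e : ∀ t ∈ Icc 0 T, ∀ m ∈ D, V' m t = V m t) : GrowthBounds D T V' U := by
  obtain ⟨C, hC⟩ := hV
  refine ⟨C, fun t ht m hm => ?_⟩
  rw [e t ht m hm]
  exact hC t ht m hm

lemma CostData.c_nonneg (hf : CostData D c C f F dF) (hne : D.Nonempty) : 0 ≤ c := by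
  obtain ⟨m, hm⟩ := hne
  have h1 := (norm_nonneg _).trans (hf.grad_growth 0 m hm)
  have h2 : 0 < 1 + ‖(0 : E n)‖ + √(secondMoment m) := by positivity
  have h3 := nonneg_of_mul_nonneg_left h1 h2
  linarith

lemma CostData.regularCost (hf : CostData D c C f F dF) (hD : StateClass D) :
    RegularCost D c (meanCost f) F :=
  regularCost_of_hasFuncDeriv hD (hf.c_nonneg hD.nonempty) hf.differentiable hf.grad_lipschitz
    hf.grad_growth hf.funcDeriv

lemma CostData.setup (hf : CostData D c C f F dF) (hh : CostData D c C h FT dFT)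
    (hD : StateClass D) (hT : 0 < T) (hlam : c * T * (1 + T) < lam) :
    Setup D lam T c (meanCost f) (meanCost h) F FT where
  state := hD
  c_nonneg := hf.c_nonneg hD.nonempty
  T_pos := hT
  small := hlam
  cost := hf.regularCost hD
  cost_T := hh.regularCost hD

end Value


end MFC

theorem mainTheorem2 (n : ℕ) (D : Set (MeasureTheory.Measure (MFC.E n)))
    (hD : D = MFC.P2 n ∨ D = MFC.P2ac n)
    (lam T c C : ℝ) (hT : 0 < T) (hlam : c * T * (1 + T) < lam)
    (f h F FT : MFC.E n → MeasureTheory.Measure (MFC.E n) → ℝ)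
    (dF dFT : MFC.E n → MeasureTheory.Measure (MFC.E n) → MFC.E n → ℝ)
    (hf : MFC.CostData D c C f F dF) (hh : MFC.CostData D c C h FT dFT)
    (hmixed : MFC.MixedDerivBound D C dF) :
    -- the control problem has a finite value, in its two equivalent forms
    (∀ t ∈ Set.Icc 0 T, ∀ m ∈ D,
      IsGLB (MFC.costSet D f h lam T m t) (MFC.value D f h lam T m t) ∧
      ∀ v X, MFC.IsAdmissible D T t m v X →
        MFC.SolvesFokkerPlanck T t m v (MFC.law m X) ∧
        MFC.cost f h lam T t m v X = MFC.costOnLaws f h lam T t v (MFC.law m X)) ∧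
    -- the value function satisfies the estimates and solves the Bellman equation
    (∃ U : MFC.E n → MeasureTheory.Measure (MFC.E n) → ℝ → ℝ,
      MFC.SolvesBellman D f h lam T (MFC.value D f h lam T) U ∧
      MFC.GrowthBounds D T (MFC.value D f h lam T) U ∧
      MFC.LipschitzGradient D T U) ∧
    -- it is the unique such solution
    (∀ (V' : MeasureTheory.Measure (MFC.E n) → ℝ → ℝ)
      (U' : MFC.E n → MeasureTheory.Measure (MFC.E n) → ℝ → ℝ),
      MFC.SolvesBellman D f h lam T V' U' → MFC.GrowthBounds D T V' U' →
      (D ≠ MFC.P2 n → MFC.LipschitzGradient D T U') →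
      ∀ t ∈ Set.Icc 0 T, ∀ m ∈ D, V' m t = MFC.value D f h lam T m t) ∧
    -- explicit formula
    (∀ t ∈ Set.Icc 0 T, ∀ m ∈ D, ∃ y : MFC.E n → ℝ → MFC.E n,
      MFC.SolvesIntegralEq D F FT lam T t m y ∧
      (∀ x, ∀ s ∈ Set.Icc t T, y x s = MFC.integralRHS F FT lam T t m y x s) ∧
      (∀ x, DifferentiableOn ℝ (fun s => y x s) (Set.Icc t T)) ∧
      MFC.value D f h lam T m t = MFC.explicitValue f h lam T t m y ∧
      ∀ y', MFC.SolvesIntegralEq D F FT lam T t m y' →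
        ∀ s ∈ Set.Icc t T, ∀ᵐ x ∂m, y' x s = y x s) := by
  have hcl : MFC.StateClass D := by
    rcases hD with rfl | rfl
    · exact MFC.stateClass_P2
    · exact MFC.stateClass_P2ac
  have H := hf.setup hh hcl hT hlam
  have hleast : ∀ t ∈ Set.Icc 0 T, ∀ m ∈ D, IsLeast (MFC.costSet D f h lam T m t)
      (MFC.optValue (MFC.meanCost f) (MFC.meanCost h) F FT lam T c m t) := fun t ht m hm =>
    H.isLeast_costSet ht hm (H.isFlow_optFlow ht hm) rfl rfl hf.integrable hh.integrable
  have hval : ∀ t ∈ Set.Icc 0 T, ∀ m ∈ D, MFC.value D f h lam T m t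
      = MFC.optValue (MFC.meanCost f) (MFC.meanCost h) F FT lam T c m t := fun t ht m hm =>
    (hleast t ht m hm).csInf_eq
  have hB := (H.solvesBellman_optValue rfl rfl).congr hT.le hval
  have hG := (H.growthBounds hcl.nonempty).congr hval
  have hL := H.lipschitzGradient
  refine ⟨fun t ht m hm => ⟨?_, fun v X hX => ⟨?_, ?_⟩⟩, ⟨_, hB, hG, hL⟩,
    fun V' U' hB' hG' hL' t ht m hm => ?_, fun t ht m hm => ?_⟩
  · rw [hval t ht m hm]
    exact (hleast t ht m hm).isGLB
  · exact hX.solvesFokkerPlanck (hcl.subset hm) ht.2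
  · exact hX.cost_eq_costOnLaws ht.2 hf.integrable hh.integrable
  · refine hB'.unique H.lam_pos hcl hB hG' hG ?_ ht hm
    by_cases hP : D = MFC.P2 n
    · exact Or.inl hP
    · exact Or.inr ⟨hL' hP, hL⟩
  · have hy := H.isFlow_optFlow ht hm
    refine ⟨MFC.optFlow F FT lam T c t m, H.solvesIntegralEq_flow ht hm hy, hy.equation,
      fun x s hs => (H.hasDerivWithinAt_flow ht hm hy x hs).differentiableWithinAt, ?_,
      fun y' hy' => H.ae_eq_flow_of_solvesIntegralEq ht hm hy hy'⟩
    rw [hval t ht m hm]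
    exact (H.explicitValue_eq_flowCost ht hm hy rfl rfl hf.integrable hh.integrable).symm
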